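/- **Lemma 3.1 (3 intervals).** Conventions. Let $\mathbb F_n$ be the free group of rank $n$. A point of Outer space $\mathcal X$ is a finite connected metric graph $G$ of volume $1$, all of whose vertices have valence $\ge 3$, with a marking $\pi_1(G)\cong\mathbb F_n$. For a map $f$ from $G$ that is linear on edges with positive speed, two directions at a point are in the same *gate* of $f$ if $f$ maps them to the same direction; a turn (pair of distinct directions at a point) is *illegal* if its directions are in the same gate and *legal* otherwise, and an immersed path is legal if all turns it takes are legal. The map is *optimal* if it has the same speed on all edges and there are at least two gates at every point. A *(greedy) folding path* $G_t$, $t\in[\alpha,\omega]$, is a path in $\mathcal X$ with compatible optimal maps $G_s\to G_t$ ($s\le t$) preserving markings, parametrized so that $G_s\to G_t$ has speed $e^{t-s}$, such that for each $t<\omega$ there is $\epsilon>0$ such that for all $\tau\in[t,t+\epsilon]\cap[\alpha,\omega]$ the graph $G_\tau$ is obtained from $G_t$ by identifying the initial segments of some common length $\delta=\delta(\tau)\geq 0$ (smaller than all edges) of all pairs of directions at a vertex that lie in the same gate, and rescaling to volume $1$; here and below gates at time $t$ are those of $G_t\to G_\omega$. For a finitely generated subgroup $A<\mathbb F_n$,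 $A|G_t$ denotes the core of the covering space of $G_t$ corresponding to $A$, with the metric and gates induced from $G_t$ (the gates at a point being those of its directions within the core). A *natural vertex* of $A|G_t$ is a point of valence $\ge 3$, a *topological edge* is an edge for the cell structure whose vertices are the natural vertices (if $A|G_t$ is empty or a circle there are none), and an *interior illegal turn* is the turn at a point of valence $2$ with one gate. The splitting complex $\mathcal S(A)$ has as $k$-simplices the free splittings of $A$ (nontrivial minimal simplicial $A$-trees with trivial edge stabilizers and no vertex of valence $2$) with $k+1$ orbits of edges, up to equivariant isomorphism, faces being given by collapsing edges; distances are measured in its $1$-skeleton. The image of $A|G_t$ in $\mathcal S(A)$ is the set of all one-edge splittings obtained by collapsing all topological edges of $A|G_t$ but one. Statement. For every $n$ there is a constant $C=C(n)$ such that for every folding path $G_t$, $t\in[\alpha,\omega]$, in $\mathcal X$ and every finitely generated subgroup $A<\mathbb F_n$, the interval can be subdivided into three consecutive segments $[\alpha,\beta)$, $[\beta,\gamma)$, $[\gamma,\omega]$ (some of which may be omitted; if the last one is omitted, the middle one is $[\beta,\omega]$) so that: 1. for every $t$ in the first segment, $A|G_t$ has a natural vertex with one gate or an interior illegal turn; 2.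 for every $t$ in the middle segment, all topological edges of $A|G_t$ have length $\le 2$ (hence, if $\mathrm{rank}(A)\ge 2$, the volume of $A|G_t$ is at most $6\,\mathrm{rank}(A)-6$), all natural vertices have at least two gates, and there are no interior illegal turns; 3. for every $t$ in the last segment, $A|G_t$ has a legal segment of length $\ge 2$ contained in a topological edge. Moreover, the image of the first segment in $\mathcal S(A)$ (the union of the images of all $A|G_t$ with $t$ in the segment) has diameter at most $C$, and so has the image of the last segment. -/

import Mathlib

open scoped ENNReal

universe u

namespace FoldPath

/-!
A connected metric graph `G` with a marking is recorded by its universal cover `T`, a metric tree on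
which the free group `F` acts by deck transformations: `G = T / F`, and the marking is the
identification of `F` with the deck group.  The covering space of `G` corresponding to a subgroup
`A` is `T / A`.  Vertices, directions, turns, gates, edges and their lengths are local, so they are
read off in the tree.
-/

section Tree

variable {T : Type*} [MetricSpace T]

/-- The segment from `x` to `y`. -/
def seg (x y : T) : Set T := {z | dist x z + dist z y = dist x y}

/-- Metric trees (real trees): geodesic spaces that satisfy the four-point condition. -/
structure IsRealTree (T : Type*) [MetricSpace T] : Prop where
  geodesic : ∀ x y : T, ∃ c : ℝ → T, c 0 = x ∧ c (dist x y) = y ∧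
    ∀ s ∈ Set.Icc 0 (dist x y), ∀ t ∈ Set.Icc 0 (dist x y), dist (c s) (c t) = |s - t|
  four_point : ∀ x y z w : T,
    dist x y + dist z w ≤ max (dist x z + dist y w) (dist x w + dist y z)

/-- For `p, q ≠ x`: the segments `[x, p]` and `[x, q]` leave `x` in the same direction, that is,
they share more than the point `x`. -/
def SameDir (x p q : T) : Prop := dist p q < dist x p + dist x q

/-- `x` has valence at least three in the subtree `Y` (a natural vertex of `Y`). -/
def IsNatVertex (Y : Set T) (x : T) : Prop :=
  x ∈ Y ∧ ∃ p ∈ Y, ∃ q ∈ Y, ∃ r ∈ Y, p ≠ x ∧ q ≠ x ∧ r ≠ x ∧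
    ¬ SameDir x p q ∧ ¬ SameDir x q r ∧ ¬ SameDir x p r

/-- `x` has valence exactly two in the subtree `Y`. -/
def IsValenceTwo (Y : Set T) (x : T) : Prop :=
  x ∈ Y ∧ ¬ IsNatVertex Y x ∧ ∃ p ∈ Y, ∃ q ∈ Y, p ≠ x ∧ q ≠ x ∧ ¬ SameDir x p q

/-- `[x, y]` is an oriented natural (topological) edge of the subtree `Y`: distinct natural
vertices with no natural vertex strictly between them. -/
def IsNatEdge (Y : Set T) (x y : T) : Prop :=
  IsNatVertex Y x ∧ IsNatVertex Y y ∧ x ≠ y ∧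
    ∀ z ∈ seg x y, z ≠ x → z ≠ y → ¬ IsNatVertex Y z

/-- For a map `f` that is a homothety along a short piece of each segment: the directions at `x`
towards `p` and towards `q` are in the same gate of `f`, that is, `f` maps them to the same
direction.  Thus the turn formed by two distinct directions is illegal if and only if this holds. -/
def SameGate {T' : Type*} (f : T → T') (x p q : T) : Prop :=
  ∃ r > 0, ∀ p' ∈ seg x p, ∀ q' ∈ seg x q, dist x p' = dist x q' → dist x p' ≤ r → f p' = f q'

/-- All directions of the subtree `Y` at `x` are in the same gate. -/
def OneGate {T' : Type*} (f : T → T') (Y : Set T) (x : T) : Prop :=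
  ∀ p ∈ Y, ∀ q ∈ Y, p ≠ x → q ≠ x → SameGate f x p q

/-- The subtree `Y` has at least two gates at `x`. -/
def TwoGates {T' : Type*} (f : T → T') (Y : Set T) (x : T) : Prop :=
  ∃ p ∈ Y, ∃ q ∈ Y, p ≠ x ∧ q ≠ x ∧ ¬ SameGate f x p q

/-- The segment `[p, q]` is legal: all turns it takes are legal. -/
def IsLegal {T' : Type*} (f : T → T') (p q : T) : Prop :=
  ∀ z ∈ seg p q, z ≠ p → z ≠ q → ¬ SameGate f z p q

/-- A map with slope `c` along every edge (after subdivision), so that its tension graph is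
everything, and with at least two gates at every point. -/
def IsOptimal {T' : Type*} [MetricSpace T'] (c : ℝ) (f : T → T') : Prop :=
  (∀ x p : T, p ≠ x → ∃ z ∈ seg x p, z ≠ x ∧
    ∀ a ∈ seg x z, ∀ b ∈ seg x z, dist (f a) (f b) = c * dist a b) ∧
  ∀ x, TwoGates f Set.univ x

/-- `p` and `q` are corresponding points on segments of length `δ` that leave a vertex in
equivalent directions, equivalence being with respect to the gates of `f`. -/
def FoldStep {T' : Type*} (f : T → T') (δ : ℝ) (p q : T) : Prop :=
  ∃ v, IsNatVertex Set.univ v ∧ dist v p = dist v q ∧ dist v p ≤ δ ∧ SameGate f v p q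

/-- The target of `h` is obtained from the source by identifying segments of length `δ` leaving any
vertex in directions that are equivalent with respect to the gates of `f`; here `δ` is smaller than
every edge. -/
def IsFold {T' T'' : Type*} (f : T → T') (δ : ℝ) (h : T → T'') : Prop :=
  0 ≤ δ ∧ (∀ x y, IsNatEdge (Set.univ : Set T) x y → δ < dist x y) ∧ Function.Surjective h ∧
    ∀ p q, h p = h q ↔ Relation.EqvGen (FoldStep f δ) p q

end Tree

section Action

variable {T : Type*} [MetricSpace T] {F : Type*} [Group F] [MulAction F T]

/-- The smallest `A`-invariant subtree.  The core of the covering space `T / A` is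
`core A / A`. -/
def core (T : Type*) [MetricSpace T] [MulAction F T] (A : Subgroup F) : Set T :=
  ⋂₀ {Y | Y.Nonempty ∧ (∀ a ∈ A, ∀ x ∈ Y, a • x ∈ Y) ∧ ∀ x ∈ Y, ∀ y ∈ Y, seg x y ⊆ Y}

/-- The oriented natural edges of the quotient graph `Y / A`. -/
def EdgeOrbit (A : Subgroup F) (Y : Set T) : Type _ :=
  Quot fun e e' : {e : T × T // IsNatEdge Y e.1 e.2} =>
    ∃ a ∈ A, a • e.1.1 = e'.1.1 ∧ a • e.1.2 = e'.1.2

/-- The sum of the lengths of all natural edges of `Y / A` (each has two orientations); this is the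
volume of the graph `Y / A` unless that is a circle. -/
noncomputable def volume (A : Subgroup F) (Y : Set T) : ℝ≥0∞ :=
  (∑' o : EdgeOrbit A Y, edist (Quot.out o).1.1 (Quot.out o).1.2) / 2

/-- `T` is the universal cover of a finite graph with a marking by `F`, all valences at least
three and volume one: a point of Outer space. -/
structure IsOuterSpacePoint (F T : Type*) [Group F] [MetricSpace T] [MulAction F T] : Prop where
  tree : IsRealTree T
  isometric : ∀ (g : F) (x y : T), dist (g • x) (g • y) = dist x y
  free : ∀ (g : F) (x : T), g • x = x → g = 1
  minimal : core T (⊤ : Subgroup F) = Set.univ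
  discrete : ∀ x : T, ∃ r > 0, ∀ y, y ≠ x → dist x y < r → ¬ IsNatVertex Set.univ y
  finite : Finite (EdgeOrbit (⊤ : Subgroup F) (Set.univ : Set T))
  volume_eq : volume (⊤ : Subgroup F) (Set.univ : Set T) = 1

end Action

/-- A greedy folding path `G_t`, `t ∈ [α, ω]`, in the Outer space of the free group of rank `n`,
parametrized by arclength for the Lipschitz metric, with its folding maps.  The gates at time `t`
are those of the folding map from time `t` to time `ω`. -/
structure FoldingPath (n : ℕ) (α ω : ℝ) where
  le : α ≤ ω
  T : Set.Icc α ω → Type u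
  [metric : ∀ t, MetricSpace (T t)]
  [action : ∀ t, MulAction (FreeGroup (Fin n)) (T t)]
  outer : ∀ t, IsOuterSpacePoint (FreeGroup (Fin n)) (T t)
  map : ∀ s t : Set.Icc α ω, s ≤ t → T s → T t
  map_self : ∀ t x, map t t le_rfl x = x
  map_map : ∀ r s t (hrs : r ≤ s) (hst : s ≤ t) x,
    map s t hst (map r s hrs x) = map r t (hrs.trans hst) x
  map_smul : ∀ s t (h : s ≤ t) (g : FreeGroup (Fin n)) x, map s t h (g • x) = g • map s t h x
  optimal : ∀ (s t : Set.Icc α ω) (h : s ≤ t), IsOptimal (Real.exp ((t : ℝ) - (s : ℝ))) (map s t h)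
  greedy : ∀ t : Set.Icc α ω, (t : ℝ) < ω → ∃ ε > 0, ∀ (τ : Set.Icc α ω) (h : t ≤ τ),
    (τ : ℝ) ≤ t + ε → ∃ δ, IsFold (map t ⟨ω, le, le_rfl⟩ t.2.2) δ (map t τ h)

attribute [instance] FoldingPath.metric FoldingPath.action

namespace FoldingPath

variable {n : ℕ} {α ω : ℝ} (G : FoldingPath.{u} n α ω) (A : Subgroup (FreeGroup (Fin n)))
  (t : Set.Icc α ω)

/-- The folding map from time `t` to the end of the path, which defines the train track structure
at time `t`. -/
def toEnd : G.T t → G.T ⟨ω, G.le, le_rfl⟩ := G.map t ⟨ω, G.le, le_rfl⟩ t.2.2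

/-- The universal cover of the graph `A|G_t`. -/
def sub : Set (G.T t) := core (G.T t) A

/-- `A|G_t` has a natural vertex with one gate. -/
def HasOneGateVertex : Prop :=
  ∃ x, IsNatVertex (G.sub A t) x ∧ OneGate (G.toEnd t) (G.sub A t) x

/-- `A|G_t` has an interior illegal turn: a point of valence two with one gate. -/
def HasInteriorIllegalTurn : Prop :=
  ∃ x, IsValenceTwo (G.sub A t) x ∧ OneGate (G.toEnd t) (G.sub A t) x

/-- `A|G_t` has a legal segment of length at least two contained in a topological edge. -/
def HasLongLegalSegment : Prop :=
  ∃ x y, IsNatEdge (G.sub A t) x y ∧ ∃ p ∈ seg x y, ∃ q ∈ seg x y,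
    2 ≤ dist p q ∧ IsLegal (G.toEnd t) p q

end FoldingPath

/-- A free splitting of `Γ` with `k` orbits of edges: a nontrivial minimal simplicial `Γ`-tree
without vertices of valence two, with trivial edge stabilizers and `k` orbits of edges. -/
structure FreeSplitting (Γ : Type*) [Group Γ] (k : ℕ) where
  V : Type
  [action : MulAction Γ V]
  graph : SimpleGraph V
  isTree : graph.IsTree
  adj_smul : ∀ (g : Γ) (v w : V), graph.Adj v w → graph.Adj (g • v) (g • w)
  edge_stabilizer : ∀ (g : Γ) (v w : V), graph.Adj v w → s(g • v, g • w) = s(v, w) → g = 1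
  nontrivial : ∀ v : V, ∃ g : Γ, g • v ≠ v
  minimal : ∀ S : Set V, S.Nonempty → (∀ g : Γ, ∀ v ∈ S, g • v ∈ S) →
    (graph.induce S).Preconnected → S = Set.univ
  reduced : ∀ v, ∃ a b c, graph.Adj v a ∧ graph.Adj v b ∧ graph.Adj v c ∧ a ≠ b ∧ b ≠ c ∧ a ≠ c
  edge_orbits : ∃ e : Fin k → Sym2 V, (∀ i, e i ∈ graph.edgeSet) ∧
    ∀ d ∈ graph.edgeSet, ∃! i, ∃ g : Γ, d = Sym2.map (fun v : V => g • v) (e i)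

attribute [instance] FreeSplitting.action

section Splitting

variable {Γ : Type*} [Group Γ]

/-- Equivariant isomorphism of free splittings. -/
def FreeSplitting.setoid (Γ : Type*) [Group Γ] (k : ℕ) : Setoid (FreeSplitting Γ k) where
  r S S' := ∃ e : S.V ≃ S'.V, (∀ (g : Γ) v, e (g • v) = g • e v) ∧
    ∀ v w, S'.graph.Adj (e v) (e w) ↔ S.graph.Adj v w
  iseqv :=
    { refl := fun S => ⟨Equiv.refl _, fun _ _ => rfl, fun _ _ => Iff.rfl⟩
      symm := by
        rintro S S' ⟨e, h₁, h₂⟩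
        refine ⟨e.symm, fun g v => ?_, fun v w => ?_⟩
        · rw [Equiv.symm_apply_eq, h₁, Equiv.apply_symm_apply]
        · rw [← h₂, Equiv.apply_symm_apply, Equiv.apply_symm_apply]
      trans := by
        rintro S S' S'' ⟨e, h₁, h₂⟩ ⟨e', h₁', h₂'⟩
        exact ⟨e.trans e', fun g v => by simp [h₁, h₁'], fun v w => by simp [h₂, h₂']⟩ }

/-- `S` is obtained from `R` by equivariantly collapsing edges. -/
def FreeSplitting.CollapsesTo {k l : ℕ} (R : FreeSplitting Γ k) (S : FreeSplitting Γ l) : Prop :=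
  ∃ p : R.V → S.V, Function.Surjective p ∧ (∀ (g : Γ) v, p (g • v) = g • p v) ∧
    (∀ v w, R.graph.Adj v w → p v = p w ∨ S.graph.Adj (p v) (p w)) ∧
    ∀ v, (R.graph.induce (p ⁻¹' {v})).Preconnected

/-- The vertices of the splitting complex: one-edge free splittings up to isomorphism. -/
def SplittingVertex (Γ : Type*) [Group Γ] : Type _ := Quotient (FreeSplitting.setoid Γ 1)

/-- The vertex of the splitting complex given by a one-edge free splitting. -/
def FreeSplitting.toVertex (S : FreeSplitting Γ 1) : SplittingVertex Γ :=
  Quotient.mk (FreeSplitting.setoid Γ 1) S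

/-- The one-skeleton of the splitting complex: the one-simplices are the two-edge free splittings,
and their faces are obtained by collapsing. -/
def splittingGraph (Γ : Type*) [Group Γ] : SimpleGraph (SplittingVertex Γ) where
  Adj a b := a ≠ b ∧ ∃ (R : FreeSplitting Γ 2) (S S' : FreeSplitting Γ 1),
    R.CollapsesTo S ∧ R.CollapsesTo S' ∧ S.toVertex = a ∧ S'.toVertex = b
  symm := ⟨fun _ _ ⟨h, R, S, S', h₁, h₂, h₃, h₄⟩ => ⟨h.symm, R, S', S, h₂, h₁, h₄, h₃⟩⟩
  loopless := ⟨fun _ h => h.1 rfl⟩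

end Splitting

section Projection

variable {T : Type*} [MetricSpace T] {F : Type*} [Group F] [MulAction F T]

/-- The complement in `Y` of the `A`-translates of the open segment between `x` and `y`. -/
def complement (A : Subgroup F) (Y : Set T) (x y : T) : Set T :=
  {z ∈ Y | ∀ a ∈ A, a • z ∈ seg x y → a • z = x ∨ a • z = y}

/-- The one-edge splitting `S` of `A` is obtained from the subtree `Y` by collapsing all natural
edges except the translates of `[x, y]`: its vertices are the components of the complement of the
translates of the open edge, and the edge `[x, y]` joins the components of `x` and `y`. -/
def IsCollapse (A : Subgroup F) (Y : Set T) (x y : T) (S : FreeSplitting A 1) : Prop :=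
  ∃ p : T → S.V, (∀ v, ∃ z ∈ complement A Y x y, p z = v) ∧
    (∀ (a : A), ∀ z ∈ complement A Y x y, p (a • z) = a • p z) ∧
    (∀ z ∈ complement A Y x y, ∀ w ∈ complement A Y x y,
      p z = p w ↔ seg z w ⊆ complement A Y x y) ∧
    S.graph.Adj (p x) (p y)

end Projection

/-- The image of `A|G_t` under the coarse projection to the splitting complex of `A`: all one-edge
splittings obtained by collapsing all but one natural edge of `A|G_t`. -/
def FoldingPath.proj {n : ℕ} {α ω : ℝ} (G : FoldingPath.{u} n α ω)
    (A : Subgroup (FreeGroup (Fin n))) (t : Set.Icc α ω) : Set (SplittingVertex A) :=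
  {σ | ∃ x y, IsNatEdge (G.sub A t) x y ∧
    ∃ S : FreeSplitting A 1, IsCollapse A (G.sub A t) x y S ∧ S.toVertex = σ}

end FoldPath

set_option linter.unusedSectionVars false
set_option linter.unusedVariables false

namespace FoldPath

/-! Call a time bad if the core of the cover has a point with one gate, either a natural vertex or a
point of valence two (`Bad`, `bad_iff`). The first segment consists of the bad times. The last
consists of the times that are not bad and at which a topological edge carries a legal segment of
length at least 2. What remains is the middle segment.

The quantitative input is bounded cancellation (`bcc`): a folding map of speed `c` backtracks by at
most `c - 1`. Both graphs have volume one, so at most `c - 1` of volume is lost, while backtracking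
over a segment that embeds in the quotient loses its whole length. This settles short time steps
(`bcc_of_small`), and the constants compose exactly.

When a core has at least two gates everywhere, legal segments in it extend indefinitely. Their far
ends stay near the core by bounded cancellation, so the folding maps send core into core, and legal
turns survive. Hence being good persists (`not_bad_mono`), being bad persists for a short time
(`bad_right`), and the last time is good. In good graphs topological edges are legal. Long legal
segments persist, because stretching outweighs the loss `c - 1` at each end (`hasLong_mono`), and
they do not appear just after a time at which all edges are shorter than 2 (`not_long_right`). This
gives half-open intervals. In the middle segment the volume bound is an Euler characteristic count.

For the diameters, one-edge splittings are encoded by half-spaces: subsets of `A` nested with all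
their translates, whose dual tree is the splitting. Points inside edges of a core give such sets,
and nested half-spaces give splittings at distance at most one (`IsHalf.edist_le_one`). In the last
segment the midpoint of a long legal segment keeps defining the same half-space (`cut_map`). In the
first segment, a one-gate point `x` at time `t` carries a legal hair whose length bounds the
cancellation of the map from time `s`, up to an arbitrarily small error (`hairProperty`). So the
partition of `A` by directions at `x` is coarsened by that at some point `y` at time `s`
(`exists_germ`), which makes the half-spaces given by germs at `x` and `y` nested.

Many arguments are real induction: a property passes from all earlier times to their limit, and from
a time to slightly later times. -/

theorem real_induction {a b : ℝ} {P : ℝ → Prop} (h0 : P a)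
    (hr : ∀ t, a ≤ t → t < b → P t → ∃ ε > 0, ∀ t', t < t' → t' ≤ t + ε → t' ≤ b → P t')
    (hl : ∀ t, a < t → t ≤ b → (∀ u, a ≤ u → u < t → P u) → P t) :
    ∀ t, a ≤ t → t ≤ b → P t := by
  by_contra! hcon
  obtain ⟨t0, h1, h2, h3⟩ := hcon
  set S := {t | a ≤ t ∧ t ≤ b ∧ ¬ P t} with hS
  have hne : S.Nonempty := ⟨t0, h1, h2, h3⟩
  have hbdd : BddBelow S := ⟨a, fun t ht => ht.1⟩
  set s := sInf S with hs
  have has : a ≤ s := le_csInf hne fun t ht => ht.1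
  have hsb : s ≤ b := (csInf_le hbdd ⟨h1, h2, h3⟩).trans h2
  have hlow : ∀ u, a ≤ u → u < s → P u := fun u hu hus => by
    by_contra hPu
    exact absurd (csInf_le hbdd ⟨hu, (hus.le.trans hsb), hPu⟩) (not_le.2 hus)
  have hPs : P s := by
    rcases has.eq_or_lt with h | h
    · rwa [← h]
    · exact hl s h hsb hlow
  have hsb' : s < b := by
    rcases hsb.eq_or_lt with h | h
    · have : t0 = s := le_antisymm (h ▸ h2) (csInf_le hbdd ⟨h1, h2, h3⟩)
      exact absurd (this ▸ hPs) h3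
    · exact h
  obtain ⟨ε, hε, he⟩ := hr s has hsb' hPs
  obtain ⟨t, ht, hts⟩ := exists_lt_of_csInf_lt hne (show sInf S < s + ε by linarith)
  have hst : s ≤ t := csInf_le hbdd ht
  rcases hst.eq_or_lt with h | h
  · exact ht.2.2 (h ▸ hPs)
  · exact ht.2.2 (he t h hts.le ht.2.1)

/-! ### Segments, medians and branches in a real tree -/

section Seg

variable {T : Type*} [MetricSpace T]

theorem mem_seg {x y z : T} : z ∈ seg x y ↔ dist x z + dist z y = dist x y := Iff.rfl

theorem left_mem_seg (x y : T) : x ∈ seg x y := by simp [mem_seg]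

theorem right_mem_seg (x y : T) : y ∈ seg x y := by simp [mem_seg]

theorem seg_comm (x y : T) : seg x y = seg y x := by
  ext z
  rw [mem_seg, mem_seg, dist_comm x z, dist_comm z y, dist_comm x y, add_comm]

theorem mem_seg_symm {x y z : T} (h : z ∈ seg x y) : z ∈ seg y x := seg_comm x y ▸ h

theorem mem_seg_self {x z : T} (h : z ∈ seg x x) : z = x := by
  rw [mem_seg, dist_self, dist_comm x z] at h
  exact dist_le_zero.1 (by linarith [dist_nonneg (x := z) (y := x)])

theorem sameDir_iff {x p q : T} : SameDir x p q ↔ x ∉ seg p q := by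
  unfold SameDir
  rw [mem_seg, dist_comm p x, ← not_le]
  have := dist_triangle p x q
  rw [dist_comm p x] at this
  exact not_congr ⟨fun h => le_antisymm h this, fun h => h.le⟩

/-- `w` in `[x, y]` and `y` in `[x, z]`. -/
theorem mem_seg_trans {x y z w : T} (hw : w ∈ seg x y) (hy : y ∈ seg x z) :
    w ∈ seg x z ∧ y ∈ seg w z := by
  simp only [mem_seg] at *
  have h1 := dist_triangle x w z
  have h2 := dist_triangle w y z
  constructor <;> linarith

theorem mem_seg_left {x y z w : T} (hw : w ∈ seg x y) (hy : y ∈ seg x z) : w ∈ seg x z :=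
  (mem_seg_trans hw hy).1

/-- `w` in `[y, z]` and `y` in `[x, z]`. -/
theorem mem_seg_right {x y z w : T} (hw : w ∈ seg y z) (hy : y ∈ seg x z) : w ∈ seg x z :=
  mem_seg_symm (mem_seg_left (mem_seg_symm hw) (mem_seg_symm hy))

theorem mem_seg_between {x y z w : T} (hw : w ∈ seg x y) (hy : y ∈ seg x z) : y ∈ seg w z :=
  (mem_seg_trans hw hy).2

theorem mem_seg_between' {x y z w : T} (hw : w ∈ seg y z) (hy : y ∈ seg x z) : y ∈ seg x w :=
  mem_seg_symm (mem_seg_between (mem_seg_symm hw) (mem_seg_symm hy))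

theorem dist_le_of_mem_seg {x y z : T} (h : z ∈ seg x y) : dist x z ≤ dist x y := by
  rw [mem_seg] at h
  linarith [dist_nonneg (x := z) (y := y)]

theorem dist_le_of_mem_seg' {x y z : T} (h : z ∈ seg x y) : dist z y ≤ dist x y := by
  rw [mem_seg] at h
  linarith [dist_nonneg (x := x) (y := z)]

theorem eq_of_mem_seg_of_mem_seg {x y z : T} (h : z ∈ seg x y) (h' : y ∈ seg x z) : y = z := by
  rw [mem_seg] at *
  rw [dist_comm y z] at h'
  have : dist z y = 0 := by linarith [dist_nonneg (x := z) (y := y)]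
  exact (dist_eq_zero.1 this).symm

variable (hT : IsRealTree T)
include hT

theorem seg_eq_of_dist_eq {x y z w : T} (hz : z ∈ seg x y) (hw : w ∈ seg x y)
    (h : dist x z = dist x w) : z = w := by
  have := hT.four_point x y z w
  rw [mem_seg] at hz hw
  rw [dist_comm y w, dist_comm y z] at this
  have h1 : dist x z + dist w y = dist x y := by linarith
  have h2 : dist x w + dist z y = dist x y := by linarith
  rw [h1, h2, max_self] at this
  exact dist_le_zero.1 (by linarith)

theorem exists_mem_seg_dist {x y : T} {r : ℝ} (h0 : 0 ≤ r) (h1 : r ≤ dist x y) :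
    ∃ z ∈ seg x y, dist x z = r := by
  obtain ⟨c, hc0, hc1, hc⟩ := hT.geodesic x y
  have hxr : dist x (c r) = r := by
    have := hc 0 ⟨le_rfl, dist_nonneg⟩ r ⟨h0, h1⟩
    rw [hc0, zero_sub, abs_neg, abs_of_nonneg h0] at this
    exact this
  have hry : dist (c r) y = dist x y - r := by
    have := hc r ⟨h0, h1⟩ (dist x y) ⟨dist_nonneg, le_rfl⟩
    rw [hc1, abs_sub_comm, abs_of_nonneg (by linarith)] at this
    exact this
  exact ⟨c r, by rw [mem_seg, hxr, hry]; ring, hxr⟩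

theorem mem_seg_of_dist_le {x y z w : T} (hz : z ∈ seg x y) (hw : w ∈ seg x y)
    (h : dist x z ≤ dist x w) : z ∈ seg x w := by
  obtain ⟨z', hz', hd⟩ := exists_mem_seg_dist hT dist_nonneg h
  have := seg_eq_of_dist_eq hT hz (mem_seg_left hz' hw) hd.symm
  exact this ▸ hz'

theorem mem_seg_or {x p r : T} (q : T) (h : x ∈ seg p r) : x ∈ seg p q ∨ x ∈ seg q r := by
  simp only [mem_seg] at *
  have h4 := hT.four_point p r q x
  have h1 := dist_triangle p x q
  have h2 := dist_triangle q x r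
  rw [dist_comm r x, dist_comm r q] at h4
  rw [dist_comm x q] at h1
  rcases le_max_iff.1 h4 with h' | h'
  · left; rw [dist_comm x q]; linarith
  · right; linarith

/-- Concatenation of geodesics that overlap in a nondegenerate segment. -/
theorem mem_seg_concat {x y z w : T} (hy : y ∈ seg x z) (hz : z ∈ seg y w) (hyz : y ≠ z) :
    z ∈ seg x w ∧ y ∈ seg x w := by
  have h1 : z ∈ seg x w := by
    rcases mem_seg_or hT x hz with h | h
    · exact absurd (eq_of_mem_seg_of_mem_seg (mem_seg_symm h) hy) hyz
    · exact h
  exact ⟨h1, mem_seg_left hy h1⟩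

theorem exists_median (x y z : T) : ∃ m, m ∈ seg x y ∧ m ∈ seg y z ∧ m ∈ seg x z := by
  have t1 := dist_triangle x z y
  have t2 := dist_triangle y x z
  have t3 := dist_triangle x y z
  rw [dist_comm z y] at t1
  rw [dist_comm y x] at t2
  obtain ⟨m, hm, hd⟩ := exists_mem_seg_dist hT (x := x) (y := y)
    (r := (dist x y + dist x z - dist y z) / 2) (by linarith) (by linarith)
  refine ⟨m, hm, ?_, ?_⟩
  all_goals
    rw [mem_seg] at *
    have h4 := hT.four_point x y m z
    have t4 := dist_triangle x m z
    have t5 := dist_triangle y m z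
    rw [dist_comm y m] at h4 t5
    have e1 : dist x m + dist y z = (dist x y + dist x z + dist y z) / 2 := by linarith
    have e2 : dist x z + dist m y = (dist x y + dist x z + dist y z) / 2 := by linarith
    rw [e1, e2, max_self] at h4
    try rw [dist_comm y m]
    linarith

theorem seg_subset_of_mem {x y a b : T} (ha : a ∈ seg x y) (hb : b ∈ seg x y) :
    seg a b ⊆ seg x y := by
  intro z hz
  rcases le_total (dist x a) (dist x b) with h | h
  · have hab := mem_seg_of_dist_le hT ha hb h
    exact mem_seg_left (mem_seg_right hz hab) hb
  · have hab := mem_seg_of_dist_le hT hb ha h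
    exact mem_seg_left (mem_seg_right (mem_seg_symm hz) hab) ha

theorem dist_of_mem_seg {x y a b : T} (ha : a ∈ seg x y) (hb : b ∈ seg x y) :
    dist a b = |dist x a - dist x b| := by
  rcases le_total (dist x a) (dist x b) with h | h
  · have hab := mem_seg_of_dist_le hT ha hb h
    rw [mem_seg] at hab
    rw [abs_of_nonpos (by linarith)]; linarith
  · have hab := mem_seg_of_dist_le hT hb ha h
    rw [mem_seg] at hab
    rw [abs_of_nonneg (by linarith), dist_comm a b]; linarith

theorem exists_path (x y : T) : ∃ c : ℝ → T, c 0 = x ∧ c (dist x y) = y ∧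
    (∀ t, 0 ≤ t → t ≤ dist x y → c t ∈ seg x y ∧ dist x (c t) = t) := by
  have : ∀ t : ℝ, ∃ z, (0 ≤ t → t ≤ dist x y → z ∈ seg x y ∧ dist x z = t) := by
    intro t
    by_cases h : 0 ≤ t ∧ t ≤ dist x y
    · obtain ⟨z, hz, hd⟩ := exists_mem_seg_dist hT h.1 h.2
      exact ⟨z, fun _ _ => ⟨hz, hd⟩⟩
    · exact ⟨x, fun h1 h2 => absurd ⟨h1, h2⟩ h⟩
  choose c hc using this
  refine ⟨c, ?_, ?_, hc⟩
  · have := (hc 0 le_rfl dist_nonneg).2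
    exact (dist_eq_zero.1 this).symm
  · obtain ⟨h1, h2⟩ := hc _ dist_nonneg le_rfl
    exact seg_eq_of_dist_eq hT h1 (right_mem_seg _ _) h2

/-- Points in the same direction: initial segments agree. -/
theorem exists_common_of_not_mem {x p q : T} (h : x ∉ seg p q) :
    ∃ m, m ≠ x ∧ m ∈ seg x p ∧ m ∈ seg x q := by
  obtain ⟨m, h1, h2, h3⟩ := exists_median hT x p q
  exact ⟨m, fun e => h (e ▸ h2), h1, h3⟩

theorem not_mem_seg_of_common {x p q m : T} (hm : m ≠ x) (h1 : m ∈ seg x p) (h2 : m ∈ seg x q) :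
    x ∉ seg p q := by
  intro h
  rw [mem_seg] at *
  have h3 := dist_triangle p m q
  have := dist_pos.2 hm
  rw [dist_comm p m] at h3
  rw [dist_comm p x] at h
  rw [dist_comm m x] at this
  linarith

theorem not_mem_seg_of_mem {x p m : T} (hm : m ≠ x) (h : m ∈ seg x p) : x ∉ seg m p :=
  not_mem_seg_of_common hT hm (right_mem_seg _ _) h

omit hT in
theorem ne_of_not_mem_seg {x p q : T} (h : x ∉ seg p q) : p ≠ x ∧ q ≠ x :=
  ⟨fun e => h (e ▸ left_mem_seg _ _), fun e => h (e ▸ right_mem_seg _ _)⟩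

theorem not_mem_seg_trans {x p q r : T} (h1 : x ∉ seg p q) (h2 : x ∉ seg q r) : x ∉ seg p r :=
  fun h => (mem_seg_or hT q h).elim h1 h2

omit hT in
theorem not_mem_seg_symm {x p q : T} (h : x ∉ seg p q) : x ∉ seg q p := fun h' => h (mem_seg_symm h')

/-- A point close to `p` is in the same direction as `p`. -/
theorem not_mem_seg_of_dist_lt {x p q : T} (h : dist p q < dist p x) : x ∉ seg p q := by
  intro h'
  exact absurd (dist_le_of_mem_seg h') (not_le.2 h)

end Seg

/-! ### Maps with constant slope, legality and bounded cancellation -/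

section Map

variable {T T' : Type*} [MetricSpace T] [MetricSpace T']

/-- `f` is a homothety of ratio `c` along an initial piece of each segment. -/
def HasSlope (c : ℝ) (f : T → T') : Prop :=
  ∀ x p : T, p ≠ x → ∃ z ∈ seg x p, z ≠ x ∧
    ∀ a ∈ seg x z, ∀ b ∈ seg x z, dist (f a) (f b) = c * dist a b

/-- Real induction along the segment. The homothetic piece pointing forward extends the estimate
beyond a point, and the one pointing backward closes it at a limit. -/
theorem HasSlope.lipschitz (hT : IsRealTree T) {c : ℝ} {f : T → T'} (hf : HasSlope c f)
    (hc : 0 ≤ c) (x y : T) : dist (f x) (f y) ≤ c * dist x y := by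
  obtain ⟨γ, h0, h1, hγ⟩ := exists_path hT x y
  have key := real_induction (a := 0) (b := dist x y)
    (P := fun t => dist (f x) (f (γ t)) ≤ c * t) (by simp [h0]) ?_ ?_ (dist x y) dist_nonneg le_rfl
  · rwa [h1] at key
  · intro t ht0 ht hP
    obtain ⟨hm, hd⟩ := hγ t ht0 ht.le
    have hne : y ≠ γ t := by
      rintro e; rw [← e] at hd; linarith
    obtain ⟨z, hz, hzne, hzs⟩ := hf (γ t) y hne
    refine ⟨dist (γ t) z, dist_pos.2 hzne.symm, fun t' htt' ht' htb => ?_⟩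
    obtain ⟨hm', hd'⟩ := hγ t' (ht0.trans htt'.le) htb
    have h2 : γ t ∈ seg x (γ t') := mem_seg_of_dist_le hT hm hm' (by linarith)
    have h3 : γ t' ∈ seg (γ t) y := mem_seg_between h2 hm'
    have h4 : dist (γ t) (γ t') = t' - t := by rw [mem_seg] at h2; linarith
    have h5 : γ t' ∈ seg (γ t) z := mem_seg_of_dist_le hT h3 hz (by linarith)
    have h6 := hzs _ (left_mem_seg _ _) _ h5
    have := dist_triangle (f x) (f (γ t)) (f (γ t'))
    rw [h6, h4] at this
    linarith
  · intro t ht0 ht hP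
    obtain ⟨hm, hd⟩ := hγ t ht0.le ht
    have hne : x ≠ γ t := by
      rintro e; rw [← e, dist_self] at hd; linarith
    obtain ⟨z, hz, hzne, hzs⟩ := hf (γ t) x hne
    have h6 := hzs _ (left_mem_seg _ _) _ (right_mem_seg _ _)
    rw [mem_seg] at hz
    have hzd : dist x z = t - dist (γ t) z := by
      rw [dist_comm (γ t) x, dist_comm z x] at hz; linarith
    have hu0 : 0 ≤ t - dist (γ t) z := by rw [← hzd]; exact dist_nonneg
    have hu1 : t - dist (γ t) z < t := by linarith [dist_pos.2 hzne.symm]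
    obtain ⟨hmu, hdu⟩ := hγ _ hu0 (hu1.le.trans ht)
    have hzx : z ∈ seg x y := mem_seg_left (mem_seg_symm hz) hm
    have : γ (t - dist (γ t) z) = z := seg_eq_of_dist_eq hT hmu hzx (by rw [hdu, hzd])
    have h7 := hP _ hu0 hu1
    rw [this] at h7
    have := dist_triangle (f x) (f z) (f (γ t))
    rw [dist_comm (f z), h6] at this
    nlinarith

/-- The intermediate value theorem for maps from a segment to a tree. -/
theorem exists_mem_seg_map_eq (hT : IsRealTree T) (hT' : IsRealTree T') {c : ℝ} {f : T → T'}
    (hc : 0 < c) (hf : ∀ x y, dist (f x) (f y) ≤ c * dist x y) {p q : T} {m : T'}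
    (hm : m ∈ seg (f p) (f q)) : ∃ y ∈ seg p q, f y = m := by
  by_contra! hcon
  obtain ⟨γ, h0, h1, hγ⟩ := exists_path hT p q
  have key := real_induction (a := 0) (b := dist p q)
    (P := fun t => m ∉ seg (f p) (f (γ t))) ?_ ?_ ?_ (dist p q) dist_nonneg le_rfl
  · rw [h1] at key; exact key hm
  · rw [h0]
    intro h
    exact hcon p (left_mem_seg _ _) (mem_seg_self h).symm
  · intro t ht0 ht hP
    obtain ⟨hmt, hdt⟩ := hγ t ht0 ht.le
    have hpos := dist_pos.2 (hcon _ hmt)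
    refine ⟨dist (f (γ t)) m / (2 * c), by positivity, fun t' htt' ht' htb => ?_⟩
    obtain ⟨hm', hd'⟩ := hγ t' (ht0.trans htt'.le) htb
    refine not_mem_seg_trans hT' hP (not_mem_seg_of_dist_lt hT' ?_)
    have h3 := hf (γ t) (γ t')
    rw [dist_of_mem_seg hT hmt hm', hdt, hd', abs_of_neg (by linarith)] at h3
    have : c * (t' - t) ≤ c * (dist (f (γ t)) m / (2 * c)) :=
      mul_le_mul_of_nonneg_left (by linarith) hc.le
    have e : c * (dist (f (γ t)) m / (2 * c)) = dist (f (γ t)) m / 2 := by field_simp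
    linarith
  · intro t ht0 ht hP
    obtain ⟨hmt, hdt⟩ := hγ t ht0.le ht
    have hpos := dist_pos.2 (hcon _ hmt)
    have hε : 0 < dist (f (γ t)) m / (2 * c) := by positivity
    set u := max 0 (t - dist (f (γ t)) m / (2 * c)) with hu
    have hu0 : 0 ≤ u := le_max_left _ _
    have hut : u < t := max_lt ht0 (by linarith)
    obtain ⟨hm', hd'⟩ := hγ u hu0 (hut.le.trans ht)
    refine not_mem_seg_trans hT' (hP u hu0 hut) (not_mem_seg_symm (not_mem_seg_of_dist_lt hT' ?_))
    have h3 := hf (γ t) (γ u)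
    rw [dist_of_mem_seg hT hmt hm', hdt, hd', abs_of_pos (by linarith)] at h3
    have h4 : t - u ≤ dist (f (γ t)) m / (2 * c) := by
      have := le_max_right 0 (t - dist (f (γ t)) m / (2 * c)); linarith
    have : c * (t - u) ≤ c * (dist (f (γ t)) m / (2 * c)) :=
      mul_le_mul_of_nonneg_left h4 hc.le
    have e : c * (dist (f (γ t)) m / (2 * c)) = dist (f (γ t)) m / 2 := by field_simp
    linarith

/-- `f` stretches the pair `p`, `q` by the factor `c`. -/
def Str (c : ℝ) (f : T → T') (p q : T) : Prop := dist (f p) (f q) = c * dist p q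

theorem Str.symm {c : ℝ} {f : T → T'} {p q : T} (h : Str c f p q) : Str c f q p := by
  unfold Str at *; rwa [dist_comm, dist_comm q p]

theorem Str.self (c : ℝ) (f : T → T') (p : T) : Str c f p p := by simp [Str]

/-- Equality in the Lipschitz bound on the whole segment forces equality on both pieces and in the
triangle inequality for the images. -/
theorem Str.mono {c : ℝ} {f : T → T'} (hf : ∀ x y, dist (f x) (f y) ≤ c * dist x y) {p q a : T}
    (h : Str c f p q) (ha : a ∈ seg p q) : Str c f p a ∧ Str c f a q ∧ f a ∈ seg (f p) (f q) := by
  unfold Str at *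
  rw [mem_seg] at *
  have h1 := hf p a
  have h2 := hf a q
  have h3 := dist_triangle (f p) (f a) (f q)
  have h4 : c * dist p a + c * dist a q = c * dist p q := by rw [← mul_add, ha]
  refine ⟨?_, ?_, ?_⟩ <;> linarith

theorem Str.sub (hT : IsRealTree T) {c : ℝ} {f : T → T'}
    (hf : ∀ x y, dist (f x) (f y) ≤ c * dist x y) {p q a b : T}
    (h : Str c f p q) (ha : a ∈ seg p q) (hb : b ∈ seg p q) : Str c f a b := by
  rcases le_total (dist p a) (dist p b) with hd | hd
  · have := mem_seg_of_dist_le hT ha hb hd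
    exact (((h.mono hf hb).1).mono hf this).2.1
  · have := mem_seg_of_dist_le hT hb ha hd
    exact ((((h.mono hf ha).1).mono hf this).2.1).symm

theorem Str.concat {c : ℝ} {f : T → T'} {p q r : T} (h1 : Str c f p q) (h2 : Str c f q r)
    (hq : q ∈ seg p r) (hfq : f q ∈ seg (f p) (f r)) : Str c f p r := by
  unfold Str at *
  rw [mem_seg] at *
  rw [← hfq, ← hq, h1, h2]; ring

theorem HasSlope.exists_str {c : ℝ} {f : T → T'} (hf : HasSlope c f) {x p : T} (h : p ≠ x) :
    ∃ z ∈ seg x p, z ≠ x ∧ Str c f x z := by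
  obtain ⟨z, hz, hzx, hs⟩ := hf x p h
  exact ⟨z, hz, hzx, hs _ (left_mem_seg _ _) _ (right_mem_seg _ _)⟩

theorem SameGate.symm {f : T → T'} {x p q : T} (h : SameGate f x p q) : SameGate f x q p := by
  obtain ⟨r, hr, h⟩ := h
  exact ⟨r, hr, fun q' hq p' hp e hle => (h p' hp q' hq e.symm (e ▸ hle)).symm⟩

theorem SameGate.trans (hT : IsRealTree T) {f : T → T'} {x p q s : T} (hq : q ≠ x)
    (h1 : SameGate f x p q) (h2 : SameGate f x q s) : SameGate f x p s := by
  obtain ⟨r1, hr1, h1⟩ := h1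
  obtain ⟨r2, hr2, h2⟩ := h2
  refine ⟨min (min r1 r2) (dist x q), lt_min (lt_min hr1 hr2) (dist_pos.2 hq.symm),
    fun p' hp s' hs e hle => ?_⟩
  have l1 := hle.trans ((min_le_left _ _).trans (min_le_left _ _))
  have l2 := hle.trans ((min_le_left _ _).trans (min_le_right _ _))
  have l3 := hle.trans (min_le_right _ _)
  obtain ⟨q', hq', hd⟩ := exists_mem_seg_dist hT dist_nonneg l3
  rw [h1 p' hp q' hq' hd.symm l1]
  exact h2 q' hq' s' hs (hd.trans e) (hd ▸ l2)

theorem sameGate_of_not_mem (hT : IsRealTree T) (f : T → T') {x p q : T} (h : x ∉ seg p q) :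
    SameGate f x p q := by
  obtain ⟨m, hm, hmp, hmq⟩ := exists_common_of_not_mem hT h
  refine ⟨dist x m, dist_pos.2 hm.symm, fun p' hp q' hq e hle => ?_⟩
  have h1 := mem_seg_of_dist_le hT hp hmp hle
  have h2 := mem_seg_of_dist_le hT hq hmq (e ▸ hle)
  rw [seg_eq_of_dist_eq hT h1 h2 e]

theorem sameGate_congr (hT : IsRealTree T) (f : T → T') {x p p' q q' : T} (h : x ∉ seg p p')
    (h' : x ∉ seg q q') : SameGate f x p q ↔ SameGate f x p' q' := by
  have a1 := sameGate_of_not_mem hT f h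
  have a2 := sameGate_of_not_mem hT f h'
  obtain ⟨b1, b2⟩ := ne_of_not_mem_seg h
  obtain ⟨b3, b4⟩ := ne_of_not_mem_seg h'
  exact ⟨fun hs => (a1.symm.trans hT b1 hs).trans hT b3 a2,
    fun hs => (a1.trans hT b2 hs).trans hT b4 a2.symm⟩

/-- Otherwise the two image segments share an initial piece. Both are traversed at speed `c`, so
points at equal small distance from `q` have the same image, which is the definition of a common
gate. -/
theorem Str.mem_seg_of_not_sameGate (hT : IsRealTree T) (hT' : IsRealTree T') {c : ℝ} {f : T → T'}
    (hc : 0 < c) (hf : ∀ x y, dist (f x) (f y) ≤ c * dist x y) {q p r : T}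
    (h1 : Str c f q p) (h2 : Str c f q r) (h : ¬ SameGate f q p r) : f q ∈ seg (f p) (f r) := by
  by_contra hcon
  obtain ⟨m, hm, hmp, hmr⟩ := exists_common_of_not_mem hT' hcon
  refine h ⟨dist (f q) m / c, div_pos (dist_pos.2 hm.symm) hc, fun p' hp r' hr e hle => ?_⟩
  have a1 := h1.mono hf hp
  have a2 := h2.mono hf hr
  have hle' : c * dist q p' ≤ dist (f q) m := by
    rw [le_div_iff₀ hc] at hle; linarith
  have b1 : f p' ∈ seg (f q) m :=
    mem_seg_of_dist_le hT' a1.2.2 hmp (by rw [a1.1]; exact hle')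
  have b2 : f r' ∈ seg (f q) m :=
    mem_seg_of_dist_le hT' a2.2.2 hmr (by rw [a2.1, ← e]; exact hle')
  exact seg_eq_of_dist_eq hT' b1 b2 (by rw [a1.1, a2.1, e])

theorem Str.not_sameGate (hT : IsRealTree T) (hT' : IsRealTree T') {c : ℝ} {f : T → T'}
    (hc : 0 < c) (hf : ∀ x y, dist (f x) (f y) ≤ c * dist x y) {q p r : T} (hp : p ≠ q)
    (hr : r ≠ q) (h1 : Str c f q p) (h2 : Str c f q r) (h : f q ∈ seg (f p) (f r)) :
    ¬ SameGate f q p r := by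
  rintro ⟨s, hs, hg⟩
  set d := min s (min (dist q p) (dist q r)) with hd
  have hdpos : 0 < d := lt_min hs (lt_min (dist_pos.2 hp.symm) (dist_pos.2 hr.symm))
  have d1 : d ≤ dist q p := (min_le_right _ _).trans (min_le_left _ _)
  have d2 : d ≤ dist q r := (min_le_right _ _).trans (min_le_right _ _)
  obtain ⟨p', hp', e1⟩ := exists_mem_seg_dist hT hdpos.le d1
  obtain ⟨r', hr', e2⟩ := exists_mem_seg_dist hT hdpos.le d2
  have e := hg p' hp' r' hr' (e1.trans e2.symm) (by rw [e1]; exact min_le_left _ _)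
  have a1 := h1.mono hf hp'
  have a2 := h2.mono hf hr'
  have hne : f p' ≠ f q := by
    intro e'
    have := a1.1
    unfold Str at this
    rw [e', dist_self, e1] at this
    have := mul_pos hc hdpos
    linarith
  exact not_mem_seg_of_common hT' hne a1.2.2 (e ▸ a2.2.2) h

/-- Locally injective paths are geodesic. -/
theorem str_of_legal (hT : IsRealTree T) (hT' : IsRealTree T') {c : ℝ} {f : T → T'}
    (hc : 0 < c) (hf : HasSlope c f) {p q : T} (hl : IsLegal f p q) : Str c f p q := by
  have hlip := hf.lipschitz hT hc.le
  obtain ⟨γ, h0, h1, hγ⟩ := exists_path hT p q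
  have key := real_induction (a := 0) (b := dist p q)
    (P := fun t => Str c f p (γ t)) ?_ ?_ ?_ (dist p q) dist_nonneg le_rfl
  · rwa [h1] at key
  · rw [h0]; exact Str.self _ _ _
  · intro t ht0 ht hP
    obtain ⟨hm, hd⟩ := hγ t ht0 ht.le
    have hne : q ≠ γ t := by
      rintro e; rw [← e] at hd; linarith
    obtain ⟨z, hz, hzne, hzs⟩ := hf.exists_str hne
    refine ⟨dist (γ t) z, dist_pos.2 hzne.symm, fun t' htt' ht' htb => ?_⟩
    obtain ⟨hm', hd'⟩ := hγ t' (ht0.trans htt'.le) htb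
    have h2 : γ t ∈ seg p (γ t') := mem_seg_of_dist_le hT hm hm' (by linarith)
    have h3 : γ t' ∈ seg (γ t) q := mem_seg_between h2 hm'
    have h4 : dist (γ t) (γ t') = t' - t := by rw [mem_seg] at h2; linarith
    have h5 : γ t' ∈ seg (γ t) z := mem_seg_of_dist_le hT h3 hz (by linarith)
    have hs' := (hzs.mono hlip h5).1
    rcases eq_or_ne (γ t) p with e | e
    · rw [← e]; exact hs'
    · refine hP.concat hs' h2 (hP.symm.mem_seg_of_not_sameGate hT hT' hc hlip hs' ?_)
      have hne' : γ t' ≠ γ t := by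
        intro e'; rw [e', dist_self] at h4; linarith
      intro hsg
      refine hl (γ t) hm e hne.symm ?_
      refine (sameGate_congr hT f ?_ ?_).1 hsg
      · intro h; exact e (mem_seg_self h)
      · exact not_mem_seg_of_mem hT hne' h3
  · intro t ht0 ht hP
    obtain ⟨hm, hd⟩ := hγ t ht0.le ht
    have hne : p ≠ γ t := by
      rintro e; rw [← e, dist_self] at hd; linarith
    -- At a limit parameter the Lipschitz bound makes the defect from a nearby earlier parameter
    -- arbitrarily small.
    refine le_antisymm (hlip _ _) (le_of_forall_pos_le_add fun ε hε => ?_)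
    set u := max 0 (t - ε / (2 * c)) with hu
    have hu0 : 0 ≤ u := le_max_left _ _
    have hut : u < t := max_lt ht0 (by have : 0 < ε / (2 * c) := by positivity
                                       linarith)
    obtain ⟨hm', hd'⟩ := hγ u hu0 (hut.le.trans ht)
    have hPu := hP u hu0 hut
    unfold Str at hPu
    have h2 : t - u ≤ ε / (2 * c) := by
      have := le_max_right 0 (t - ε / (2 * c)); linarith
    have h3 := hlip (γ u) (γ t)
    rw [dist_of_mem_seg hT hm' hm, hd, hd', abs_of_neg (by linarith)] at h3
    have h4 := dist_triangle (f p) (f (γ t)) (f (γ u))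
    rw [dist_comm (f (γ t))] at h4
    rw [hPu, hd'] at h4
    rw [hd]
    have h5 : c * (t - u) ≤ ε / 2 := by
      calc c * (t - u) ≤ c * (ε / (2 * c)) := mul_le_mul_of_nonneg_left h2 hc.le
        _ = ε / 2 := by field_simp
    nlinarith

/-- Cancellation in `f` is at most `κ`. -/
def BCC (f : T → T') (κ : ℝ) : Prop :=
  ∀ p q, f p = f q → ∀ y ∈ seg p q, dist (f y) (f p) ≤ κ

theorem BCC.mono {f : T → T'} {κ κ' : ℝ} (h : BCC f κ) (hk : κ ≤ κ') : BCC f κ' :=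
  fun p q e y hy => (h p q e y hy).trans hk

/-- The median of the three images has preimages on either side of `y`. These have equal image, so
the definition of cancellation applies to them with `y` in between. -/
theorem BCC.exists_near (hT : IsRealTree T) (hT' : IsRealTree T') {c κ : ℝ} {f : T → T'}
    (hc : 0 < c) (hf : ∀ x y, dist (f x) (f y) ≤ c * dist x y) (h : BCC f κ) {p q y : T}
    (hy : y ∈ seg p q) : ∃ m ∈ seg (f p) (f q), m ∈ seg (f p) (f y) ∧ m ∈ seg (f y) (f q) ∧
      dist (f y) m ≤ κ := by
  obtain ⟨m, h1, h2, h3⟩ := exists_median hT' (f p) (f y) (f q)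
  obtain ⟨p', hp', e1⟩ := exists_mem_seg_map_eq hT hT' hc hf h1
  obtain ⟨q', hq', e2⟩ := exists_mem_seg_map_eq hT hT' hc hf h2
  refine ⟨m, h3, h1, h2, ?_⟩
  rw [← e1]
  refine h p' q' (e1.trans e2.symm) y ?_
  have : y ∈ seg p' q := mem_seg_between hp' hy
  exact mem_seg_between' hq' this

/-- Move `f y` to a point of `[f p, f q]`, at a cost of `κ` that `g` multiplies by `c'`. Then use
the cancellation of `g` on that segment. -/
theorem BCC.comp {T'' : Type*} [MetricSpace T''] (hT : IsRealTree T) (hT' : IsRealTree T')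
    {c c' κ κ' : ℝ} {f : T → T'} {g : T' → T''}
    (hc : 0 < c) (hf : ∀ x y, dist (f x) (f y) ≤ c * dist x y)
    (hc' : 0 < c') (hg : ∀ x y, dist (g x) (g y) ≤ c' * dist x y)
    (h : BCC f κ) (h' : BCC g κ') : BCC (g ∘ f) (c' * κ + κ') := by
  intro p q e y hy
  obtain ⟨m, hm, -, -, hd⟩ := h.exists_near hT hT' hc hf hy
  have h1 := h' (f p) (f q) e m hm
  have h2 := hg (f y) m
  have h3 := dist_triangle (g (f y)) (g m) (g (f p))
  have h4 : c' * dist (f y) m ≤ c' * κ := mul_le_mul_of_nonneg_left hd hc'.le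
  simp only [Function.comp]
  linarith

theorem BCC.id : BCC (fun x : T => x) 0 := by
  intro p q e y hy
  have e : p = q := e
  subst e
  rw [mem_seg_self hy, dist_self]

end Map

/-! ### Subtrees, natural vertices and natural edges -/

section Subtree

variable {T : Type*} [MetricSpace T]

/-- A subtree. -/
def Cvx (Y : Set T) : Prop := ∀ x ∈ Y, ∀ y ∈ Y, seg x y ⊆ Y

theorem Cvx.univ : Cvx (Set.univ : Set T) := fun _ _ _ _ _ _ => Set.mem_univ _

theorem isNatVertex_iff {Y : Set T} {x : T} : IsNatVertex Y x ↔ x ∈ Y ∧ ∃ p ∈ Y, ∃ q ∈ Y, ∃ r ∈ Y,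
    p ≠ x ∧ q ≠ x ∧ r ≠ x ∧ x ∈ seg p q ∧ x ∈ seg q r ∧ x ∈ seg p r := by
  simp only [IsNatVertex, sameDir_iff, not_not]

theorem IsNatVertex.mono {Y Y' : Set T} {x : T} (h : IsNatVertex Y x) (hY : Y ⊆ Y') :
    IsNatVertex Y' x := by
  obtain ⟨h0, p, hp, q, hq, r, hr, h⟩ := h
  exact ⟨hY h0, p, hY hp, q, hY hq, r, hY hr, h⟩

theorem IsNatVertex.univ {Y : Set T} {x : T} (h : IsNatVertex Y x) : IsNatVertex Set.univ x :=
  h.mono (Set.subset_univ _)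

theorem isNatVertex_of_median {Y : Set T} (hY : Cvx Y) {x y z m : T} (hx : x ∈ Y) (hy : y ∈ Y)
    (hz : z ∈ Y) (h1 : m ∈ seg x y) (h2 : m ∈ seg y z) (h3 : m ∈ seg x z) (n1 : m ≠ x)
    (n2 : m ≠ y) (n3 : m ≠ z) : IsNatVertex Y m :=
  isNatVertex_iff.2 ⟨hY _ hx _ hy h1, x, hx, y, hy, z, hz, n1.symm, n2.symm, n3.symm, h1, h2, h3⟩

/-- At a point which is not a natural vertex there are at most two directions. -/
theorem two_of_not_natVertex {Y : Set T} {x p q r : T} (hx : ¬ IsNatVertex Y x) (hxY : x ∈ Y)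
    (hp : p ∈ Y) (hq : q ∈ Y) (hr : r ∈ Y) (hrx : r ≠ x) (hpx : p ≠ x) (hqx : q ≠ x)
    (h : x ∈ seg p q) : x ∉ seg p r ∨ x ∉ seg q r := by
  by_contra! hcon
  exact hx (isNatVertex_iff.2 ⟨hxY, p, hp, q, hq, r, hr, hpx, hqx, hrx, h, hcon.2, hcon.1⟩)

/-- Two directions without a natural vertex between the points and the base point. -/
theorem mem_seg_or_of_no_natVertex (hT : IsRealTree T) {Y : Set T} (hY : Cvx Y) {x p q : T}
    (hx : x ∈ Y) (hp : p ∈ Y) (hq : q ∈ Y) (h : x ∉ seg p q)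
    (hn : ∀ z ∈ seg x p, z ≠ x → z ≠ p → ¬ IsNatVertex Y z) : p ∈ seg x q ∨ q ∈ seg x p := by
  obtain ⟨m, h1, h2, h3⟩ := exists_median hT x p q
  by_cases e1 : m = p
  · left; exact e1 ▸ h3
  by_cases e2 : m = q
  · right; exact e2 ▸ h1
  have e0 : m ≠ x := fun e => h (e ▸ h2)
  exact absurd (isNatVertex_of_median hY hx hp hq h1 h2 h3 e0 e1 e2) (hn m h1 e0 e1)

theorem IsNatEdge.symm {Y : Set T} {x y : T} (h : IsNatEdge Y x y) : IsNatEdge Y y x :=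
  ⟨h.2.1, h.1, h.2.2.1.symm, fun z hz h1 h2 => h.2.2.2 z (mem_seg_symm hz) h2 h1⟩

theorem IsNatEdge.subset {Y : Set T} (hY : Cvx Y) {x y : T} (h : IsNatEdge Y x y) : seg x y ⊆ Y :=
  hY _ h.1.1 _ h.2.1.1

/-- Natural edges with a common interior point agree up to orientation. -/
theorem IsNatEdge.eq_or_of_mem (hT : IsRealTree T) {Y : Set T} (hY : Cvx Y) {x y x' y' z : T}
    (h : IsNatEdge Y x y) (h' : IsNatEdge Y x' y') (hz : z ∈ seg x y) (hzx : z ≠ x) (hzy : z ≠ y)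
    (hz' : z ∈ seg x' y') (hzx' : z ≠ x') (hzy' : z ≠ y') :
    (x = x' ∧ y = y') ∨ (x = y' ∧ y = x') := by
  have hnz := h.2.2.2 z hz hzx hzy
  have hzY := h.subset hY hz
  -- In a given direction from `z` both edges end at the first natural vertex, so their endpoints
  -- there agree.
  have key : ∀ {a b a' b'}, IsNatEdge Y a b → IsNatEdge Y a' b' → z ∈ seg a b → z ≠ a → z ≠ b →
      z ∈ seg a' b' → z ≠ a' → z ≠ b' → z ∉ seg a a' → a = a' := by
    intro a b a' b' h h' hz hza hzb hz' hza' hzb' hd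
    have hsub : ∀ {a b}, IsNatEdge Y a b → z ∈ seg a b → z ≠ a → z ≠ b →
        ∀ w ∈ seg z a, w ≠ a → ¬ IsNatVertex Y w := by
      intro a b h hz hza hzb w hw hwa
      rcases eq_or_ne w z with e | e
      · exact e ▸ hnz
      · refine h.2.2.2 w (mem_seg_left (mem_seg_symm hw) hz) hwa ?_
        rintro rfl
        exact hzb (eq_of_mem_seg_of_mem_seg hz (mem_seg_symm hw)).symm
    rcases mem_seg_or_of_no_natVertex hT hY hzY h.1.1 h'.1.1 hd
        (fun w hw _ hwa => hsub h hz hza hzb w hw hwa) with h1 | h1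
    · by_contra hne
      exact hsub h' hz' hza' hzb' a h1 hne h.1
    · by_contra hne
      exact hsub h hz hza hzb a' h1 (Ne.symm hne) h'.1
  rcases two_of_not_natVertex hnz hzY h'.1.1 h'.2.1.1 h.1.1 hzx.symm hzx'.symm hzy'.symm hz'
    with h1 | h1
  · have e1 := key h h' hz hzx hzy hz' hzx' hzy' (not_mem_seg_symm h1)
    left
    refine ⟨e1, ?_⟩
    refine key h.symm h'.symm (mem_seg_symm hz) hzy hzx (mem_seg_symm hz') hzy' hzx' ?_
    rcases two_of_not_natVertex hnz hzY h'.1.1 h'.2.1.1 h.2.1.1 hzy.symm hzx'.symm hzy'.symm hz'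
      with h2 | h2
    · exact absurd (e1 ▸ hz) h2
    · exact not_mem_seg_symm h2
  · have e1 := key h h'.symm hz hzx hzy (mem_seg_symm hz') hzy' hzx' (not_mem_seg_symm h1)
    right
    refine ⟨e1, ?_⟩
    refine key h.symm h' (mem_seg_symm hz) hzy hzx hz' hzx' hzy' ?_
    rcases two_of_not_natVertex hnz hzY h'.1.1 h'.2.1.1 h.2.1.1 hzy.symm hzx'.symm hzy'.symm hz'
      with h2 | h2
    · exact not_mem_seg_symm h2
    · exact absurd (e1 ▸ hz) h2

end Subtree

/-! ### Minimal subtrees of subgroups; separation of vertices and of orbits -/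

section Action

variable {T : Type*} [MetricSpace T] {F : Type*} [Group F] [MulAction F T]

theorem core_cvx (A : Subgroup F) : Cvx (core T A) := by
  intro x hx y hy z hz
  rintro Y ⟨h1, h2, h3⟩
  exact h3 x (hx Y ⟨h1, h2, h3⟩) y (hy Y ⟨h1, h2, h3⟩) hz

theorem smul_mem_core {A : Subgroup F} {a : F} (ha : a ∈ A) {x : T} (hx : x ∈ core T A) :
    a • x ∈ core T A := by
  rintro Y ⟨h1, h2, h3⟩
  exact h2 a ha x (hx Y ⟨h1, h2, h3⟩)

theorem core_subset {A : Subgroup F} {Y : Set T} (h1 : Y.Nonempty)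
    (h2 : ∀ a ∈ A, ∀ x ∈ Y, a • x ∈ Y) (h3 : Cvx Y) : core T A ⊆ Y :=
  Set.sInter_subset_of_mem ⟨h1, h2, h3⟩

variable (hO : IsOuterSpacePoint F T)
include hO

theorem IsOuterSpacePoint.smul_mem_seg {x y z : T} (g : F) (h : z ∈ seg x y) :
    g • z ∈ seg (g • x) (g • y) := by
  rw [mem_seg] at *
  rw [hO.isometric, hO.isometric, hO.isometric, h]

theorem IsOuterSpacePoint.smul_mem_seg_iff {x y z : T} (g : F) :
    g • z ∈ seg (g • x) (g • y) ↔ z ∈ seg x y := by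
  rw [mem_seg, mem_seg, hO.isometric, hO.isometric, hO.isometric]

theorem IsOuterSpacePoint.natVertex_smul {A : Subgroup F} {a : F} (ha : a ∈ A) {x : T}
    (h : IsNatVertex (core T A) x) : IsNatVertex (core T A) (a • x) := by
  rw [isNatVertex_iff] at *
  obtain ⟨h0, p, hp, q, hq, r, hr, n1, n2, n3, h1, h2, h3⟩ := h
  have inj : ∀ {y : T}, y ≠ x → a • y ≠ a • x := fun hy e => hy (smul_left_cancel _ e)
  exact ⟨smul_mem_core ha h0, _, smul_mem_core ha hp, _, smul_mem_core ha hq, _,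
    smul_mem_core ha hr, inj n1, inj n2, inj n3, hO.smul_mem_seg a h1, hO.smul_mem_seg a h2,
    hO.smul_mem_seg a h3⟩

theorem IsOuterSpacePoint.natEdge_smul {A : Subgroup F} {a : F} (ha : a ∈ A) {x y : T}
    (h : IsNatEdge (core T A) x y) : IsNatEdge (core T A) (a • x) (a • y) := by
  refine ⟨hO.natVertex_smul ha h.1, hO.natVertex_smul ha h.2.1,
    fun e => h.2.2.1 (smul_left_cancel _ e), fun z hz h1 h2 hn => ?_⟩
  have hn' := hO.natVertex_smul (A.inv_mem ha) hn
  refine h.2.2.2 (a⁻¹ • z) ?_ ?_ ?_ hn'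
  · rw [← hO.smul_mem_seg_iff a, smul_inv_smul]; exact hz
  · rintro rfl; exact h1 (smul_inv_smul _ _).symm
  · rintro rfl; exact h2 (smul_inv_smul _ _).symm

theorem IsOuterSpacePoint.core_top : core T (⊤ : Subgroup F) = Set.univ := hO.minimal

/-- The union of all segments between translates of `x0` is an invariant subtree. -/
theorem IsOuterSpacePoint.core_subset_hull (A : Subgroup F) (x0 : T) {w : T} (hw : w ∈ core T A) :
    ∃ a ∈ A, ∃ b ∈ A, w ∈ seg (a • x0) (b • x0) := by
  have := core_subset (T := T) (A := A) (Y := {w | ∃ a ∈ A, ∃ b ∈ A, w ∈ seg (a • x0) (b • x0)})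
    ⟨x0, 1, A.one_mem, 1, A.one_mem, by rw [one_smul]; exact left_mem_seg _ _⟩ ?_ ?_ hw
  · exact this
  · rintro c hc x ⟨a, ha, b, hb, h⟩
    exact ⟨c * a, A.mul_mem hc ha, c * b, A.mul_mem hc hb, by
      rw [mul_smul, mul_smul]; exact hO.smul_mem_seg c h⟩
  · rintro u ⟨a, ha, b, hb, hu⟩ v ⟨c, hc, d, hd, hv⟩ z hz
    rcases mem_seg_or hO.tree (c • x0) hz with h | h
    · rcases mem_seg_or hO.tree (a • x0) h with h | h
      · exact ⟨a, ha, b, hb, mem_seg_left (mem_seg_symm h) hu⟩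
      · exact ⟨a, ha, c, hc, h⟩
    · exact ⟨c, hc, d, hd, mem_seg_left h hv⟩

/-- Every direction of the core contains a translate of any given point. -/
theorem IsOuterSpacePoint.exists_smul_dir {A : Subgroup F} {x p : T} (hp : p ∈ core T A)
    (hpx : p ≠ x) (x0 : T) : ∃ a ∈ A, x ∉ seg p (a • x0) := by
  obtain ⟨a, ha, b, hb, h⟩ := hO.core_subset_hull A x0 hp
  by_contra! hcon
  have h1 := hcon a ha
  have h2 := hcon b hb
  have h3 := dist_triangle (a • x0) x (b • x0)
  have := dist_pos.2 hpx
  rw [mem_seg] at *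
  rw [dist_comm (a • x0) p] at h
  rw [dist_comm (a • x0) x] at h3
  linarith

theorem IsOuterSpacePoint.exists_natEdge : ∃ x y : T, IsNatEdge Set.univ x y := by
  by_contra! hcon
  have : IsEmpty (EdgeOrbit (⊤ : Subgroup F) (Set.univ : Set T)) :=
    ⟨fun o => hcon _ _ (Quot.out o).2⟩
  have h := hO.volume_eq
  unfold volume at h
  rw [tsum_empty] at h
  simp at h

/-- The core has no endpoints. -/
theorem IsOuterSpacePoint.exists_two_dirs {A : Subgroup F} {x : T} (hx : x ∈ core T A) :
    ∃ p ∈ core T A, ∃ q ∈ core T A, p ≠ x ∧ q ≠ x ∧ x ∈ seg p q := by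
  by_contra! hcon
  -- all translates of `x` are endpoints
  have hend : ∀ a ∈ A, ∀ p ∈ core T A, ∀ q ∈ core T A, p ≠ a • x → q ≠ a • x →
      a • x ∉ seg p q := by
    intro a ha p hp q hq hpa hqa h
    refine hcon (a⁻¹ • p) (smul_mem_core (A.inv_mem ha) hp) (a⁻¹ • q)
      (smul_mem_core (A.inv_mem ha) hq) ?_ ?_ ?_
    · rintro rfl; exact hpa (smul_inv_smul _ _).symm
    · rintro rfl; exact hqa (smul_inv_smul _ _).symm
    · rw [← hO.smul_mem_seg_iff a, smul_inv_smul, smul_inv_smul]; exact h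
  by_cases hne : ∃ y ∈ core T A, ∀ a ∈ A, y ≠ a • x
  -- Deleting the orbit of an endpoint leaves an invariant subtree, which contradicts minimality
  -- unless nothing is left.
  · have hsub := core_subset (T := T) (A := A) (Y := {y ∈ core T A | ∀ a ∈ A, y ≠ a • x}) hne ?_ ?_
    · exact (hsub hx).2 1 A.one_mem (one_smul _ _).symm
    · rintro a ha y ⟨hy, hyx⟩
      refine ⟨smul_mem_core ha hy, fun b hb e => hyx (a⁻¹ * b) (A.mul_mem (A.inv_mem ha) hb) ?_⟩
      rw [mul_smul, ← e, inv_smul_smul]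
    · rintro y ⟨hy, hyx⟩ z ⟨hz, hzx⟩ w hw
      refine ⟨core_cvx A y hy z hz hw, fun a ha e => ?_⟩
      exact hend a ha y hy z hz (hyx a ha) (hzx a ha) (e ▸ hw)
  -- Now the core is a single orbit of endpoints. If `A` moves `x`, the midpoint of a segment
  -- between translates is not an endpoint. If it does not, `A` is trivial by freeness and every
  -- one-point set contains the core.
  · push Not at hne
    by_cases hA : ∃ a ∈ A, a • x ≠ x
    · obtain ⟨a, ha, hax⟩ := hA
      have hpos := dist_pos.2 hax.symm
      obtain ⟨m, hm, hd⟩ := exists_mem_seg_dist hO.tree (x := x) (y := a • x)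
        (r := dist x (a • x) / 2) (by positivity) (by linarith)
      obtain ⟨b, hb, e⟩ := hne m (core_cvx A x hx _ (smul_mem_core ha hx) hm)
      have hm' := hm
      rw [mem_seg] at hm'
      refine hend b hb x hx (a • x) (smul_mem_core ha hx) ?_ ?_ (e ▸ hm)
      · rintro h; rw [e, ← h, dist_self] at hd; linarith
      · rintro h; rw [← e] at h; rw [h] at hd hpos; linarith
    · push Not at hA
      obtain ⟨u, v, huv⟩ := hO.exists_natEdge
      have hA1 : ∀ a ∈ A, a = 1 := fun a ha => hO.free a x (hA a ha)
      have hs : ∀ w : T, core T A ⊆ {w} := fun w => core_subset ⟨w, rfl⟩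
        (fun a ha y hy => by rw [hA1 a ha, one_smul]; exact hy)
        (fun y hy z hz t ht => by
          rw [Set.mem_singleton_iff] at hy hz; subst hy; subst hz; exact mem_seg_self ht)
      have h1 := hs u hx
      have h2 := hs v hx
      rw [Set.mem_singleton_iff] at h1 h2
      exact huv.2.2.1 (h1.symm.trans h2)

/-- Natural vertices do not accumulate: the first one along a segment. -/
theorem IsOuterSpacePoint.exists_first_natVertex {Y : Set T} {x v : T} (hv : IsNatVertex Y v)
    (hvx : v ≠ x) : ∃ w ∈ seg x v, IsNatVertex Y w ∧ w ≠ x ∧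
      ∀ z ∈ seg x w, z ≠ x → z ≠ w → ¬ IsNatVertex Y z := by
  set S := {s | ∃ w ∈ seg x v, IsNatVertex Y w ∧ w ≠ x ∧ dist x w = s} with hS
  have hne : S.Nonempty := ⟨_, v, right_mem_seg _ _, hv, hvx, rfl⟩
  have hbdd : BddBelow S := ⟨0, by rintro s ⟨w, -, -, -, rfl⟩; exact dist_nonneg⟩
  have hs1 : sInf S ≤ dist x v := csInf_le hbdd ⟨v, right_mem_seg _ _, hv, hvx, rfl⟩
  obtain ⟨r0, hr0, hd0⟩ := hO.discrete x
  have hs0 : 0 < sInf S := by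
    refine hr0.trans_le (le_csInf hne ?_)
    rintro s ⟨w, -, hw, hwx, rfl⟩
    by_contra hlt
    exact hd0 w hwx (not_le.1 hlt) hw.univ
  obtain ⟨w, hw, hdw⟩ := exists_mem_seg_dist hO.tree hs0.le hs1
  obtain ⟨r, hr, hdr⟩ := hO.discrete w
  obtain ⟨s, ⟨v', hv', hn', hvx', rfl⟩, hlt⟩ :=
    exists_lt_of_csInf_lt hne (show sInf S < sInf S + r by linarith)
  have hge : sInf S ≤ dist x v' := csInf_le hbdd ⟨v', hv', hn', hvx', rfl⟩
  have hvw : v' = w := by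
    by_contra hne'
    refine hdr v' hne' ?_ hn'.univ
    rw [dist_of_mem_seg hO.tree hw hv', hdw, abs_lt]
    constructor <;> linarith
  subst hvw
  refine ⟨v', hw, hn', hvx', fun z hz hzx hzw hnz => ?_⟩
  have h1 := csInf_le hbdd ⟨z, mem_seg_left hz hw, hnz, hzx, rfl⟩
  rw [mem_seg] at hz
  have := dist_pos.2 hzw
  linarith

theorem IsOuterSpacePoint.exists_natVertex_dir {A : Subgroup F} {v0 : T}
    (hv0 : IsNatVertex (core T A) v0) {x p : T} (hp : p ∈ core T A) (hpx : p ≠ x) :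
    ∃ w, IsNatVertex (core T A) w ∧ x ∉ seg p w ∧
      ∀ z ∈ seg x w, z ≠ x → z ≠ w → ¬ IsNatVertex (core T A) z := by
  obtain ⟨a, ha, h⟩ := hO.exists_smul_dir hp hpx v0
  have hne := (ne_of_not_mem_seg h).2
  obtain ⟨w, hw, hn, hwx, hz⟩ := hO.exists_first_natVertex (hO.natVertex_smul ha hv0) hne
  exact ⟨w, hn, not_mem_seg_trans hO.tree h
    (not_mem_seg_symm (not_mem_seg_of_mem hO.tree hwx hw)), hz⟩

theorem IsOuterSpacePoint.exists_natEdge_mem {A : Subgroup F} {v0 : T}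
    (hv0 : IsNatVertex (core T A) v0) {x p q : T} (hp : p ∈ core T A) (hq : q ∈ core T A)
    (hpx : p ≠ x) (hqx : q ≠ x) (h : x ∈ seg p q) (hn : ¬ IsNatVertex (core T A) x) :
    ∃ u w, IsNatEdge (core T A) u w ∧ x ∈ seg u w ∧ u ≠ x ∧ w ≠ x ∧ x ∉ seg p u ∧ x ∉ seg q w := by
  obtain ⟨u, hu, hu1, hu2⟩ := hO.exists_natVertex_dir hv0 hp hpx
  obtain ⟨w, hw, hw1, hw2⟩ := hO.exists_natVertex_dir hv0 hq hqx
  have hux := (ne_of_not_mem_seg hu1).2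
  have hwx := (ne_of_not_mem_seg hw1).2
  have hx : x ∈ seg u w := by
    by_contra hcon
    exact not_mem_seg_trans hO.tree (not_mem_seg_trans hO.tree hu1 hcon) (not_mem_seg_symm hw1) h
  refine ⟨u, w, ⟨hu, hw, ?_, fun z hz h1 h2 => ?_⟩, hx, hux, hwx, hu1, hw1⟩
  · rintro rfl; exact hux (mem_seg_self hx).symm
  · rcases mem_seg_or hO.tree x hz with h3 | h3
    · by_cases e : z = x
      · exact e ▸ hn
      · exact hu2 z (mem_seg_symm h3) e h1
    · by_cases e : z = x
      · exact e ▸ hn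
      · exact hw2 z h3 e h2

/-- Distinct natural vertices are uniformly separated. -/
theorem IsOuterSpacePoint.exists_sep : ∃ ε > 0, ∀ x y : T, IsNatVertex Set.univ x →
    IsNatVertex Set.univ y → x ≠ y → ε ≤ dist x y := by
  have := hO.finite
  obtain ⟨u, v, huv⟩ := hO.exists_natEdge
  let len : EdgeOrbit (⊤ : Subgroup F) (Set.univ : Set T) → ℝ :=
    Quot.lift (fun e => dist e.1.1 e.1.2) (by
      rintro e e' ⟨a, -, h1, h2⟩
      rw [← h1, ← h2, hO.isometric])
  have : Nonempty (EdgeOrbit (⊤ : Subgroup F) (Set.univ : Set T)) := ⟨Quot.mk _ ⟨(u, v), huv⟩⟩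
  obtain ⟨o, ho⟩ := Finite.exists_min len
  refine ⟨len o, ?_, fun x y hx hy hxy => ?_⟩
  · obtain ⟨e, rfl⟩ := Quot.exists_rep o
    exact dist_pos.2 e.2.2.2.1
  · obtain ⟨w, hw, hn, hwx, hz⟩ := hO.exists_first_natVertex hy hxy.symm
    have := ho (Quot.mk _ ⟨(x, w), hx, hn, hwx.symm, hz⟩)
    exact this.trans (dist_le_of_mem_seg hw)

/-- Translation lengths are bounded below. -/
theorem IsOuterSpacePoint.exists_systole : ∃ ε > 0, (∀ x y : T, IsNatVertex Set.univ x →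
    IsNatVertex Set.univ y → x ≠ y → ε ≤ dist x y) ∧
    ∀ g : F, g ≠ 1 → ∀ x : T, ε ≤ dist x (g • x) := by
  obtain ⟨ε, hε, hsep⟩ := hO.exists_sep
  refine ⟨ε, hε, hsep, fun g hg x => ?_⟩
  have hU := hO.core_top
  have hgx : ∀ y : T, g • y ≠ y := fun y h => hg (hO.free g y h)
  have hnat : ∀ y : T, IsNatVertex Set.univ y → IsNatVertex Set.univ (g • y) := by
    intro y hy
    rw [← hU] at *
    exact hO.natVertex_smul (Subgroup.mem_top g) hy
  by_cases hx : IsNatVertex Set.univ x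
  · exact hsep x _ hx (hnat x hx) (hgx x).symm
  by_contra! hlt
  obtain ⟨u0, v0, huv⟩ := hO.exists_natEdge
  have hu0 : IsNatVertex (core T (⊤ : Subgroup F)) u0 := hU ▸ huv.1
  obtain ⟨p, hp, q, hq, hpx, hqx, hpq⟩ := hO.exists_two_dirs (A := ⊤) (x := x)
    (by rw [hU]; trivial)
  obtain ⟨u, w, he, hxm, hux, hwx, -, -⟩ := hO.exists_natEdge_mem hu0 hp hq hpx hqx hpq
    (by rw [hU]; exact hx)
  have he' := hO.natEdge_smul (Subgroup.mem_top g) he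
  rw [hU] at he he'
  have hgxm := hO.smul_mem_seg g hxm
  have hngx : ¬ IsNatVertex Set.univ (g • x) := by
    intro h
    have := (hU ▸ hO.natVertex_smul (Subgroup.mem_top g⁻¹) (hU.symm ▸ h))
    rw [inv_smul_smul] at this
    exact hx this
  have inj : ∀ {y : T}, y ≠ x → g • y ≠ g • x := fun hy e => hy (smul_left_cancel _ e)
  -- A deck transformation that flips an edge would fix its midpoint.
  have hflip : ∀ u w : T, u = g • w → w = g • u → False := fun u w e1 e2 => by
    have hd : dist u w = dist w u := dist_comm _ _
    obtain ⟨m, hm, hdm⟩ := exists_mem_seg_dist hO.tree (x := u) (y := w) (r := dist u w / 2)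
      (by positivity) (by linarith [dist_nonneg (x := u) (y := w)])
    have hgm := hO.smul_mem_seg g hm
    rw [← e1, ← e2] at hgm
    refine hgx m (seg_eq_of_dist_eq hO.tree (mem_seg_symm hgm) hm ?_)
    have h3 : dist (g • u) (g • m) = dist u w / 2 := by rw [hO.isometric, hdm]
    rw [← e2] at h3
    rw [mem_seg, h3, hd] at hgm
    rw [hdm, dist_comm u (g • m)]; linarith
  -- `g • x` is not in the interior of the edge
  have hnot : ∀ u w : T, IsNatEdge Set.univ u w → IsNatEdge Set.univ (g • u) (g • w) → x ∈ seg u w →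
      u ≠ x → w ≠ x → g • x ∉ seg x u := by
    intro u w he he' hxm hux hwx hin
    have h1 : g • x ∈ seg u w := mem_seg_left (mem_seg_symm hin) hxm
    have n1 : g • x ≠ u := fun e => hngx (e ▸ he.1)
    have n2 : g • x ≠ w := fun e => hngx (e ▸ he.2.1)
    rcases he.eq_or_of_mem hO.tree Cvx.univ he' h1 n1 n2 (hO.smul_mem_seg g hxm)
      (inj hux).symm (inj hwx).symm with ⟨e1, e2⟩ | ⟨e1, e2⟩
    · exact hgx u e1.symm
    · exact hflip u w e1 e2
  -- leaving the edge
  have key : ∀ y z : T, ¬ IsNatVertex Set.univ z → ∀ u w : T, IsNatEdge Set.univ u w → y ∈ seg u w →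
      u ≠ y → w ≠ y → z ≠ y → z ∉ seg y u → z ∉ seg y w → u ∈ seg y z ∨ w ∈ seg y z := by
    intro y z hz u w he hy huy hwy hzy h1 h2
    have hny := he.2.2.2 y hy huy.symm hwy.symm
    rcases two_of_not_natVertex hny trivial trivial trivial trivial hzy huy hwy hy (r := z)
      with h | h
    · rcases mem_seg_or_of_no_natVertex hO.tree Cvx.univ trivial trivial trivial h
        (fun t ht hty htu => he.2.2.2 t (mem_seg_left (mem_seg_symm ht) hy) htu (by
          rintro rfl
          exact hwy (eq_of_mem_seg_of_mem_seg hy (mem_seg_symm ht)))) with h3 | h3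
      · exact Or.inl h3
      · exact absurd h3 h1
    · rcases mem_seg_or_of_no_natVertex hO.tree Cvx.univ trivial trivial trivial h
        (fun t ht hty htw => he.2.2.2 t (mem_seg_right ht hy) (by
          rintro rfl
          exact huy (eq_of_mem_seg_of_mem_seg (mem_seg_symm hy) (mem_seg_symm ht))) htw) with h3 | h3
      · exact Or.inr h3
      · exact absurd h3 h2
  have f1 := hnot u w he he' hxm hux hwx
  have f2 := hnot w u he.symm he'.symm (mem_seg_symm hxm) hwx hux
  -- the same for the translated edge
  have hnot' : ∀ u w : T, IsNatEdge Set.univ u w → IsNatEdge Set.univ (g • u) (g • w) → x ∈ seg u w →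
      u ≠ x → w ≠ x → x ∉ seg (g • x) (g • u) := by
    intro u w he he' hxm hux hwx hin
    have h1 : x ∈ seg (g • u) (g • w) := mem_seg_left (mem_seg_symm hin) (hO.smul_mem_seg g hxm)
    have n1 : x ≠ g • u := fun e => hx (e ▸ he'.1)
    have n2 : x ≠ g • w := fun e => hx (e ▸ he'.2.1)
    rcases he.eq_or_of_mem hO.tree Cvx.univ he' hxm hux.symm hwx.symm h1 n1 n2
      with ⟨e1, e2⟩ | ⟨e1, e2⟩
    · exact hgx u e1.symm
    · exact hflip u w e1 e2
  have f3 := hnot' u w he he' hxm hux hwx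
  have f4 := hnot' w u he.symm he'.symm (mem_seg_symm hxm) hwx hux
  -- Two distinct vertices on `[x, g • x]` would already be `ε` apart. So the vertex where this path
  -- leaves the edge of `x` is the one where it enters the translated edge. This vertex is `g • u`,
  -- giving a fixed point, or `g • w`, and then the path is as long as the edge.
  have main : ∀ u w : T, IsNatEdge Set.univ u w → IsNatEdge Set.univ (g • u) (g • w) → x ∈ seg u w →
      u ∈ seg x (g • x) → (g • u ∈ seg (g • x) x ∨ g • w ∈ seg (g • x) x) → False := by
    intro u w he he' hxm hu h
    have haux : ∀ v, IsNatVertex Set.univ v → v ∈ seg (g • x) x → v = u := by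
      intro v hv hvm
      by_contra hne
      have h1 := hsep u v he.1 hv (Ne.symm hne)
      rw [dist_of_mem_seg hO.tree hu (mem_seg_symm hvm)] at h1
      have h2 := dist_le_of_mem_seg hu
      have h3 := dist_le_of_mem_seg (mem_seg_symm hvm)
      have : |dist x u - dist x v| ≤ dist x (g • x) := by
        rw [abs_le]; constructor <;> linarith [dist_nonneg (x := x) (y := u), dist_nonneg (x := x) (y := v)]
      linarith
    rcases h with h | h
    · exact hgx u (haux _ he'.1 h)
    · have e := haux _ he'.2.1 h
      have h1 := hsep u w he.1 he.2.1 he.2.2.1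
      have h2 : dist u (g • x) = dist w x := by rw [← e, hO.isometric]
      rw [mem_seg] at hu hxm
      rw [h2] at hu
      rw [dist_comm u x, dist_comm x w] at hxm
      linarith
  have r1 := key x (g • x) hngx u w he hxm hux hwx (hgx x) f1 f2
  have r2 := key (g • x) x hx (g • u) (g • w) he' hgxm (inj hux) (inj hwx) (hgx x).symm f3 f4
  rcases r1 with r1 | r1
  · exact main u w he he' hxm r1 r2
  · exact main w u he.symm he'.symm (mem_seg_symm hxm) r1 r2.symm

end Action

/-! ### Local finiteness, nearest points and nonempty cores -/

section Action

variable {T : Type*} [MetricSpace T] {F : Type*} [Group F] [MulAction F T]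
variable (hO : IsOuterSpacePoint F T)
include hO

/-- An involution fixes the midpoint of `[u, g • u]`. -/
theorem IsOuterSpacePoint.eq_one_of_sq {g : F} (h : g * g = 1) (u : T) : g = 1 := by
  obtain ⟨m, hm, hd⟩ := exists_mem_seg_dist hO.tree (x := u) (y := g • u)
    (r := dist u (g • u) / 2) (by positivity) (by linarith [dist_nonneg (x := u) (y := g • u)])
  refine hO.free g m (seg_eq_of_dist_eq hO.tree (x := u) (y := g • u) ?_ hm ?_)
  · have := hO.smul_mem_seg g hm
    rw [← mul_smul, h, one_smul] at this
    exact mem_seg_symm this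
  · have h1 : dist (g • u) (g • m) = dist u (g • u) / 2 := by rw [hO.isometric, hd]
    have := hO.smul_mem_seg g hm
    rw [← mul_smul, h, one_smul, mem_seg, h1, dist_comm (g • u) u] at this
    rw [hd, dist_comm u]; linarith

/-- Distinct translates of `z` are at least the systole `ε` apart. On a segment they are told apart
by the integer part of their distance to `u`, divided by `ε`. -/
theorem IsOuterSpacePoint.finite_smul_mem_seg (z u v : T) : {g : F | g • z ∈ seg u v}.Finite := by
  obtain ⟨ε, hε, -, hsys⟩ := hO.exists_systole
  have hinj : Set.InjOn (fun g : F => ⌊dist u (g • z) / ε⌋) {g : F | g • z ∈ seg u v} := by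
    intro g hg h hh e
    by_contra hne
    have h1 := hsys (h * g⁻¹) (fun e' => hne (mul_inv_eq_one.1 e').symm) (g • z)
    rw [← mul_smul, inv_mul_cancel_right, dist_of_mem_seg hO.tree hg hh] at h1
    have h2 := Int.abs_sub_lt_one_of_floor_eq_floor e
    rw [← sub_div, abs_div, abs_of_pos hε, div_lt_one hε] at h2
    linarith
  refine Set.Finite.of_finite_image ((Set.finite_Icc 0 ⌊dist u v / ε⌋).subset ?_) hinj
  rintro k ⟨g, hg, rfl⟩
  refine ⟨Int.floor_nonneg.2 (by positivity), Int.floor_le_floor ?_⟩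
  exact div_le_div_of_nonneg_right (dist_le_of_mem_seg hg) hε.le

/-- Nearest points in the core. -/
theorem IsOuterSpacePoint.exists_proj {A : Subgroup F} (hne : (core T A).Nonempty) (p : T) :
    ∃ x ∈ core T A, ∀ y ∈ core T A, x ∈ seg p y := by
  obtain ⟨y0, hy0⟩ := hne
  set S := {s | ∃ w ∈ seg p y0, w ∈ core T A ∧ dist p w = s} with hS
  have hSne : S.Nonempty := ⟨_, y0, right_mem_seg _ _, hy0, rfl⟩
  have hbdd : BddBelow S := ⟨0, by rintro s ⟨w, -, -, rfl⟩; exact dist_nonneg⟩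
  have hs1 : sInf S ≤ dist p y0 := csInf_le hbdd ⟨y0, right_mem_seg _ _, hy0, rfl⟩
  have hs0 : 0 ≤ sInf S := le_csInf hSne (by rintro s ⟨w, -, -, rfl⟩; exact dist_nonneg)
  obtain ⟨w, hw, hdw⟩ := exists_mem_seg_dist hO.tree hs0 hs1
  have hwY : w ∈ core T A := by
    by_contra hwn
    obtain ⟨ε, hε, -, hsys⟩ := hO.exists_systole
    obtain ⟨r, hr, hdr⟩ := hO.discrete w
    obtain ⟨s, ⟨w', hw', hY', rfl⟩, hlt⟩ :=
      exists_lt_of_csInf_lt hSne (show sInf S < sInf S + min ε r by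
        have := lt_min hε hr; linarith)
    have hge : sInf S ≤ dist p w' := csInf_le hbdd ⟨w', hw', hY', rfl⟩
    have hne : w' ≠ w := fun e => hwn (e ▸ hY')
    have hww' : w ∈ seg p w' := mem_seg_of_dist_le hO.tree hw hw' (by rw [hdw]; exact hge)
    have hdww : dist w w' < min ε r := by rw [mem_seg] at hww'; linarith
    -- a point of the core strictly between `w` and `w'`
    have hpos := dist_pos.2 hne.symm
    have hgt : sInf S < dist p w' := by rw [mem_seg] at hww'; linarith
    obtain ⟨s, ⟨w2, hw2, hY2, rfl⟩, hlt2⟩ := exists_lt_of_csInf_lt hSne hgt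
    have hge2 : sInf S ≤ dist p w2 := csInf_le hbdd ⟨w2, hw2, hY2, rfl⟩
    have hw2w' : w2 ∈ seg w w' :=
      mem_seg_between (mem_seg_of_dist_le hO.tree hw hw2 (by rw [hdw]; exact hge2))
        (mem_seg_of_dist_le hO.tree hw2 hw' hlt2.le)
    have hw2ne : w2 ≠ w' := fun e => by rw [e] at hlt2; exact lt_irrefl _ hlt2
    -- A translate of `w'` lies on the side of `w`. Its path from `w'` must leave `[w', w]` before
    -- reaching `w`, since `w` is not in the core, and this makes a branch point too close to `w`.
    obtain ⟨a, ha, hdir⟩ := hO.exists_smul_dir hY2 hw2ne w'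
    have haw := (ne_of_not_mem_seg hdir).2
    have h3 : w' ∉ seg w (a • w') := not_mem_seg_trans hO.tree
      (not_mem_seg_symm (not_mem_seg_of_mem hO.tree hw2ne (mem_seg_symm hw2w'))) hdir
    obtain ⟨m, m1, m2, m3⟩ := exists_median hO.tree w' w (a • w')
    have e1 : m ≠ w' := fun e => h3 (e ▸ m2)
    have e2 : m ≠ w := by
      rintro rfl
      exact hwn (core_cvx A _ hY' _ (smul_mem_core ha hY') m3)
    have e3 : m ≠ a • w' := by
      rintro rfl
      have ha1 : a ≠ 1 := by rintro rfl; exact haw (one_smul _ _)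
      have := hsys a ha1 w'
      have h4 := dist_le_of_mem_seg m1
      rw [dist_comm w' w] at h4
      have := min_le_left ε r
      linarith
    have hn := isNatVertex_of_median Cvx.univ (Set.mem_univ w') (Set.mem_univ w)
      (Set.mem_univ (a • w')) m1 m2 m3 e1 e2 e3
    refine hdr m e2 ?_ hn
    have h4 := dist_le_of_mem_seg (mem_seg_symm m1)
    have := min_le_right ε r
    linarith
  refine ⟨w, hwY, fun y hy => ?_⟩
  obtain ⟨m, m1, m2, m3⟩ := exists_median hO.tree p y0 y
  have hmY := core_cvx A _ hy0 _ hy m2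
  have hle : dist p w ≤ dist p m := by rw [hdw]; exact csInf_le hbdd ⟨m, m1, hmY, rfl⟩
  exact mem_seg_left (mem_seg_of_dist_le hO.tree hw m1 hle) m3

/-- A nontrivial deck transformation translates along an axis. A point of the axis separates high
positive powers from high negative powers applied to any point, hence lies in every invariant
subtree. -/
theorem IsOuterSpacePoint.core_nonempty {A : Subgroup F} {a : F} (ha : a ∈ A) (ha1 : a ≠ 1) :
    (core T A).Nonempty := by
  obtain ⟨u, -, -⟩ := hO.exists_natEdge
  have hfree : ∀ y : T, a • y ≠ y := fun y h => ha1 (hO.free a y h)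
  -- the midpoint of `[u, a • u]` is on the axis
  obtain ⟨m, hm, hd⟩ := exists_mem_seg_dist hO.tree (x := u) (y := a • u)
    (r := dist u (a • u) / 2) (by positivity) (by linarith [dist_nonneg (x := u) (y := a • u)])
  have hm' : dist m (a • u) = dist u (a • u) / 2 := by rw [mem_seg] at hm; linarith
  have ham : dist (a • u) (a • m) = dist u (a • u) / 2 := by rw [hO.isometric, hd]
  have hmm := dist_pos.2 (hfree m).symm
  have n1 : m ∉ seg (a • u) (a • m) := by
    intro h; rw [mem_seg, dist_comm (a • u) m, hm', ham] at h; linarith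
  have n2 : a • m ∉ seg (a • u) m := by
    intro h; rw [mem_seg, ham, dist_comm (a • u) m, hm', dist_comm (a • m)] at h; linarith
  have n3 : m ∉ seg u (a⁻¹ • m) := by
    rw [← hO.smul_mem_seg_iff a, smul_inv_smul]; exact n2
  have hax : m ∈ seg (a⁻¹ • m) (a • m) := by
    by_contra hcon
    exact not_mem_seg_trans hO.tree (not_mem_seg_trans hO.tree n3 hcon) (not_mem_seg_symm n1) hm
  -- a translate of `v` in the direction of `b • m`
  have key : ∀ b : F, b • m ≠ m → ∀ v : T, ∃ n : ℕ, m ∉ seg (b • m) (b ^ n • v) := by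
    intro b hb v
    by_contra! hcon
    have hL := dist_pos.2 hb
    have hstep : ∀ n : ℕ, dist m (b ^ n • v) = dist m v - n * dist (b • m) m := by
      intro n
      induction n with
      | zero => simp
      | succ n ih =>
        have := hcon (n + 1)
        rw [mem_seg, pow_succ', mul_smul, hO.isometric, ih] at this
        rw [pow_succ', mul_smul]
        push_cast
        linarith
    obtain ⟨n, hn⟩ := exists_nat_gt (dist m v / dist (b • m) m)
    rw [div_lt_iff₀ hL] at hn
    have := hstep n
    linarith [dist_nonneg (x := m) (y := b ^ n • v)]
  refine ⟨m, fun Y ⟨⟨v, hv⟩, h2, h3⟩ => ?_⟩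
  have hpow : ∀ b ∈ A, ∀ n : ℕ, b ^ n • v ∈ Y := fun b hb n => h2 _ (A.pow_mem hb n) v hv
  obtain ⟨n, hn⟩ := key a (hfree m) v
  obtain ⟨k, hk⟩ := key a⁻¹ (fun e => hfree m (by rw [inv_smul_eq_iff] at e; exact e.symm)) v
  refine h3 _ (hpow a⁻¹ (A.inv_mem ha) k) _ (hpow a ha n) ?_
  by_contra hcon
  exact not_mem_seg_trans hO.tree (not_mem_seg_trans hO.tree hk hcon) (not_mem_seg_symm hn) hax

/-- At any point the number of natural edges is finite. -/
theorem IsOuterSpacePoint.finite_natEdge (x : T) : {y : T | IsNatEdge Set.univ x y}.Finite := by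
  have := hO.finite
  let φ : {y : T | IsNatEdge Set.univ x y} → EdgeOrbit (⊤ : Subgroup F) (Set.univ : Set T) :=
    fun y => Quot.mk _ ⟨(x, y.1), y.2⟩
  have hφ : Function.Injective φ := by
    intro y y' h
    have h' := Quot.eqvGen_exact h
    have key : ∀ e e' : {e : T × T // IsNatEdge (Set.univ : Set T) e.1 e.2},
        Relation.EqvGen (fun e e' : {e : T × T // IsNatEdge (Set.univ : Set T) e.1 e.2} =>
          ∃ a ∈ (⊤ : Subgroup F), a • e.1.1 = e'.1.1 ∧ a • e.1.2 = e'.1.2) e e' →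
        ∃ a : F, a • e.1.1 = e'.1.1 ∧ a • e.1.2 = e'.1.2 := by
      intro e e' he
      induction he with
      | rel e e' h => obtain ⟨a, -, h⟩ := h; exact ⟨a, h⟩
      | refl e => exact ⟨1, one_smul _ _, one_smul _ _⟩
      | symm e e' _ ih =>
        obtain ⟨a, h1, h2⟩ := ih
        exact ⟨a⁻¹, by rw [← h1, inv_smul_smul], by rw [← h2, inv_smul_smul]⟩
      | trans e e' e'' _ _ ih ih' =>
        obtain ⟨a, h1, h2⟩ := ih
        obtain ⟨b, h3, h4⟩ := ih'
        exact ⟨b * a, by rw [mul_smul, h1, h3], by rw [mul_smul, h2, h4]⟩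
    obtain ⟨a, h1, h2⟩ := key _ _ h'
    have ha := hO.free a x h1
    rw [ha, one_smul] at h2
    exact Subtype.ext h2
  exact Set.finite_coe_iff.1 (Finite.of_injective φ hφ)

end Action

/-! ### Length as one-dimensional Hausdorff measure -/

section Measure

open MeasureTheory MeasureTheory.Measure
open scoped Pointwise

variable {T : Type*} [MetricSpace T]

/-- The distance from an endpoint is an isometry from the segment to the line. -/
theorem hausdorffMeasure_of_subset_seg [MeasurableSpace T] [BorelSpace T] (hT : IsRealTree T)
    {x y : T} {B : Set T} (hB : B ⊆ seg x y) :
    μH[1] B = MeasureTheory.volume ((fun z => dist x z) '' B) := by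
  have h1 : Isometry (fun z : B => dist x z.1) := by
    refine Isometry.of_dist_eq fun a b => ?_
    rw [Real.dist_eq, Subtype.dist_eq]
    exact (dist_of_mem_seg hT (hB a.2) (hB b.2)).symm
  have h2 := h1.hausdorffMeasure_image (d := 1) (Or.inl zero_le_one) Set.univ
  have h3 := (isometry_subtype_coe (s := B)).hausdorffMeasure_image (d := 1)
    (Or.inl zero_le_one) Set.univ
  rw [Set.image_univ, Subtype.range_coe] at h3
  rw [h3, ← h2, hausdorffMeasure_real]
  congr 1
  ext t
  simp

theorem isClosed_seg (x y : T) : IsClosed (seg x y) :=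
  isClosed_eq (by fun_prop) continuous_const

/-- The half of the segment `[x, y]` near `x`, without its endpoints. -/
def halfSeg (x y : T) : Set T := {z ∈ seg x y | 0 < dist x z ∧ dist x z < dist x y / 2}

theorem measurableSet_halfSeg [MeasurableSpace T] [BorelSpace T] (x y : T) :
    MeasurableSet (halfSeg x y) := by
  refine (isClosed_seg x y).measurableSet.inter ?_
  have hd : Continuous fun z : T => dist x z := by fun_prop
  exact ((isOpen_lt continuous_const hd).inter (isOpen_lt hd continuous_const)).measurableSet

theorem hausdorffMeasure_halfSeg [MeasurableSpace T] [BorelSpace T] (hT : IsRealTree T) (x y : T) :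
    μH[1] (halfSeg x y) = edist x y / 2 := by
  rw [hausdorffMeasure_of_subset_seg hT (x := x) (y := y) fun z hz => hz.1]
  have : (fun z => dist x z) '' halfSeg x y = Set.Ioo 0 (dist x y / 2) := by
    ext t
    constructor
    · rintro ⟨z, hz, rfl⟩; exact hz.2
    · rintro ⟨h1, h2⟩
      obtain ⟨z, hz, hd⟩ := exists_mem_seg_dist hT (x := x) (y := y) h1.le
        (by linarith [dist_nonneg (x := x) (y := y)])
      exact ⟨z, ⟨hz, by rw [hd]; exact ⟨h1, h2⟩⟩, hd⟩
  rw [this, Real.volume_Ioo, edist_dist, sub_zero, ENNReal.ofReal_div_of_pos two_pos,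
    ENNReal.ofReal_ofNat]

variable {F : Type*} [Group F] [MulAction F T] (hO : IsOuterSpacePoint F T)
include hO

/-- Half-edges in a set of representatives of the oriented natural edges. -/
theorem IsOuterSpacePoint.exists_fundamentalDomain [Countable F] [MeasurableSpace T]
    [BorelSpace T] : ∃ D : Set T, IsFundamentalDomain F D (μH[1] : Measure T) ∧
      μH[1] D = 1 := by
  have := hO.finite
  have hna := nullSingletonClass_hausdorff T one_pos
  set O := EdgeOrbit (⊤ : Subgroup F) (Set.univ : Set T) with hOdef
  have hU := hO.core_top
  obtain ⟨u0, v0, huv⟩ := hO.exists_natEdge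
  have hu0 : IsNatVertex (core T (⊤ : Subgroup F)) u0 := hU ▸ huv.1
  -- One half per oriented edge: the two orientations cover an edge up to its ends and midpoint, and
  -- the total length matches the factor one half in `volume`.
  let H : O → Set T := fun o => halfSeg (Quot.out o).1.1 (Quot.out o).1.2
  have hedge : ∀ o : O, IsNatEdge Set.univ (Quot.out o).1.1 (Quot.out o).1.2 :=
    fun o => (Quot.out o).2
  have hsmul : ∀ (g : F) {x y : T}, IsNatEdge Set.univ x y → IsNatEdge Set.univ (g • x) (g • y) := by
    intro g x y h
    rw [← hU] at *
    exact hO.natEdge_smul (Subgroup.mem_top g) h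
  have hrep : ∀ {x y : T} (h : IsNatEdge Set.univ x y), ∃ (g : F) (o : O),
      g • x = (Quot.out o).1.1 ∧ g • y = (Quot.out o).1.2 := by
    intro x y h
    have h' := Quot.eqvGen_exact (Quot.out_eq (Quot.mk _ ⟨(x, y), h⟩ : O)).symm
    have key : ∀ e e' : {e : T × T // IsNatEdge (Set.univ : Set T) e.1 e.2},
        Relation.EqvGen (fun e e' : {e : T × T // IsNatEdge (Set.univ : Set T) e.1 e.2} =>
          ∃ a ∈ (⊤ : Subgroup F), a • e.1.1 = e'.1.1 ∧ a • e.1.2 = e'.1.2) e e' →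
        ∃ a : F, a • e.1.1 = e'.1.1 ∧ a • e.1.2 = e'.1.2 := by
      intro e e' he
      induction he with
      | rel e e' h => obtain ⟨a, -, h⟩ := h; exact ⟨a, h⟩
      | refl e => exact ⟨1, one_smul _ _, one_smul _ _⟩
      | symm e e' _ ih =>
        obtain ⟨a, h1, h2⟩ := ih
        exact ⟨a⁻¹, by rw [← h1, inv_smul_smul], by rw [← h2, inv_smul_smul]⟩
      | trans e e' e'' _ _ ih ih' =>
        obtain ⟨a, h1, h2⟩ := ih
        obtain ⟨b, h3, h4⟩ := ih'
        exact ⟨b * a, by rw [mul_smul, h1, h3], by rw [mul_smul, h2, h4]⟩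
    obtain ⟨g, h1, h2⟩ := key _ _ h'
    exact ⟨g, _, h1, h2⟩
  -- translates of half-edges
  have hdisj : ∀ (g : F) (o o' : O) (z : T), z ∈ H o → g • z ∈ H o' → g = 1 ∧ o = o' := by
    intro g o o' z hz hz'
    have e1 := hsmul g (hedge o)
    have e2 := hedge o'
    obtain ⟨z1, z2, z3⟩ := hz
    obtain ⟨z1', z2', z3'⟩ := hz'
    have z1g := hO.smul_mem_seg g z1
    have d1 : dist (g • (Quot.out o).1.1) (g • z) = dist (Quot.out o).1.1 z := hO.isometric _ _ _
    have d2 : dist (g • (Quot.out o).1.1) (g • (Quot.out o).1.2) =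
      dist (Quot.out o).1.1 (Quot.out o).1.2 := hO.isometric _ _ _
    rw [← d1] at z2 z3
    rw [← d2] at z3
    have ne : ∀ {x y w : T}, w ∈ seg x y → 0 < dist x w → dist x w < dist x y / 2 →
        w ≠ x ∧ w ≠ y := by
      intro x y w h h1 h2
      constructor
      · rintro rfl; rw [dist_self] at h1; exact lt_irrefl _ h1
      · rintro rfl; linarith
    obtain ⟨n1, n2⟩ := ne z1g z2 z3
    obtain ⟨n1', n2'⟩ := ne z1' z2' z3'
    rcases e1.eq_or_of_mem hO.tree Cvx.univ e2 z1g n1 n2 z1' n1' n2' with ⟨h1, h2⟩ | ⟨h1, h2⟩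
    · have hoo : o = o' := by
        rw [← Quot.out_eq o, ← Quot.out_eq o']
        exact Quot.sound ⟨g, Subgroup.mem_top g, h1, h2⟩
      refine ⟨hO.free g (Quot.out o).1.1 ?_, hoo⟩
      rw [h1, hoo]
    · exfalso
      rw [h1, h2] at z1g z3
      rw [mem_seg] at z1g z1'
      rw [dist_comm _ (g • z), dist_comm (Quot.out o').1.2 (Quot.out o').1.1] at z3
      rw [dist_comm (Quot.out o').1.1 (Quot.out o').1.2] at z3 z3' z1'
      linarith
  choose mid hmid hmidd using fun o : O => exists_mem_seg_dist hO.tree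
    (x := (Quot.out o).1.1) (y := (Quot.out o).1.2)
    (r := dist (Quot.out o).1.1 (Quot.out o).1.2 / 2) (by positivity)
    (by linarith [dist_nonneg (x := (Quot.out o).1.1) (y := (Quot.out o).1.2)])
  -- The translates miss only vertices and midpoints, a countable set and so a null set.
  have hcov : ∀ x : T, (∀ g : F, g • x ∉ ⋃ o, H o) →
      ∃ (g : F) (o : O), x = g⁻¹ • (Quot.out o).1.1 ∨ x = g⁻¹ • mid o := by
    intro x hx
    by_cases hn : IsNatVertex Set.univ x
    · obtain ⟨p, hp, q, hq, hpx, hqx, hpq⟩ := hO.exists_two_dirs (A := ⊤) (x := x)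
        (by rw [hU]; trivial)
      obtain ⟨w, hw, hw1, hw2⟩ := hO.exists_natVertex_dir hu0 hp hpx
      rw [hU] at hw hw2
      obtain ⟨g, o, h1, h2⟩ := hrep ⟨hn, hw, (ne_of_not_mem_seg hw1).2.symm, hw2⟩
      exact ⟨g, o, Or.inl (by rw [← h1, inv_smul_smul])⟩
    · obtain ⟨p, hp, q, hq, hpx, hqx, hpq⟩ := hO.exists_two_dirs (A := ⊤) (x := x)
        (by rw [hU]; trivial)
      obtain ⟨u, w, he, hxm, hux, hwx, -, -⟩ := hO.exists_natEdge_mem hu0 hp hq hpx hqx hpq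
        (by rw [hU]; exact hn)
      rw [hU] at he
      have hhalf : ∀ {u w : T}, IsNatEdge Set.univ u w → x ∈ seg u w → u ≠ x →
          ¬ dist u x < dist u w / 2 := by
        intro u w he hxm hux hlt
        obtain ⟨g, o, h1, h2⟩ := hrep he
        refine hx g (Set.mem_iUnion.2 ⟨o, ?_, ?_, ?_⟩)
        · rw [← h1, ← h2]; exact hO.smul_mem_seg g hxm
        · rw [← h1, hO.isometric]; exact dist_pos.2 hux
        · rw [← h1, ← h2, hO.isometric, hO.isometric]; exact hlt
      have h1 := hhalf he hxm hux
      have h2 := hhalf he.symm (mem_seg_symm hxm) hwx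
      have hd : dist u x = dist u w / 2 := by
        rw [mem_seg] at hxm
        rw [dist_comm w x, dist_comm w u] at h2
        push Not at h1 h2
        linarith
      obtain ⟨g, o, h3, h4⟩ := hrep he
      refine ⟨g, o, Or.inr ?_⟩
      rw [eq_inv_smul_iff]
      refine seg_eq_of_dist_eq hO.tree (x := (Quot.out o).1.1) (y := (Quot.out o).1.2) ?_ (hmid o) ?_
      · rw [← h3, ← h4]; exact hO.smul_mem_seg g hxm
      · rw [hmidd, ← h3, ← h4, hO.isometric, hO.isometric, hd]
  refine ⟨⋃ o, H o, ⟨?_, ?_, ?_⟩, ?_⟩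
  · exact (MeasurableSet.iUnion fun o => measurableSet_halfSeg _ _).nullMeasurableSet
  · rw [ae_iff]
    push Not
    refine Set.Countable.measure_zero (Set.Countable.mono (fun x hx => ?_)
      (Set.countable_iUnion fun g : F => Set.countable_iUnion fun o : O =>
        (Set.countable_singleton (g⁻¹ • mid o)).insert (g⁻¹ • (Quot.out o).1.1))) _
    obtain ⟨g, o, h⟩ := hcov x hx
    exact Set.mem_iUnion.2 ⟨g, Set.mem_iUnion.2 ⟨o, h⟩⟩
  · intro g h hgh
    refine Disjoint.aedisjoint (Set.disjoint_left.2 fun z hz hz' => hgh ?_)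
    obtain ⟨w, hw, e⟩ := hz
    obtain ⟨w', hw', e'⟩ := hz'
    obtain ⟨o, ho⟩ := Set.mem_iUnion.1 hw
    obtain ⟨o', ho'⟩ := Set.mem_iUnion.1 hw'
    have : (h⁻¹ * g) • w = w' := by
      rw [mul_smul, inv_smul_eq_iff]
      exact e.trans e'.symm
    obtain ⟨h1, -⟩ := hdisj (h⁻¹ * g) o o' w ho (by rw [this]; exact ho')
    rw [inv_mul_eq_one] at h1
    exact h1.symm
  · rw [measure_iUnion]
    · have h1 : ∀ o : O, μH[1] (H o) =
          edist (Quot.out o).1.1 (Quot.out o).1.2 * 2⁻¹ := fun o => by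
        rw [hausdorffMeasure_halfSeg hO.tree, div_eq_mul_inv]
      simp_rw [h1]
      rw [ENNReal.tsum_mul_right, ← div_eq_mul_inv]
      exact hO.volume_eq
    · intro o o' hne
      refine Set.disjoint_left.2 fun z hz hz' => hne ?_
      exact (hdisj 1 o o' z hz (by rw [one_smul]; exact hz')).2
    · exact fun o => measurableSet_halfSeg _ _

end Measure

/-! ### Loss of volume bounds cancellation -/

section Volume

open MeasureTheory MeasureTheory.Measure
open scoped Pointwise

variable {T T' : Type*} [MetricSpace T] [MetricSpace T'] {F : Type*} [Group F] [Countable F]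
  [MulAction F T] [MulAction F T'] (hO : IsOuterSpacePoint F T) (hO' : IsOuterSpacePoint F T')
include hO hO'

/-- Folding loses volume: if `f` identifies `Q` with a part of the rest of the tree, then the
length of the image of `Q` is at most the stretching factor minus one. -/
theorem one_add_measure_le [MeasurableSpace T] [BorelSpace T] [MeasurableSpace T'] [BorelSpace T']
    {c : ℝ} {f : T → T'} (hc : 0 ≤ c)
    (hf : ∀ x y, dist (f x) (f y) ≤ c * dist x y) (heq : ∀ (g : F) x, f (g • x) = g • f x)
    (hsurj : Function.Surjective f) {P Q : Set T} (hQ : MeasurableSet Q)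
    (hPQ : f '' Q ⊆ f '' P) (hd1 : ∀ (g : F), ∀ p ∈ P, ∀ q ∈ Q, p ≠ g • q)
    (hd2 : ∀ (g : F), g ≠ 1 → ∀ q ∈ Q, ∀ q' ∈ Q, q ≠ g • q') :
    1 + μH[1] (f '' Q) ≤ ENNReal.ofReal c := by
  have : IsIsometricSMul F T := ⟨fun g => Isometry.of_dist_eq fun x y => hO.isometric g x y⟩
  have : IsIsometricSMul F T' := ⟨fun g => Isometry.of_dist_eq fun x y => hO'.isometric g x y⟩
  obtain ⟨D, hD, hD1⟩ := hO.exists_fundamentalDomain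
  obtain ⟨D', hD', hD1'⟩ := hO'.exists_fundamentalDomain
  have hlip : LipschitzWith c.toNNReal f := LipschitzWith.of_dist_le_mul fun x y => by
    rw [Real.coe_toNNReal _ hc]; exact hf x y
  have himg : ∀ s : Set T, μH[1] (f '' s) ≤ ENNReal.ofReal c * μH[1] s := fun s => by
    have := hlip.hausdorffMeasure_image_le (d := 1) zero_le_one s
    rwa [ENNReal.rpow_one] at this
  set W : Set T := ⋃ g : F, g • Q with hW
  have hWm : MeasurableSet W := MeasurableSet.iUnion fun g => hQ.const_smul g
  have hQW : μH[1] Q = μH[1] (D ∩ W) := by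
    rw [hD.measure_eq_tsum Q, hW, Set.inter_iUnion, measure_iUnion₀]
    · exact tsum_congr fun g => by rw [Set.inter_comm]
    · intro g h hgh
      refine Disjoint.aedisjoint (Set.disjoint_left.2 fun z hz hz' => ?_)
      obtain ⟨-, q, hq, e⟩ := hz
      obtain ⟨-, q', hq', e'⟩ := hz'
      refine hd2 (g⁻¹ * h) (fun e1 => hgh (inv_mul_eq_one.1 e1)) q hq q' hq' ?_
      rw [mul_smul, eq_inv_smul_iff]
      exact e.trans e'.symm
    · exact fun g => hD.nullMeasurableSet.inter (hQ.const_smul g).nullMeasurableSet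
  have hsplit : μH[1] (D ∩ W) + μH[1] (D \ W) = 1 := by
    rw [measure_inter_add_sdiff D hWm, hD1]
  set N : Set T := {x | ¬ ∃ g : F, g • x ∈ D} with hN
  have hN0 : μH[1] N = 0 := ae_iff.1 hD.ae_covers
  have hfN : μH[1] (f '' N) = 0 := by
    refine le_antisymm ((himg N).trans ?_) zero_le
    rw [hN0, mul_zero]
  -- Whatever the translates of `Q` cover is covered again by translates of `P`, which avoids them.
  -- So `D \ W` and the null set `N` suffice to cover the target.
  have hcov : ∀ w : T', w ∈ (⋃ g : F, g • (f '' (D \ W))) ∪ ⋃ g : F, g • (f '' N) := by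
    intro w
    have main : ∀ x : T, x ∉ W → ∀ h : F,
        h • f x ∈ (⋃ g : F, g • (f '' (D \ W))) ∪ ⋃ g : F, g • (f '' N) := by
      intro x hx h
      by_cases hxN : x ∈ N
      · exact Or.inr (Set.mem_iUnion.2 ⟨h, f x, ⟨x, hxN, rfl⟩, rfl⟩)
      · obtain ⟨g, hg⟩ := not_not.1 hxN
        refine Or.inl (Set.mem_iUnion.2 ⟨h * g⁻¹, f (g • x), ⟨g • x, ⟨hg, fun hgx => hx ?_⟩, rfl⟩, ?_⟩)
        · obtain ⟨k, q, hq, e⟩ := Set.mem_iUnion.1 hgx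
          refine Set.mem_iUnion.2 ⟨g⁻¹ * k, q, hq, ?_⟩
          change (g⁻¹ * k) • q = x
          rw [mul_smul, inv_smul_eq_iff]
          exact e
        · change (h * g⁻¹) • f (g • x) = h • f x
          rw [heq, mul_smul, inv_smul_smul]
    obtain ⟨x, rfl⟩ := hsurj w
    by_cases hx : x ∈ W
    · obtain ⟨g, q, hq, e⟩ := Set.mem_iUnion.1 hx
      obtain ⟨p, hp, e'⟩ := hPQ ⟨q, hq, rfl⟩
      have : f x = g • f p := by rw [e', ← heq]; exact congrArg f e.symm
      rw [this]
      refine main p (fun hpW => ?_) g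
      obtain ⟨k, q', hq', e2⟩ := Set.mem_iUnion.1 hpW
      exact hd1 k p hp q' hq' e2.symm
    · have := main x hx 1
      rwa [one_smul] at this
  have hle : (1 : ℝ≥0∞) ≤ μH[1] (f '' (D \ W)) := by
    rw [← hD1', hD'.measure_eq_tsum (f '' (D \ W))]
    have hnull : μH[1] (⋃ g : F, g • (f '' N)) = 0 := by
      refine measure_iUnion_null fun g => ?_
      rw [hausdorffMeasure_smul g (Or.inl zero_le_one), hfN]
    calc μH[1] D' ≤ μH[1] ((⋃ g : F, g • (f '' (D \ W)) ∩ D') ∪ ⋃ g : F, g • (f '' N)) := by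
          refine measure_mono fun w hw => ?_
          rcases hcov w with h | h
          · obtain ⟨g, hg⟩ := Set.mem_iUnion.1 h
            exact Or.inl (Set.mem_iUnion.2 ⟨g, hg, hw⟩)
          · exact Or.inr h
      _ ≤ μH[1] (⋃ g : F, g • (f '' (D \ W)) ∩ D') + 0 := by
          rw [← hnull]; exact measure_union_le _ _
      _ ≤ ∑' g : F, μH[1] (g • (f '' (D \ W)) ∩ D') := by
          rw [add_zero]; exact measure_iUnion_le _
  -- The image of `D \ W` accounts for the whole volume of the target and that of `Q` for the extra
  -- term. Since `Q` and `D ∩ W` have equal measure, both are paid from the volume one of `D`.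
  calc 1 + μH[1] (f '' Q) ≤ ENNReal.ofReal c * μH[1] (D \ W) + ENNReal.ofReal c * μH[1] Q :=
        add_le_add (hle.trans (himg _)) (himg _)
    _ = ENNReal.ofReal c := by
        rw [← mul_add, hQW, add_comm, hsplit, mul_one]

/-- Cancellation is bounded by the stretching factor minus one, for small stretching factors. -/
theorem bcc_of_small {c ε : ℝ} {f : T → T'} (hc : 0 < c)
    (hf : ∀ x y, dist (f x) (f y) ≤ c * dist x y) (heq : ∀ (g : F) x, f (g • x) = g • f x)
    (hsurj : Function.Surjective f) (hε : ∀ g : F, g ≠ 1 → ∀ x : T', ε ≤ dist x (g • x))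
    (hcε : c - 1 < ε) : BCC f (c - 1) := by
  intro p q e y hy
  by_contra! hlt
  let : MeasurableSpace T := borel T
  have : BorelSpace T := ⟨rfl⟩
  let : MeasurableSpace T' := borel T'
  have : BorelSpace T' := ⟨rfl⟩
  -- Since `η` is below the translation lengths of the target, the initial piece of `[f p, f y]` of
  -- length `η` embeds in the quotient. It is covered on the way from `p` to `y` and again on the
  -- way back, so a volume `η > c - 1` would be lost.
  obtain ⟨η, h1, h2⟩ := exists_between (lt_min hcε hlt)
  have hηε := h2.trans_le (min_le_left _ _)
  have hηd := h2.trans_le (min_le_right _ _)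
  set I : Set T' := {w ∈ seg (f p) (f y) | dist (f p) w ≤ η} with hI
  have hIc : IsClosed I := (isClosed_seg _ _).inter (isClosed_le (continuous_const.dist continuous_id) continuous_const)
  have hcont : Continuous f := (LipschitzWith.of_dist_le_mul (K := c.toNNReal) fun x y => by
    rw [Real.coe_toNNReal _ hc.le]; exact hf x y).continuous
  have hIdist : ∀ w ∈ I, ∀ w' ∈ I, dist w w' ≤ η := by
    intro w hw w' hw'
    rw [dist_of_mem_seg hO'.tree hw.1 hw'.1, abs_le]
    constructor <;> linarith [hw.2, hw'.2, dist_nonneg (x := f p) (y := w),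
      dist_nonneg (x := f p) (y := w')]
  have hIg : ∀ g : F, ∀ w ∈ I, ∀ w' ∈ I, w = g • w' → g = 1 := by
    intro g w hw w' hw' e
    by_contra hg
    have := hε g hg w'
    rw [← e] at this
    linarith [hIdist w' hw' w hw]
  have hfy : f y ∉ I := fun h => by
    have := h.2
    rw [dist_comm] at this
    linarith
  have key := one_add_measure_le hO hO' (P := {z ∈ seg p y | f z ∈ I})
    (Q := {z ∈ seg y q | f z ∈ I}) hc.le hf heq hsurj
    ((isClosed_seg y q).inter (hIc.preimage hcont)).measurableSet ?_ ?_ ?_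
  · have himg : f '' {z ∈ seg y q | f z ∈ I} = I := by
      ext w
      constructor
      · rintro ⟨z, hz, rfl⟩; exact hz.2
      · intro hw
        have hw' : w ∈ seg (f y) (f q) := by rw [← e]; exact mem_seg_symm hw.1
        obtain ⟨z, hz, rfl⟩ := exists_mem_seg_map_eq hO.tree hO'.tree hc hf hw'
        exact ⟨z, ⟨hz, hw⟩, rfl⟩
    rw [himg, hausdorffMeasure_of_subset_seg hO'.tree (x := f p) (y := f y) fun z hz => hz.1] at key
    have hη0 : 0 ≤ η := by
      by_contra! hneg
      have h3 := one_add_measure_le hO hO' (P := ∅) (Q := ∅) hc.le hf heq hsurj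
        MeasurableSet.empty (by simp) (by simp) (by simp)
      rw [Set.image_empty, measure_empty, add_zero, ← ENNReal.ofReal_one,
        ENNReal.ofReal_le_ofReal_iff hc.le] at h3
      linarith
    have himg2 : (fun z => dist (f p) z) '' I = Set.Icc 0 η := by
      ext t
      constructor
      · rintro ⟨z, hz, rfl⟩; exact ⟨dist_nonneg, hz.2⟩
      · rintro ⟨h3, h4⟩
        rw [dist_comm] at hηd
        obtain ⟨z, hz, hd⟩ := exists_mem_seg_dist hO'.tree h3 (h4.trans hηd.le)
        exact ⟨z, ⟨hz, hd.le.trans h4⟩, hd⟩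
    rw [himg2, Real.volume_Icc, sub_zero, ← ENNReal.ofReal_one, ← ENNReal.ofReal_add zero_le_one hη0,
      ENNReal.ofReal_le_ofReal_iff hc.le] at key
    linarith
  · rintro w ⟨z, hz, rfl⟩
    obtain ⟨z', hz', e'⟩ := exists_mem_seg_map_eq hO.tree hO'.tree hc hf hz.2.1
    exact ⟨z', ⟨hz', by rw [e']; exact hz.2⟩, e'⟩
  · rintro g p' ⟨hp', hpI⟩ q' ⟨hq', hqI⟩ e'
    have hg := hIg g _ hpI _ hqI (by rw [e', heq])
    rw [hg, one_smul] at e'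
    subst e'
    have hyy : p' = y := by
      have h3 := mem_seg_between' hq' hy
      have h4 := eq_of_mem_seg_of_mem_seg hp' h3
      exact h4.symm
    rw [hyy] at hpI
    exact hfy hpI
  · rintro g hg q' ⟨-, hq'⟩ q'' ⟨-, hq''⟩ e'
    exact hg (hIg g _ hq' _ hq'' (by rw [e', heq]))

theorem one_le_of_surjective {c : ℝ} {f : T → T'} (hc : 0 ≤ c)
    (hf : ∀ x y, dist (f x) (f y) ≤ c * dist x y) (heq : ∀ (g : F) x, f (g • x) = g • f x)
    (hsurj : Function.Surjective f) : 1 ≤ c := by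
  let : MeasurableSpace T := borel T
  have : BorelSpace T := ⟨rfl⟩
  let : MeasurableSpace T' := borel T'
  have : BorelSpace T' := ⟨rfl⟩
  have h3 := one_add_measure_le hO hO' (P := ∅) (Q := ∅) hc hf heq hsurj
    MeasurableSet.empty (by simp) (by simp) (by simp)
  rwa [Set.image_empty, measure_empty, add_zero, ← ENNReal.ofReal_one,
    ENNReal.ofReal_le_ofReal_iff hc] at h3

/-- By the intermediate value theorem the image of the core is again a subtree, and it is invariant.
-/
theorem map_core {c : ℝ} {f : T → T'} (hc : 0 < c)
    (hf : ∀ x y, dist (f x) (f y) ≤ c * dist x y) (heq : ∀ (g : F) x, f (g • x) = g • f x)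
    (A : Subgroup F) (hne : (core T A).Nonempty) : core T' A ⊆ f '' core T A := by
  refine core_subset (hne.image f) ?_ ?_
  · rintro a ha _ ⟨x, hx, rfl⟩
    exact ⟨a • x, smul_mem_core ha hx, heq a x⟩
  · rintro _ ⟨x, hx, rfl⟩ _ ⟨y, hy, rfl⟩ z hz
    obtain ⟨w, hw, rfl⟩ := exists_mem_seg_map_eq hO.tree hO'.tree hc hf hz
    exact ⟨w, core_cvx A x hx y hy hw, rfl⟩

theorem surjective_of_lipschitz {c : ℝ} {f : T → T'} (hc : 0 < c)
    (hf : ∀ x y, dist (f x) (f y) ≤ c * dist x y) (heq : ∀ (g : F) x, f (g • x) = g • f x) :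
    Function.Surjective f := by
  intro w
  obtain ⟨u, -, -⟩ := hO.exists_natEdge
  have := map_core hO hO' hc hf heq ⊤ (by rw [hO.core_top]; exact ⟨u, trivial⟩)
  rw [hO'.core_top] at this
  obtain ⟨x, -, h⟩ := this (Set.mem_univ w)
  exact ⟨x, h⟩

end Volume

/-! ### Directions and small stars -/

section Star

variable {T : Type*} [MetricSpace T] {F : Type*} [Group F] [MulAction F T]
variable (hO : IsOuterSpacePoint F T)
include hO

theorem IsOuterSpacePoint.exists_smul_dir_self {A : Subgroup F} {x p : T} (hp : p ∈ core T A)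
    (hpx : p ≠ x) : ∃ a ∈ A, a ≠ 1 ∧ x ∉ seg p (a • x) := by
  obtain ⟨a, ha, h⟩ := hO.exists_smul_dir hp hpx x
  refine ⟨a, ha, ?_, h⟩
  rintro rfl
  exact (ne_of_not_mem_seg h).2 (one_smul _ _)

theorem IsOuterSpacePoint.exists_mem_seg_smul {A : Subgroup F} {x : T} (hx : x ∈ core T A) :
    ∃ a ∈ A, ∃ b ∈ A, a ≠ 1 ∧ b ≠ 1 ∧ x ∈ seg (a • x) (b • x) := by
  obtain ⟨p, hp, q, hq, hpx, hqx, h⟩ := hO.exists_two_dirs hx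
  obtain ⟨a, ha, ha1, h1⟩ := hO.exists_smul_dir_self hp hpx
  obtain ⟨b, hb, hb1, h2⟩ := hO.exists_smul_dir_self hq hqx
  refine ⟨a, ha, b, hb, ha1, hb1, ?_⟩
  by_contra h3
  exact not_mem_seg_trans hO.tree (not_mem_seg_trans hO.tree h1 h3) (not_mem_seg_symm h2) h

theorem IsOuterSpacePoint.exists_mem_seg_smul_of_ne {A : Subgroup F} {x p : T}
    (hp : p ∈ core T A) (hpx : p ≠ x) : ∃ a ∈ A, a ≠ 1 ∧ p ∈ seg x (a • x) := by
  obtain ⟨q, hq, hqp, h⟩ : ∃ q ∈ core T A, q ≠ p ∧ p ∈ seg x q := by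
    obtain ⟨q, hq, r, hr, hqp, hrp, h⟩ := hO.exists_two_dirs hp
    rcases mem_seg_or hO.tree x h with h1 | h1
    · exact ⟨q, hq, hqp, mem_seg_symm h1⟩
    · exact ⟨r, hr, hrp, h1⟩
  obtain ⟨a, ha, h1⟩ := hO.exists_smul_dir hq hqp x
  have h2 : p ∈ seg x (a • x) := by
    by_contra h3
    exact not_mem_seg_trans hO.tree h3 (not_mem_seg_symm h1) h
  refine ⟨a, ha, ?_, h2⟩
  rintro rfl
  rw [one_smul] at h2
  exact hpx (mem_seg_self h2)

theorem IsOuterSpacePoint.exists_ne_one {A : Subgroup F} {x : T} (hx : x ∈ core T A) :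
    ∃ a ∈ A, a ≠ 1 := by
  obtain ⟨a, ha, b, hb, ha1, -⟩ := hO.exists_mem_seg_smul hx
  exact ⟨a, ha, ha1⟩

theorem IsOuterSpacePoint.smul_ne {g : F} (hg : g ≠ 1) (x : T) : g • x ≠ x :=
  fun h => hg (hO.free g x h)

theorem IsOuterSpacePoint.exists_dirs (x : T) : ∃ S : Set T, S.Finite ∧ (∀ s ∈ S, s ≠ x) ∧
    ∀ p, p ≠ x → ∃ s ∈ S, x ∉ seg p s := by
  have hU := hO.core_top
  have hxU : x ∈ core T (⊤ : Subgroup F) := by rw [hU]; trivial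
  by_cases hx : IsNatVertex Set.univ x
  · refine ⟨{y | IsNatEdge Set.univ x y}, hO.finite_natEdge x, fun s hs => hs.2.2.1.symm, ?_⟩
    intro p hp
    obtain ⟨w, hw, h1, h2⟩ := hO.exists_natVertex_dir (A := ⊤) (hU ▸ hx : IsNatVertex _ x)
      (by rw [hU]; trivial) hp
    rw [hU] at hw h2
    exact ⟨w, ⟨hx, hw, (ne_of_not_mem_seg h1).2.symm, h2⟩, h1⟩
  · obtain ⟨p, hp, q, hq, hpx, hqx, h⟩ := hO.exists_two_dirs hxU
    refine ⟨{p, q}, by simp, ?_, ?_⟩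
    · rintro s (rfl | rfl) <;> assumption
    · intro r hr
      rcases two_of_not_natVertex hx trivial trivial trivial trivial hr hpx hqx h with h1 | h1
      · exact ⟨p, by simp, not_mem_seg_symm h1⟩
      · exact ⟨q, by simp, not_mem_seg_symm h1⟩

/-- A small ball in a tree is a finite star. -/
theorem IsOuterSpacePoint.exists_star (x : T) : ∃ r > 0, ∃ S : Set T, S.Finite ∧
    (∀ s ∈ S, s ≠ x) ∧ ∀ p, p ≠ x → dist x p < r → ∃ s ∈ S, p ∈ seg x s := by
  obtain ⟨S, hS, hSx, h⟩ := hO.exists_dirs x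
  obtain ⟨r, hr, hd⟩ := hO.discrete x
  obtain ⟨r', hr', h'⟩ : ∃ r' > 0, ∀ s ∈ S, r' ≤ dist x s := by
    rcases S.eq_empty_or_nonempty with rfl | hne
    · exact ⟨1, one_pos, by simp⟩
    · obtain ⟨s0, hs0, hmin⟩ := Set.exists_min_image S (fun s => dist x s) hS hne
      exact ⟨dist x s0, dist_pos.2 (hSx s0 hs0).symm, hmin⟩
  refine ⟨min r r', lt_min hr hr', S, hS, hSx, ?_⟩
  intro p hp hlt
  obtain ⟨s, hs, hps⟩ := h p hp
  refine ⟨s, hs, ?_⟩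
  have hT := hO.tree
  obtain ⟨m, h1, h2, h3⟩ := exists_median hT x p s
  by_cases hmp : m = p
  · rwa [hmp] at h3
  have hms : m ≠ s := by
    rintro rfl
    have := dist_le_of_mem_seg h1
    linarith [h' _ hs, min_le_right r r']
  have hmx : m ≠ x := by
    rintro rfl
    exact hps h2
  exact absurd (isNatVertex_of_median Cvx.univ trivial trivial trivial h1 h2 h3 hmx hmp hms)
    (hd m hmx ((dist_le_of_mem_seg h1).trans_lt (hlt.trans_le (min_le_left _ _))))

/-- Near a point, a map with slope stretches segments, and gates identify the points at equal
distance, with uniform size. -/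
theorem IsOuterSpacePoint.exists_uniform {T' : Type*} [MetricSpace T'] {c : ℝ} {f : T → T'}
    (hc : 0 < c) (hf : HasSlope c f) (x : T) : ∃ r > 0,
      (∀ p, dist x p ≤ r → Str c f x p) ∧
      ∀ p q, p ≠ x → q ≠ x → SameGate f x p q → dist x p = dist x q → dist x p ≤ r →
        f p = f q := by
  have hT := hO.tree
  have hlip := hf.lipschitz hT hc.le
  obtain ⟨r, hr, S, hS, hSx, h⟩ := hO.exists_star x
  have hmin : ∀ {ι : Type _} (s : Set ι), s.Finite → ∀ (P : ι → ℝ → Prop),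
      (∀ i ∈ s, ∃ ρ > 0, ∀ ρ' ≤ ρ, P i ρ') → ∃ ρ > 0, ∀ i ∈ s, ∀ ρ' ≤ ρ, P i ρ' := by
    intro ι s hs P
    induction s, hs using Set.Finite.induction_on with
    | empty => exact fun _ => ⟨1, one_pos, by simp⟩
    | @insert a s _ _ ih =>
      intro hP
      obtain ⟨ρ1, h1, h1'⟩ := hP a (Set.mem_insert _ _)
      obtain ⟨ρ2, h2, h2'⟩ := ih fun i hi => hP i (Set.mem_insert_of_mem _ hi)
      refine ⟨min ρ1 ρ2, lt_min h1 h2, ?_⟩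
      rintro i (rfl | hi) ρ' hρ
      · exact h1' ρ' (hρ.trans (min_le_left _ _))
      · exact h2' i hi ρ' (hρ.trans (min_le_right _ _))
  obtain ⟨r1, hr1, h1⟩ := hmin S hS (fun s ρ => ∀ p ∈ seg x s, dist x p ≤ ρ → Str c f x p)
    fun s hs => by
      obtain ⟨z, hz, hzx, hstr⟩ := hf.exists_str (hSx s hs)
      refine ⟨dist x z, dist_pos.2 hzx.symm, fun ρ' hρ p hp hd => ?_⟩
      exact (hstr.mono hlip (mem_seg_of_dist_le hT hp hz (hd.trans hρ))).1
  obtain ⟨r2, hr2, h2⟩ := hmin (S ×ˢ S) (hS.prod hS) (fun s ρ => SameGate f x s.1 s.2 →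
      ∀ p ∈ seg x s.1, ∀ q ∈ seg x s.2, dist x p = dist x q → dist x p ≤ ρ → f p = f q)
    fun s hs => by
      by_cases hg : SameGate f x s.1 s.2
      · obtain ⟨ρ, hρ, hh⟩ := hg
        exact ⟨ρ, hρ, fun ρ' hρ' _ p hp q hq e hd => hh p hp q hq e (hd.trans hρ')⟩
      · exact ⟨1, one_pos, fun _ _ h => absurd h hg⟩
  refine ⟨min (r / 2) (min r1 r2), by positivity, fun p hd => ?_, fun p q hp hq hg e hd => ?_⟩
  · rcases eq_or_ne p x with rfl | hp
    · exact Str.self _ _ _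
    obtain ⟨s, hs, hps⟩ := h p hp (by linarith [min_le_left (r / 2) (min r1 r2)])
    exact h1 s hs r1 le_rfl p hps (hd.trans ((min_le_right _ _).trans (min_le_left _ _)))
  · have hd1 : dist x p < r := by linarith [min_le_left (r / 2) (min r1 r2)]
    obtain ⟨s, hs, hps⟩ := h p hp hd1
    obtain ⟨s', hs', hqs⟩ := h q hq (e ▸ hd1)
    refine h2 (s, s') ⟨hs, hs'⟩ r2 le_rfl ?_ p hps q hqs e
      (hd.trans ((min_le_right _ _).trans (min_le_right _ _)))
    exact (sameGate_congr hT f (not_mem_seg_of_mem hT hp hps) (not_mem_seg_of_mem hT hq hqs)).1 hg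

end Star

/-- Equivariant maps with slope between points of Outer space. -/
structure IsFolding (F : Type*) {T T' : Type*} [MetricSpace T] [MetricSpace T'] [Group F]
    [MulAction F T] [MulAction F T'] (c : ℝ) (f : T → T') : Prop where
  src : IsOuterSpacePoint F T
  tgt : IsOuterSpacePoint F T'
  pos : 0 < c
  slope : HasSlope c f
  smul : ∀ (g : F) x, f (g • x) = g • f x

/-! ### Equivariant maps with slope and cores of subgroups -/

namespace IsFolding

variable {T T' : Type*} [MetricSpace T] [MetricSpace T'] {F : Type*} [Group F]
  [MulAction F T] [MulAction F T'] {c : ℝ} {f : T → T'}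

theorem lip (h : IsFolding F c f) (x y : T) : dist (f x) (f y) ≤ c * dist x y :=
  h.slope.lipschitz h.src.tree h.pos.le x y

/-- Write `y` between two translates `a • y` and `b • y`. All paths from `f y` to its nontrivial
translates run through its projection `x` to the core. If `x` were farther than `κ`, the image of
the path would backtrack by more than `κ` at `f y`. -/
theorem dist_proj_le (h : IsFolding F c f) {κ : ℝ} (hκ : BCC f κ) {A : Subgroup F} {y : T}
    (hy : y ∈ core T A) {x : T'} (hx : x ∈ core T' A) (hp : ∀ w ∈ core T' A, x ∈ seg (f y) w) :
    dist (f y) x ≤ κ := by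
  have hT' := h.tgt.tree
  obtain ⟨a, ha, b, hb, ha1, hb1, hab⟩ := h.src.exists_mem_seg_smul hy
  obtain ⟨m, hm, hm1, hm2, hd⟩ := hκ.exists_near h.src.tree hT' h.pos h.lip hab
  rw [h.smul] at hm hm1
  rw [h.smul] at hm hm2
  have main : ∀ a ∈ A, a ≠ 1 → x ∈ seg (f y) (a • f y) := fun a ha ha1 => by
    have h1 := h.tgt.smul_mem_seg a (hp _ (smul_mem_core (inv_mem ha) hx))
    rw [smul_inv_smul] at h1
    exact (mem_seg_concat hT' (hp _ (smul_mem_core ha hx)) (mem_seg_symm h1)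
      (h.tgt.smul_ne ha1 x).symm).2
  by_contra! hlt
  have hmx : m ∈ seg (f y) x := mem_seg_of_dist_le hT' (mem_seg_symm hm1) (main a ha ha1)
    (hd.trans hlt.le)
  have hne : x ≠ m := by
    rintro rfl
    exact absurd hd (not_le.2 hlt)
  exact not_mem_seg_of_common hT' hne (mem_seg_between hmx (main a ha ha1))
    (mem_seg_between hmx (main b hb hb1)) hm

/-- The images of `w` and `w'` project to the core within `κ`. As `f y` is farther than that from
both, it lies between the two projections. -/
theorem mem_core_of_str (h : IsFolding F c f) {κ : ℝ} (hκ : BCC f κ) {A : Subgroup F} {y w w' : T}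
    (hne : (core T' A).Nonempty) (hw : w ∈ core T A) (hw' : w' ∈ core T A)
    (h1 : f y ∈ seg (f w) (f w')) (h2 : κ < dist (f w) (f y)) (h3 : κ < dist (f w') (f y)) :
    f y ∈ core T' A := by
  have hT' := h.tgt.tree
  obtain ⟨x, hx, hxp⟩ := h.tgt.exists_proj hne (f w)
  obtain ⟨x', hx', hxp'⟩ := h.tgt.exists_proj hne (f w')
  have d1 := h.dist_proj_le hκ hw hx hxp
  have d2 := h.dist_proj_le hκ hw' hx' hxp'
  rcases mem_seg_or hT' x h1 with h4 | h4
  · exact absurd (dist_le_of_mem_seg h4) (by linarith)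
  rcases mem_seg_or hT' x' h4 with h5 | h5
  · exact core_cvx A _ hx _ hx' h5
  · have := dist_le_of_mem_seg' h5
    rw [dist_comm, dist_comm x'] at this
    linarith

/-- At a point of valence two in the whole tree, having two gates means that the only turn is legal.
-/
theorem str_of_no_natVertex (h : IsFolding F c f) (h2 : ∀ x, TwoGates f Set.univ x) {x v : T}
    (hv : ∀ z ∈ seg x v, z ≠ x → z ≠ v → ¬ IsNatVertex Set.univ z) : Str c f x v := by
  have hT := h.src.tree
  refine str_of_legal hT h.tgt.tree h.pos h.slope fun z hz hzx hzv hg => ?_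
  obtain ⟨p, -, q, -, hpz, hqz, hpq⟩ := h2 z
  have key : ∀ p, p ≠ z → SameGate f z x p := by
    intro p hpz
    rcases two_of_not_natVertex (hv z hz hzx hzv) trivial trivial trivial trivial hpz
      hzx.symm hzv.symm hz with h1 | h1
    · exact sameGate_of_not_mem hT f h1
    · exact hg.trans hT hzv.symm (sameGate_of_not_mem hT f h1)
  exact hpq ((key p hpz).symm.trans hT hzx.symm (key q hqz))

/-- The second gate at `x` must use a direction outside the core. So `x` is a vertex of the ambient
graph, a place where greedy folding acts. -/
theorem natVertex_of_oneGate (h : IsFolding F c f) (h2 : ∀ x, TwoGates f Set.univ x)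
    {A : Subgroup F} {x : T} (hx : x ∈ core T A) (h1 : OneGate f (core T A) x) :
    IsNatVertex Set.univ x := by
  have hT := h.src.tree
  by_contra hn
  obtain ⟨p, hp, q, hq, hpx, hqx, hpq⟩ := h.src.exists_two_dirs hx
  obtain ⟨p', -, q', -, hpx', hqx', hpq'⟩ := h2 x
  have key : ∀ r, r ≠ x → SameGate f x p r := by
    intro r hr
    rcases two_of_not_natVertex hn trivial trivial trivial trivial hr hpx hqx hpq with h3 | h3
    · exact sameGate_of_not_mem hT f h3
    · exact (h1 p hp q hq hpx hqx).trans hT hqx (sameGate_of_not_mem hT f h3)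
  exact hpq' ((key p' hpx').symm.trans hT hpx (key q' hqx'))

/-- A segment of the core in a given direction that is legal up to a point of the core with one
gate or a natural vertex of the ambient tree. -/
theorem exists_legal_step (h : IsFolding F c f) {ε : ℝ}
    (hε1 : ∀ x y : T, IsNatVertex Set.univ x → IsNatVertex Set.univ y → x ≠ y → ε ≤ dist x y)
    (hε2 : ∀ g : F, g ≠ 1 → ∀ x : T, ε ≤ dist x (g • x))
    (h2 : ∀ x, TwoGates f Set.univ x) {A : Subgroup F} {x p : T} (hx : x ∈ core T A)
    (hp : p ∈ core T A) (hpx : p ≠ x) : ∃ v ∈ core T A, v ≠ x ∧ x ∉ seg p v ∧ Str c f x v ∧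
      (IsNatVertex Set.univ v ∨ ε ≤ dist x v) ∧ (IsNatVertex Set.univ x → ε ≤ dist x v) := by
  have hT := h.src.tree
  obtain ⟨a, ha, ha1, hax⟩ := h.src.exists_smul_dir_self hp hpx
  have hmem : a • x ∈ core T A := smul_mem_core ha hx
  have hstr := fun v => @str_of_no_natVertex _ _ _ _ _ _ _ _ _ _ h h2 x v
  by_cases hnat : ∃ u ∈ seg x (a • x), u ≠ x ∧ IsNatVertex Set.univ u
  · obtain ⟨u, hu, hux, hun⟩ := hnat
    obtain ⟨v, hv, hvn, hvx, hfirst⟩ := h.src.exists_first_natVertex hun hux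
    have hv' := mem_seg_left hv hu
    exact ⟨v, core_cvx A _ hx _ hmem hv', hvx,
      not_mem_seg_trans hT hax (not_mem_seg_symm (not_mem_seg_of_mem hT hvx hv')),
      hstr v hfirst, Or.inl hvn, fun hxn => hε1 x v hxn hvn hvx.symm⟩
  · push Not at hnat
    exact ⟨a • x, hmem, h.src.smul_ne ha1 x, hax, hstr _ fun z hz hzx _ => hnat z hz hzx,
      Or.inr (hε2 a ha1 x), fun _ => hε2 a ha1 x⟩

/-- Legal segments of the core can be prolonged until they reach a point with one gate. -/
theorem exists_long_legal (h : IsFolding F c f) (h2 : ∀ x, TwoGates f Set.univ x)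
    {A : Subgroup F} {x p : T} (hx : x ∈ core T A) (hp : p ∈ core T A) (hpx : p ≠ x) (B : ℝ) :
    ∃ w ∈ core T A, w ≠ x ∧ x ∉ seg p w ∧ Str c f x w ∧
      (OneGate f (core T A) w ∨ B < dist x w) := by
  have hT := h.src.tree
  obtain ⟨ε, hε, hε1, hε2⟩ := h.src.exists_systole
  have step := @exists_legal_step _ _ _ _ _ _ _ _ _ _ h ε hε1 hε2 h2 A
  have extend : ∀ w ∈ core T A, w ≠ x → x ∉ seg p w → Str c f x w →
      ¬ OneGate f (core T A) w → ∃ v ∈ core T A, v ≠ x ∧ x ∉ seg p v ∧ Str c f x v ∧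
        dist x v = dist x w + dist w v ∧
        (IsNatVertex Set.univ v ∨ ε ≤ dist w v) ∧ (IsNatVertex Set.univ w → ε ≤ dist w v) := by
    intro w hw hwx hpw hstr hone
    unfold OneGate at hone
    push Not at hone
    obtain ⟨q, hq, q', hq', hqw, hqw', hqq⟩ := hone
    obtain ⟨r, hr, hrw, hgr⟩ : ∃ r ∈ core T A, r ≠ w ∧ ¬ SameGate f w x r := by
      by_contra! hcon
      exact hqq ((hcon q hq hqw).symm.trans hT hwx.symm (hcon q' hq' hqw'))
    obtain ⟨v, hv, hvw, hrv, hsv, h3, h4⟩ := step hw hr hrw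
    have hgv : ¬ SameGate f w x v := fun hg => hgr
      (hg.trans hT hvw (sameGate_of_not_mem hT f (not_mem_seg_symm hrv)))
    have hwv : w ∈ seg x v := by
      by_contra hcon
      exact hgv (sameGate_of_not_mem hT f hcon)
    refine ⟨v, hv, ?_, ?_, ?_, hwv.symm, h3, h4⟩
    · rintro rfl
      exact hwx (mem_seg_self hwv)
    · exact not_mem_seg_trans hT hpw (not_mem_seg_of_mem hT hwx hwv)
    · exact hstr.concat hsv hwv (Str.mem_seg_of_not_sameGate hT h.tgt.tree h.pos h.lip
        hstr.symm hsv hgv)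
  -- A step either gains `ε` or ends at a natural vertex, and a step from a natural vertex gains
  -- `ε`. So at most two steps are needed for each further `ε`.
  have main : ∀ k : ℕ, ∃ w ∈ core T A, w ≠ x ∧ x ∉ seg p w ∧ Str c f x w ∧
      (OneGate f (core T A) w ∨ k * ε ≤ dist x w) := by
    intro k
    induction k with
    | zero =>
      obtain ⟨v, hv, hvx, hpv, hstr, -⟩ := step hx hp hpx
      exact ⟨v, hv, hvx, hpv, hstr, Or.inr (by simp)⟩
    | succ k ih =>
      obtain ⟨w, hw, hwx, hpw, hstr, hk⟩ := ih
      by_cases hone : OneGate f (core T A) w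
      · exact ⟨w, hw, hwx, hpw, hstr, Or.inl hone⟩
      have hk := hk.resolve_left hone
      push_cast
      obtain ⟨v, hv, hvx, hpv, hsv, e, h3, h4⟩ := extend w hw hwx hpw hstr hone
      rcases h3 with h3 | h3
      · by_cases honev : OneGate f (core T A) v
        · exact ⟨v, hv, hvx, hpv, hsv, Or.inl honev⟩
        obtain ⟨u, hu, hux, hpu, hsu, e', -, h5⟩ := extend v hv hvx hpv hsv honev
        exact ⟨u, hu, hux, hpu, hsu, Or.inr (by
          have := dist_nonneg (x := w) (y := v)
          linarith [h5 h3])⟩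
      · exact ⟨v, hv, hvx, hpv, hsv, Or.inr (by linarith)⟩
  obtain ⟨k, hk⟩ := exists_nat_gt (B / ε)
  obtain ⟨w, hw, hwx, hpw, hstr, h3⟩ := main k
  refine ⟨w, hw, hwx, hpw, hstr, h3.imp_right fun h3 => lt_of_lt_of_le ?_ h3⟩
  rwa [div_lt_iff₀ hε] at hk

/-- Lifting a direction: on a segment whose image leaves the branch at `x` containing `e`, the last
point before which the image is in the branch. -/
theorem exists_lift_dir (hT : IsRealTree T) (hT' : IsRealTree T') (hc : 0 < c) (hf : HasSlope c f)
    {p q : T} {x e : T'} (hp : x ∉ seg e (f p)) (hq : x ∈ seg e (f q)) :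
    ∃ z ∈ seg p q, z ≠ p ∧ f z = x ∧ (∃ w ∈ seg z p, w ≠ z ∧ ∀ w' ∈ seg z w, w' ≠ z →
      x ∉ seg e (f w')) ∧ ∀ w ∈ seg z q, x ∈ seg e (f w) := by
  have hlip := hf.lipschitz hT hc.le
  have hcont : Continuous f := (LipschitzWith.of_dist_le_mul (K := c.toNNReal) fun x y => by
    rw [Real.coe_toNNReal _ hc.le]; exact hlip x y).continuous
  obtain ⟨γ, hγ0, hγ1, hγ⟩ := exists_path hT p q
  set D := {t : ℝ | 0 ≤ t ∧ t ≤ dist p q ∧ x ∉ seg e (f (γ t))} with hD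
  have hD0 : (0 : ℝ) ∈ D := ⟨le_rfl, dist_nonneg, by rwa [hγ0]⟩
  have hDb : BddAbove D := ⟨dist p q, fun t ht => ht.2.1⟩
  set τ := sSup D with hτ
  have hτ0 : 0 ≤ τ := le_csSup hDb hD0
  have hτ1 : τ ≤ dist p q := csSup_le ⟨0, hD0⟩ fun t ht => ht.2.1
  have hγd : ∀ s t, 0 ≤ s → s ≤ dist p q → 0 ≤ t → t ≤ dist p q →
      dist (γ s) (γ t) = |s - t| := fun s t h1 h2 h3 h4 => by
    rw [dist_of_mem_seg hT (hγ s h1 h2).1 (hγ t h3 h4).1, (hγ s h1 h2).2, (hγ t h3 h4).2]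
  have hzq : ∀ t, τ < t → t ≤ dist p q → x ∈ seg e (f (γ t)) := by
    intro t h1 h2
    by_contra h3
    exact absurd (le_csSup hDb (⟨hτ0.trans h1.le, h2, h3⟩ : t ∈ D)) (not_le.2 h1)
  -- the branch is open
  have hopen : ∀ s t, 0 ≤ s → s ≤ dist p q → 0 ≤ t → t ≤ dist p q → x ∉ seg e (f (γ s)) →
      c * |s - t| < dist (f (γ s)) x → x ∉ seg e (f (γ t)) := by
    intro s t h1 h2 h3 h4 h5 h6
    refine not_mem_seg_trans hT' h5 (not_mem_seg_of_dist_lt hT' ?_)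
    refine (hlip _ _).trans_lt ?_
    rwa [hγd s t h1 h2 h3 h4]
  have hzx : f (γ τ) = x := by
    by_contra hne
    have hpos : 0 < dist (f (γ τ)) x := dist_pos.2 hne
    by_cases hin : x ∈ seg e (f (γ τ))
    · obtain ⟨s, hs, hlt⟩ := exists_lt_of_lt_csSup ⟨0, hD0⟩
        (show τ - dist (f (γ τ)) x / c < τ by linarith [div_pos hpos hc])
      have hsτ : s ≤ τ := le_csSup hDb hs
      refine hs.2.2 ?_
      by_contra hcon
      refine absurd hin (not_mem_seg_trans hT' hs.2.2
        (not_mem_seg_symm (not_mem_seg_of_dist_lt hT' ((hlip _ _).trans_lt ?_))))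
      rw [hγd τ s hτ0 hτ1 hs.1 hs.2.1, abs_of_nonneg (by linarith), mul_comm, ← lt_div_iff₀ hc]
      linarith
    · have hlt : τ < dist p q := by
        refine lt_of_le_of_ne hτ1 fun h => hin ?_
        rw [h, hγ1]
        exact hq
      obtain ⟨t, ht1, ht2⟩ := exists_between
        (lt_min hlt (show τ < τ + dist (f (γ τ)) x / c by linarith [div_pos hpos hc]))
      refine hopen τ t hτ0 hτ1 (hτ0.trans ht1.le) (ht2.le.trans (min_le_left _ _)) hin ?_
        (hzq t ht1 (ht2.le.trans (min_le_left _ _)))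
      rw [abs_sub_comm, abs_of_nonneg (by linarith), mul_comm, ← lt_div_iff₀ hc]
      linarith [min_le_right (dist p q) (τ + dist (f (γ τ)) x / c)]
  have hzp : γ τ ≠ p := by
    rintro h
    rw [← hzx, h] at hp
    exact hp (right_mem_seg _ _)
  refine ⟨γ τ, (hγ τ hτ0 hτ1).1, hzp, hzx, ?_, ?_⟩
  · obtain ⟨w, hw, hwz, hstr⟩ := hf (γ τ) p hzp.symm
    have hdz : 0 < dist (γ τ) w := dist_pos.2 hwz.symm
    obtain ⟨s, hs, hlt⟩ := exists_lt_of_lt_csSup ⟨0, hD0⟩ (show τ - dist (γ τ) w < τ by linarith)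
    have hsτ : s ≤ τ := le_csSup hDb hs
    have hds : dist (γ τ) (γ s) = τ - s := by
      rw [hγd τ s hτ0 hτ1 hs.1 hs.2.1, abs_of_nonneg (by linarith)]
    have hsp : γ s ∈ seg (γ τ) p := by
      refine mem_seg_symm (mem_seg_of_dist_le hT (hγ s hs.1 hs.2.1).1 (hγ τ hτ0 hτ1).1 ?_)
      rwa [(hγ s hs.1 hs.2.1).2, (hγ τ hτ0 hτ1).2]
    have hsw : γ s ∈ seg (γ τ) w := mem_seg_of_dist_le hT hsp hw (by linarith)
    refine ⟨w, hw, hwz, fun w' hw' hne => ?_⟩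
    have hfs := hs.2.2
    refine not_mem_seg_trans hT' hfs ?_
    have hsub : ∀ a ∈ seg (γ τ) w, Str c f (γ τ) a := fun a ha => hstr _ (left_mem_seg _ _) a ha
    have himg : ∀ a ∈ seg (γ τ) w, ∀ b ∈ seg (γ τ) a, a ≠ γ τ → b ≠ γ τ → x ∉ seg (f a) (f b) := by
      intro a ha b hb h1 h2
      have h3 := (hsub a ha).mono hlip hb
      rw [hzx] at h3
      refine not_mem_seg_symm (not_mem_seg_of_mem hT' ?_ h3.2.2)
      rintro h4
      have h5 : dist (f (γ τ)) (f b) = c * dist (γ τ) b := h3.1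
      rw [h4, hzx, dist_self] at h5
      exact h2 (dist_eq_zero.1 ((mul_eq_zero.1 h5.symm).resolve_left hc.ne')).symm
    have hsne : γ s ≠ γ τ := by
      intro h
      rw [h, hzx] at hfs
      exact hfs (right_mem_seg _ _)
    rcases le_total (dist (γ τ) w') (dist (γ τ) (γ s)) with h1 | h1
    · exact himg _ hsw _ (mem_seg_of_dist_le hT hw' hsw h1) hsne hne
    · exact not_mem_seg_symm (himg _ hw' _ (mem_seg_of_dist_le hT hsw hw' h1) hne hsne)
  · intro w hw
    rcases eq_or_ne w (γ τ) with rfl | hne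
    · rw [hzx]; exact right_mem_seg _ _
    have hwpq := mem_seg_right hw (hγ τ hτ0 hτ1).1
    have h1 := mem_seg_between' hw (hγ τ hτ0 hτ1).1
    have h2 := dist_le_of_mem_seg hwpq
    have h3 : w = γ (dist p w) := seg_eq_of_dist_eq hT hwpq (hγ _ dist_nonneg h2).1
      (hγ _ dist_nonneg h2).2.symm
    rw [h3]
    refine hzq _ (lt_of_le_of_ne ?_ fun e => hne ?_) h2
    · have := dist_le_of_mem_seg h1
      rwa [(hγ τ hτ0 hτ1).2] at this
    · rw [h3, ← e]

end IsFolding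

theorem icc_induction {α ω : ℝ} {s : Set.Icc α ω} {P : Set.Icc α ω → Prop} (h0 : P s)
    (hr : ∀ t, s ≤ t → (t : ℝ) < ω → P t →
      ∃ ε > 0, ∀ t' : Set.Icc α ω, t < t' → (t' : ℝ) ≤ t + ε → P t')
    (hl : ∀ t, s < t → (∀ u, s ≤ u → u < t → P u) → P t) (t : Set.Icc α ω) (hst : s ≤ t) : P t := by
  have key := real_induction (a := s) (b := ω) (P := fun r => ∀ h : r ∈ Set.Icc α ω, P ⟨r, h⟩)
    (fun _ => h0) ?_ ?_ t hst t.2.2 t.2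
  · exact key
  · intro r h1 h2 h3
    have hr' : r ∈ Set.Icc α ω := ⟨s.2.1.trans h1, h2.le⟩
    obtain ⟨ε, hε, h4⟩ := hr ⟨r, hr'⟩ h1 h2 (h3 hr')
    exact ⟨ε, hε, fun t' h5 h6 h7 h8 => h4 ⟨t', h8⟩ h5 h6⟩
  · intro r h1 h2 h3 h4
    exact hl ⟨r, h4⟩ h1 fun u h5 h6 => h3 u h5 h6 u.2

theorem exists_exp_sub_one_le {r : ℝ} (hr : 0 < r) : ∃ ε > 0, ∀ u ≤ ε, Real.exp u - 1 ≤ r := by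
  refine ⟨Real.log (1 + r), Real.log_pos (by linarith), fun u hu => ?_⟩
  have := Real.exp_le_exp.2 hu
  rw [Real.exp_log (by linarith)] at this
  linarith

/-! ### Folding paths: cancellation and persistence of gates -/

namespace FoldingPath

variable {n : ℕ} {α ω : ℝ} (G : FoldingPath.{u} n α ω) (A : Subgroup (FreeGroup (Fin n)))

theorem isFolding {s t : Set.Icc α ω} (h : s ≤ t) :
    IsFolding (FreeGroup (Fin n)) (Real.exp ((t : ℝ) - s)) (G.map s t h) :=
  ⟨G.outer s, G.outer t, Real.exp_pos _, (G.optimal s t h).1, G.map_smul s t h⟩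

theorem isFolding_toEnd (t : Set.Icc α ω) :
    IsFolding (FreeGroup (Fin n)) (Real.exp (ω - t)) (G.toEnd t) :=
  G.isFolding (t := ⟨ω, G.le, le_rfl⟩) t.2.2

theorem twoGates_toEnd (t : Set.Icc α ω) (x : G.T t) : TwoGates (G.toEnd t) Set.univ x :=
  (G.optimal t ⟨ω, G.le, le_rfl⟩ t.2.2).2 x

theorem toEnd_map {s t : Set.Icc α ω} (h : s ≤ t) (x : G.T s) :
    G.toEnd t (G.map s t h x) = G.toEnd s x := G.map_map _ _ _ _ _ _

theorem surjective_map {s t : Set.Icc α ω} (h : s ≤ t) : Function.Surjective (G.map s t h) :=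
  surjective_of_lipschitz (G.outer s) (G.outer t) (Real.exp_pos _) (G.isFolding h).lip
    (G.map_smul s t h)

theorem one_le_exp {α ω : ℝ} {s t : Set.Icc α ω} (h : s ≤ t) : 1 ≤ Real.exp ((t : ℝ) - s) :=
  Real.one_le_exp (sub_nonneg.2 h)

/-- The volume argument needs a lower bound for translation lengths that is uniform in time. The one
at the end of the path pulls back, because the maps to the end are Lipschitz with factor at most
`exp (ω - α)`. -/
theorem exists_bcc_small : ∃ ε > 0, ∀ (s t : Set.Icc α ω) (h : s ≤ t), (t : ℝ) ≤ s + ε →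
    BCC (G.map s t h) (Real.exp ((t : ℝ) - s) - 1) := by
  obtain ⟨ρ, hρ, -, hsys⟩ := (G.outer ⟨ω, G.le, le_rfl⟩).exists_systole
  have hpos : 0 < ρ / Real.exp (ω - α) := div_pos hρ (Real.exp_pos _)
  obtain ⟨ε, hε, hexp⟩ := exists_exp_sub_one_le (half_pos hpos)
  refine ⟨ε, hε, fun s t h hst => ?_⟩
  refine bcc_of_small (G.outer s) (G.outer t) (Real.exp_pos _) (G.isFolding h).lip
    (G.map_smul s t h) (G.surjective_map h) (ε := ρ / Real.exp (ω - α)) ?_ ?_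
  · intro g hg x
    rw [div_le_iff₀ (Real.exp_pos _), mul_comm]
    have h1 := hsys g hg (G.toEnd t x)
    rw [← (G.isFolding_toEnd t).smul] at h1
    refine h1.trans (((G.isFolding_toEnd t).lip _ _).trans ?_)
    gcongr
    exact t.2.1
  · have := hexp (t - s) (by linarith)
    linarith

theorem map_comp {r s t : Set.Icc α ω} (hrs : r ≤ s) (hst : s ≤ t) :
    G.map r t (hrs.trans hst) = G.map s t hst ∘ G.map r s hrs :=
  funext fun x => (G.map_map r s t hrs hst x).symm

theorem bcc_comp {r s t : Set.Icc α ω} (hrs : r ≤ s) (hst : s ≤ t) {κ κ' : ℝ}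
    (h : BCC (G.map r s hrs) κ) (h' : BCC (G.map s t hst) κ') :
    BCC (G.map r t (hrs.trans hst)) (Real.exp ((t : ℝ) - s) * κ + κ') := by
  rw [G.map_comp hrs hst]
  exact BCC.comp (G.outer r).tree (G.outer s).tree (Real.exp_pos _) (G.isFolding hrs).lip
    (Real.exp_pos _) (G.isFolding hst).lip h h'

theorem map_self_eq (s : Set.Icc α ω) : G.map s s le_rfl = fun x => x := funext (G.map_self s)

/-- The cancellation constant of a folding map is at most its stretching factor minus one. -/
theorem bcc {s t : Set.Icc α ω} (h : s ≤ t) : BCC (G.map s t h) (Real.exp ((t : ℝ) - s) - 1) := by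
  obtain ⟨ε, hε, hsmall⟩ := G.exists_bcc_small
  -- The bounds compose without loss: `c' * (c - 1) + (c' - 1) = c' * c - 1`. So a uniform step size
  -- suffices to reach any time.
  have hadd : ∀ u t : Set.Icc α ω, ∀ (hu : s ≤ u) (ht : u ≤ t),
      BCC (G.map s u hu) (Real.exp ((u : ℝ) - s) - 1) → (t : ℝ) ≤ u + ε →
      BCC (G.map s t (hu.trans ht)) (Real.exp ((t : ℝ) - s) - 1) := by
    intro u t hu ht h1 h2
    refine (G.bcc_comp hu ht h1 (hsmall u t ht h2)).mono (le_of_eq ?_)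
    have : Real.exp ((t : ℝ) - s) = Real.exp ((t : ℝ) - u) * Real.exp ((u : ℝ) - s) := by
      rw [← Real.exp_add]; congr 1; ring
    rw [this]; ring
  refine icc_induction (s := s)
    (P := fun t => ∀ h : s ≤ t, BCC (G.map s t h) (Real.exp ((t : ℝ) - s) - 1))
    (fun _ => ?_) ?_ ?_ t h h
  · rw [sub_self, Real.exp_zero, sub_self, G.map_self_eq]
    exact BCC.id
  · intro t hst _ hP
    exact ⟨ε, hε, fun t' h1 h2 h3 => hadd t t' hst h1.le (hP hst) h2⟩
  · intro t hst hP h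
    have hst' : (s : ℝ) < t := hst
    have hu : max (s : ℝ) (t - ε) < t := max_lt hst' (by linarith)
    have hu' : max (s : ℝ) (t - ε) ∈ Set.Icc α ω :=
      ⟨s.2.1.trans (le_max_left _ _), hu.le.trans t.2.2⟩
    exact hadd ⟨_, hu'⟩ t (le_max_left (s : ℝ) (t - ε)) hu.le (hP ⟨_, hu'⟩ (le_max_left (s : ℝ) (t - ε)) hu
      (le_max_left (s : ℝ) (t - ε))) (by
        change (t : ℝ) ≤ max (s : ℝ) (t - ε) + ε
        linarith [le_max_right (s : ℝ) (t - ε)])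

variable {A}

theorem core_nonempty_of {s t : Set.Icc α ω} {x : G.T s} (hx : x ∈ G.sub A s) :
    (G.sub A t).Nonempty := by
  obtain ⟨a, ha, h⟩ := (G.outer s).exists_ne_one hx
  exact (G.outer t).core_nonempty ha h

theorem sub_subset_image {s t : Set.Icc α ω} (h : s ≤ t) {x : G.T t} (hx : x ∈ G.sub A t) :
    ∃ y ∈ G.sub A s, G.map s t h y = x :=
  map_core (G.outer s) (G.outer t) (Real.exp_pos _) (G.isFolding h).lip (G.map_smul s t h) A
    (G.core_nonempty_of hx) hx

theorem dist_proj_le {s t : Set.Icc α ω} (h : s ≤ t) {y : G.T s} (hy : y ∈ G.sub A s)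
    {x : G.T t} (hx : x ∈ G.sub A t) (hp : ∀ w ∈ G.sub A t, x ∈ seg (G.map s t h y) w) :
    dist (G.map s t h y) x ≤ Real.exp ((t : ℝ) - s) - 1 :=
  (G.isFolding h).dist_proj_le (G.bcc h) hy hx hp

/-- The segment `[p, q]` is stretched by the folding map to the end of the path. -/
def Legal (t : Set.Icc α ω) (p q : G.T t) : Prop := Str (Real.exp (ω - t)) (G.toEnd t) p q

variable {G}

theorem Legal.symm {t : Set.Icc α ω} {p q : G.T t} (h : G.Legal t p q) : G.Legal t q p :=
  Str.symm h

/-- The stretching factors multiply. Equality for the composition to the end forces equality for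
both factors. -/
theorem Legal.str {s t : Set.Icc α ω} (h : s ≤ t) {p q : G.T s} (hl : G.Legal s p q) :
    Str (Real.exp ((t : ℝ) - s)) (G.map s t h) p q ∧
      G.Legal t (G.map s t h p) (G.map s t h q) := by
  have h1 := (G.isFolding_toEnd t).lip (G.map s t h p) (G.map s t h q)
  rw [G.toEnd_map, G.toEnd_map] at h1
  have h2 := (G.isFolding h).lip p q
  have h3 : Real.exp (ω - s) = Real.exp (ω - t) * Real.exp ((t : ℝ) - s) := by
    rw [← Real.exp_add]; congr 1; ring
  unfold Legal Str at *
  rw [G.toEnd_map, G.toEnd_map]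
  rw [hl, h3, mul_assoc] at h1 ⊢
  have h4 := le_of_mul_le_mul_left h1 (Real.exp_pos _)
  have h5 := le_antisymm h2 h4
  exact ⟨h5, by rw [h5]⟩

theorem Legal.sub {t : Set.Icc α ω} {p q a b : G.T t} (h : G.Legal t p q) (ha : a ∈ seg p q)
    (hb : b ∈ seg p q) : G.Legal t a b :=
  Str.sub (G.outer t).tree (G.isFolding_toEnd t).lip h ha hb

theorem Legal.map_mem {s t : Set.Icc α ω} (h : s ≤ t) {p q a : G.T s} (hl : G.Legal s p q)
    (ha : a ∈ seg p q) : G.map s t h a ∈ seg (G.map s t h p) (G.map s t h q) :=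
  ((hl.str h).1.mono (G.isFolding h).lip ha).2.2

theorem Legal.map_ne {s t : Set.Icc α ω} (h : s ≤ t) {p q : G.T s} (hl : G.Legal s p q)
    (hne : p ≠ q) : G.map s t h p ≠ G.map s t h q := by
  intro e
  have h1 := (hl.str h).1
  unfold Str at h1
  rw [e, dist_self] at h1
  exact hne (dist_eq_zero.1 ((mul_eq_zero.1 h1.symm).resolve_left (Real.exp_pos _).ne'))

theorem Legal.not_sameGate {t : Set.Icc α ω} {p q y : G.T t} (hl : G.Legal t p q)
    (hy : y ∈ seg p q) (hyp : p ≠ y) (hyq : q ≠ y) : ¬ SameGate (G.toEnd t) y p q := by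
  have h1 := Str.mono (G.isFolding_toEnd t).lip hl hy
  exact Str.not_sameGate (G.outer t).tree (G.outer _).tree (Real.exp_pos _)
    (G.isFolding_toEnd t).lip hyp hyq h1.1.symm h1.2.1 h1.2.2

theorem Legal.concat {t : Set.Icc α ω} {p q y : G.T t} (h1 : G.Legal t p y) (h2 : G.Legal t y q)
    (h : ¬ SameGate (G.toEnd t) y p q) : y ∈ seg p q ∧ G.Legal t p q := by
  have hy : y ∈ seg p q := by
    by_contra hcon
    exact h (sameGate_of_not_mem (G.outer t).tree _ hcon)
  exact ⟨hy, Str.concat h1 h2 hy (Str.mem_seg_of_not_sameGate (G.outer t).tree (G.outer _).tree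
    (Real.exp_pos _) (G.isFolding_toEnd t).lip h1.symm h2 h)⟩

theorem Legal.map_not_sameGate {s t : Set.Icc α ω} (h : s ≤ t) {p q y : G.T s}
    (hl : G.Legal s p q) (hy : y ∈ seg p q) (hyp : p ≠ y) (hyq : q ≠ y) :
    ¬ SameGate (G.toEnd t) (G.map s t h y) (G.map s t h p) (G.map s t h q) :=
  (hl.str h).2.not_sameGate (hl.map_mem h hy)
    ((hl.sub (left_mem_seg _ _) hy).map_ne h hyp) ((hl.sub (right_mem_seg _ _) hy).map_ne h hyq)

theorem exists_legal {t : Set.Icc α ω} {x p : G.T t} (h : p ≠ x) :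
    ∃ z ∈ seg x p, z ≠ x ∧ G.Legal t x z := (G.isFolding_toEnd t).slope.exists_str h

variable (G A)

/-- The graph `A|G_t` has a point with one gate. -/
def Bad (t : Set.Icc α ω) : Prop := ∃ x ∈ G.sub A t, OneGate (G.toEnd t) (G.sub A t) x

variable {G A}

theorem exists_gates {t : Set.Icc α ω} {x : G.T t} (h : ¬ OneGate (G.toEnd t) (G.sub A t) x) :
    ∃ p ∈ G.sub A t, ∃ q ∈ G.sub A t, p ≠ x ∧ q ≠ x ∧ ¬ SameGate (G.toEnd t) x p q := by
  unfold OneGate at h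
  push Not at h
  obtain ⟨p, hp, q, hq, h⟩ := h
  exact ⟨p, hp, q, hq, h⟩

/-- Two gates at every point let a legal segment through `y` be prolonged inside the core on both
sides beyond the cancellation bound. Its image is a geodesic whose ends are that close to the new
core, so the image of `y` is in the core. -/
theorem map_mem_of_not_bad {s t : Set.Icc α ω} (h : s ≤ t) (hs : ¬ G.Bad A s) {y : G.T s}
    (hy : y ∈ G.sub A s) : G.map s t h y ∈ G.sub A t := by
  have hone : ∀ w ∈ G.sub A s, ¬ OneGate (G.toEnd s) (G.sub A s) w := fun w hw h1 => hs ⟨w, hw, h1⟩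
  obtain ⟨p, hp, q, hq, hpy, hqy, hpq⟩ := exists_gates (hone y hy)
  have hT := (G.outer s).tree
  have key : ∀ p ∈ G.sub A s, p ≠ y → ∃ w ∈ G.sub A s, w ≠ y ∧ y ∉ seg p w ∧ G.Legal s y w ∧
      Real.exp ((t : ℝ) - s) - 1 < dist y w := fun p hp hpy => by
    obtain ⟨w, hw, h1, h2, h3, h4⟩ := (G.isFolding_toEnd s).exists_long_legal
      (G.twoGates_toEnd s) hy hp hpy (Real.exp ((t : ℝ) - s) - 1)
    exact ⟨w, hw, h1, h2, h3, h4.resolve_left (hone w hw)⟩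
  obtain ⟨w, hw, hwy, hpw, hlw, hdw⟩ := key p hp hpy
  obtain ⟨w', hw', hwy', hqw', hlw', hdw'⟩ := key q hq hqy
  obtain ⟨hyw, hl⟩ := hlw.symm.concat hlw' (by
    rwa [← sameGate_congr hT (G.toEnd s) hpw hqw'])
  refine (G.isFolding h).mem_core_of_str (G.bcc h) (G.core_nonempty_of hy) hw hw'
    (hl.map_mem h hyw) ?_ ?_
  · have h1 : dist (G.map s t h w) (G.map s t h y) = _ := (hlw.symm.str h).1
    rw [h1, dist_comm w y]
    refine hdw.trans_le (le_mul_of_one_le_left dist_nonneg (one_le_exp h))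
  · have h1 : dist (G.map s t h w') (G.map s t h y) = _ := (hlw'.symm.str h).1
    rw [h1, dist_comm w' y]
    refine hdw'.trans_le (le_mul_of_one_le_left dist_nonneg (one_le_exp h))

/-- A point of the later core lifts to the earlier one, where it lies on a legal segment of the
core. The image is a legal segment through the point, contained in the later core by
`map_mem_of_not_bad`. -/
theorem not_bad_mono {s t : Set.Icc α ω} (h : s ≤ t) (hs : ¬ G.Bad A s) : ¬ G.Bad A t := by
  rintro ⟨x, hx, h1⟩
  obtain ⟨y, hy, rfl⟩ := G.sub_subset_image h hx
  obtain ⟨p, hp, q, hq, hpy, hqy, hpq⟩ := exists_gates (fun h1 => hs ⟨y, hy, h1⟩)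
  obtain ⟨z, hz, hzy, hlz⟩ := exists_legal hpy
  obtain ⟨z', hz', hzy', hlz'⟩ := exists_legal hqy
  have hT := (G.outer s).tree
  obtain ⟨hm, hl⟩ := hlz.symm.concat hlz' (by
    rwa [sameGate_congr hT (G.toEnd s) (not_mem_seg_of_mem hT hzy hz)
      (not_mem_seg_of_mem hT hzy' hz')])
  refine hl.map_not_sameGate h hm hzy hzy' (h1 _ ?_ _ ?_ (hlz.symm.map_ne h hzy)
    (hlz'.symm.map_ne h hzy'))
  · exact map_mem_of_not_bad h hs (core_cvx A _ hy _ hp hz)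
  · exact map_mem_of_not_bad h hs (core_cvx A _ hy _ hq hz')

/-- At the end the folding map is the identity, so all turns are legal, and a core has no endpoints.
-/
theorem not_bad_end : ¬ G.Bad A ⟨ω, G.le, le_rfl⟩ := by
  rintro ⟨x, hx, h1⟩
  obtain ⟨p, hp, q, hq, hpx, hqx, h⟩ := (G.outer _).exists_two_dirs hx
  have hl : ∀ p q : G.T ⟨ω, G.le, le_rfl⟩, G.Legal _ p q := fun p q => by
    unfold Legal Str toEnd
    rw [G.map_self, G.map_self, sub_self, Real.exp_zero, one_mul]
  exact (hl p q).not_sameGate h hpx hqx (h1 p hp q hq hpx hqx)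

/-- The projection `x'` of the image of `x` to the later core has one gate. Core points near `x'`
lift to core points near `x` along legal segments. Points equidistant from `x'` therefore have lifts
equidistant from `x`, which the single gate at `x` identifies. -/
theorem bad_right {t : Set.Icc α ω} (ht : G.Bad A t) :
    ∃ ε > 0, ∀ t' : Set.Icc α ω, t ≤ t' → (t' : ℝ) ≤ t + ε → G.Bad A t' := by
  obtain ⟨x, hx, hone⟩ := ht
  have hT := (G.outer t).tree
  obtain ⟨r0, hr0, hu1, hu2⟩ := (G.outer t).exists_uniform (Real.exp_pos _)
    (G.isFolding_toEnd t).slope x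
  obtain ⟨ρ, hρ, -, hsys⟩ := (G.outer t).exists_systole
  -- Within `r0` segments from `x` are legal and gates identify points. Below `ρ` the segments from
  -- `x` to its translates are long enough to contain the lifts.
  set r := min r0 ρ with hr
  have hr' : 0 < r := lt_min hr0 hρ
  obtain ⟨ε, hε, hexp⟩ := exists_exp_sub_one_le (show 0 < r / 4 by positivity)
  refine ⟨ε, hε, fun t' htt ht' => ?_⟩
  have hT' := (G.outer t').tree
  set h := G.map t t' htt with hh
  have hF := G.isFolding htt
  rw [← hh] at hF
  set c := Real.exp ((t' : ℝ) - t) with hc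
  have hc1 : 1 ≤ c := one_le_exp htt
  have hcr : c - 1 ≤ r / 4 := hexp _ (by linarith)
  obtain ⟨x', hx', hproj⟩ := (G.outer t').exists_proj (G.core_nonempty_of (t := t') hx) (h x)
  have hdx : dist (h x) x' ≤ c - 1 := G.dist_proj_le htt hx hx' hproj
  -- A legal piece of `[x, a • x]` of length `r` has an image that loses at most `c - 1` near its
  -- far end. So its image still reaches past `p'`.
  have key : ∀ p' ∈ G.sub A t', p' ≠ x' → dist x' p' ≤ r / 4 →
      ∃ p ∈ G.sub A t, p ≠ x ∧ h p = p' ∧ c * dist x p = dist (h x) p' ∧ dist x p ≤ r0 := by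
    intro p' hp' hpx' hd
    obtain ⟨a, ha, ha1, hpa⟩ := (G.outer t').exists_mem_seg_smul_of_ne hp' hpx'
    have hmem : p' ∈ seg (h x) (h (a • x)) := by
      have h1 := (G.outer t').smul_mem_seg a (hproj _ (smul_mem_core (inv_mem ha) hx'))
      rw [smul_inv_smul] at h1
      have h2 := mem_seg_concat hT' (hproj _ (smul_mem_core ha hx')) (mem_seg_symm h1)
        ((G.outer t').smul_ne ha1 x').symm
      rw [hF.smul]
      exact seg_subset_of_mem hT' h2.2 h2.1 hpa
    obtain ⟨w, hw, hwd⟩ := exists_mem_seg_dist hT hr'.le ((min_le_right _ _).trans (hsys a ha1 x))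
    have hlw : G.Legal t x w := hu1 w (hwd.le.trans (min_le_left _ _))
    obtain ⟨m, hm1, hm2, -, hmd⟩ := (G.bcc htt).exists_near hT hT' hF.pos hF.lip hw
    have hsw : dist (h x) (h w) = c * r := by rw [← hwd]; exact (hlw.str htt).1
    have hdm : c * r - (c - 1) ≤ dist (h x) m := by
      have := dist_triangle (h x) m (h w)
      rw [dist_comm m] at this
      change dist (h w) m ≤ c - 1 at hmd
      linarith
    have hdp : dist (h x) p' ≤ dist (h x) m := by
      have h1 : dist (h x) x' + dist x' p' = dist (h x) p' := hproj p' hp'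
      have h2 : r ≤ c * r := le_mul_of_one_le_left hr'.le hc1
      linarith
    have hpm := mem_seg_left (mem_seg_of_dist_le hT' hmem hm1 hdp) hm2
    obtain ⟨p, hp, hpe⟩ := exists_mem_seg_map_eq hT hT' hF.pos hF.lip hpm
    have hpr : dist x p ≤ r0 := (dist_le_of_mem_seg hp).trans (hwd.le.trans (min_le_left _ _))
    refine ⟨p, core_cvx A _ hx _ (smul_mem_core ha hx) (mem_seg_left hp hw), ?_, hpe, ?_, hpr⟩
    · rintro rfl
      rw [← hpe] at hpx'
      have h1 := hproj p' hp'
      rw [← hpe] at h1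
      exact hpx' (mem_seg_self h1).symm
    · rw [← hpe]
      exact Eq.symm ((hlw.sub (left_mem_seg _ _) hp).str htt).1
  refine ⟨x', hx', fun P hP Q hQ hPx hQx => ⟨r / 4, by positivity, fun p' hp' q' hq' e hd => ?_⟩⟩
  rcases eq_or_ne p' x' with rfl | hpx'
  · rw [dist_self] at e
    rw [dist_eq_zero.1 e.symm]
  have hqx' : q' ≠ x' := by
    rintro rfl
    rw [dist_self] at e
    exact hpx' (dist_eq_zero.1 e).symm
  obtain ⟨p, hp, hpx, hpe, hpd, hpr⟩ := key p' (core_cvx A _ hx' _ hP hp') hpx' hd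
  obtain ⟨q, hq, hqx, hqe, hqd, hqr⟩ := key q' (core_cvx A _ hx' _ hQ hq') hqx' (e ▸ hd)
  have hpq : dist x p = dist x q := by
    have h1 : dist (h x) x' + dist x' p' = dist (h x) p' := hproj p' (core_cvx A _ hx' _ hP hp')
    have h2 : dist (h x) x' + dist x' q' = dist (h x) q' := hproj q' (core_cvx A _ hx' _ hQ hq')
    have h3 : c * dist x p = c * dist x q := by rw [hpd, hqd, ← h1, ← h2, e]
    exact mul_left_cancel₀ hF.pos.ne' h3
  have := hu2 p q hpx hqx (hone p hp q hq hpx hqx) hpq hpr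
  rw [← hpe, ← hqe, G.toEnd_map, G.toEnd_map]
  exact this

end FoldingPath

/-! ### A single greedy fold -/

section Fold

variable {T T' T'' : Type*} [MetricSpace T] [MetricSpace T'] [MetricSpace T'']

/-- When `2 * δ` is below the distance between vertices, the folded stars at distinct vertices are
disjoint. Chains of identifications stay at one vertex and collapse to one step. -/
theorem IsFold.map_eq_iff (hT : IsRealTree T) {f : T → T'} {δ ε : ℝ} {h : T → T''}
    (hf : IsFold f δ h)
    (hε : ∀ x y : T, IsNatVertex Set.univ x → IsNatVertex Set.univ y → x ≠ y → ε ≤ dist x y)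
    (hδ : 2 * δ < ε) {p q : T} : h p = h q ↔ p = q ∨ FoldStep f δ p q := by
  rw [hf.2.2.2]
  constructor
  · intro h
    induction h with
    | rel p q h => exact Or.inr h
    | refl p => exact Or.inl rfl
    | symm p q _ ih =>
      rcases ih with rfl | ⟨v, hv, h1, h2, h3⟩
      · exact Or.inl rfl
      · exact Or.inr ⟨v, hv, h1.symm, h1 ▸ h2, h3.symm⟩
    | trans p q r _ _ ih ih' =>
      rcases ih with rfl | ⟨v, hv, h1, h2, h3⟩
      · exact ih'
      rcases ih' with rfl | ⟨v', hv', h1', h2', h3'⟩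
      · exact Or.inr ⟨v, hv, h1, h2, h3⟩
      have hvv : v = v' := by
        by_contra hne
        have := hε v v' hv hv' hne
        have := dist_triangle_right v v' q
        linarith
      subst hvv
      rcases eq_or_ne q v with rfl | hq
      · rw [dist_self] at h1 h1'
        exact Or.inl ((dist_eq_zero.1 h1).symm.trans (dist_eq_zero.1 h1'.symm))
      · exact Or.inr ⟨v, hv, h1.trans h1', h2, h3.trans hT hq h3'⟩
  · rintro (rfl | h)
    · exact Relation.EqvGen.refl _
    · exact Relation.EqvGen.rel _ _ h

/-- Identified points lie on a star of radius `δ`, so any point between them is within `δ` of one of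
the two. -/
theorem IsFold.bcc (hT : IsRealTree T) {f : T → T'} {δ ε c : ℝ} {h : T → T''}
    (hf : IsFold f δ h)
    (hε : ∀ x y : T, IsNatVertex Set.univ x → IsNatVertex Set.univ y → x ≠ y → ε ≤ dist x y)
    (hδ : 2 * δ < ε) (hc : 0 < c) (hlip : ∀ x y, dist (h x) (h y) ≤ c * dist x y) :
    BCC h (c * δ) := by
  intro p q e y hy
  have key : ∀ z, h z = h p → dist y z ≤ δ → dist (h y) (h p) ≤ c * δ := fun z hz hd => by
    rw [← hz]
    exact (hlip _ _).trans (mul_le_mul_of_nonneg_left hd hc.le)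
  rcases (hf.map_eq_iff hT hε hδ).1 e with rfl | ⟨v, hv, h1, h2, h3⟩
  · exact key p rfl (by rw [mem_seg_self hy, dist_self]; exact hf.1)
  · rcases mem_seg_or hT v hy with h4 | h4
    · refine key p rfl ?_
      have := dist_le_of_mem_seg h4
      rw [dist_comm y, ← dist_comm v p] at *
      linarith [dist_comm p v]
    · refine key q e.symm ?_
      have := dist_le_of_mem_seg' h4
      linarith

theorem str_of_injective (hT : IsRealTree T) (hT' : IsRealTree T') {c : ℝ} (hc : 0 < c)
    {f : T → T'} (hf : HasSlope c f) (hinj : Function.Injective f) (p q : T) : Str c f p q := by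
  refine str_of_legal hT hT' hc hf fun z hz hzp hzq hg => ?_
  obtain ⟨r, hr, h⟩ := hg
  have hdp : 0 < dist z p := dist_pos.2 hzp
  have hdq : 0 < dist z q := dist_pos.2 hzq
  obtain ⟨p', hp', e1⟩ := exists_mem_seg_dist hT (x := z) (y := p) (r := min r (min (dist z p) (dist z q)))
    (by positivity) ((min_le_right _ _).trans (min_le_left _ _))
  obtain ⟨q', hq', e2⟩ := exists_mem_seg_dist hT (x := z) (y := q) (r := min r (min (dist z p) (dist z q)))
    (by positivity) ((min_le_right _ _).trans (min_le_right _ _))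
  have := hinj (h p' hp' q' hq' (e1.trans e2.symm) (e1.le.trans (min_le_left _ _)))
  subst this
  refine not_mem_seg_of_common hT (m := p') ?_ hp' hq' hz
  rintro rfl
  rw [dist_self] at e1
  have : 0 < min r (min (dist p' p) (dist p' q)) := by positivity
  linarith

/-- A fold with stretching factor bigger than one is nontrivial. -/
theorem IsFolding.fold_bounds {F : Type*} [Group F] [Countable F] [MulAction F T] [MulAction F T']
    [MulAction F T''] {c c' : ℝ} {f : T → T'} {h : T → T''} (hF : IsFolding F c' f)
    (h2 : ∀ x, TwoGates f Set.univ x) (hH : IsFolding F c h) (hc : 1 < c)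
    (hstr : ∀ p q, Str c' f p q → Str c h p q) (hb : BCC h (c - 1)) {δ : ℝ} (hf : IsFold f δ h) :
    0 < δ ∧ c * δ ≤ c - 1 := by
  have hT := hF.src.tree
  have hsurj : Function.Surjective h := hf.2.2.1
  have hU := hF.src.core_top
  -- If nothing were identified, the map would be an injective homothety. Its inverse would map a
  -- graph of volume one onto another with factor `c⁻¹ < 1`.
  obtain ⟨p, q, ⟨v, hv, h1, h3, hg⟩, hne⟩ : ∃ p q, FoldStep f δ p q ∧ p ≠ q := by
    by_contra! hcon
    have hinj : Function.Injective h := by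
      intro p q e
      rw [hf.2.2.2] at e
      induction e with
      | rel p q h => exact hcon p q h
      | refl p => rfl
      | symm p q _ ih => exact ih.symm
      | trans p q r _ _ ih ih' => exact ih.trans ih'
    have hs := str_of_injective hT hH.tgt.tree hH.pos hH.slope hinj
    choose g hg using hsurj
    have hgl : ∀ x, g (h x) = x := fun x => hinj (hg _)
    have := one_le_of_surjective hH.tgt hH.src (c := c⁻¹) (f := g) (by positivity) ?_ ?_ ?_
    · exact absurd this (not_le.2 (inv_lt_one_of_one_lt₀ hc))
    · intro x y
      have h1 : dist (h (g x)) (h (g y)) = c * dist (g x) (g y) := hs _ _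
      rw [hg, hg] at h1
      rw [h1, inv_mul_cancel_left₀ hH.pos.ne']
    · intro a x
      apply hinj
      rw [hg, hH.smul, hg]
    · exact fun x => ⟨h x, hgl x⟩
  have hpv : p ≠ v := by
    rintro rfl
    rw [dist_self] at h1
    exact hne (dist_eq_zero.1 h1.symm)
  have hqv : q ≠ v := by
    rintro rfl
    rw [dist_self] at h1
    exact hne (dist_eq_zero.1 h1).symm
  have hδ : 0 < δ := (dist_pos.2 hpv.symm).trans_le h3
  refine ⟨hδ, ?_⟩
  -- Prolong the identified pair to distance exactly `δ`. Backtracking over `v` then has size `c *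
  -- δ`, to which the cancellation bound applies.
  have key : ∀ r, r ≠ v → dist v r ≤ δ → ∃ r' w, IsNatEdge Set.univ v w ∧ r' ∈ seg v w ∧
      dist v r' = δ ∧ r ∈ seg v r' := by
    intro r hr hd
    obtain ⟨w, hw, hw1, hw2⟩ := hF.src.exists_natVertex_dir (A := ⊤)
      (hU ▸ hv : IsNatVertex _ v) (show r ∈ _ by rw [hU]; trivial) hr
    rw [hU] at hw hw2
    have he : IsNatEdge Set.univ v w := ⟨hv, hw, (ne_of_not_mem_seg hw1).2.symm, hw2⟩
    have hlt := hf.2.1 v w he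
    have hrw : r ∈ seg v w := by
      rcases mem_seg_or_of_no_natVertex hT Cvx.univ trivial trivial trivial
        (not_mem_seg_symm hw1) hw2 with h4 | h4
      · exact absurd (dist_le_of_mem_seg h4) (by linarith)
      · exact h4
    obtain ⟨r', hr', hd'⟩ := exists_mem_seg_dist hT hδ.le hlt.le
    exact ⟨r', w, he, hr', hd', mem_seg_of_dist_le hT hrw hr' (by rw [hd']; exact hd)⟩
  obtain ⟨p', w, he, hp', hdp, hpp⟩ := key p hpv h3
  obtain ⟨q', w', he', hq', hdq, hqq⟩ := key q hqv (h1 ▸ h3)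
  have e : h p' = h q' := by
    rw [hf.2.2.2]
    refine Relation.EqvGen.rel _ _ ⟨v, hv, hdp.trans hdq.symm, hdp.le, ?_⟩
    exact (sameGate_congr hT f (not_mem_seg_of_mem hT hpv hpp)
      (not_mem_seg_of_mem hT hqv hqq)).1 hg
  have hvpq : v ∈ seg p' q' := by
    by_contra hcon
    have hp'v : p' ≠ v := (ne_of_not_mem_seg hcon).1
    have hq'v : q' ≠ v := (ne_of_not_mem_seg hcon).2
    have hww : v ∉ seg w q' := not_mem_seg_trans hT
      (not_mem_seg_symm (not_mem_seg_of_mem hT hp'v hp')) hcon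
    have : q' ∈ seg v w := by
      rcases mem_seg_or_of_no_natVertex hT Cvx.univ trivial trivial trivial hww he.2.2.2
        with h4 | h4
      · have := dist_le_of_mem_seg h4
        have := hf.2.1 v w he
        linarith
      · exact h4
    have h5 := seg_eq_of_dist_eq hT hp' this (hdp.trans hdq.symm)
    subst h5
    exact hne (seg_eq_of_dist_eq hT hpp hqq h1)
  have hst : Str c' f v p' := by
    have := hF.str_of_no_natVertex h2 he.2.2.2
    exact this.sub hT hF.lip (left_mem_seg _ _) hp'
  have h4 : dist (h v) (h p') = c * dist v p' := hstr _ _ hst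
  rw [← hdp, ← h4]
  exact hb p' q' e v hvpq

end Fold

/-! ### Hairs at one-gate points -/

namespace FoldingPath

variable {n : ℕ} {α ω : ℝ} {G : FoldingPath.{u} n α ω} {A : Subgroup (FreeGroup (Fin n))}

theorem fold_bounds {s t : Set.Icc α ω} (h : s ≤ t) (hst : s < t) {δ : ℝ}
    (hf : IsFold (G.toEnd s) δ (G.map s t h)) :
    0 < δ ∧ Real.exp ((t : ℝ) - s) * δ ≤ Real.exp ((t : ℝ) - s) - 1 :=
  (G.isFolding_toEnd s).fold_bounds (G.twoGates_toEnd s) (G.isFolding h)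
    (Real.one_lt_exp_iff.2 (sub_pos.2 hst)) (fun p q hl => (Legal.str h hl).1) (G.bcc h) hf

/-- The segment `[x, y]` is a legal hair of the core, attached at `x`. -/
structure Hair (G : FoldingPath.{u} n α ω) (A : Subgroup (FreeGroup (Fin n)))
    (t : Set.Icc α ω) (x y : G.T t) : Prop where
  mem : x ∈ G.sub A t
  legal : G.Legal t x y
  gates : ∀ p ∈ G.sub A t, p ≠ x → y ≠ x → ¬ SameGate (G.toEnd t) x p y

theorem Hair.proj {t : Set.Icc α ω} {x y : G.T t} (h : Hair G A t x y) {w : G.T t}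
    (hw : w ∈ G.sub A t) : x ∈ seg y w := by
  by_contra hcon
  obtain ⟨h1, h2⟩ := ne_of_not_mem_seg hcon
  exact h.gates w hw h2 h1 (sameGate_of_not_mem (G.outer t).tree _ (not_mem_seg_symm hcon))

/-- A point with one gate can only arise by folding away the core at an earlier one-gate point. A
lift `z` of `x` has a legal direction besides the lifted core direction. Following it leads to a
one-gate point `y`, whose path to `z` becomes a hair leaving the core at `x`. -/
theorem exists_tip {s t : Set.Icc α ω} (h : s ≤ t) (hst : s < t) {x : G.T t}
    (hx : x ∈ G.sub A t) (hone : OneGate (G.toEnd t) (G.sub A t) x) :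
    ∃ z ∈ G.sub A s, G.map s t h z = x ∧ ∃ y ∈ G.sub A s, y ≠ z ∧ G.Legal s z y ∧
      OneGate (G.toEnd s) (G.sub A s) y ∧ Hair G A t x (G.map s t h y) := by
  have hT := (G.outer s).tree
  have hT' := (G.outer t).tree
  have hF := G.isFolding h
  obtain ⟨p1, hp1, q1, hq1, hpx, hqx, hpq⟩ := (G.outer t).exists_two_dirs hx
  obtain ⟨p0, hp0, rfl⟩ := G.sub_subset_image h hp1
  obtain ⟨q0, hq0, rfl⟩ := G.sub_subset_image h hq1
  obtain ⟨z, hz, hzp, hzx, ⟨w, hw, hwz, hleft⟩, hright⟩ := IsFolding.exists_lift_dir hT hT' hF.pos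
    hF.slope (p := p0) (q := q0) (x := x) (e := G.map s t h p0)
    (fun hm => hpx (mem_seg_self hm).symm) hpq
  have hzs : z ∈ G.sub A s := core_cvx A _ hp0 _ hq0 hz
  have hws : w ∈ G.sub A s := core_cvx A _ hzs _ hp0 hw
  have hzq : q0 ≠ z := by rintro rfl; exact hqx hzx
  -- If `z` had one gate, greedy folding would at once identify its directions towards `w` and `q0`.
  -- But the image of the first enters the branch of `p0` and that of the second never does.
  have hnone : ¬ OneGate (G.toEnd s) (G.sub A s) z := by
    intro h1
    have hnat := (G.isFolding_toEnd s).natVertex_of_oneGate (G.twoGates_toEnd s) hzs h1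
    have hg := h1 w hws q0 hq0 hwz hzq
    obtain ⟨ε, hε, hgr⟩ := G.greedy s (lt_of_lt_of_le hst t.2.2)
    have hst' : (s : ℝ) < t := hst
    have hτ : min (t : ℝ) (s + ε) ∈ Set.Icc α ω :=
      ⟨s.2.1.trans (le_min hst'.le (by linarith)), (min_le_left _ _).trans t.2.2⟩
    have hsτ : s < (⟨_, hτ⟩ : Set.Icc α ω) := (lt_min hst' (by linarith) : (s : ℝ) < min (t : ℝ) (s + ε))
    have hτt : (⟨_, hτ⟩ : Set.Icc α ω) ≤ t := (min_le_left _ _ : min (t : ℝ) (s + ε) ≤ t)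
    obtain ⟨δ, hδ⟩ := hgr ⟨_, hτ⟩ hsτ.le (min_le_right (t : ℝ) (s + ε))
    have hδ0 := (fold_bounds hsτ.le hsτ hδ).1
    have hd1 : 0 < dist z w := dist_pos.2 hwz.symm
    have hd2 : 0 < dist z q0 := dist_pos.2 hzq.symm
    obtain ⟨w', hw', e1⟩ := exists_mem_seg_dist hT (x := z) (y := w)
      (r := min δ (min (dist z w) (dist z q0))) (by positivity)
      ((min_le_right _ _).trans (min_le_left _ _))
    obtain ⟨q', hq', e2⟩ := exists_mem_seg_dist hT (x := z) (y := q0)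
      (r := min δ (min (dist z w) (dist z q0))) (by positivity)
      ((min_le_right _ _).trans (min_le_right _ _))
    have hpos : 0 < min δ (min (dist z w) (dist z q0)) := by positivity
    have hw'z : w' ≠ z := by rintro rfl; rw [dist_self] at e1; linarith
    have hq'z : q' ≠ z := by rintro rfl; rw [dist_self] at e2; linarith
    have e3 : G.map s ⟨_, hτ⟩ hsτ.le w' = G.map s ⟨_, hτ⟩ hsτ.le q' := by
      rw [hδ.2.2.2]
      refine Relation.EqvGen.rel _ _ ⟨z, hnat, e1.trans e2.symm, e1.le.trans (min_le_left _ _), ?_⟩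
      exact (sameGate_congr hT _ (not_mem_seg_symm (not_mem_seg_of_mem hT hw'z hw'))
        (not_mem_seg_symm (not_mem_seg_of_mem hT hq'z hq'))).1 hg
    have e4 : G.map s t h w' = G.map s t h q' := by
      rw [← G.map_map _ _ _ hsτ.le hτt, e3, G.map_map]
    exact hleft w' hw' hw'z (e4 ▸ hright q' hq')
  obtain ⟨r1, hr1, r2, hr2, hrz1, hrz2, hrr⟩ := exists_gates hnone
  obtain ⟨r, hr, hrz, hgr⟩ : ∃ r ∈ G.sub A s, r ≠ z ∧ ¬ SameGate (G.toEnd s) z w r := by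
    by_contra! hcon
    exact hrr ((hcon r1 hr1 hrz1).symm.trans hT hwz (hcon r2 hr2 hrz2))
  obtain ⟨y, hy, hyz, hry, hly, hB⟩ := (G.isFolding_toEnd s).exists_long_legal
    (G.twoGates_toEnd s) hzs hr hrz (Real.exp ((t : ℝ) - s) - 1)
  change G.Legal s z y at hly
  obtain ⟨w1, hw1, hwz1, hlw⟩ := exists_legal (G := G) hwz
  have hgy : ¬ SameGate (G.toEnd s) z w1 y := by
    rwa [sameGate_congr hT _ (not_mem_seg_of_mem hT hwz1 hw1) (not_mem_seg_symm hry)]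
  obtain ⟨hzm, hl⟩ := hlw.symm.concat hly hgy
  have hgx := hl.map_not_sameGate h hzm hwz1 hyz
  have hyx := (hly.symm.map_ne h hyz)
  rw [hzx] at hgx hyx
  have hhair : Hair G A t x (G.map s t h y) := by
    refine ⟨hx, ?_, fun p hp hpx' _ hg => hgx ?_⟩
    · have := (hly.str h).2
      rwa [hzx] at this
    · have h1 := hone p hp _ hp1 hpx' hpx
      have h2 := sameGate_of_not_mem hT' (G.toEnd t) (hleft w1 hw1 hwz1)
      exact (h1.trans hT' hpx h2).symm.trans hT' hpx' hg
  -- A legal prolongation longer than the cancellation bound would push the image of a core point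
  -- too far off the later core.
  refine ⟨z, hzs, hzx, y, hy, hyz, hly, hB.resolve_right fun hlt => ?_, hhair⟩
  have h1 := G.dist_proj_le h hy hx (fun w hw => hhair.proj hw)
  have h2 : dist (G.map s t h y) (G.map s t h z) = _ := (hly.symm.str h).1
  rw [hzx, dist_comm y z] at h2
  have h3 : dist z y ≤ Real.exp ((t : ℝ) - s) * dist z y :=
    le_mul_of_one_le_left dist_nonneg (one_le_exp h)
  linarith

/-- If `z` were inside the star of radius `δ` folded at `y`, every core direction at `x` would lift
to points of that star slightly beyond distance `dist y z`. Folding identifies these, so the core at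
`x` would have a single direction. -/
theorem le_dist_tip {s t : Set.Icc α ω} (h : s ≤ t) {δ ε : ℝ}
    (hf : IsFold (G.toEnd s) δ (G.map s t h))
    (hε : ∀ x y : G.T s, IsNatVertex Set.univ x → IsNatVertex Set.univ y → x ≠ y → ε ≤ dist x y)
    (hδ : 2 * δ < ε) {x : G.T t} {z y : G.T s} (hx : x ∈ G.sub A t) (hz : z ∈ G.sub A s)
    (hzx : G.map s t h z = x) (hy : y ∈ G.sub A s) (hyz : y ≠ z) (hl : G.Legal s z y)
    (hone : OneGate (G.toEnd s) (G.sub A s) y) (hh : Hair G A t x (G.map s t h y)) :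
    δ ≤ dist y z := by
  have hT := (G.outer s).tree
  have hT' := (G.outer t).tree
  have hF := G.isFolding h
  by_contra! hlt
  have hnat := (G.isFolding_toEnd s).natVertex_of_oneGate (G.twoGates_toEnd s) hy hone
  -- the folded star at `y`
  have hstar : ∀ a ∈ G.sub A s, ∀ b ∈ G.sub A s, dist y a = dist y b → dist y a ≤ δ →
      G.map s t h a = G.map s t h b := by
    intro a ha b hb e hd
    rw [hf.map_eq_iff hT hε hδ]
    rcases eq_or_ne a y with rfl | hay
    · rw [dist_self] at e
      exact Or.inl (dist_eq_zero.1 e.symm)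
    have hby : b ≠ y := by
      rintro rfl
      rw [dist_self] at e
      exact hay (dist_eq_zero.1 e).symm
    exact Or.inr ⟨y, hnat, e, hd, hone a ha b hb hay hby⟩
  have key : ∀ p ∈ G.sub A t, p ≠ x → ∃ η > 0, ∀ η', 0 < η' → η' ≤ η →
      ∃ w ∈ G.sub A s, dist y w = dist y z + η' ∧ dist y w ≤ δ ∧ x ∉ seg p (G.map s t h w) := by
    intro p hp hpx
    obtain ⟨p0, hp0, rfl⟩ := G.sub_subset_image h hp
    obtain ⟨z1, hz1, hz1p, hz1x, ⟨w, hw, hwz, hleft⟩, -⟩ := IsFolding.exists_lift_dir hT hT' hF.pos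
      hF.slope (p := p0) (q := z) (x := x) (e := G.map s t h p0)
      (fun hm => hpx (mem_seg_self hm).symm) (by rw [hzx]; exact right_mem_seg _ _)
    have hz1s : z1 ∈ G.sub A s := core_cvx A _ hp0 _ hz hz1
    have hws : w ∈ G.sub A s := core_cvx A _ hz1s _ hp0 hw
    have hd1 : dist y z1 = dist y z := by
      rcases (hf.map_eq_iff hT hε hδ).1 (hz1x.trans hzx.symm) with rfl | ⟨v, hv, h1, h2, -⟩
      · rfl
      · have hvy : v = y := by
          by_contra hne
          have := hε v y hv hnat hne
          have := dist_triangle_right v y z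
          linarith
        rw [← hvy, h1]
    -- A point no farther from `y` than `z` is folded onto `[y, z]`, so its image lies on the hair
    -- and not in the branch of `p`.
    have hfar : ∀ w' ∈ seg z1 w, w' ≠ z1 → dist y z < dist y w' := by
      intro w' hw' hne
      by_contra! hle
      obtain ⟨a, ha, hda⟩ := exists_mem_seg_dist hT dist_nonneg hle
      have hw's : w' ∈ G.sub A s := core_cvx A _ hz1s _ hws hw'
      have e := hstar w' hw's a (core_cvx A _ hy _ hz ha) hda.symm (hle.trans hlt.le)
      have hout := hleft w' hw' hne
      rw [e] at hout
      have hmem := hl.symm.map_mem h ha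
      rw [hzx] at hmem
      have h3 : x ∉ seg (G.map s t h a) (G.map s t h y) :=
        not_mem_seg_of_mem hT' (ne_of_not_mem_seg hout).2 (mem_seg_symm hmem)
      exact not_mem_seg_trans hT' hout h3 (mem_seg_symm (hh.proj hp))
    have hz1w : z1 ∈ seg y w := by
      obtain ⟨m, h1, h2, h3⟩ := exists_median hT y z1 w
      rcases eq_or_ne m z1 with rfl | hne
      · exact h3
      · have h4 := hfar m h2 hne
        have h5 := dist_le_of_mem_seg h1
        linarith
    refine ⟨min (dist z1 w) (δ - dist y z), lt_min (dist_pos.2 hwz.symm) (by linarith),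
      fun η' h1 h2 => ?_⟩
    obtain ⟨w', hw', hd⟩ := exists_mem_seg_dist hT h1.le (h2.trans (min_le_left _ _))
    have hne : w' ≠ z1 := by rintro rfl; rw [dist_self] at hd; linarith
    have hd' : dist y w' = dist y z + η' := by
      have : dist y z1 + dist z1 w' = dist y w' := mem_seg_between' hw' hz1w
      linarith
    exact ⟨w', core_cvx A _ hz1s _ hws hw', hd', by linarith [min_le_right (dist z1 w) (δ - dist y z)],
      hleft w' hw' hne⟩
  obtain ⟨p, hp, q, hq, hpx, hqx, hpq⟩ := (G.outer t).exists_two_dirs hx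
  obtain ⟨η1, hη1, k1⟩ := key p hp hpx
  obtain ⟨η2, hη2, k2⟩ := key q hq hqx
  obtain ⟨a, ha, hda, hda', hpa⟩ := k1 (min η1 η2) (lt_min hη1 hη2) (min_le_left _ _)
  obtain ⟨b, hb, hdb, hdb', hqb⟩ := k2 (min η1 η2) (lt_min hη1 hη2) (min_le_right _ _)
  have e := hstar a ha b hb (hda.trans hdb.symm) hda'
  rw [e] at hpa
  exact not_mem_seg_trans hT' hpa (not_mem_seg_symm hqb) hpq

/-- Every point with one gate at time `t` carries hairs that come from the core at time `s`, and
whose length controls the cancellation. -/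
def HairProperty (G : FoldingPath.{u} n α ω) (A : Subgroup (FreeGroup (Fin n)))
    (s t : Set.Icc α ω) (h : s ≤ t) : Prop :=
  ∀ x ∈ G.sub A t, OneGate (G.toEnd t) (G.sub A t) x → ∀ η > 0, ∃ y ∈ G.sub A s,
    Hair G A t x (G.map s t h y) ∧ BCC (G.map s t h) (dist (G.map s t h y) x + η)

/-- The new hair is the image of the old hair at `y1` preceded by that of `[z, y1]`. Its length is
`c` times the old length plus the new piece, which is also how cancellation constants compose. -/
theorem HairProperty.step {s u t : Set.Icc α ω} {hsu : s ≤ u} (hut : u ≤ t)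
    (hp : HairProperty G A s u hsu) {x : G.T t} (hx : x ∈ G.sub A t) {z y1 : G.T u}
    (hz : z ∈ G.sub A u) (hzx : G.map u t hut z = x) (hy1 : y1 ∈ G.sub A u) (hyz : y1 ≠ z)
    (hl : G.Legal u z y1) (hone : OneGate (G.toEnd u) (G.sub A u) y1)
    (hh : Hair G A t x (G.map u t hut y1)) {η κ : ℝ} (hη : 0 < η) (hκ : BCC (G.map u t hut) κ)
    (hκ' : κ ≤ dist (G.map u t hut y1) x + η) : ∃ y ∈ G.sub A s,
    Hair G A t x (G.map s t (hsu.trans hut) y) ∧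
      BCC (G.map s t (hsu.trans hut)) (dist (G.map s t (hsu.trans hut) y) x + 2 * η) := by
  have hT := (G.outer u).tree
  have hT' := (G.outer t).tree
  set c := Real.exp ((t : ℝ) - u) with hc
  have hc0 : 0 < c := Real.exp_pos _
  obtain ⟨y, hy, hhy, hbcc⟩ := hp y1 hy1 hone (η / c) (by positivity)
  have hcomp := G.bcc_comp hsu hut hbcc hκ
  rw [← hc] at hcomp
  have hmap : G.map s t (hsu.trans hut) y = G.map u t hut (G.map s u hsu y) :=
    (G.map_map _ _ _ _ _ _).symm
  have hmul : c * (dist (G.map s u hsu y) y1 + η / c) = c * dist (G.map s u hsu y) y1 + η := by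
    rw [mul_add, mul_div_cancel₀ _ hc0.ne']
  rcases eq_or_ne (G.map s u hsu y) y1 with e | hne
  · refine ⟨y, hy, by rw [hmap, e]; exact hh, hcomp.mono ?_⟩
    rw [hmul, hmap, e, dist_self]
    linarith
  have hg := hhy.gates z hz hyz.symm hne
  obtain ⟨hm, hl'⟩ := hl.concat hhy.legal hg
  have hstr := (hl'.str hut).1
  have hstr1 : dist (G.map u t hut y1) (G.map u t hut (G.map s u hsu y)) = c * _ :=
    (hhy.legal.str hut).1
  have hmem := hl'.map_mem hut hm
  have hne' := hl.symm.map_ne hut hyz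
  rw [hzx] at hmem hne'
  have hd : dist x (G.map u t hut y1) + _ = dist x (G.map u t hut (G.map s u hsu y)) := hmem
  rw [hstr1] at hd
  refine ⟨y, hy, ?_, hcomp.mono ?_⟩
  · rw [hmap]
    refine ⟨hx, ?_, fun p hp hpx hyx hgp => hh.gates p hp hpx hne' ?_⟩
    · have := (hl'.str hut).2
      rwa [hzx] at this
    · exact hgp.trans hT' hyx (sameGate_of_not_mem hT' _
        (not_mem_seg_symm (not_mem_seg_of_mem hT' hne' hmem)))
  · rw [hmul, hmap, dist_comm _ x, ← hd, dist_comm _ y1, dist_comm x]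
    linarith

/-- Real induction on `t`. The error `η` is renewed at each step instead of accumulating, because
the induction hypothesis holds for every `η`. -/
theorem hairProperty {s t : Set.Icc α ω} (h : s ≤ t) : HairProperty G A s t h := by
  refine icc_induction (s := s) (P := fun t => ∀ h : s ≤ t, HairProperty G A s t h)
    ?_ ?_ ?_ t h h
  · intro _ x hx hone η hη
    refine ⟨x, hx, ?_, ?_⟩
    · rw [G.map_self]
      exact ⟨hx, Str.self _ _ _, fun p _ _ h => absurd rfl h⟩
    · rw [G.map_self, dist_self, zero_add, G.map_self_eq]
      exact BCC.id.mono hη.le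
  -- A greedy fold of size `δ` cancels at most `c * δ`, and by `le_dist_tip` the new piece of hair
  -- is at least that long.
  · intro u hsu hu hP
    obtain ⟨ε, hε, hgr⟩ := G.greedy u hu
    obtain ⟨ρ, hρ, hsep⟩ := (G.outer u).exists_sep
    obtain ⟨ε', hε', hexp⟩ := exists_exp_sub_one_le (show 0 < ρ / 4 by positivity)
    refine ⟨min ε ε', lt_min hε hε', fun t hut ht _ x hx hone η hη => ?_⟩
    obtain ⟨δ, hδ⟩ := hgr t hut.le (ht.trans (by linarith [min_le_left ε ε']))
    have hb := fold_bounds hut.le hut hδ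
    have hexp' := hexp ((t : ℝ) - u) (by linarith [min_le_right ε ε'])
    have hδc : δ ≤ Real.exp ((t : ℝ) - u) * δ := le_mul_of_one_le_left hb.1.le (one_le_exp hut.le)
    have h2δ : 2 * δ < ρ := by linarith
    obtain ⟨z, hz, hzx, y1, hy1, hyz, hl, hone1, hh⟩ := exists_tip hut.le hut hx hone
    have hle := le_dist_tip hut.le hδ hsep h2δ hx hz hzx hy1 hyz hl hone1 hh
    have h3 : dist (G.map u t hut.le y1) (G.map u t hut.le z) = _ := (hl.symm.str hut.le).1
    rw [hzx] at h3
    obtain ⟨y, hy, h4, h5⟩ := (hP hsu).step hut.le hx hz hzx hy1 hyz hl hone1 hh (half_pos hη)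
      (hδ.bcc (G.outer u).tree hsep h2δ (Real.exp_pos _) (G.isFolding hut.le).lip) (by
        rw [h3]
        have := mul_le_mul_of_nonneg_left hle (Real.exp_pos ((t : ℝ) - u)).le
        linarith)
    exact ⟨y, hy, h4, h5.mono (by linarith)⟩
  -- At a limit, choose `u` so close to `t` that the whole cancellation from `u` to `t` fits in the
  -- error.
  · intro t hst hP _ x hx hone η hη
    obtain ⟨ε', hε', hexp⟩ := exists_exp_sub_one_le (half_pos hη)
    have hst' : (s : ℝ) < t := hst
    have hult : max (s : ℝ) (t - ε') < t := max_lt hst' (by linarith)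
    have hu' : max (s : ℝ) (t - ε') ∈ Set.Icc α ω :=
      ⟨s.2.1.trans (le_max_left _ _), hult.le.trans t.2.2⟩
    obtain ⟨u, hut, hsu, hu⟩ : ∃ u : Set.Icc α ω, u < t ∧ s ≤ u ∧ (t : ℝ) - u ≤ ε' :=
      ⟨⟨_, hu'⟩, hult, le_max_left (s : ℝ) (t - ε'), by
        change (t : ℝ) - max (s : ℝ) (t - ε') ≤ ε'
        linarith [le_max_right (s : ℝ) (t - ε')]⟩
    obtain ⟨z, hz, hzx, y1, hy1, hyz, hl, hone1, hh⟩ := exists_tip hut.le hut hx hone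
    obtain ⟨y, hy, h4, h5⟩ := (hP u hsu hut hsu).step hut.le hx hz hzx hy1 hyz hl hone1 hh
      (half_pos hη) (G.bcc hut.le) (by
        have := dist_nonneg (x := G.map u t hut.le y1) (y := x)
        linarith [hexp _ hu])
    exact ⟨y, hy, h4, h5.mono (by linarith)⟩

/-- The germs at a point with one gate at time `t` refine the germs at some point at time `s`. -/
theorem exists_germ {s t : Set.Icc α ω} (h : s ≤ t) {x : G.T t} (hx : x ∈ G.sub A t)
    (hone : OneGate (G.toEnd t) (G.sub A t) x) : ∃ y ∈ G.sub A s,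
    ∀ a ∈ A, ∀ b ∈ A, a ≠ 1 → b ≠ 1 → y ∈ seg (a • y) (b • y) → x ∈ seg (a • x) (b • x) := by
  have hT := (G.outer s).tree
  have hT' := (G.outer t).tree
  have hF := G.isFolding h
  obtain ⟨ρ, hρ, -, hsys⟩ := (G.outer t).exists_systole
  obtain ⟨r, hr, hdisc⟩ := (G.outer t).discrete x
  obtain ⟨y, hy, hh, hbcc⟩ := hairProperty h x hx hone (min ρ r / 2) (by positivity)
  refine ⟨y, hy, fun a ha b hb ha1 hb1 hab => ?_⟩
  set f := G.map s t h with hf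
  obtain ⟨m, hm, hm1, hm2, hd⟩ := hbcc.exists_near hT hT' hF.pos hF.lip hab
  rw [hF.smul] at hm hm1
  rw [hF.smul] at hm hm2
  by_contra hcon
  have main : ∀ a ∈ A, a ≠ 1 → a • x ∈ seg (f y) (a • f y) := fun a ha ha1 => by
    have h1 := (G.outer t).smul_mem_seg a (hh.proj (smul_mem_core (inv_mem ha) hx))
    rw [smul_inv_smul] at h1
    exact (mem_seg_concat hT' (hh.proj (smul_mem_core ha hx)) (mem_seg_symm h1)
      ((G.outer t).smul_ne ha1 x).symm).1
  -- If `a • x` and `b • x` lay in the same direction from `x`, the paths to them would agree for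
  -- length `min ρ r`. The two image paths from the tip of the hair would then cancel by the hair
  -- length plus this, which exceeds the allowed error of half of it.
  obtain ⟨m0, h1, h2, h3⟩ := exists_median hT' x (a • x) (b • x)
  have hm0 : m0 ≠ x := by rintro rfl; exact hcon h2
  have hdm : min ρ r ≤ dist x m0 := by
    by_cases e1 : m0 = a • x
    · rw [e1]; exact (min_le_left _ _).trans (hsys a ha1 x)
    by_cases e2 : m0 = b • x
    · rw [e2]; exact (min_le_left _ _).trans (hsys b hb1 x)
    have hn := isNatVertex_of_median Cvx.univ trivial trivial trivial h1 h2 h3 hm0 e1 e2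
    by_contra! hlt
    exact hdisc m0 hm0 (hlt.trans_le (min_le_right _ _)) hn
  have hpa := hh.proj (smul_mem_core ha hx)
  have hpb := hh.proj (smul_mem_core hb hx)
  have hd0 : dist (f y) x + dist x m0 = dist (f y) m0 := mem_seg_between' h1 hpa
  have h0a := mem_seg_left (mem_seg_right h1 hpa) (main a ha ha1)
  have h0b := mem_seg_left (mem_seg_right h3 hpb) (main b hb hb1)
  have hpos : 0 < min ρ r := lt_min hρ hr
  have hmm : m ∈ seg (f y) m0 := mem_seg_of_dist_le hT' (mem_seg_symm hm1) h0a (by linarith)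
  have hne : m0 ≠ m := by rintro rfl; linarith
  exact not_mem_seg_of_common hT' hne (mem_seg_between hmm h0a) (mem_seg_between hmm h0b) hm

end FoldingPath

/-! ### Families of half-spaces and their dual trees -/

section HalfSystem

open scoped Pointwise

variable {Γ : Type} [Group Γ]

/-- One of the four intersections of `K`, `L` and their complements is empty. -/
def Nested (K L : Set Γ) : Prop := K ⊆ L ∨ K ⊆ Lᶜ ∨ Kᶜ ⊆ L ∨ Kᶜ ⊆ Lᶜ

/-- An invariant discrete nested family of halfspaces of `Γ`. -/
structure HalfSystem (𝓗 : Set (Set Γ)) : Prop where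
  nonempty : 𝓗.Nonempty
  compl : ∀ K ∈ 𝓗, Kᶜ ∈ 𝓗
  smul : ∀ (g : Γ), ∀ K ∈ 𝓗, g • K ∈ 𝓗
  nested : ∀ K ∈ 𝓗, ∀ L ∈ 𝓗, Nested K L
  fin : ∀ a b, {K ∈ 𝓗 | a ∈ K ∧ b ∉ K}.Finite
  move : ∀ K ∈ 𝓗, ∃ g : Γ, Disjoint (g • K) K
  free : ∀ (g : Γ), ∀ K ∈ 𝓗, g • K = K → g = 1
  no_inv : ∀ (g : Γ), ∀ K ∈ 𝓗, g • K ≠ Kᶜ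

/-- An orientation of a family of halfspaces, that is, a vertex of the dual tree. -/
structure Ori (𝓗 v : Set (Set Γ)) : Prop where
  sub : v ⊆ 𝓗
  xor : ∀ K ∈ 𝓗, K ∈ v ↔ Kᶜ ∉ v
  up : ∀ K ∈ v, ∀ L ∈ 𝓗, K ⊆ L → L ∈ v
  fin : ∀ p, {K ∈ v | p ∉ K}.Finite

/-- The endpoint in `K` of the edge of the dual tree given by `K`. -/
def vtx (𝓗 : Set (Set Γ)) (K : Set Γ) : Set (Set Γ) := {L ∈ 𝓗 | K ⊆ L ∨ (Kᶜ ⊆ L ∧ L ≠ Kᶜ)}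

namespace HalfSystem

variable {𝓗 : Set (Set Γ)} (h : HalfSystem 𝓗)
include h

theorem nonempty_of_mem {K : Set Γ} (hK : K ∈ 𝓗) : K.Nonempty := by
  rw [Set.nonempty_iff_ne_empty]
  rintro rfl
  obtain ⟨g, hg⟩ := h.move _ (h.compl _ hK)
  rw [Set.compl_empty, Set.smul_set_univ, disjoint_self] at hg
  exact Set.univ_nonempty.ne_empty hg

theorem not_subset_compl {K L : Set Γ} (hK : K ∈ 𝓗) (h1 : K ⊆ L) (h2 : K ⊆ Lᶜ) : False := by
  obtain ⟨x, hx⟩ := h.nonempty_of_mem hK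
  exact h2 hx (h1 hx)

theorem self_mem_vtx {K : Set Γ} (hK : K ∈ 𝓗) : K ∈ vtx 𝓗 K := ⟨hK, Or.inl subset_rfl⟩

theorem ori_vtx {K : Set Γ} (hK : K ∈ 𝓗) : Ori 𝓗 (vtx 𝓗 K) := by
  refine ⟨fun L hL => hL.1, fun L hL => ?_, ?_, fun p => ?_⟩
  · constructor
    · rintro ⟨-, h1⟩ ⟨-, h2⟩
      rcases h1 with h1 | ⟨h1, h1'⟩ <;> rcases h2 with h2 | ⟨h2, h2'⟩
      · exact h.not_subset_compl hK h1 h2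
      · exact h2' (congrArg (·ᶜ) (subset_antisymm (Set.compl_subset_compl.1 h2) h1))
      · exact h1' (subset_antisymm (Set.subset_compl_comm.1 h2) h1)
      · exact h.not_subset_compl (h.compl _ hK) h1 h2
    · intro h1
      by_contra h2
      have h1 : ¬ _ := fun h3 => h1 ⟨h.compl _ hL, h3⟩
      have h2 : ¬ _ := fun h3 => h2 ⟨hL, h3⟩
      push Not at h1 h2
      rcases h.nested K hK L hL with h3 | h3 | h3 | h3
      · exact h2.1 h3
      · exact h1.1 h3
      · have := h2.2 h3
        exact h1.1 (by rw [this, compl_compl])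
      · exact h2.1 (by rw [compl_injective (h1.2 h3)])
  · rintro L ⟨hL, h1 | ⟨h1, h1'⟩⟩ M hM hLM
    · exact ⟨hM, Or.inl (h1.trans hLM)⟩
    · refine ⟨hM, Or.inr ⟨h1.trans hLM, ?_⟩⟩
      rintro rfl
      exact h1' (subset_antisymm hLM h1)
  · obtain ⟨a, ha⟩ := h.nonempty_of_mem hK
    obtain ⟨b, hb⟩ := h.nonempty_of_mem (h.compl _ hK)
    refine ((h.fin a p).union (h.fin b p)).subset ?_
    rintro L ⟨⟨hL, h1 | ⟨h1, -⟩⟩, hp⟩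
    · exact Or.inl ⟨hL, h1 ha, hp⟩
    · exact Or.inr ⟨hL, h1 hb, hp⟩

omit h in
theorem _root_.FoldPath.Ori.ne_univ_of_mem {v : Set (Set Γ)} (hv : Ori 𝓗 v) (h : HalfSystem 𝓗)
    {K : Set Γ} (hK : K ∈ v) : ∃ p, p ∉ K :=
  h.nonempty_of_mem (h.compl _ (hv.sub hK))

/-- Below every halfspace of an orientation there is a minimal one. -/
theorem exists_min {v : Set (Set Γ)} (hv : Ori 𝓗 v) {M : Set Γ} (hM : M ∈ v) :
    ∃ K ∈ v, K ⊆ M ∧ ∀ L ∈ v, L ⊆ K → L = K := by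
  obtain ⟨p, hp⟩ := hv.ne_univ_of_mem h hM
  have hf : {K ∈ v | K ⊆ M}.Finite := (hv.fin p).subset fun K hK => ⟨hK.1, fun h => hp (hK.2 h)⟩
  obtain ⟨K, hK⟩ := hf.exists_minimal ⟨M, hM, subset_rfl⟩
  refine ⟨K, hK.1.1, hK.1.2, fun L hL hLK => ?_⟩
  exact subset_antisymm hLK (hK.2 ⟨hL, hLK.trans hK.1.2⟩ hLK)

/-- Nestedness with a minimal element decides the orientation of every other half-space. So an
orientation is determined by any one of its minimal elements. -/
theorem eq_vtx {v : Set (Set Γ)} (hv : Ori 𝓗 v) {K : Set Γ} (hK : K ∈ v)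
    (hmin : ∀ L ∈ v, L ⊆ K → L = K) : v = vtx 𝓗 K := by
  have hK' := hv.sub hK
  ext M
  constructor
  · intro hM
    refine ⟨hv.sub hM, ?_⟩
    rcases h.nested K hK' M (hv.sub hM) with h1 | h1 | h1 | h1
    · exact Or.inl h1
    · exact absurd (hv.up K hK _ (h.compl _ (hv.sub hM)) h1) ((hv.xor M (hv.sub hM)).1 hM)
    · exact Or.inr ⟨h1, fun e => (hv.xor K hK').1 hK (e ▸ hM)⟩
    · exact Or.inl (hmin M hM (Set.compl_subset_compl.1 h1)).symm.subset
  · rintro ⟨hM, h1 | ⟨h1, h2⟩⟩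
    · exact hv.up K hK M hM h1
    · rw [hv.xor M hM]
      intro h3
      exact h2 (by rw [← hmin _ h3 (Set.compl_subset_comm.1 h1), compl_compl])

theorem exists_eq_vtx {v : Set (Set Γ)} (hv : Ori 𝓗 v) : ∃ K ∈ 𝓗, v = vtx 𝓗 K := by
  obtain ⟨M, hM⟩ := h.nonempty
  have : ∃ M, M ∈ v := by
    by_cases h1 : M ∈ v
    · exact ⟨M, h1⟩
    · exact ⟨Mᶜ, by rwa [hv.xor _ hM, not_not] at h1⟩
  obtain ⟨M, hM⟩ := this
  obtain ⟨K, hK, -, h1⟩ := h.exists_min hv hM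
  exact ⟨K, hv.sub hK, h.eq_vtx hv hK h1⟩

theorem min_vtx {K : Set Γ} (hK : K ∈ 𝓗) : ∀ L ∈ vtx 𝓗 K, L ⊆ K → L = K := by
  rintro L ⟨hL, h1 | ⟨h1, h2⟩⟩ h3
  · exact subset_antisymm h3 h1
  · obtain ⟨x, hx⟩ := h.nonempty_of_mem (h.compl _ hK)
    exact absurd (h3 (h1 hx)) hx

theorem eq_of_ori_subset {v w : Set (Set Γ)} (hv : Ori 𝓗 v) (hw : Ori 𝓗 w) (hvw : v ⊆ w) :
    v = w := by
  refine subset_antisymm hvw fun K hK => ?_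
  rw [hv.xor K (hw.sub hK)]
  exact fun h1 => (hw.xor K (hw.sub hK)).1 hK (hvw h1)

/-- Crossing an edge changes the orientation of that edge only. -/
theorem mem_vtx_compl {K L : Set Γ} (hK : K ∈ 𝓗) (hLK : L ≠ K) (hLK' : L ≠ Kᶜ) :
    L ∈ vtx 𝓗 Kᶜ ↔ L ∈ vtx 𝓗 K := by
  simp only [vtx, Set.mem_ofPred_eq, compl_compl]
  tauto

theorem notMem_vtx_compl {K : Set Γ} (hK : K ∈ 𝓗) : K ∉ vtx 𝓗 Kᶜ := by
  rw [(h.ori_vtx (h.compl _ hK)).xor K hK, not_not]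
  exact h.self_mem_vtx (h.compl _ hK)

omit h in
theorem smul_vtx (h : HalfSystem 𝓗) (g : Γ) (K : Set Γ) : g • vtx 𝓗 K = vtx 𝓗 (g • K) := by
  ext L
  rw [Set.mem_smul_set_iff_inv_smul_mem]
  simp only [vtx, Set.mem_ofPred_eq]
  have h1 : g⁻¹ • L ∈ 𝓗 ↔ L ∈ 𝓗 :=
    ⟨fun h1 => by have := h.smul g _ h1; rwa [smul_inv_smul] at this, h.smul _ _⟩
  have h2 : ∀ M : Set Γ, M ⊆ g⁻¹ • L ↔ g • M ⊆ L := fun M => by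
    rw [← Set.smul_set_subset_smul_set_iff (a := g), smul_inv_smul]
  rw [h1, h2, h2, Set.smul_set_compl, ne_eq, inv_smul_eq_iff, Set.smul_set_compl]

omit h in
theorem ori_smul (h : HalfSystem 𝓗) (g : Γ) {v : Set (Set Γ)} (hv : Ori 𝓗 v) : Ori 𝓗 (g • v) := by
  obtain ⟨K, hK, rfl⟩ := h.exists_eq_vtx hv
  rw [h.smul_vtx]
  exact h.ori_vtx (h.smul _ _ hK)

/-- The two endpoints of an edge differ only by that edge. -/
theorem eq_of_crossing {K M : Set Γ} (hM : M ∈ 𝓗) (hK : K ∈ 𝓗) (h1 : K ∈ vtx 𝓗 M)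
    (h2 : K ∉ vtx 𝓗 Mᶜ) : M = K := by
  by_contra hne
  by_cases h3 : K = Mᶜ
  · exact h2 (h3.symm ▸ h.self_mem_vtx (h.compl _ hM))
  · exact h2 ((h.mem_vtx_compl hM (Ne.symm hne) h3).2 h1)

end HalfSystem

/-- The vertices of the tree dual to a family of halfspaces. -/
abbrev Vert (𝓗 : Set (Set Γ)) : Type := {v : Set (Set Γ) // Ori 𝓗 v}

/-- The tree dual to a family of halfspaces. -/
def dualGraph (𝓗 : Set (Set Γ)) (h : HalfSystem 𝓗) : SimpleGraph (Vert 𝓗) where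
  Adj v w := ∃ K ∈ 𝓗, v.1 = vtx 𝓗 K ∧ w.1 = vtx 𝓗 Kᶜ
  symm := ⟨fun v w ⟨K, hK, h1, h2⟩ => ⟨Kᶜ, h.compl _ hK, h2, by rw [compl_compl]; exact h1⟩⟩
  loopless := ⟨fun v ⟨K, hK, h1, h2⟩ => h.notMem_vtx_compl hK (h2 ▸ h1 ▸ h.self_mem_vtx hK)⟩

namespace HalfSystem

variable {𝓗 : Set (Set Γ)} (h : HalfSystem 𝓗)
include h

/-- Flip a minimal element of `v \ w`: the number of disagreements with `w` drops by one, and all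
half-spaces common to `v` and `w` are kept. The path therefore stays in `S`, which gives
connectedness of the tree and of the fibres of collapses. -/
theorem reachable_induce {v w : Vert 𝓗} (S : Set (Vert 𝓗)) (hv : v ∈ S) (hw : w ∈ S)
    (hS : ∀ u : Vert 𝓗, v.1 ∩ w.1 ⊆ u.1 → u ∈ S) :
    ((dualGraph 𝓗 h).induce S).Reachable ⟨v, hv⟩ ⟨w, hw⟩ := by
  have hfin : ∀ v : Vert 𝓗, (v.1 \ w.1).Finite := by
    intro v
    refine ((v.2.fin 1).union ((w.2.fin 1).image (·ᶜ))).subset ?_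
    rintro M ⟨h1, h2⟩
    rw [w.2.xor M (v.2.sub h1), not_not] at h2
    by_cases h3 : 1 ∈ M
    · exact Or.inr ⟨Mᶜ, ⟨h2, fun h4 => h4 h3⟩, compl_compl M⟩
    · exact Or.inl ⟨h1, h3⟩
  obtain ⟨k, hk⟩ : ∃ k, (v.1 \ w.1).ncard = k := ⟨_, rfl⟩
  induction k generalizing v with
  | zero =>
    rw [Set.ncard_eq_zero (hfin v), Set.sdiff_eq_empty] at hk
    have : v = w := Subtype.ext (h.eq_of_ori_subset v.2 w.2 hk)
    subst this
    exact SimpleGraph.Reachable.refl _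
  | succ k ih =>
    obtain ⟨K, hK⟩ := (hfin v).exists_minimal (Set.nonempty_of_ncard_ne_zero (by omega))
    have hKv : K ∈ v.1 := hK.1.1
    have hKw : K ∉ w.1 := hK.1.2
    have hK𝓗 := v.2.sub hKv
    have hmin : ∀ L ∈ v.1, L ⊆ K → L = K := by
      intro L hL hLK
      by_cases hLw : L ∈ w.1
      · exact absurd (w.2.up L hLw K hK𝓗 hLK) hKw
      · exact subset_antisymm hLK (hK.2 ⟨hL, hLw⟩ hLK)
    have hvK := h.eq_vtx v.2 hKv hmin
    have hKw' : Kᶜ ∈ w.1 := by rwa [w.2.xor K hK𝓗, not_not] at hKw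
    set v' : Vert 𝓗 := ⟨vtx 𝓗 Kᶜ, h.ori_vtx (h.compl _ hK𝓗)⟩ with hv'
    have hmem : ∀ L, L ∈ v.1 → L ≠ K → L ∈ v'.1 := by
      intro L hL hLK
      have hLK' : L ≠ Kᶜ := by
        rintro rfl
        exact (v.2.xor K hK𝓗).1 hKv hL
      exact (h.mem_vtx_compl hK𝓗 hLK hLK').2 (hvK ▸ hL)
    have hmem' : ∀ L, L ∈ v'.1 → L ≠ Kᶜ → L ∈ v.1 := by
      intro L hL hLK
      have hLK' : L ≠ K := by
        rintro rfl
        exact h.notMem_vtx_compl hK𝓗 hL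
      rw [hvK]
      exact (h.mem_vtx_compl hK𝓗 hLK' hLK).1 hL
    have hv'S : v' ∈ S := hS v' fun L hL => hmem L hL.1 (by rintro rfl; exact hKw hL.2)
    have hcard : (v'.1 \ w.1).ncard = k := by
      have : v'.1 \ w.1 = (v.1 \ w.1) \ {K} := by
        ext L
        constructor
        · rintro ⟨h1, h2⟩
          refine ⟨⟨hmem' L h1 (by rintro rfl; exact h2 hKw'), h2⟩, ?_⟩
          rintro rfl
          exact h.notMem_vtx_compl hK𝓗 h1
        · rintro ⟨⟨h1, h2⟩, h3⟩
          exact ⟨hmem L h1 h3, h2⟩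
      rw [this, Set.ncard_sdiff_singleton_of_mem hK.1, hk]
      rfl
    have hadj : ((dualGraph 𝓗 h).induce S).Adj ⟨v, hv⟩ ⟨v', hv'S⟩ := ⟨K, hK𝓗, hvK, rfl⟩
    refine hadj.reachable.trans (ih hv'S (fun u hu => hS u fun L hL => hu ⟨?_, hL.2⟩) hcard)
    exact hmem L hL.1 (by rintro rfl; exact hKw hL.2)

theorem connected : (dualGraph 𝓗 h).Connected := by
  obtain ⟨K, hK⟩ := h.nonempty
  have : Nonempty (Vert 𝓗) := ⟨⟨_, h.ori_vtx hK⟩⟩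
  refine ⟨fun v w => ?_⟩
  have := h.reachable_induce Set.univ (v := v) (w := w) trivial trivial fun _ _ => trivial
  exact this.map (SimpleGraph.Embedding.induce Set.univ).toHom

/-- A connected set of vertices on both sides of an edge contains its endpoint. -/
theorem mem_of_crossing {S : Set (Vert 𝓗)} (hS : ((dualGraph 𝓗 h).induce S).Preconnected)
    {v w : Vert 𝓗} (hv : v ∈ S) (hw : w ∈ S) {K : Set Γ} (hK : K ∈ 𝓗) (hKv : K ∈ v.1)
    (hKw : K ∉ w.1) : ∃ u ∈ S, u.1 = vtx 𝓗 K := by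
  by_contra! hcon
  have key : ∀ a b : S, ((dualGraph 𝓗 h).induce S).Reachable a b → K ∈ a.1.1 → K ∈ b.1.1 := by
    intro a b hab
    rw [SimpleGraph.reachable_iff_reflTransGen] at hab
    induction hab with
    | refl => exact id
    | tail _ hbc ih =>
      rename_i b c _
      intro h1
      have h2 := ih h1
      obtain ⟨M, hM, e1, e2⟩ := hbc
      change b.1.1 = vtx 𝓗 M at e1
      change c.1.1 = vtx 𝓗 Mᶜ at e2
      by_contra h3
      rw [e1] at h2
      rw [e2] at h3
      have := h.eq_of_crossing hM hK h2 h3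
      exact hcon b.1 b.2 (this ▸ e1)
  exact hKw (key ⟨v, hv⟩ ⟨w, hw⟩ (hS _ _) hKv)

/-- Once the edge of `K` is removed, no remaining edge changes the orientation of `K`. So every edge
is a bridge. -/
theorem isTree : (dualGraph 𝓗 h).IsTree := by
  refine ⟨h.connected, ?_⟩
  rw [SimpleGraph.isAcyclic_iff_forall_adj_isBridge]
  rintro v w ⟨K, hK, h1, h2⟩
  rw [SimpleGraph.isBridge_iff, SimpleGraph.reachable_iff_reflTransGen]
  intro hr
  have key : ∀ b, Relation.ReflTransGen ((dualGraph 𝓗 h).deleteEdges {s(v, w)}).Adj v b →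
      K ∈ b.1 := by
    intro b hb
    induction hb with
    | refl => rw [h1]; exact h.self_mem_vtx hK
    | tail _ hbc ih =>
      rename_i b c _
      rw [SimpleGraph.deleteEdges_adj] at hbc
      obtain ⟨⟨M, hM, e1, e2⟩, hne⟩ := hbc
      by_contra h3
      rw [e1] at ih
      rw [e2] at h3
      have := h.eq_of_crossing hM hK ih h3
      subst this
      refine hne ?_
      rw [Set.mem_singleton_iff, Subtype.ext (e1.trans h1.symm), Subtype.ext (e2.trans h2.symm)]
  have := key w hr
  rw [h2] at this
  exact h.notMem_vtx_compl hK this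

end HalfSystem

/-- Every vertex of the dual tree has valence at least three. -/
def Branching (𝓗 : Set (Set Γ)) : Prop :=
  ∀ v, Ori 𝓗 v → ∃ K ∈ v, ∃ L ∈ v, ∃ M ∈ v, K ≠ L ∧ L ≠ M ∧ K ≠ M ∧
    (∀ N ∈ v, N ⊆ K → N = K) ∧ (∀ N ∈ v, N ⊆ L → N = L) ∧ (∀ N ∈ v, N ⊆ M → N = M)

/-- `𝓗` consists of the translates of `k` inequivalent halfspaces and of their complements. -/
def HasOrbits (𝓗 : Set (Set Γ)) (k : ℕ) : Prop :=
  ∃ H : Fin k → Set Γ, (∀ i, H i ∈ 𝓗) ∧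
    ∀ K ∈ 𝓗, ∃! i, ∃ g : Γ, K = g • H i ∨ K = (g • H i)ᶜ

namespace HalfSystem

variable {𝓗 : Set (Set Γ)} (h : HalfSystem 𝓗)

/-- The free splitting given by an invariant family of halfspaces. -/
def splitting (hb : Branching 𝓗) {k : ℕ} (ho : HasOrbits 𝓗 k) : FreeSplitting Γ k where
  V := Vert 𝓗
  action :=
    { smul := fun g v => ⟨g • v.1, h.ori_smul g v.2⟩
      one_smul := fun v => Subtype.ext (one_smul _ _)
      mul_smul := fun a b v => Subtype.ext (mul_smul _ _ _) }
  graph := dualGraph 𝓗 h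
  isTree := h.isTree
  adj_smul := by
    rintro g v w ⟨K, hK, h1, h2⟩
    refine ⟨g • K, h.smul g K hK, ?_, ?_⟩
    · change g • v.1 = _
      rw [h1, h.smul_vtx]
    · change g • w.1 = _
      rw [h2, h.smul_vtx, Set.smul_set_compl]
  edge_stabilizer := by
    rintro g v w ⟨K, hK, h1, h2⟩ he
    have hgv : ∀ u : Vert 𝓗, (⟨g • v.1, h.ori_smul g v.2⟩ : Vert 𝓗) = u → u.1 = vtx 𝓗 (g • K) := by
      rintro u rfl
      change g • v.1 = _
      rw [h1, h.smul_vtx]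
    have hgw : ∀ u : Vert 𝓗, (⟨g • w.1, h.ori_smul g w.2⟩ : Vert 𝓗) = u →
        u.1 = vtx 𝓗 (g • K)ᶜ := by
      rintro u rfl
      change g • w.1 = _
      rw [h2, h.smul_vtx, Set.smul_set_compl]
    rcases Sym2.eq_iff.1 he with ⟨e1, e2⟩ | ⟨e1, e2⟩
    · have e1 := hgv _ e1
      have e2 := hgw _ e2
      refine h.free g K hK (h.eq_of_crossing (h.smul g K hK) hK ?_ ?_)
      · rw [← e1, h1]; exact h.self_mem_vtx hK
      · rw [← e2, h2]; exact h.notMem_vtx_compl hK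
    · have e1 := hgv _ e1
      have e2 := hgw _ e2
      refine absurd (h.eq_of_crossing (h.smul g K hK) (h.compl K hK) ?_ ?_) (h.no_inv g K hK)
      · rw [← e1, h2]; exact h.self_mem_vtx (h.compl _ hK)
      · rw [← e2, h1]
        have := h.notMem_vtx_compl (h.compl _ hK)
        rwa [compl_compl] at this
  nontrivial := by
    intro v
    obtain ⟨K, hK, hv⟩ := h.exists_eq_vtx v.2
    obtain ⟨g, hg⟩ := h.move K hK
    refine ⟨g, fun e => ?_⟩
    have e : g • v.1 = v.1 := congrArg Subtype.val e
    have h1 : K ∈ v.1 := hv ▸ h.self_mem_vtx hK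
    have h2 : g • K ∈ v.1 := e ▸ Set.smul_mem_smul_set h1
    exact (v.2.xor _ hK).1 h1 (v.2.up _ h2 _ (h.compl _ hK) hg.subset_compl_right)
  minimal := by
    rintro S ⟨v, hv⟩ hinv hS
    refine Set.eq_univ_of_forall fun u => ?_
    obtain ⟨K, hK, hu⟩ := h.exists_eq_vtx u.2
    -- A translate disjoint from a half-space shows that every invariant set of vertices has points
    -- on both sides of each edge. A connected one then contains the ends of each edge.
    have main : ∀ K ∈ 𝓗, K ∈ v.1 → ∃ w ∈ S, K ∉ w.1 := by
      intro K hK hKv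
      obtain ⟨g, hg⟩ := h.move K hK
      refine ⟨_, hinv g⁻¹ v hv, fun hmem => ?_⟩
      have hmem : K ∈ g⁻¹ • v.1 := hmem
      rw [Set.mem_smul_set_iff_inv_smul_mem, inv_inv] at hmem
      exact (v.2.xor _ hK).1 hKv (v.2.up _ hmem _ (h.compl _ hK) hg.subset_compl_right)
    have : ∃ a ∈ S, ∃ b ∈ S, K ∈ a.1 ∧ K ∉ b.1 := by
      by_cases hKv : K ∈ v.1
      · obtain ⟨w, hw, h1⟩ := main K hK hKv
        exact ⟨v, hv, w, hw, hKv, h1⟩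
      · have hKv' : Kᶜ ∈ v.1 := by rwa [v.2.xor K hK, not_not] at hKv
        obtain ⟨w, hw, h1⟩ := main Kᶜ (h.compl K hK) hKv'
        exact ⟨w, hw, v, hv, by rwa [w.2.xor K hK], hKv⟩
    obtain ⟨a, ha, b, hb', h1, h2⟩ := this
    obtain ⟨u', hu', e⟩ := h.mem_of_crossing hS ha hb' hK h1 h2
    rwa [Subtype.ext (hu.trans e.symm)]
  reduced := by
    intro v
    obtain ⟨K, hK, L, hL, M, hM, h1, h2, h3, mK, mL, mM⟩ := hb v.1 v.2
    have hadj : ∀ K, (hK : K ∈ v.1) → (∀ N ∈ v.1, N ⊆ K → N = K) →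
        (dualGraph 𝓗 h).Adj v ⟨vtx 𝓗 Kᶜ, h.ori_vtx (h.compl _ (v.2.sub hK))⟩ :=
      fun K hK mK => ⟨K, v.2.sub hK, h.eq_vtx v.2 hK mK, rfl⟩
    have hne : ∀ K ∈ v.1, ∀ L ∈ v.1, (∀ N ∈ v.1, N ⊆ K → N = K) → (∀ N ∈ v.1, N ⊆ L → N = L) →
        K ≠ L → vtx 𝓗 Kᶜ ≠ vtx 𝓗 Lᶜ := by
      intro K hK L hL mK mL hne e
      refine hne (h.eq_of_crossing (v.2.sub hK) (v.2.sub hL) ?_ ?_)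
      · rw [← h.eq_vtx v.2 hK mK]; exact hL
      · rw [e]; exact h.notMem_vtx_compl (v.2.sub hL)
    exact ⟨_, _, _, hadj K hK mK, hadj L hL mL, hadj M hM mM,
      fun e => hne K hK L hL mK mL h1 (congrArg Subtype.val e),
      fun e => hne L hL M hM mL mM h2 (congrArg Subtype.val e),
      fun e => hne K hK M hM mK mM h3 (congrArg Subtype.val e)⟩
  edge_orbits := by
    obtain ⟨H, hH, huniq⟩ := ho
    let V' : ∀ K, K ∈ 𝓗 → Vert 𝓗 := fun K hK => ⟨vtx 𝓗 K, h.ori_vtx hK⟩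
    have hadj : ∀ K (hK : K ∈ 𝓗), (dualGraph 𝓗 h).Adj (V' K hK) (V' Kᶜ (h.compl K hK)) :=
      fun K hK => ⟨K, hK, rfl, rfl⟩
    refine ⟨fun i => s(V' (H i) (hH i), V' (H i)ᶜ (h.compl _ (hH i))), fun i => hadj (H i) (hH i), ?_⟩
    intro d
    induction d using Sym2.ind with
    | _ v w =>
    rintro ⟨K, hK, e1, e2⟩
    change v.1 = _ at e1
    change w.1 = _ at e2
    have key : ∀ i, (∃ g : Γ, K = g • H i ∨ K = (g • H i)ᶜ) ↔
        ∃ g : Γ, s(v, w) = s((⟨g • vtx 𝓗 (H i), h.ori_smul g (h.ori_vtx (hH i))⟩ : Vert 𝓗),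
          (⟨g • vtx 𝓗 (H i)ᶜ, h.ori_smul g (h.ori_vtx (h.compl _ (hH i)))⟩ : Vert 𝓗)) := by
      intro i
      refine exists_congr fun g => ?_
      have hext : ∀ a b : Vert 𝓗, a = b ↔ a.1 = b.1 := fun a b => Subtype.ext_iff
      rw [Sym2.eq_iff, hext, hext, hext, hext, e1, e2]
      simp only [h.smul_vtx, Set.smul_set_compl]
      constructor
      · rintro (rfl | rfl)
        · exact Or.inl ⟨rfl, rfl⟩
        · exact Or.inr ⟨rfl, by rw [compl_compl]⟩
      · rintro (⟨h1, h2⟩ | ⟨h1, h2⟩)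
        · left
          refine (h.eq_of_crossing (h.smul g _ (hH i)) hK ?_ ?_).symm
          · rw [← h1]; exact h.self_mem_vtx hK
          · rw [← h2]; exact h.notMem_vtx_compl hK
        · right
          refine (h.eq_of_crossing (h.compl _ (h.smul g _ (hH i))) hK ?_ ?_).symm
          · rw [← h1]; exact h.self_mem_vtx hK
          · rw [compl_compl, ← h2]; exact h.notMem_vtx_compl hK
    obtain ⟨i, hi, hu⟩ := huniq K hK
    exact ⟨i, (key i).1 hi, fun j hj => hu j ((key j).2 hj)⟩

end HalfSystem

end HalfSystem

/-! ### Single half-spaces, their splittings and distances -/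

section Half

open scoped Pointwise

variable {Γ : Type} [Group Γ]

theorem Nested.symm {K L : Set Γ} (h : Nested K L) : Nested L K := by
  rcases h with h | h | h | h
  · exact Or.inr (Or.inr (Or.inr (Set.compl_subset_compl.2 h)))
  · exact Or.inr (Or.inl (Set.subset_compl_comm.1 h))
  · exact Or.inr (Or.inr (Or.inl (Set.compl_subset_comm.1 h)))
  · exact Or.inl (Set.compl_subset_compl.1 h)

theorem Nested.compl_right {K L : Set Γ} (h : Nested K L) : Nested K Lᶜ := by
  unfold Nested at *
  rw [compl_compl]
  tauto

theorem Nested.compl_left {K L : Set Γ} (h : Nested K L) : Nested Kᶜ L := h.symm.compl_right.symm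

theorem Nested.smul {K L : Set Γ} (g : Γ) (h : Nested K L) : Nested (g • K) (g • L) := by
  unfold Nested at *
  simpa only [← Set.smul_set_compl, Set.smul_set_subset_smul_set_iff] using h

/-- The translates of a halfspace and of its complement. -/
def orb (H : Set Γ) : Set (Set Γ) := {K | ∃ g : Γ, K = g • H ∨ K = (g • H)ᶜ}

theorem self_mem_orb (H : Set Γ) : H ∈ orb H := ⟨1, Or.inl (one_smul _ _).symm⟩

theorem compl_mem_orb {H K : Set Γ} (h : K ∈ orb H) : Kᶜ ∈ orb H := by
  obtain ⟨g, rfl | rfl⟩ := h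
  · exact ⟨g, Or.inr rfl⟩
  · exact ⟨g, Or.inl (compl_compl _)⟩

theorem smul_mem_orb {H K : Set Γ} (a : Γ) (h : K ∈ orb H) : a • K ∈ orb H := by
  obtain ⟨g, rfl | rfl⟩ := h
  · exact ⟨a * g, Or.inl (mul_smul _ _ _).symm⟩
  · exact ⟨a * g, Or.inr (by rw [mul_smul, Set.smul_set_compl])⟩

theorem orb_symm {H K : Set Γ} (h : K ∈ orb H) : H ∈ orb K := by
  obtain ⟨g, rfl | rfl⟩ := h
  · exact ⟨g⁻¹, Or.inl (inv_smul_smul _ _).symm⟩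
  · exact ⟨g⁻¹, Or.inr (by rw [← Set.smul_set_compl, compl_compl, inv_smul_smul])⟩

theorem orb_trans {H K L : Set Γ} (h : K ∈ orb H) (h' : L ∈ orb K) : L ∈ orb H := by
  obtain ⟨g, rfl | rfl⟩ := h'
  · exact smul_mem_orb g h
  · exact compl_mem_orb (smul_mem_orb g h)

theorem orb_eq {H K : Set Γ} (h : K ∈ orb H) : orb K = orb H :=
  Set.ext fun _ => ⟨orb_trans h, orb_trans (orb_symm h)⟩

/-- A set all of whose translates and their complements are halfspaces of a discrete tree. -/
structure IsHalf (H : Set Γ) : Prop where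
  nested : ∀ g : Γ, Nested (g • H) H
  fin : ∀ a b : Γ, {g : Γ | a ∈ g • H ∧ b ∉ g • H}.Finite
  move : ∃ g : Γ, Disjoint (g • H) H
  move' : ∃ g : Γ, Disjoint (g • Hᶜ) Hᶜ

theorem IsHalf.compl {H : Set Γ} (h : IsHalf H) : IsHalf Hᶜ := by
  refine ⟨fun g => ?_, fun a b => ?_, h.move', by rw [compl_compl]; exact h.move⟩
  · rw [Set.smul_set_compl]
    exact (h.nested g).compl_left.compl_right
  · refine (h.fin b a).subset ?_
    rintro g ⟨h1, h2⟩
    rw [Set.smul_set_compl] at h1 h2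
    exact ⟨not_not.1 h2, h1⟩

theorem disjoint_smul_smul {K L : Set Γ} (g : Γ) : Disjoint (g • K) (g • L) ↔ Disjoint K L := by
  rw [← Set.subset_compl_iff_disjoint_right, ← Set.smul_set_compl,
    Set.smul_set_subset_smul_set_iff, Set.subset_compl_iff_disjoint_right]

theorem IsHalf.smul {H : Set Γ} (h : IsHalf H) (a : Γ) : IsHalf (a • H) := by
  refine ⟨fun g => ?_, fun x y => ?_, ?_, ?_⟩
  · have := (h.nested (a⁻¹ * g * a)).smul a
    rwa [smul_smul, ← mul_assoc, ← mul_assoc, mul_inv_cancel, one_mul, mul_smul] at this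
  · refine ((h.fin x y).image (· * a⁻¹)).subset ?_
    rintro g hg
    rw [Set.mem_ofPred_eq, smul_smul] at hg
    exact ⟨g * a, hg, by simp⟩
  · obtain ⟨g, hg⟩ := h.move
    refine ⟨a * g * a⁻¹, ?_⟩
    rw [smul_smul, inv_mul_cancel_right, mul_smul, disjoint_smul_smul]
    exact hg
  · obtain ⟨g, hg⟩ := h.move'
    refine ⟨a * g * a⁻¹, ?_⟩
    rw [← Set.smul_set_compl, smul_smul, inv_mul_cancel_right, mul_smul, disjoint_smul_smul]
    exact hg

theorem IsHalf.of_mem {H K : Set Γ} (h : IsHalf H) (hK : K ∈ orb H) : IsHalf K := by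
  obtain ⟨g, rfl | rfl⟩ := hK
  · exact h.smul g
  · exact (h.smul g).compl

theorem IsHalf.nonempty {H : Set Γ} (h : IsHalf H) : H.Nonempty := by
  rw [Set.nonempty_iff_ne_empty]
  rintro rfl
  obtain ⟨g, hg⟩ := h.move'
  rw [Set.compl_empty, Set.smul_set_univ, disjoint_self] at hg
  exact Set.univ_nonempty.ne_empty hg

variable [IsMulTorsionFree Γ]

/-- The infinitely many powers of `g` would all fix `H`, and so all count among the translates of
`H` that separate a point of `H` from one outside. -/
theorem IsHalf.free {H : Set Γ} (h : IsHalf H) {g : Γ} (hg : g • H = H) : g = 1 := by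
  by_contra hne
  obtain ⟨a, ha⟩ := h.nonempty
  obtain ⟨b, hb⟩ := h.compl.nonempty
  have hinj : Function.Injective fun n : ℕ => g ^ n := by
    rw [injective_pow_iff_not_isOfFinOrder]
    exact not_isOfFinOrder_of_isMulTorsionFree hne
  have hpow : ∀ n : ℕ, g ^ n • H = H := by
    intro n
    induction n with
    | zero => rw [pow_zero, one_smul]
    | succ n ih => rw [pow_succ, mul_smul, hg, ih]
  refine Set.infinite_of_injective_forall_mem hinj (fun n => ?_) (h.fin a b)
  exact ⟨by rw [hpow]; exact ha, by rw [hpow]; exact hb⟩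

theorem eq_one_of_mul_self {g : Γ} (h : g * g = 1) : g = 1 := by
  by_contra hne
  refine not_isOfFinOrder_of_isMulTorsionFree hne (isOfFinOrder_iff_pow_eq_one.2 ⟨2, two_pos, ?_⟩)
  rw [pow_two, h]

theorem IsHalf.no_inv {H : Set Γ} (h : IsHalf H) (g : Γ) : g • H ≠ Hᶜ := by
  intro hg
  have h1 : (g * g) • H = H := by
    rw [mul_smul, hg, Set.smul_set_compl, hg, compl_compl]
  have := eq_one_of_mul_self (h.free h1)
  rw [this, one_smul] at hg
  obtain ⟨x, hx⟩ := h.nonempty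
  exact (hg ▸ hx : x ∈ Hᶜ) hx

theorem IsHalf.eq_of_smul_eq {H : Set Γ} (h : IsHalf H) {g k : Γ} (e : g • H = k • H) : g = k := by
  have := h.free (g := k⁻¹ * g) (by rw [mul_smul, e, inv_smul_smul])
  rwa [inv_mul_eq_one, eq_comm] at this

theorem IsHalf.smul_ne_compl {H : Set Γ} (h : IsHalf H) (g k : Γ) : g • H ≠ (k • H)ᶜ := by
  intro e
  refine h.no_inv (k⁻¹ * g) ?_
  rw [mul_smul, e, Set.smul_set_compl, inv_smul_smul]

theorem IsHalf.system {H : Set Γ} (h : IsHalf H) : HalfSystem (orb H) where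
  nonempty := ⟨H, self_mem_orb H⟩
  compl := fun K => compl_mem_orb
  smul := fun g K => smul_mem_orb g
  nested := by
    have h1 : ∀ K ∈ orb H, Nested K H := by
      rintro K ⟨g, rfl | rfl⟩
      · exact h.nested g
      · exact (h.nested g).compl_left
    intro K hK L hL
    obtain ⟨g, e⟩ : ∃ g : Γ, L = g • H ∨ L = (g • H)ᶜ := hL
    have h2 : Nested K (g • H) := by
      have := (h1 _ (smul_mem_orb g⁻¹ hK)).smul g
      rwa [smul_inv_smul] at this
    rcases e with rfl | rfl
    · exact h2
    · exact h2.compl_right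
  fin := by
    intro a b
    refine (((h.fin a b).image (· • H)).union ((h.fin b a).image fun g => (g • H)ᶜ)).subset ?_
    rintro K ⟨⟨g, rfl | rfl⟩, h1, h2⟩
    · exact Or.inl ⟨g, ⟨h1, h2⟩, rfl⟩
    · exact Or.inr ⟨g, ⟨not_not.1 h2, h1⟩, rfl⟩
  move := fun K hK => (h.of_mem hK).move
  free := fun g K hK => (h.of_mem hK).free
  no_inv := fun g K hK => (h.of_mem hK).no_inv g

/-- Take `g` moving `H` off itself and `k` moving the complement off itself. If they commuted, `g *
k` would preserve `H` and so be trivial, and then `k` would exchange the two sides. -/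
theorem IsHalf.not_comm {H : Set Γ} (h : IsHalf H) : ∃ a b : Γ, a * b ≠ b * a := by
  obtain ⟨g, hg⟩ := h.move
  obtain ⟨k, hk⟩ := h.move'
  refine ⟨g, k, fun e => ?_⟩
  have h1 : g • H ⊆ Hᶜ := hg.subset_compl_right
  have h2 : k • Hᶜ ⊆ H := by have := hk.subset_compl_right; rwa [compl_compl] at this
  have h3 : (g * k) • Hᶜ ⊆ Hᶜ := by
    rw [mul_smul]
    exact (Set.smul_set_mono h2).trans h1
  have h4 : (g * k) • H ⊆ H := by
    rw [e, mul_smul]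
    exact (Set.smul_set_mono h1).trans h2
  have h5 : (g * k) • H = H := by
    refine subset_antisymm h4 ?_
    rw [Set.smul_set_compl] at h3
    exact Set.compl_subset_compl.1 h3
  have h6 := h.free h5
  have h7 : H ⊆ k • Hᶜ := by
    have := Set.smul_set_mono (a := k) h1
    rwa [← mul_smul, ← e, h6, one_smul] at this
  exact h.compl.no_inv k (by rw [compl_compl]; exact subset_antisymm h2 h7)

/-- With one orbit of edges, a vertex of valence at most two would force a symmetry of order two or
make the dual tree a line on which the group acts as a cyclic group. Neither is possible. -/
theorem IsHalf.branching {H : Set Γ} (hH : IsHalf H) : Branching (orb H) := by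
  have h := hH.system
  intro v hv
  by_contra hcon
  obtain ⟨M, hM, hvM⟩ := h.exists_eq_vtx hv
  obtain ⟨K, hK, -, mK⟩ := h.exists_min hv (hvM ▸ h.self_mem_vtx hM)
  have hKo := hv.sub hK
  have hKh := hH.of_mem hKo
  have hvK := h.eq_vtx hv hK mK
  obtain ⟨L, hL, mL, hKL⟩ : ∃ L ∈ v, (∀ N ∈ v, N ⊆ L → N = L) ∧ K ≠ L := by
    obtain ⟨g, hg⟩ := hKh.move'
    have h1 : Kᶜ ⊆ g • K := by
      have := hg.subset_compl_left
      rwa [← Set.smul_set_compl, compl_compl] at this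
    have h2 : g • K ∈ v := by
      rw [hvK]
      exact ⟨h.smul g K hKo, Or.inr ⟨h1, h.no_inv g K hKo⟩⟩
    obtain ⟨L, hL, hLK, mL⟩ := h.exists_min hv h2
    refine ⟨L, hL, mL, ?_⟩
    rintro rfl
    obtain ⟨p, hp⟩ := hv.ne_univ_of_mem h h2
    exact hp ((em (p ∈ K)).elim (fun h3 => hLK h3) fun h3 => h1 h3)
  have hmin : ∀ N ∈ v, (∀ N' ∈ v, N' ⊆ N → N' = N) → N = K ∨ N = L := by
    intro N hN mN
    by_contra! hne
    exact hcon ⟨K, hK, L, hL, N, hN, hKL, hne.2.symm, hne.1.symm, mK, mL, mN⟩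
  have hmins : ∀ (a : Γ) (N : Set Γ), N ∈ a • v → (∀ N' ∈ a • v, N' ⊆ N → N' = N) →
      N = a • K ∨ N = a • L := by
    intro a N hN mN
    rw [Set.mem_smul_set_iff_inv_smul_mem] at hN
    have hm : ∀ N' ∈ v, N' ⊆ a⁻¹ • N → N' = a⁻¹ • N := by
      intro N' hN' hs
      have := mN (a • N') (Set.smul_mem_smul_set hN')
        (by rwa [← Set.smul_set_subset_smul_set_iff (a := a), smul_inv_smul] at hs)
      rw [← this, inv_smul_smul]
    rcases hmin (a⁻¹ • N) hN hm with e | e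
    · left; rw [← e, smul_inv_smul]
    · right; rw [← e, smul_inv_smul]
  have hLmem : L ∈ orb K := orb_trans (orb_symm hKo) (hv.sub hL)
  have hvL := h.eq_vtx hv hL mL
  -- The two edges at `v` are equivalent. If `a` carries one to the other keeping the orientation,
  -- it fixes `v`, so `a` or its square fixes an edge. Otherwise the neighbours of `v` are its
  -- translates by `a` and `a⁻¹`, so powers of `a` reach every vertex and exhaust the group.
  obtain ⟨a, e | e⟩ := hLmem
  · have hav : a • v = v := by rw [hvK, h.smul_vtx, ← e, ← hvL, hvK]
    have ha1 : a ≠ 1 := by rintro rfl; exact hKL (by rw [e, one_smul])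
    rcases hmins a K (by rwa [hav]) (by rwa [hav]) with e' | e'
    · exact ha1 (hKh.free e'.symm)
    · rw [e, smul_smul] at e'
      exact ha1 (eq_one_of_mul_self (hKh.free e'.symm))
  · have h1 : vtx (orb H) Kᶜ = a⁻¹ • v := by
      rw [eq_inv_smul_iff, h.smul_vtx, Set.smul_set_compl, ← e, ← hvL]
    have h2 : vtx (orb H) Lᶜ = a • v := by
      rw [e, compl_compl, ← h.smul_vtx, ← hvK]
    have hall : ∀ u : Vert (orb H), ∃ k : ℤ, u.1 = a ^ k • v := by
      intro u
      have hr := h.connected.preconnected ⟨v, hv⟩ u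
      rw [SimpleGraph.reachable_iff_reflTransGen] at hr
      induction hr with
      | refl => exact ⟨0, by rw [zpow_zero, one_smul]⟩
      | tail _ hbc ih =>
        obtain ⟨k, hk⟩ := ih
        obtain ⟨N, hN, e1, e2⟩ := hbc
        rw [hk] at e1
        rcases hmins (a ^ k) N (e1 ▸ h.self_mem_vtx hN) (e1 ▸ h.min_vtx hN) with e3 | e3
        · refine ⟨k - 1, ?_⟩
          rw [e2, e3, ← Set.smul_set_compl, ← h.smul_vtx, h1, smul_smul, zpow_sub_one]
        · refine ⟨k + 1, ?_⟩
          rw [e2, e3, ← Set.smul_set_compl, ← h.smul_vtx, h2, smul_smul, zpow_add_one]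
    have hpow : ∀ b : Γ, ∃ k : ℤ, b = a ^ k := by
      intro b
      obtain ⟨k, hk⟩ := hall ⟨b • v, h.ori_smul b hv⟩
      change b • v = a ^ k • v at hk
      have hbv : a ^ k • v = vtx (orb H) (b • K) := by rw [← hk, hvK, h.smul_vtx]
      have hbK := h.smul b K hKo
      rcases hmins (a ^ k) (b • K) (hbv ▸ h.self_mem_vtx hbK) (hbv ▸ h.min_vtx hbK) with e3 | e3
      · exact ⟨k, hKh.eq_of_smul_eq e3⟩
      · rw [e, Set.smul_set_compl, smul_smul] at e3
        exact absurd e3 (hKh.smul_ne_compl _ _)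
    obtain ⟨x, y, hxy⟩ := hH.not_comm
    obtain ⟨i, rfl⟩ := hpow x
    obtain ⟨j, rfl⟩ := hpow y
    exact hxy (by rw [← zpow_add, ← zpow_add, add_comm])

theorem IsHalf.hasOrbits {H : Set Γ} (h : IsHalf H) : HasOrbits (orb H) 1 :=
  ⟨fun _ => H, fun _ => self_mem_orb H, fun K hK => ⟨0, hK, fun i _ => Subsingleton.elim _ _⟩⟩

/-- The one-edge splitting given by a halfspace. -/
def IsHalf.splitting {H : Set Γ} (h : IsHalf H) : FreeSplitting Γ 1 :=
  h.system.splitting h.branching h.hasOrbits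

/-- The vertex of the splitting complex given by a halfspace. -/
def IsHalf.tree {H : Set Γ} (h : IsHalf H) : SplittingVertex Γ := h.splitting.toVertex

theorem IsHalf.tree_eq_of_mem {H K : Set Γ} (h : IsHalf H) (h' : IsHalf K) (hK : K ∈ orb H) :
    h'.tree = h.tree := by
  have key : ∀ 𝓗, ∀ e : orb K = 𝓗, ∀ (h1 : HalfSystem 𝓗) (h2 : Branching 𝓗) (h3 : HasOrbits 𝓗 1),
      h'.tree = (h1.splitting h2 h3).toVertex := by
    rintro 𝓗 rfl h1 h2 h3
    rfl
  exact key _ (orb_eq hK) _ _ _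

/-- The map of orientations induced by sending translates of `K` to translates of `L`. -/
def transfer (K L : Set Γ) (v : Set (Set Γ)) : Set (Set Γ) :=
  {M | ∃ g : Γ, (M = g • L ∧ g • K ∈ v) ∨ (M = (g • L)ᶜ ∧ (g • K)ᶜ ∈ v)}

section Transfer

variable {K L : Set Γ} (hK : IsHalf K) (hL : IsHalf L)
include hL

theorem smul_mem_transfer {v : Set (Set Γ)} (g : Γ) : g • L ∈ transfer K L v ↔ g • K ∈ v := by
  constructor
  · rintro ⟨k, ⟨e, h⟩ | ⟨e, -⟩⟩
    · rwa [hL.eq_of_smul_eq e]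
    · exact absurd e (hL.smul_ne_compl _ _)
  · exact fun h => ⟨g, Or.inl ⟨rfl, h⟩⟩

theorem compl_mem_transfer {v : Set (Set Γ)} (g : Γ) :
    (g • L)ᶜ ∈ transfer K L v ↔ (g • K)ᶜ ∈ v := by
  constructor
  · rintro ⟨k, ⟨e, -⟩ | ⟨e, h⟩⟩
    · exact absurd e.symm (hL.smul_ne_compl _ _)
    · rwa [hL.eq_of_smul_eq (compl_injective e)]
  · exact fun h => ⟨g, Or.inr ⟨rfl, h⟩⟩

omit hL in
theorem transfer_subset {v : Set (Set Γ)} : transfer K L v ⊆ orb L := by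
  rintro M ⟨g, ⟨rfl, -⟩ | ⟨rfl, -⟩⟩
  · exact ⟨g, Or.inl rfl⟩
  · exact ⟨g, Or.inr rfl⟩

theorem eq_of_transfer {v w : Set (Set Γ)} (hw : w ⊆ orb L) (h1 : ∀ g : Γ, g • K ∈ v ↔ g • L ∈ w)
    (h2 : ∀ g : Γ, (g • K)ᶜ ∈ v ↔ (g • L)ᶜ ∈ w) : transfer K L v = w := by
  ext M
  by_cases hM : M ∈ orb L
  · obtain ⟨g, rfl | rfl⟩ := hM
    · rw [smul_mem_transfer hL, h1]
    · rw [compl_mem_transfer hL, h2]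
  · exact ⟨fun h => absurd (transfer_subset h) hM, fun h => absurd (hw h) hM⟩

/-- `K` and `L` are nested with their translates in the same way. -/
def SameNesting (K L : Set Γ) : Prop := ∀ g : Γ, (g • K ⊆ K ↔ g • L ⊆ L) ∧
  (K ⊆ g • K ↔ L ⊆ g • L) ∧ (g • K ⊆ Kᶜ ↔ g • L ⊆ Lᶜ) ∧ ((g • K)ᶜ ⊆ K ↔ (g • L)ᶜ ⊆ L)

include hK

omit hK hL in
theorem subset_smul_iff (g k : Γ) (A B : Set Γ) : g • A ⊆ k • B ↔ (k⁻¹ * g) • A ⊆ B := by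
  rw [← Set.smul_set_subset_smul_set_iff (a := k⁻¹), smul_smul, inv_smul_smul]

omit hK hL in
theorem smul_subset_iff (g k : Γ) (A B : Set Γ) : g • A ⊆ k • B ↔ A ⊆ (g⁻¹ * k) • B := by
  rw [← Set.smul_set_subset_smul_set_iff (a := g⁻¹), inv_smul_smul, smul_smul]

/-- Endpoints of edges are defined by inclusions among translates, which are the same for `K` and
`L` by assumption. -/
theorem transfer_vtx (hs : SameNesting K L) (g : Γ) :
    transfer K L (vtx (orb K) (g • K)) = vtx (orb L) (g • L) ∧
      transfer K L (vtx (orb K) (g • K)ᶜ) = vtx (orb L) (g • L)ᶜ := by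
  have m1 : ∀ (k : Γ) (M : Set Γ), k • M ∈ orb M := fun k M => ⟨k, Or.inl rfl⟩
  have m2 : ∀ (k : Γ) (M : Set Γ), (k • M)ᶜ ∈ orb M := fun k M => ⟨k, Or.inr rfl⟩
  have i1 : ∀ k : Γ, g • K ⊆ k • K ↔ g • L ⊆ k • L := fun k => by
    rw [subset_smul_iff, subset_smul_iff g k L]
    exact (hs _).1
  have i2 : ∀ k : Γ, (g • K)ᶜ ⊆ (k • K)ᶜ ↔ (g • L)ᶜ ⊆ (k • L)ᶜ := fun k => by
    rw [Set.compl_subset_compl, Set.compl_subset_compl, smul_subset_iff, smul_subset_iff k g L]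
    exact (hs _).2.1
  have i3 : ∀ k : Γ, g • K ⊆ (k • K)ᶜ ↔ g • L ⊆ (k • L)ᶜ := fun k => by
    rw [← Set.smul_set_compl, ← Set.smul_set_compl, subset_smul_iff, subset_smul_iff g k L]
    exact (hs _).2.2.1
  have i4 : ∀ k : Γ, (g • K)ᶜ ⊆ k • K ↔ (g • L)ᶜ ⊆ k • L := fun k => by
    rw [← Set.smul_set_compl, ← Set.smul_set_compl, subset_smul_iff, subset_smul_iff g k Lᶜ,
      Set.smul_set_compl, Set.smul_set_compl]
    exact (hs _).2.2.2
  have n1 : ∀ k : Γ, k • K ≠ (g • K)ᶜ ↔ k • L ≠ (g • L)ᶜ := fun k =>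
    ⟨fun _ => hL.smul_ne_compl _ _, fun _ => hK.smul_ne_compl _ _⟩
  have n2 : ∀ k : Γ, k • K ≠ g • K ↔ k • L ≠ g • L := fun k => not_congr
    ⟨fun e => by rw [hK.eq_of_smul_eq e], fun e => by rw [hL.eq_of_smul_eq e]⟩
  have n3 : ∀ k : Γ, (k • K)ᶜ ≠ (g • K)ᶜ ↔ (k • L)ᶜ ≠ (g • L)ᶜ := fun k => by
    rw [ne_eq, ne_eq, compl_inj_iff, compl_inj_iff]; exact n2 k
  have n4 : ∀ k : Γ, (k • K)ᶜ ≠ g • K ↔ (k • L)ᶜ ≠ g • L := fun k =>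
    ⟨fun _ => (hL.smul_ne_compl _ _).symm, fun _ => (hK.smul_ne_compl _ _).symm⟩
  constructor
  · refine eq_of_transfer hL (fun M hM => hM.1) (fun k => ?_) (fun k => ?_)
    · simp only [vtx, Set.mem_ofPred_eq, m1, true_and]
      rw [i1, i4, n1]
    · simp only [vtx, Set.mem_ofPred_eq, m2, true_and]
      rw [i2, i3, n3]
  · refine eq_of_transfer hL (fun M hM => hM.1) (fun k => ?_) (fun k => ?_)
    · simp only [vtx, Set.mem_ofPred_eq, m1, true_and, compl_compl]
      rw [i1, i4, n2]
    · simp only [vtx, Set.mem_ofPred_eq, m2, true_and, compl_compl]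
      rw [i2, i3, n4]

theorem transfer_vtx_of_mem (hs : SameNesting K L) {M : Set Γ} (hM : M ∈ orb K) :
    ∃ N ∈ orb L, transfer K L (vtx (orb K) M) = vtx (orb L) N ∧
      transfer K L (vtx (orb K) Mᶜ) = vtx (orb L) Nᶜ := by
  obtain ⟨g, rfl | rfl⟩ := hM
  · exact ⟨g • L, ⟨g, Or.inl rfl⟩, transfer_vtx hK hL hs g⟩
  · refine ⟨(g • L)ᶜ, ⟨g, Or.inr rfl⟩, ?_⟩
    rw [compl_compl, compl_compl]
    exact (transfer_vtx hK hL hs g).symm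

theorem ori_transfer (hs : SameNesting K L) {v : Set (Set Γ)} (hv : Ori (orb K) v) :
    Ori (orb L) (transfer K L v) := by
  obtain ⟨M, hM, rfl⟩ := hK.system.exists_eq_vtx hv
  obtain ⟨N, hN, e, -⟩ := transfer_vtx_of_mem hK hL hs hM
  rw [e]
  exact hL.system.ori_vtx hN

theorem IsHalf.tree_eq_of_sameNesting (hs : SameNesting K L) : hK.tree = hL.tree := by
  have hs' : SameNesting L K := fun g =>
    ⟨(hs g).1.symm, (hs g).2.1.symm, (hs g).2.2.1.symm, (hs g).2.2.2.symm⟩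
  have hinv : ∀ v, Ori (orb K) v → transfer L K (transfer K L v) = v := fun v hv =>
    eq_of_transfer hK hv.sub (fun g => smul_mem_transfer hL g) fun g => compl_mem_transfer hL g
  have hinv' : ∀ v, Ori (orb L) v → transfer K L (transfer L K v) = v := fun v hv =>
    eq_of_transfer hL hv.sub (fun g => smul_mem_transfer hK g) fun g => compl_mem_transfer hK g
  let e : Vert (orb K) ≃ Vert (orb L) :=
    { toFun := fun v => ⟨transfer K L v.1, ori_transfer hK hL hs v.2⟩
      invFun := fun v => ⟨transfer L K v.1, ori_transfer hL hK hs' v.2⟩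
      left_inv := fun v => Subtype.ext (hinv v.1 v.2)
      right_inv := fun v => Subtype.ext (hinv' v.1 v.2) }
  refine Quotient.sound (s := FreeSplitting.setoid Γ 1) ⟨e, fun g v => Subtype.ext ?_,
    fun v w => ⟨?_, ?_⟩⟩
  · change transfer K L (g • v.1) = g • transfer K L v.1
    refine eq_of_transfer hL (hL.system.ori_smul g (ori_transfer hK hL hs v.2)).sub
      (fun k => ?_) (fun k => ?_)
    · rw [Set.mem_smul_set_iff_inv_smul_mem, Set.mem_smul_set_iff_inv_smul_mem, smul_smul,
        smul_smul, smul_mem_transfer hL]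
    · rw [Set.mem_smul_set_iff_inv_smul_mem, Set.mem_smul_set_iff_inv_smul_mem,
        Set.smul_set_compl, Set.smul_set_compl, smul_smul, smul_smul, compl_mem_transfer hL]
  · rintro ⟨N, hN, e1, e2⟩
    obtain ⟨M, hM, e3, e4⟩ := transfer_vtx_of_mem hL hK hs' hN
    refine ⟨M, hM, ?_, ?_⟩
    · rw [← e3, ← e1]; exact (hinv v.1 v.2).symm
    · rw [← e4, ← e2]; exact (hinv w.1 w.2).symm
  · rintro ⟨M, hM, e1, e2⟩
    obtain ⟨N, hN, e3, e4⟩ := transfer_vtx_of_mem hK hL hs hM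
    refine ⟨N, hN, ?_, ?_⟩
    · rw [← e3, ← e1]; rfl
    · rw [← e4, ← e2]; rfl

end Transfer

/-- Restricting orientations to the subfamily is the collapse. Its fibres are convex, hence
connected by `reachable_induce`. -/
theorem HalfSystem.collapsesTo {𝓗 𝓗' : Set (Set Γ)} (h : HalfSystem 𝓗) (h' : HalfSystem 𝓗')
    (hsub : 𝓗' ⊆ 𝓗) (hb : Branching 𝓗) (hb' : Branching 𝓗') {k l : ℕ} (ho : HasOrbits 𝓗 k)
    (ho' : HasOrbits 𝓗' l) : (h.splitting hb ho).CollapsesTo (h'.splitting hb' ho') := by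
  have hori : ∀ v, Ori 𝓗 v → Ori 𝓗' (v ∩ 𝓗') := by
    intro v hv
    refine ⟨Set.inter_subset_right, fun K hK => ?_, ?_, fun p => (hv.fin p).subset ?_⟩
    · have h1 := hv.xor K (hsub hK)
      have h2 := h'.compl K hK
      simp only [Set.mem_inter_iff, hK, h2, and_true]
      exact h1
    · rintro K ⟨hK, -⟩ L hL hKL
      exact ⟨hv.up K hK L (hsub hL) hKL, hL⟩
    · rintro K ⟨⟨h1, -⟩, h2⟩
      exact ⟨h1, h2⟩
  have hvtx : ∀ K, vtx 𝓗 K ∩ 𝓗' = vtx 𝓗' K := by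
    intro K
    ext L
    simp only [vtx, Set.mem_inter_iff, Set.mem_ofPred_eq]
    constructor
    · rintro ⟨⟨-, h1⟩, h2⟩; exact ⟨h2, h1⟩
    · rintro ⟨h1, h2⟩; exact ⟨⟨hsub h1, h2⟩, h1⟩
  let p : Vert 𝓗 → Vert 𝓗' := fun v => ⟨v.1 ∩ 𝓗', hori v.1 v.2⟩
  refine ⟨p, ?_, ?_, ?_, ?_⟩
  · intro w
    obtain ⟨K, hK, e⟩ := h'.exists_eq_vtx (v := w.1) w.2
    refine ⟨(⟨vtx 𝓗 K, h.ori_vtx (hsub hK)⟩ : Vert 𝓗), Subtype.ext ?_⟩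
    change vtx 𝓗 K ∩ 𝓗' = w.1
    rw [hvtx, e]
  · intro g v
    refine Subtype.ext ?_
    change (g • v.1) ∩ 𝓗' = g • (v.1 ∩ 𝓗')
    have : g • 𝓗' = 𝓗' := by
      ext K
      rw [Set.mem_smul_set_iff_inv_smul_mem]
      exact ⟨fun h1 => by have := h'.smul g _ h1; rwa [smul_inv_smul] at this, h'.smul _ _⟩
    rw [Set.smul_set_inter, this]
  · rintro v w ⟨K, hK, e1, e2⟩
    by_cases hK' : K ∈ 𝓗'
    · right
      refine ⟨K, hK', ?_, ?_⟩
      · change v.1 ∩ 𝓗' = _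
        rw [e1, hvtx]
      · change w.1 ∩ 𝓗' = _
        rw [e2, hvtx]
    · left
      refine Subtype.ext ?_
      change v.1 ∩ 𝓗' = w.1 ∩ 𝓗'
      ext L
      refine and_congr_left fun hL => ?_
      rw [e1, e2, h.mem_vtx_compl hK (by rintro rfl; exact hK' hL)]
      rintro rfl
      have := h'.compl _ hL
      rw [compl_compl] at this
      exact hK' this
  · intro u
    rintro ⟨v, hv⟩ ⟨w, hw⟩
    have hv' : v.1 ∩ 𝓗' = u.1 := congrArg Subtype.val hv
    have hw' : w.1 ∩ 𝓗' = u.1 := congrArg Subtype.val hw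
    refine h.reachable_induce (p ⁻¹' {u}) hv hw fun x hx => Subtype.ext ?_
    refine (h'.eq_of_ori_subset u.2 (hori x.1 x.2) fun K hK => ⟨hx ⟨?_, ?_⟩, u.2.sub hK⟩).symm
    · exact (hv' ▸ hK : K ∈ v.1 ∩ 𝓗').1
    · exact (hw' ▸ hK : K ∈ w.1 ∩ 𝓗').1

theorem HalfSystem.union {𝓗 𝓗' : Set (Set Γ)} (h : HalfSystem 𝓗) (h' : HalfSystem 𝓗')
    (hn : ∀ K ∈ 𝓗, ∀ L ∈ 𝓗', Nested K L) : HalfSystem (𝓗 ∪ 𝓗') where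
  nonempty := h.nonempty.inl
  compl := fun K hK => hK.imp (h.compl K) (h'.compl K)
  smul := fun g K hK => hK.imp (h.smul g K) (h'.smul g K)
  nested := by
    rintro K (hK | hK) L (hL | hL)
    · exact h.nested K hK L hL
    · exact hn K hK L hL
    · exact (hn L hL K hK).symm
    · exact h'.nested K hK L hL
  fin := fun a b => ((h.fin a b).union (h'.fin a b)).subset (by
    rintro K ⟨h1 | h1, h2⟩
    · exact Or.inl ⟨h1, h2⟩
    · exact Or.inr ⟨h1, h2⟩)
  move := fun K hK => hK.elim (h.move K) (h'.move K)
  free := fun g K hK => hK.elim (h.free g K) (h'.free g K)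
  no_inv := fun g K hK => hK.elim (h.no_inv g K) (h'.no_inv g K)

/-- Nested halfspaces give splittings at distance at most one. -/
theorem IsHalf.edist_le_one {H H' : Set Γ} (hH : IsHalf H) (hH' : IsHalf H')
    (hn : ∀ g : Γ, Nested H (g • H')) :
    (splittingGraph Γ).edist hH.tree hH'.tree ≤ 1 := by
  by_cases hmem : H' ∈ orb H
  · rw [hH.tree_eq_of_mem hH' hmem, SimpleGraph.edist_self]
    exact zero_le_one
  have hcross : ∀ K ∈ orb H, ∀ L ∈ orb H', Nested K L := by
    have h1 : ∀ L ∈ orb H', Nested H L := by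
      rintro L ⟨g, rfl | rfl⟩
      · exact hn g
      · exact (hn g).compl_right
    intro K hK L hL
    obtain ⟨g, e⟩ : ∃ g : Γ, K = g • H ∨ K = (g • H)ᶜ := hK
    have h2 : Nested (g • H) L := by
      have := (h1 _ (smul_mem_orb g⁻¹ hL)).smul g
      rwa [smul_inv_smul] at this
    rcases e with rfl | rfl
    · exact h2
    · exact h2.compl_left
  have hdisj : ∀ K ∈ orb H, K ∉ orb H' := fun K h1 h2 => hmem (orb_trans h1 (orb_symm h2))
  have h := hH.system.union hH'.system hcross
  by_cases hb : Branching (orb H ∪ orb H')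
  · have ho : HasOrbits (orb H ∪ orb H') 2 := by
      refine ⟨![H, H'], ?_, ?_⟩
      · rw [Fin.forall_fin_two]
        exact ⟨Or.inl (self_mem_orb H), Or.inr (self_mem_orb H')⟩
      · rintro K (hK | hK)
        · refine ⟨0, hK, fun i hi => ?_⟩
          fin_cases i
          · rfl
          · exact absurd hi (hdisj K hK)
        · refine ⟨1, hK, fun i hi => ?_⟩
          fin_cases i
          · exact absurd hK (hdisj K hi)
          · rfl
    by_cases he : hH.tree = hH'.tree
    · rw [he, SimpleGraph.edist_self]
      exact zero_le_one
    · refine le_of_eq (SimpleGraph.edist_eq_one_iff_adj.2 ⟨he, h.splitting hb ho, hH.splitting,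
        hH'.splitting, ?_, ?_, rfl, rfl⟩)
      · exact h.collapsesTo _ Set.subset_union_left _ _ _ _
      · exact h.collapsesTo _ Set.subset_union_right _ _ _ _
  -- The joint dual tree has a vertex `v` of valence at most two. It remains to see that the two
  -- families give the same splitting.
  unfold Branching at hb
  push Not at hb
  obtain ⟨v, hv, hmin⟩ := hb
  have hex : ∀ {H0 : Set Γ} (h0 : IsHalf H0) (hs : orb H0 ⊆ orb H ∪ orb H'),
      ∃ N ∈ v, N ∉ orb H0 ∧ ∀ N' ∈ v, N' ⊆ N → N' = N := by
    intro H0 h0 hs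
    by_contra! hcon
    have hori : Ori (orb H0) (v ∩ orb H0) := by
      refine ⟨Set.inter_subset_right, fun K hK => ?_, ?_, fun p => (hv.fin p).subset ?_⟩
      · have h1 := hv.xor K (hs hK)
        simp only [Set.mem_inter_iff, hK, compl_mem_orb hK, and_true]
        exact h1
      · rintro K ⟨hK, -⟩ L hL hKL
        exact ⟨hv.up K hK L (hs hL) hKL, hL⟩
      · rintro K ⟨⟨h1, -⟩, h2⟩
        exact ⟨h1, h2⟩
    obtain ⟨K, hK, L, hL, M, hM, h1, h2, h3, mK, mL, mM⟩ := h0.branching _ hori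
    have hm : ∀ K ∈ v ∩ orb H0, (∀ N ∈ v ∩ orb H0, N ⊆ K → N = K) → ∀ N ∈ v, N ⊆ K → N = K := by
      intro K hK mK N hN hNK
      obtain ⟨N', hN', hs', mN'⟩ := h.exists_min hv hN
      by_cases ho : N' ∈ orb H0
      · have := mK N' ⟨hN', ho⟩ (hs'.trans hNK)
        exact subset_antisymm hNK (this ▸ hs')
      · obtain ⟨N'', hN'', h4, h5⟩ := hcon N' hN' ho
        exact absurd (mN' N'' hN'' h4) h5
    obtain ⟨N, hN, hs', hne⟩ := hmin K hK.1 L hL.1 M hM.1 h1 h2 h3 (hm K hK mK) (hm L hL mL)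
    exact hne (hm M hM mM N hN hs')
  -- Each family alone has branching dual tree. So the minimal half-spaces at `v` cannot all be in
  -- one family: one edge at `v` comes from each.
  obtain ⟨L, hL, hL', mL⟩ := hex hH Set.subset_union_left
  obtain ⟨K, hK, hK', mK⟩ := hex hH' Set.subset_union_right
  have hKo : K ∈ orb H := (hv.sub hK).resolve_right hK'
  have hLo : L ∈ orb H' := (hv.sub hL).resolve_left hL'
  have hKL : K ≠ L := fun e => hdisj K hKo (e ▸ hLo)
  have hbelow : ∀ M ∈ v, K ⊆ M ∨ L ⊆ M := by
    intro M hM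
    obtain ⟨N, hN, hNM, mN⟩ := h.exists_min hv hM
    by_cases hNK : K = N
    · exact Or.inl (hNK ▸ hNM)
    by_cases hNL : L = N
    · exact Or.inr (hNL ▸ hNM)
    obtain ⟨N', hN', h1, h2⟩ := hmin K hK L hL N hN hKL hNL hNK mK mL
    exact absurd (mN N' hN' h1) h2
  have hcover : ∀ {A B : Set Γ}, A ∈ v → B ∈ v → A ≠ B → (∀ N ∈ v, N ⊆ A → N = A) →
      (∀ N ∈ v, N ⊆ B → N = B) → Bᶜ ⊆ A := by
    intro A B hA hB hAB mA mB
    rcases h.nested A (hv.sub hA) B (hv.sub hB) with h1 | h1 | h1 | h1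
    · exact absurd (mB A hA h1) hAB
    · exact absurd (hv.up A hA _ (h.compl _ (hv.sub hB)) h1) ((hv.xor B (hv.sub hB)).1 hB)
    · exact Set.compl_subset_comm.1 h1
    · exact absurd (mA B hB (Set.compl_subset_compl.1 h1)) hAB.symm
  -- The edges of `A` and `Bᶜ` are adjacent at a vertex of valence two and point the same way, so
  -- they lie below the same half-spaces, apart from `Bᶜ` itself.
  have hL1 : ∀ {A B : Set Γ}, A ∈ v → B ∈ v → A ≠ B → (∀ N ∈ v, N ⊆ A → N = A) →
      (∀ N ∈ v, N ⊆ B → N = B) → (∀ M ∈ v, A ⊆ M ∨ B ⊆ M) →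
      ∀ M ∈ orb H ∪ orb H', M ≠ Bᶜ → (A ⊆ M ↔ Bᶜ ⊆ M) := by
    intro A B hA hB hAB mA mB hlow M hM hne
    have hBA := hcover hA hB hAB mA mB
    refine ⟨hBA.trans, fun hBM => ?_⟩
    have hM1 : M ∈ v := by
      rw [hv.xor M hM]
      intro hMc
      have h1 : Mᶜ ⊆ B := Set.compl_subset_comm.1 hBM
      exact hne (by rw [← mB _ hMc h1, compl_compl])
    rcases hlow M hM1 with h1 | h1
    · exact h1
    · obtain ⟨p, hp⟩ := hv.ne_univ_of_mem h hM1
      exact absurd ((em (p ∈ B)).elim (fun h2 => h1 h2) fun h2 => hBM h2) hp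
  have l1 := hL1 hK hL hKL mK mL hbelow
  have l2 := hL1 hL hK hKL.symm mL mK fun M hM => (hbelow M hM).symm
  have hKh := hH.of_mem hKo
  have hLh := hH'.of_mem hLo
  have sK : ∀ g : Γ, g • K ∈ orb H ∪ orb H' := fun g => Or.inl (smul_mem_orb g hKo)
  have sK' : ∀ g : Γ, g • Kᶜ ∈ orb H ∪ orb H' := fun g => Or.inl (smul_mem_orb g (compl_mem_orb hKo))
  have sL : ∀ g : Γ, g • L ∈ orb H ∪ orb H' := fun g => Or.inr (smul_mem_orb g hLo)
  have sL' : ∀ g : Γ, g • Lᶜ ∈ orb H ∪ orb H' := fun g => Or.inr (smul_mem_orb g (compl_mem_orb hLo))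
  have dKL : ∀ (g : Γ) {A B : Set Γ}, A ∈ orb H → B ∈ orb H' → g • A ≠ B := fun g A B hA hB e =>
    hdisj _ (smul_mem_orb g hA) (e ▸ hB)
  have hshift : ∀ (g : Γ) (A B : Set Γ), g • A ⊆ B ↔ A ⊆ g⁻¹ • B := fun g A B => by
    rw [← Set.smul_set_subset_smul_set_iff (a := g⁻¹), inv_smul_smul]
  have hflip : ∀ (g : Γ) (A B : Set Γ), g • A ⊆ B ↔ Bᶜ ⊆ g • Aᶜ := fun g A B => by
    rw [Set.smul_set_compl, Set.compl_subset_compl]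
  have t1 : ∀ g : Γ, g • K ⊆ K ↔ g • Lᶜ ⊆ Lᶜ := by
    intro g
    by_cases hg : g = 1
    · subst hg; simp
    have hg' : g⁻¹ ≠ 1 := inv_ne_one.2 hg
    rw [hflip, ← l2 _ (sK' g) (fun e => hg (hKh.compl.free e)), ← compl_compl L, ← hflip, hshift,
      l1 _ (sL' _) (fun e => hg' (hLh.compl.free e)), ← hshift, compl_compl]
  -- Each comparison with a translate is converted by exchanging `K` for `Lᶜ` on one side, moving
  -- the translation across, and exchanging again. The excluded cases are trivial group elements,
  -- inversions, or coincidences between the two orbits.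
  have hs : SameNesting K Lᶜ := by
    intro g
    refine ⟨t1 g, ?_, ?_, ?_⟩
    · have := t1 g⁻¹
      rwa [hshift, hshift, inv_inv] at this
    · rw [hshift, l1 _ (sK' _) (fun e => dKL _ (compl_mem_orb hKo) (compl_mem_orb hLo) e), ← hshift,
        hflip, compl_compl, compl_compl, l1 _ (sL _) (hLh.no_inv g)]
      conv_lhs => rw [← compl_compl L, Set.smul_set_compl, Set.subset_compl_comm, compl_compl]
      rw [compl_compl]
    · rw [← Set.smul_set_compl, ← Set.smul_set_compl, hshift, ← l2 _ (sK _) (hKh.no_inv _),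
        ← hshift, hflip, ← l2 _ (sL' _) (fun e => dKL 1 (compl_mem_orb hKo) (smul_mem_orb g (compl_mem_orb hLo)) (by rw [one_smul, e])),
        compl_compl]
      conv_lhs => rw [Set.smul_set_compl, Set.subset_compl_comm]
  have e1 := hKh.tree_eq_of_sameNesting hLh.compl hs
  rw [← hH.tree_eq_of_mem hKh hKo, ← hH'.tree_eq_of_mem hLh.compl (compl_mem_orb hLo), e1,
    SimpleGraph.edist_self]
  exact zero_le_one

end Half

/-! ### Half-spaces of a subgroup cut out by points of the tree -/

section Cut

open scoped Pointwise

variable {T : Type*} [MetricSpace T] {F : Type} [Group F] [MulAction F T]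

/-- The elements of `A` that move the base point `o` into the branch at `z` containing `p`. -/
def cut (A : Subgroup F) (z p o : T) : Set A := {a | z ∉ seg p ((a : F) • o)}

/-- A point beyond `z'` as seen from `z` is on the same side of `z` as `z'`. The four cases say
which pair of branches, taken from those given or their complements, is nested. -/
theorem branch_nested (hT : IsRealTree T) {z z' p p' : T} (hne : z ≠ z') :
    (z ∉ seg p z' → z' ∉ seg p' z → ∀ w, z ∈ seg p w → z' ∉ seg p' w) ∧
    (z ∈ seg p z' → z' ∉ seg p' z → ∀ w, z ∉ seg p w → z' ∉ seg p' w) ∧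
    (z ∉ seg p z' → z' ∈ seg p' z → ∀ w, z ∈ seg p w → z' ∈ seg p' w) ∧
    (z ∈ seg p z' → z' ∈ seg p' z → ∀ w, z ∉ seg p w → z' ∈ seg p' w) := by
  have key : ∀ w, z' ∈ seg z w → z ∉ seg z' w := fun w h => not_mem_seg_of_mem hT hne.symm h
  refine ⟨fun h1 h2 w h3 h4 => ?_, fun h1 h2 w h3 h4 => ?_, fun h1 h2 w h3 => ?_,
    fun h1 h2 w h3 => ?_⟩
  · have h5 : z' ∈ seg z w := by
      by_contra h5
      exact not_mem_seg_trans hT h2 h5 h4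
    exact not_mem_seg_trans hT h1 (key w h5) h3
  · have h5 : z' ∈ seg z w := by
      by_contra h5
      exact not_mem_seg_trans hT h2 h5 h4
    exact not_mem_seg_trans hT h3 (not_mem_seg_symm (key w h5)) h1
  · by_contra h4
    have h5 : z' ∈ seg z w := by
      by_contra h5
      exact not_mem_seg_trans hT h4 (not_mem_seg_symm h5) h2
    exact not_mem_seg_trans hT h1 (key w h5) h3
  · by_contra h4
    have h5 : z' ∈ seg z w := by
      by_contra h5
      exact not_mem_seg_trans hT h4 (not_mem_seg_symm h5) h2
    exact not_mem_seg_trans hT h3 (not_mem_seg_symm (key w h5)) h1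

theorem nested_cut (hT : IsRealTree T) (A : Subgroup F) (z z' p p' o : T) :
    Nested (cut A z p o) (cut A z' p' o) := by
  by_cases hne : z = z'
  · subst hne
    by_cases h : z ∈ seg p p'
    · right; left
      intro a h1 h2
      exact not_mem_seg_trans hT h1 (not_mem_seg_symm h2) h
    · left
      intro a h1
      exact not_mem_seg_trans hT (not_mem_seg_symm h) h1
  · obtain ⟨k1, k2, k3, k4⟩ := branch_nested hT (p := p) (p' := p') hne
    by_cases h1 : z ∈ seg p z' <;> by_cases h2 : z' ∈ seg p' z
    · right; left
      exact fun a ha h3 => h3 (k4 h1 h2 _ ha)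
    · left
      exact fun a ha => k2 h1 h2 _ ha
    · right; right; right
      exact fun a ha h3 => h3 (k3 h1 h2 _ (not_not.1 ha))
    · right; right; left
      exact fun a ha => k1 h1 h2 _ (not_not.1 ha)

variable (hO : IsOuterSpacePoint F T)
include hO

theorem smul_cut {A : Subgroup F} (g : A) (z p o : T) :
    g • cut A z p o = cut A ((g : F) • z) ((g : F) • p) o := by
  ext a
  rw [Set.mem_smul_set_iff_inv_smul_mem]
  simp only [cut, Set.mem_ofPred_eq]
  rw [← hO.smul_mem_seg_iff (g : F), smul_eq_mul, Subgroup.coe_mul, mul_smul, Subgroup.coe_inv,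
    smul_inv_smul]

/-- Supplies a ping-pong element: both it and its inverse move `v` away from the direction of `z`.
Two other directions at `v` each contain a translate of `v`. Either one of the elements works, or
both inverses point towards `z` and a quotient of the two works. -/
theorem IsOuterSpacePoint.exists_turn {A : Subgroup F} {v z : T}
    (hv : IsNatVertex (core T A) v) (hz : z ≠ v) :
    ∃ a ∈ A, v ∈ seg z (a • v) ∧ v ∈ seg z (a⁻¹ • v) ∧ a • v ≠ v := by
  have hT := hO.tree
  obtain ⟨p, hp, q, hq, hpv, hqv, hpz, hqz, hpq⟩ : ∃ p ∈ core T A, ∃ q ∈ core T A, p ≠ v ∧ q ≠ v ∧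
      v ∈ seg z p ∧ v ∈ seg z q ∧ v ∈ seg p q := by
    obtain ⟨-, p, hp, q, hq, r, hr, n1, n2, n3, h1, h2, h3⟩ := isNatVertex_iff.1 hv
    by_cases hzp : v ∈ seg z p
    · by_cases hzq : v ∈ seg z q
      · exact ⟨p, hp, q, hq, n1, n2, hzp, hzq, h1⟩
      · refine ⟨p, hp, r, hr, n1, n3, hzp, ?_, h3⟩
        by_contra hzr
        exact not_mem_seg_trans hT (not_mem_seg_symm hzq) hzr h2
    · refine ⟨q, hq, r, hr, n2, n3, ?_, ?_, h2⟩
      · by_contra hzr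
        exact not_mem_seg_trans hT (not_mem_seg_symm hzp) hzr h1
      · by_contra hzr
        exact not_mem_seg_trans hT (not_mem_seg_symm hzp) hzr h3
  obtain ⟨ε, hε, -, hsys⟩ := hO.exists_systole
  have hmin : ∀ p ∈ core T A, p ≠ v → ∃ a ∈ A, v ∉ seg p (a • v) ∧
      ∀ b ∈ A, v ∉ seg p (b • v) → dist v (a • v) < dist v (b • v) + ε := by
    intro p hp hpv
    set D := {r | ∃ a ∈ A, v ∉ seg p (a • v) ∧ dist v (a • v) = r} with hD
    obtain ⟨a0, ha0, -, h0⟩ := hO.exists_smul_dir_self hp hpv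
    have hDb : BddBelow D := ⟨0, by rintro r ⟨a, -, -, rfl⟩; exact dist_nonneg⟩
    obtain ⟨r, ⟨a, ha, h1, rfl⟩, hlt⟩ := exists_lt_of_csInf_lt (⟨_, a0, ha0, h0, rfl⟩ : D.Nonempty)
      (show sInf D < sInf D + ε by linarith)
    refine ⟨a, ha, h1, fun b hb hb' => hlt.trans_le ?_⟩
    linarith [csInf_le hDb (⟨b, hb, hb', rfl⟩ : dist v (b • v) ∈ D)]
  have hdir : ∀ {p x : T}, v ∈ seg z p → v ∉ seg p x → v ∈ seg z x := by
    intro p x h1 h2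
    by_contra h3
    exact not_mem_seg_trans hT h3 (not_mem_seg_symm h2) h1
  obtain ⟨a1, ha1, hd1, hm1⟩ := hmin p hp hpv
  obtain ⟨a2, ha2, hd2, hm2⟩ := hmin q hq hqv
  by_cases hz1 : v ∈ seg z (a1⁻¹ • v)
  · exact ⟨a1, ha1, hdir hpz hd1, hz1, (ne_of_not_mem_seg hd1).2⟩
  by_cases hz2 : v ∈ seg z (a2⁻¹ • v)
  · exact ⟨a2, ha2, hdir hqz hd2, hz2, (ne_of_not_mem_seg hd2).2⟩
  have hdist : ∀ a : F, dist v (a⁻¹ • v) = dist v (a • v) := fun a => by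
    rw [← hO.isometric a v, smul_inv_smul, dist_comm]
  -- Unless the median is an endpoint, the quotients `a1 * a2⁻¹` and `a2 * a1⁻¹` move `v` in the
  -- directions of `p` and `q`. An endpoint would give a translate in one of these directions closer
  -- by at least `ε`, contrary to the almost minimal choice.
  obtain ⟨m, h1, h2, h3⟩ := exists_median hT v (a1⁻¹ • v) (a2⁻¹ • v)
  have hne1 : ∀ {p : T} {a b : F}, v ∉ seg p (a • v) → m ∈ seg v (a⁻¹ • v) →
      m ∈ seg (a⁻¹ • v) (b⁻¹ • v) → m ≠ a⁻¹ • v → v ∉ seg p ((a * b⁻¹) • v) := by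
    intro p a b hd h1 h2 hne
    have e1 := hO.smul_mem_seg a h1
    have e2 := hO.smul_mem_seg a h2
    rw [smul_inv_smul] at e1 e2
    rw [smul_smul] at e2
    refine not_mem_seg_trans hT hd (not_mem_seg_of_common hT (m := a • m) (fun e => hne ?_)
      (mem_seg_symm e1) e2)
    rw [eq_inv_smul_iff, e]
  by_cases e1 : m = a1⁻¹ • v
  · by_cases e2 : m = a2⁻¹ • v
    · exfalso
      have : a1 = a2 := by
        by_contra hne
        refine hne ?_
        have h4 : (a2 * a1⁻¹) • v = v := by
          rw [mul_smul, ← e1, e2, smul_inv_smul]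
        have := hO.free _ v h4
        rw [mul_inv_eq_one] at this
        exact this.symm
      subst this
      exact not_mem_seg_trans hT hd1 (not_mem_seg_symm hd2) hpq
    · exfalso
      have h4 := hm2 _ (A.mul_mem ha2 (inv_mem ha1)) (hne1 hd2 h3 (mem_seg_symm h2) e2)
      have h5 : dist v (a1⁻¹ • v) + dist (a1⁻¹ • v) (a2⁻¹ • v) = dist v (a2⁻¹ • v) := by
        rw [e1] at h3
        exact h3
      have h6 : dist v ((a2 * a1⁻¹) • v) = dist (a1⁻¹ • v) (a2⁻¹ • v) := by
        rw [← hO.isometric a2 (a1⁻¹ • v), smul_inv_smul, smul_smul, dist_comm]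
      have h7 := hsys a1 (fun h => (ne_of_not_mem_seg hd1).2 (by rw [h, one_smul])) v
      rw [hdist, hdist] at h5
      linarith
  · have k1 := hne1 hd1 h1 h2 e1
    by_cases e2 : m = a2⁻¹ • v
    · exfalso
      have h4 := hm1 _ (A.mul_mem ha1 (inv_mem ha2)) k1
      have h5 : dist v (a2⁻¹ • v) + dist (a2⁻¹ • v) (a1⁻¹ • v) = dist v (a1⁻¹ • v) := by
        rw [e2] at h1
        exact h1
      have h6 : dist v ((a1 * a2⁻¹) • v) = dist (a2⁻¹ • v) (a1⁻¹ • v) := by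
        rw [← hO.isometric a1 (a2⁻¹ • v), smul_inv_smul, smul_smul, dist_comm]
      have h7 := hsys a2 (fun h => (ne_of_not_mem_seg hd2).2 (by rw [h, one_smul])) v
      rw [hdist, hdist] at h5
      linarith
    · have k2 := hne1 hd2 h3 (mem_seg_symm h2) e2
      refine ⟨a1 * a2⁻¹, A.mul_mem ha1 (inv_mem ha2), hdir hpz k1, ?_, (ne_of_not_mem_seg k1).2⟩
      rw [mul_inv_rev, inv_inv]
      exact hdir hqz k2

/-- A point `w` in both the branch beyond `z` and its translate would see `v` before `a • v` and
also `a • v` before `v`. -/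
theorem IsOuterSpacePoint.not_mem_of_turn {v z w : T} {a : F} (hz : z ≠ v)
    (h1 : v ∈ seg z (a • v)) (h2 : v ∈ seg z (a⁻¹ • v)) (h3 : a • v ≠ v) (hw : z ∈ seg v w)
    (hw' : a • z ∈ seg (a • v) w) : False := by
  have hT := hO.tree
  have k1 : v ∈ seg w (a • v) := by
    by_contra hcon
    exact not_mem_seg_trans hT (not_mem_seg_of_mem hT hz hw) hcon h1
  have k2 : a • v ∈ seg (a • z) v := by
    have := hO.smul_mem_seg a h2
    rwa [smul_inv_smul] at this
  have k3 : a • v ∈ seg w v := by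
    by_contra hcon
    refine not_mem_seg_trans hT (not_mem_seg_of_mem hT ?_ hw') hcon k2
    exact fun e => hz (MulAction.injective a e)
  exact h3 (eq_of_mem_seg_of_mem_seg k1 k3)

/-- Finiteness holds because a segment contains finitely many translates of `z`. To move a side off
itself, apply the ping-pong element of `exists_turn` at a natural vertex on the other side. -/
theorem isHalf_cut {A : Subgroup F} {v0 z p : T} (hv0 : IsNatVertex (core T A) v0)
    (hz : z ∈ core T A) (hzn : ¬ IsNatVertex (core T A) z) (hp : p ∈ core T A) (hpz : p ≠ z)
    (o : T) : IsHalf (cut A z p o) := by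
  have hT := hO.tree
  have hmem : ∀ (g a : A), a ∈ g • cut A z p o ↔ (g : F) • z ∉ seg ((g : F) • p) ((a : F) • o) := by
    intro g a
    rw [smul_cut hO]
    rfl
  refine ⟨fun g => ?_, fun a b => ?_, ?_, ?_⟩
  · rw [smul_cut hO]
    exact nested_cut hT A _ _ _ _ _
  · refine ((hO.finite_smul_mem_seg z ((a : F) • o) ((b : F) • o)).preimage
      (f := fun g : A => (g : F)) Subtype.val_injective.injOn).subset ?_
    rintro g ⟨h1, h2⟩
    rw [hmem] at h1 h2
    rw [not_not] at h2
    by_contra hcon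
    exact not_mem_seg_trans hT h1 hcon h2
  · obtain ⟨q, hq, hqz, hpq⟩ : ∃ q ∈ core T A, q ≠ z ∧ z ∈ seg p q := by
      obtain ⟨q, hq, r, hr, hqz, hrz, h⟩ := hO.exists_two_dirs hz
      rcases mem_seg_or hT p h with h1 | h1
      · exact ⟨q, hq, hqz, mem_seg_symm h1⟩
      · exact ⟨r, hr, hrz, h1⟩
    obtain ⟨v, hv, hqv, -⟩ := hO.exists_natVertex_dir hv0 hq hqz
    have hvz : z ≠ v := fun e => hzn (e ▸ hv)
    obtain ⟨a, ha, h1, h2, h3⟩ := hO.exists_turn hv hvz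
    have hpv : z ∈ seg p v := by
      by_contra hcon
      exact not_mem_seg_trans hT hcon (not_mem_seg_symm hqv) hpq
    have key : ∀ w, z ∉ seg p w → z ∈ seg v w := fun w hw => by
      by_contra hcon
      exact not_mem_seg_trans hT hw (not_mem_seg_symm hcon) hpv
    refine ⟨⟨a, ha⟩, Set.disjoint_left.2 fun b hb1 hb2 => ?_⟩
    rw [hmem] at hb1
    have hb2 : z ∉ seg p ((b : F) • o) := hb2
    refine hO.not_mem_of_turn hvz h1 h2 h3 (key _ hb2) ?_
    have := key (a⁻¹ • (b : F) • o) (by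
      rwa [← hO.smul_mem_seg_iff a, smul_inv_smul])
    rwa [← hO.smul_mem_seg_iff a, smul_inv_smul] at this
  · obtain ⟨v, hv, hpv, -⟩ := hO.exists_natVertex_dir hv0 hp hpz
    have hvz : z ≠ v := fun e => hzn (e ▸ hv)
    obtain ⟨a, ha, h1, h2, h3⟩ := hO.exists_turn hv hvz
    have key : ∀ w, z ∈ seg p w → z ∈ seg v w := fun w hw => by
      by_contra hcon
      exact not_mem_seg_trans hT hpv hcon hw
    refine ⟨⟨a, ha⟩, Set.disjoint_left.2 fun b hb1 hb2 => ?_⟩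
    rw [Set.smul_set_compl, Set.mem_compl_iff, hmem, not_not] at hb1
    have hb2 : z ∈ seg p ((b : F) • o) := not_not.1 hb2
    refine hO.not_mem_of_turn hvz h1 h2 h3 (key _ hb2) ?_
    have := key (a⁻¹ • (b : F) • o) (by
      rwa [← hO.smul_mem_seg_iff a, smul_inv_smul])
    rwa [← hO.smul_mem_seg_iff a, smul_inv_smul] at this

end Cut

/-! ### Recognising a one-edge splitting from its half-spaces -/

section Select

open scoped Pointwise

variable {Γ : Type} [Group Γ] [IsMulTorsionFree Γ]

/-- The orientation of the translates of `H` given by a choice of sides. -/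
def select (H : Set Γ) (P : Γ → Prop) : Set (Set Γ) :=
  {M | ∃ g : Γ, (M = g • H ∧ P g) ∨ (M = (g • H)ᶜ ∧ ¬ P g)}

variable {H : Set Γ} (hH : IsHalf H)
include hH

theorem smul_mem_select {P : Γ → Prop} (g : Γ) : g • H ∈ select H P ↔ P g := by
  constructor
  · rintro ⟨k, ⟨e, h⟩ | ⟨e, -⟩⟩
    · rwa [hH.eq_of_smul_eq e]
    · exact absurd e (hH.smul_ne_compl _ _)
  · exact fun h => ⟨g, Or.inl ⟨rfl, h⟩⟩

theorem compl_mem_select {P : Γ → Prop} (g : Γ) : (g • H)ᶜ ∈ select H P ↔ ¬ P g := by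
  constructor
  · rintro ⟨k, ⟨e, -⟩ | ⟨e, h⟩⟩
    · exact absurd e.symm (hH.smul_ne_compl _ _)
    · rwa [hH.eq_of_smul_eq (compl_injective e)]
  · exact fun h => ⟨g, Or.inr ⟨rfl, h⟩⟩

theorem select_inj {P Q : Γ → Prop} : select H P = select H Q ↔ ∀ g, P g ↔ Q g := by
  constructor
  · intro h g
    rw [← smul_mem_select hH (P := P), h, smul_mem_select hH]
  · intro h
    rw [funext fun g => propext (h g)]

theorem select_eq {P : Γ → Prop} {v : Set (Set Γ)} (hv : Ori (orb H) v)
    (h : ∀ g : Γ, g • H ∈ v ↔ P g) : select H P = v := by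
  ext M
  constructor
  · rintro ⟨g, ⟨rfl, h1⟩ | ⟨rfl, h1⟩⟩
    · exact (h g).2 h1
    · have := (hv.xor (g • H) ⟨g, Or.inl rfl⟩).not
      rw [not_not] at this
      exact this.1 fun h2 => h1 ((h g).1 h2)
  · intro hM
    obtain ⟨g, rfl | rfl⟩ := hv.sub hM
    · exact (smul_mem_select hH g).2 ((h g).1 hM)
    · refine (compl_mem_select hH g).2 fun h1 => ?_
      exact (hv.xor (g • H) ⟨g, Or.inl rfl⟩).1 ((h g).2 h1) hM

end Select

section Recognize

open scoped Pointwise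

variable {Γ : Type} [Group Γ] [IsMulTorsionFree Γ]

theorem smul_select {H : Set Γ} (hH : IsHalf H) {P Q : Γ → Prop} (a : Γ)
    (h : ∀ g, Q (a * g) ↔ P g) : select H Q = a • select H P := by
  ext M
  rw [Set.mem_smul_set_iff_inv_smul_mem]
  constructor
  · rintro ⟨g, ⟨rfl, h1⟩ | ⟨rfl, h1⟩⟩
    · rw [smul_smul, smul_mem_select hH, ← h, mul_inv_cancel_left]
      exact h1
    · rw [Set.smul_set_compl, smul_smul, compl_mem_select hH, ← h, mul_inv_cancel_left]
      exact h1
  · rintro ⟨g, ⟨e, h1⟩ | ⟨e, h1⟩⟩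
    · rw [inv_smul_eq_iff, smul_smul] at e
      rw [e, smul_mem_select hH, h]
      exact h1
    · rw [inv_smul_eq_iff, Set.smul_set_compl, smul_smul] at e
      rw [e, compl_mem_select hH, h]
      exact h1

/-- A one-edge splitting is determined by the sides of the translates of an edge on which its
vertices lie. -/
theorem FreeSplitting.toVertex_eq_tree (S : FreeSplitting Γ 1) {H : Set Γ} (hH : IsHalf H)
    (P : S.V → Γ → Prop) (hP : ∀ a v g, P (a • v) (a * g) ↔ P v g)
    (hinj : ∀ v w, (∀ g, P v g ↔ P w g) → v = w) {v0 v1 : S.V} (hadj : S.graph.Adj v0 v1)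
    (h0 : ∀ g : Γ, g • H ∈ vtx (orb H) H ↔ P v0 g)
    (h1 : ∀ g : Γ, g • H ∈ vtx (orb H) Hᶜ ↔ P v1 g) : S.toVertex = hH.tree := by
  have hs := hH.system
  have hself := self_mem_orb H
  have hcomp := compl_mem_orb hself
  have heq : ∀ (a : Γ) v, select H (P (a • v)) = a • select H (P v) := fun a v =>
    smul_select hH a fun g => hP a v g
  have e0 : select H (P v0) = vtx (orb H) H := select_eq hH (hs.ori_vtx hself) h0
  have e1 : select H (P v1) = vtx (orb H) Hᶜ := select_eq hH (hs.ori_vtx hcomp) h1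
  have hedge : ∀ v w, S.graph.Adj v w → ∃ a : Γ,
      (v = a • v0 ∧ w = a • v1) ∨ (v = a • v1 ∧ w = a • v0) := by
    obtain ⟨e, he, hu⟩ := S.edge_orbits
    have h2 : ∀ d ∈ S.graph.edgeSet, ∃ g : Γ, d = Sym2.map (fun v : S.V => g • v) (e 0) := by
      intro d hd
      obtain ⟨i, hi, -⟩ := hu d hd
      rwa [Subsingleton.elim i 0] at hi
    obtain ⟨b, hb⟩ := h2 s(v0, v1) hadj
    intro v w hvw
    obtain ⟨a, ha⟩ := h2 s(v, w) hvw
    have h3 : e 0 = s(b⁻¹ • v0, b⁻¹ • v1) := by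
      rw [← Sym2.map_mk, hb, Sym2.map_map]
      have : ((fun v : S.V => b⁻¹ • v) ∘ fun v : S.V => b • v) = id := by
        funext v
        simp
      rw [this, Sym2.map_id, id]
    rw [h3, Sym2.map_mk, smul_smul, smul_smul, Sym2.eq_iff] at ha
    exact ⟨_, ha⟩
  -- Every vertex has a neighbour, hence is a translate of an end of the given edge, where the
  -- choice of sides is known to be an orientation.
  have hori : ∀ v, Ori (orb H) (select H (P v)) := by
    intro v
    obtain ⟨w, -, -, hw, -⟩ := S.reduced v
    obtain ⟨a, ⟨rfl, -⟩ | ⟨rfl, -⟩⟩ := hedge v w hw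
    · rw [heq, e0]
      exact hs.ori_smul a (hs.ori_vtx hself)
    · rw [heq, e1]
      exact hs.ori_smul a (hs.ori_vtx hcomp)
  let f : S.V → Vert (orb H) := fun v => ⟨select H (P v), hori v⟩
  have hf : Function.Injective f := fun v w h =>
    hinj v w ((select_inj hH).1 (congrArg Subtype.val h))
  have hvtx : ∀ K ∈ orb H, ∃ a : Γ, (vtx (orb H) K = select H (P (a • v0)) ∧
      vtx (orb H) Kᶜ = select H (P (a • v1))) ∨
      (vtx (orb H) K = select H (P (a • v1)) ∧ vtx (orb H) Kᶜ = select H (P (a • v0))) := by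
    rintro K ⟨a, rfl | rfl⟩
    · refine ⟨a, Or.inl ⟨?_, ?_⟩⟩
      · rw [heq, e0, hs.smul_vtx]
      · rw [heq, e1, hs.smul_vtx, Set.smul_set_compl]
    · refine ⟨a, Or.inr ⟨?_, ?_⟩⟩
      · rw [heq, e1, hs.smul_vtx, Set.smul_set_compl]
      · rw [heq, e0, hs.smul_vtx, compl_compl]
  have hf' : Function.Surjective f := by
    intro v
    obtain ⟨K, hK, hv⟩ := hs.exists_eq_vtx v.2
    obtain ⟨a, ⟨h, -⟩ | ⟨h, -⟩⟩ := hvtx K hK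
    · exact ⟨a • v0, Subtype.ext (h.symm.trans hv.symm)⟩
    · exact ⟨a • v1, Subtype.ext (h.symm.trans hv.symm)⟩
  refine Quotient.sound (s := FreeSplitting.setoid Γ 1)
    ⟨Equiv.ofBijective f ⟨hf, hf'⟩, fun g v => Subtype.ext (heq g v), fun v w => ⟨?_, ?_⟩⟩
  · rintro ⟨K, hK, hv, hw⟩
    have hv : select H (P v) = _ := hv
    have hw : select H (P w) = _ := hw
    obtain ⟨a, ⟨h2, h3⟩ | ⟨h2, h3⟩⟩ := hvtx K hK
    · rw [hf (Subtype.ext (hv.trans h2) : f v = f (a • v0)),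
        hf (Subtype.ext (hw.trans h3) : f w = f (a • v1))]
      exact S.adj_smul _ _ _ hadj
    · rw [hf (Subtype.ext (hv.trans h2) : f v = f (a • v1)),
        hf (Subtype.ext (hw.trans h3) : f w = f (a • v0))]
      exact S.adj_smul _ _ _ hadj.symm
  · intro hvw
    obtain ⟨a, ⟨rfl, rfl⟩ | ⟨rfl, rfl⟩⟩ := hedge v w hvw
    · refine ⟨a • H, smul_mem_orb a hself, ?_, ?_⟩
      · change select H _ = _
        rw [heq, e0, hs.smul_vtx]
      · change select H _ = _
        rw [heq, e1, hs.smul_vtx, Set.smul_set_compl]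
    · refine ⟨(a • H)ᶜ, compl_mem_orb (smul_mem_orb a hself), ?_, ?_⟩
      · change select H _ = _
        rw [heq, e1, hs.smul_vtx, Set.smul_set_compl]
      · change select H _ = _
        rw [heq, e0, hs.smul_vtx, compl_compl]

end Recognize

/-! ### Collapsing all natural edges but one gives a cut -/

section Collapse

open scoped Pointwise

variable {T : Type*} [MetricSpace T] {F : Type} [Group F] [MulAction F T] [IsMulTorsionFree F]
  (hO : IsOuterSpacePoint F T)
include hO

/-- Two points of the complement lie in the same component if and only if they are on the same side
of every translate of `z`. So the sides of the translates determine the vertices of the collapse,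
and `toVertex_eq_tree` applies. -/
theorem IsCollapse.toVertex_eq {A : Subgroup F} {x y z : T} (hxy : IsNatEdge (core T A) x y)
    (hz : z ∈ seg x y) (hzx : z ≠ x) (hzy : z ≠ y) {S : FreeSplitting A 1}
    (hS : IsCollapse A (core T A) x y S) {o : T} (hH : IsHalf (cut A z y o)) :
    S.toVertex = hH.tree := by
  have hT := hO.tree
  have hY := core_cvx (T := T) A
  obtain ⟨p, hsurj, hsm, hfib, hadj⟩ := hS
  have hx : x ∈ complement A (core T A) x y := by
    refine ⟨hxy.1.1, fun a ha h => ?_⟩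
    by_contra hcon
    rw [not_or] at hcon
    exact hxy.2.2.2 _ h hcon.1 hcon.2 (hO.natVertex_smul ha hxy.1)
  have hy : y ∈ complement A (core T A) x y := by
    refine ⟨hxy.2.1.1, fun a ha h => ?_⟩
    by_contra hcon
    rw [not_or] at hcon
    exact hxy.2.2.2 _ h hcon.1 hcon.2 (hO.natVertex_smul ha hxy.2.1)
  have hout : ∀ g : A, g ≠ 1 → (g : F) • z ∉ seg x y := by
    intro g hg h
    have hg' : (g : F) ≠ 1 := fun e => hg (Subtype.ext e)
    have hn := hO.natEdge_smul g.2 hxy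
    have hzn : ¬ IsNatVertex (core T A) z := hxy.2.2.2 z hz hzx hzy
    have hne : ∀ u, IsNatVertex (core T A) u → (g : F) • z ≠ u := by
      intro u hu e
      have := hO.natVertex_smul (inv_mem g.2) hu
      rw [← e, inv_smul_smul] at this
      exact hzn this
    rcases hxy.eq_or_of_mem hT hY hn h (hne _ hxy.1) (hne _ hxy.2.1) (hO.smul_mem_seg (g : F) hz)
      (hne _ hn.1) (hne _ hn.2.1) with h1 | h1
    · exact hg' (hO.free _ x h1.1.symm)
    · have : ((g : F) * g) • x = x := by rw [mul_smul, ← h1.2, ← h1.1]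
      exact hg' (hO.eq_one_of_sq (hO.free _ _ this) x)
  have hcomp_smul : ∀ (a : A) w, w ∈ complement A (core T A) x y →
      (a : F) • w ∈ complement A (core T A) x y := by
    intro a w hw
    refine ⟨smul_mem_core a.2 hw.1, fun b hb h => ?_⟩
    rw [smul_smul] at h ⊢
    exact hw.2 _ (A.mul_mem hb a.2) h
  have hzn : ¬ IsNatVertex (core T A) z := hxy.2.2.2 z hz hzx hzy
  -- the sides of the translates of `z` determine the components of the complement
  have hside : ∀ w ∈ complement A (core T A) x y, ∀ w' ∈ complement A (core T A) x y,
      p w = p w' ↔ ∀ g : A, ((g : F) • z ∉ seg ((g : F) • y) w ↔ (g : F) • z ∉ seg ((g : F) • y) w') := by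
    have hsep : ∀ w w', seg w w' ⊆ complement A (core T A) x y → ∀ g : A,
        (g : F) • z ∉ seg ((g : F) • y) w → (g : F) • z ∉ seg ((g : F) • y) w' := by
      intro w w' hsub g h1 h2
      have h3 : (g : F) • z ∈ seg w w' := by
        by_contra h3
        exact not_mem_seg_trans hT h1 h3 h2
      have := (hsub h3).2 _ (inv_mem g.2)
      rw [inv_smul_smul] at this
      rcases this hz with h | h
      exacts [hzx h, hzy h]
    intro w hw w' hw'
    rw [hfib w hw w' hw']
    constructor
    · intro h g
      refine ⟨hsep w w' h g, hsep w' w (fun u hu => h (mem_seg_symm hu)) g⟩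
    · intro h u hu
      refine ⟨hY _ hw.1 _ hw'.1 hu, fun a ha hau => ?_⟩
      by_contra hcon
      rw [not_or] at hcon
      have hun := hxy.2.2.2 _ hau hcon.1 hcon.2
      have huY : a • u ∈ core T A := hxy.subset hY hau
      have hau' := hO.smul_mem_seg a hu
      -- From inside an uncollapsed edge, a path to a point of the complement must leave through one
      -- of the two ends of that edge.
      have hdir : ∀ w ∈ complement A (core T A) x y,
          x ∈ seg (a • u) (a • w) ∨ y ∈ seg (a • u) (a • w) := by
        intro w hw
        have hne : a • w ≠ a • u := by
          intro e
          have := hw.2 a ha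
          rw [e] at this
          rcases this hau with h | h
          exacts [hcon.1 h, hcon.2 h]
        have haw := smul_mem_core ha hw.1
        have hd : a • u ∉ seg x (a • w) ∨ a • u ∉ seg y (a • w) := by
          by_contra hd
          rw [not_or, not_not, not_not] at hd
          exact hun (isNatVertex_iff.2 ⟨huY, x, hxy.1.1, y, hxy.2.1.1, a • w, haw, Ne.symm hcon.1,
            Ne.symm hcon.2, hne, hau, hd.2, hd.1⟩)
        have hk : ∀ x' y', a • u ∈ seg x' y' → IsNatEdge (core T A) x' y' →
            (a • w ∈ seg x' y' → a • w = x' ∨ a • w = y') → a • u ≠ x' → a • u ≠ y' →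
            a • u ∉ seg x' (a • w) → x' ∈ seg (a • u) (a • w) := by
          intro x' y' hm he hc hux huy hn
          rcases mem_seg_or_of_no_natVertex hT hY huY he.1.1 haw hn (fun v hv hvu hvx =>
            he.2.2.2 v (mem_seg_symm (mem_seg_right hv (mem_seg_symm hm))) hvx (by
              rintro rfl
              exact huy (eq_of_mem_seg_of_mem_seg hm (mem_seg_symm hv)).symm))
            with h1 | h1
          · exact h1
          · rcases hc (mem_seg_symm (mem_seg_right h1 (mem_seg_symm hm))) with h2 | h2
            · rw [h2]; exact right_mem_seg _ _
            · rw [h2] at h1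
              exact absurd (eq_of_mem_seg_of_mem_seg hm (mem_seg_symm h1)).symm huy
        rcases hd with hd | hd
        · exact Or.inl (hk x y hau hxy (hw.2 a ha) hcon.1 hcon.2 hd)
        · exact Or.inr (hk y x (mem_seg_symm hau) hxy.symm
            (fun h => (hw.2 a ha (mem_seg_symm h)).symm) hcon.2 hcon.1 hd)
      have hfin : ∀ w w', x ∈ seg (a • u) (a • w) → y ∈ seg (a • u) (a • w') →
          z ∈ seg y (a • w) ∧ z ∉ seg y (a • w') := by
        intro w w' h1 h2
        constructor
        · exact mem_seg_left (mem_seg_symm hz)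
            (mem_seg_concat hT (mem_seg_symm hau) h1 hcon.1).1
        · exact not_mem_seg_of_mem hT hzy.symm
            (mem_seg_between hz (mem_seg_concat hT hau h2 hcon.2).1)
      have htr : ∀ w, z ∈ seg y (a • w) ↔ a⁻¹ • z ∈ seg (a⁻¹ • y) w := by
        intro w
        have := hO.smul_mem_seg_iff a (x := a⁻¹ • y) (y := w) (z := a⁻¹ • z)
        rwa [smul_inv_smul, smul_inv_smul] at this
      have hg := not_congr (h ⟨a⁻¹, inv_mem ha⟩)
      simp only [not_not, ← htr] at hg
      rcases hdir w hw with h1 | h1 <;> rcases hdir w' hw' with h2 | h2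
      · exact not_mem_seg_of_common hT (Ne.symm hcon.1) h1 h2 hau'
      · exact (hfin w w' h1 h2).2 (hg.1 (hfin w w' h1 h2).1)
      · exact (hfin w' w h2 h1).2 (hg.2 (hfin w' w h2 h1).1)
      · exact not_mem_seg_of_common hT (Ne.symm hcon.2) h1 h2 hau'
  have hgen : ∀ (g : A) {w w'}, w ∈ complement A (core T A) x y → w' ∈ complement A (core T A) x y →
      p w = p w' → ((g : F) • z ∉ seg ((g : F) • y) w ↔ (g : F) • z ∉ seg ((g : F) • y) w') :=
    fun g w w' hw hw' e => (hside w hw w' hw').1 e g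
  have hPv : ∀ w ∈ complement A (core T A) x y, ∀ g : A,
      (∃ w' ∈ complement A (core T A) x y, p w' = p w ∧ (g : F) • z ∉ seg ((g : F) • y) w') ↔
        (g : F) • z ∉ seg ((g : F) • y) w := fun w hw g =>
    ⟨fun ⟨w', hw', e, h⟩ => (hgen g hw' hw e).1 h, fun h => ⟨w, hw, rfl, h⟩⟩
  have hs := hH.system
  have hself := self_mem_orb (cut A z y o)
  -- For `g ≠ 1` the point `g • z` misses `[x, y]`, so `y` and `z` are on the same side of it and
  -- the position of `z` decides the inclusion.
  have hvy : ∀ g : A, g • cut A z y o ∈ vtx (orb (cut A z y o)) (cut A z y o) ↔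
      (g : F) • z ∉ seg ((g : F) • y) y := by
    intro g
    by_cases hg : g = 1
    · subst hg
      rw [one_smul, OneMemClass.coe_one, one_smul, one_smul]
      refine ⟨fun _ h => hzy (eq_of_mem_seg_of_mem_seg h (left_mem_seg _ _)).symm,
        fun _ => hs.self_mem_vtx hself⟩
    · have hgz := hout g hg
      have hgzy : (g : F) • z ∉ seg z y := fun h => hgz (mem_seg_right h hz)
      have hne : z ≠ (g : F) • z := fun h => hgz (h ▸ hz)
      have hM := smul_mem_orb g hself
      obtain ⟨k1, k2, k3, k4⟩ := branch_nested hT (p := y) (p' := (g : F) • y) hne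
      have hcut := smul_cut hO g z y o
      constructor
      · intro h h1
        have h2 : (g : F) • z ∈ seg ((g : F) • y) z := by
          by_contra h2
          exact not_mem_seg_trans hT h2 hgzy h1
        refine (hs.ori_vtx hself).xor _ hM |>.1 h ⟨compl_mem_orb hM, ?_⟩
        rw [hcut]
        by_cases h3 : z ∈ seg y ((g : F) • z)
        · exact Or.inl fun a ha h4 => h4 (k4 h3 h2 _ ha)
        · refine Or.inr ⟨fun a ha h4 => h4 (k3 h3 h2 _ (not_not.1 ha)), ?_⟩
          rw [← hcut]
          intro e
          exact hg (hH.free (compl_injective e))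
      · intro h1
        have h2 : (g : F) • z ∉ seg ((g : F) • y) z :=
          not_mem_seg_trans hT h1 (not_mem_seg_symm hgzy)
        refine ⟨hM, ?_⟩
        by_cases h3 : z ∈ seg y ((g : F) • z)
        · rw [hcut]
          exact Or.inl fun a ha => k2 h3 h2 _ ha
        · refine Or.inr ⟨?_, hH.no_inv g⟩
          rw [hcut]
          exact fun a ha => k1 h3 h2 _ (not_not.1 ha)
  refine S.toVertex_eq_tree hH
    (fun v g => ∃ w ∈ complement A (core T A) x y, p w = v ∧ (g : F) • z ∉ seg ((g : F) • y) w)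
    (fun a v g => ?_) (fun v w h => ?_) hadj.symm (fun g => ?_) (fun g => ?_)
  · obtain ⟨w, hw, rfl⟩ := hsurj v
    rw [← hsm a w hw]
    change (∃ w' ∈ complement A (core T A) x y, p w' = p ((a : F) • w) ∧ _) ↔ _
    rw [hPv _ (hcomp_smul a w hw), hPv w hw, Subgroup.coe_mul, mul_smul, mul_smul,
      hO.smul_mem_seg_iff]
  · obtain ⟨v, hv, rfl⟩ := hsurj v
    obtain ⟨w, hw, rfl⟩ := hsurj w
    refine (hside v hv w hw).2 fun g => ?_
    rw [← hPv v hv, ← hPv w hw]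
    exact h g
  · rw [hPv y hy, hvy]
  · rw [hPv x hx]
    by_cases hg : g = 1
    · subst hg
      rw [one_smul, OneMemClass.coe_one, one_smul, one_smul]
      exact ⟨fun h => absurd h (hs.notMem_vtx_compl hself), fun h => absurd (mem_seg_symm hz) h⟩
    · rw [hs.mem_vtx_compl hself (fun e => hg (hH.free e)) (hH.no_inv g), hvy]
      have := hout g hg
      exact ⟨fun h => not_mem_seg_trans hT h (not_mem_seg_symm this),
        fun h => not_mem_seg_trans hT h this⟩

end Collapse

/-! ### Comparing cuts; cuts given by germs -/

section CutDistance

open scoped Pointwise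

variable {T : Type*} [MetricSpace T] {F : Type} [Group F] [MulAction F T] [IsMulTorsionFree F]
  (hO : IsOuterSpacePoint F T)
include hO

theorem edist_cut_le_one {A : Subgroup F} {z p z' p' o : T} (h : IsHalf (cut A z p o))
    (h' : IsHalf (cut A z' p' o)) : (splittingGraph A).edist h.tree h'.tree ≤ 1 := by
  refine h.edist_le_one h' fun g => ?_
  rw [smul_cut hO]
  exact nested_cut hO.tree _ _ _ _ _ _

theorem IsCollapse.exists_cut {A : Subgroup F} {x y : T} (hxy : IsNatEdge (core T A) x y)
    {S : FreeSplitting A 1} (hS : IsCollapse A (core T A) x y S) (o : T) :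
    ∃ z, ∃ h : IsHalf (cut A z y o), S.toVertex = h.tree := by
  have hd : 0 < dist x y := dist_pos.2 hxy.2.2.1
  obtain ⟨z, hz, hxz⟩ := exists_mem_seg_dist hO.tree (x := x) (y := y) (r := dist x y / 2)
    (by linarith) (by linarith)
  have hzx : z ≠ x := by
    rintro rfl
    rw [dist_self] at hxz
    linarith
  have hzy : z ≠ y := by
    rintro rfl
    linarith
  exact ⟨z, isHalf_cut hO hxy.1 (hxy.subset (core_cvx A) hz) (hxy.2.2.2 z hz hzx hzy) hxy.2.1.1
    hzy.symm o, hS.toVertex_eq hO hxy hz hzx hzy _⟩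

/-- A point `c` so close to `x` that no branching occurs before it separates exactly the translates
of `x` in one direction at `x`. The resulting half-space is described by a germ at `x` alone, which
can be compared between different times. -/
theorem IsOuterSpacePoint.exists_germ_cut {A : Subgroup F} {x : T} (hx : x ∈ core T A) {a0 : F}
    (ha0 : a0 ∈ A) (h1 : a0 ≠ 1) : ∃ c ∈ core T A, ¬ IsNatVertex (core T A) c ∧ a0 • x ≠ c ∧
      ∀ a ∈ A, c ∉ seg (a0 • x) (a • x) ↔ a ≠ 1 ∧ x ∉ seg (a0 • x) (a • x) := by
  have hT := hO.tree
  obtain ⟨ε, hε, -, hsys⟩ := hO.exists_systole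
  obtain ⟨r, hr, hdisc⟩ := hO.discrete x
  have hm := lt_min hε hr
  have hm1 := min_le_left ε r
  have hm2 := min_le_right ε r
  have hax := smul_mem_core ha0 hx
  have hdx := hsys a0 h1 x
  obtain ⟨c, hc, hxc⟩ := exists_mem_seg_dist hT (x := x) (y := a0 • x) (r := min ε r / 2)
    (by linarith) (by linarith)
  have hcx : c ≠ x := by
    rintro rfl
    rw [dist_self] at hxc
    linarith
  refine ⟨c, core_cvx A _ hx _ hax hc, fun h => hdisc c hcx (by linarith)
    (h.mono (Set.subset_univ _)), ?_, fun a ha => ⟨fun h => ⟨?_, fun h2 => ?_⟩, ?_⟩⟩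
  · rintro rfl
    linarith
  · rintro rfl
    rw [one_smul] at h
    exact h (mem_seg_symm hc)
  · exact h (mem_seg_left (mem_seg_symm hc) h2)
  · rintro ⟨ha1, h2⟩
    obtain ⟨m, k1, k2, k3⟩ := exists_median hT x (a0 • x) (a • x)
    have hmx : m ≠ x := by
      rintro rfl
      exact h2 k2
    have hdm : min ε r ≤ dist x m := by
      by_cases e1 : m = a0 • x
      · rw [e1]; linarith
      by_cases e2 : m = a • x
      · rw [e2]; linarith [hsys a ha1 x]
      by_contra hcon
      exact hdisc m hmx (by linarith) (isNatVertex_of_median Cvx.univ (Set.mem_univ x)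
        (Set.mem_univ (a0 • x)) (Set.mem_univ (a • x)) k1 k2 k3 hmx e1 e2)
    have hcm : c ∈ seg x m := mem_seg_of_dist_le hT hc k1 (by linarith)
    have hne : m ≠ c := by
      rintro rfl
      linarith
    exact not_mem_seg_of_common hT hne (mem_seg_between hcm k1) (mem_seg_between hcm k3)

end CutDistance

/-! ### The image of the first segment -/

namespace FoldingPath

open scoped Pointwise

variable {n : ℕ} {α ω : ℝ} (G : FoldingPath.{u} n α ω) (A : Subgroup (FreeGroup (Fin n)))

/-- One step from the given splitting at time `s` to the germ cut at `y`, one to the germ cut at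
`x`, and one to the given splitting at time `t`. Outer steps compare cuts of one tree. The middle
one uses `exists_germ`. -/
theorem edist_le_of_bad_aux {s t : Set.Icc α ω} (h : s ≤ t) (ht : G.Bad A t) {σ τ : SplittingVertex A}
    (hσ : σ ∈ G.proj A s) (hτ : τ ∈ G.proj A t) : (splittingGraph A).edist σ τ ≤ 3 := by
  have hOs := G.outer s
  have hOt := G.outer t
  have hT := hOt.tree
  obtain ⟨x, hx, hone⟩ := ht
  obtain ⟨y, hy, hxy⟩ := exists_germ h hx hone
  obtain ⟨u1, u2, hu, S, hS, rfl⟩ := hσ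
  obtain ⟨w1, w2, hw, S', hS', rfl⟩ := hτ
  obtain ⟨z, hz, e1⟩ := hS.exists_cut hOs hu y
  obtain ⟨z', hz', e2⟩ := hS'.exists_cut hOt hw x
  obtain ⟨a0, ha0, h1⟩ := hOs.exists_ne_one hy
  obtain ⟨c, hc, hcn, hca, hcut⟩ := hOs.exists_germ_cut hy ha0 h1
  obtain ⟨d, hd, hdn, hda, hdcut⟩ := hOt.exists_germ_cut hx ha0 h1
  have Hs := isHalf_cut hOs hu.1 hc hcn (smul_mem_core ha0 hy) hca y
  have Ht := isHalf_cut hOt hw.1 hd hdn (smul_mem_core ha0 hx) hda x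
  have hmem_s : ∀ a : A, a ∈ cut A c (a0 • y) y ↔ (a : FreeGroup (Fin n)) ≠ 1 ∧
      y ∉ seg (a0 • y) ((a : FreeGroup (Fin n)) • y) := fun a => hcut a a.2
  have hmem_t : ∀ a : A, a ∈ cut A d (a0 • x) x ↔ (a : FreeGroup (Fin n)) ≠ 1 ∧
      x ∉ seg (a0 • x) ((a : FreeGroup (Fin n)) • x) := fun a => hdcut a a.2
  -- A set of nontrivial elements that move `x` into a single direction also moves `y` into a single
  -- direction, by `exists_germ`. It is then contained in the germ cut at `y` or disjoint from it.
  have hside : ∀ X : Set A, (∀ a ∈ X, (a : FreeGroup (Fin n)) ≠ 1 ∧ ∀ b ∈ X,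
      x ∉ seg ((a : FreeGroup (Fin n)) • x) ((b : FreeGroup (Fin n)) • x)) →
      Nested (cut A c (a0 • y) y) X := by
    intro X hX
    refine Nested.symm ?_
    by_cases hne : ∃ a ∈ X, a ∈ cut A c (a0 • y) y
    · left
      obtain ⟨a, ha, ha'⟩ := hne
      intro b hb
      rw [hmem_s] at ha' ⊢
      refine ⟨(hX b hb).1, not_mem_seg_trans hOs.tree ha'.2 fun hcon => ?_⟩
      exact (hX a ha).2 b hb (hxy a a.2 b b.2 (hX a ha).1 (hX b hb).1 hcon)
    · right; left
      exact fun b hb hb' => hne ⟨b, hb, hb'⟩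
  have hmid : (splittingGraph A).edist Hs.tree Ht.tree ≤ 1 := by
    refine Hs.edist_le_one Ht fun g => ?_
    by_cases hg : g = 1
    · subst hg
      rw [one_smul]
      refine hside _ fun a ha => ?_
      rw [hmem_t] at ha
      refine ⟨ha.1, fun b hb => ?_⟩
      rw [hmem_t] at hb
      exact not_mem_seg_trans hT (not_mem_seg_symm ha.2) hb.2
    have hg' : (g : FreeGroup (Fin n)) ≠ 1 := fun e => hg (Subtype.ext e)
    have hgx := hOt.smul_ne hg' x
    have hmem_g : ∀ a : A, a ∈ g • cut A d (a0 • x) x ↔ a ≠ g ∧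
        (g : FreeGroup (Fin n)) • x ∉ seg ((g : FreeGroup (Fin n)) • a0 • x)
          ((a : FreeGroup (Fin n)) • x) := by
      intro a
      rw [Set.mem_smul_set_iff_inv_smul_mem, hmem_t, smul_eq_mul, Subgroup.coe_mul,
        Subgroup.coe_inv, ← hOt.smul_mem_seg_iff (g : FreeGroup (Fin n)), mul_smul, smul_inv_smul,
        Ne, inv_mul_eq_one]
      refine and_congr_left fun _ => not_congr ⟨fun e => Subtype.ext e.symm, fun e => by rw [e]⟩
    -- For `g ≠ 1`, the side of the translated cut that lies beyond `g • x` is contained in one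
    -- direction at `x`. It is the translate itself or its complement, according to the position of
    -- `x`.
    have hfin : ∀ X : Set A, (∀ a ∈ X,
        (g : FreeGroup (Fin n)) • x ∈ seg x ((a : FreeGroup (Fin n)) • x)) →
        Nested (cut A c (a0 • y) y) X := by
      intro X hX
      refine hside X fun a ha => ⟨fun e => ?_, fun b hb => ?_⟩
      · have := hX a ha
        rw [e, one_smul] at this
        exact hgx (eq_of_mem_seg_of_mem_seg this (left_mem_seg _ _)).symm
      · exact not_mem_seg_of_common hT hgx (hX a ha) (hX b hb)
    by_cases hcase : (g : FreeGroup (Fin n)) • x ∈ seg ((g : FreeGroup (Fin n)) • a0 • x) x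
    · refine hfin _ fun a ha => ?_
      rw [hmem_g] at ha
      by_contra hcon
      exact not_mem_seg_trans hT ha.2 (not_mem_seg_symm hcon) hcase
    · rw [← compl_compl (g • cut A d (a0 • x) x)]
      refine Nested.compl_right (hfin _ fun a ha => ?_)
      rw [Set.mem_compl_iff, hmem_g, not_and_or, not_not, not_not] at ha
      rcases ha with rfl | ha
      · exact right_mem_seg _ _
      · by_contra hcon
        exact not_mem_seg_trans hT hcase hcon ha
  have k1 := edist_cut_le_one hOs hz Hs
  have k2 := edist_cut_le_one hOt Ht hz'
  rw [e1, e2]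
  calc (splittingGraph A).edist hz.tree hz'.tree
      ≤ (splittingGraph A).edist hz.tree Hs.tree + (splittingGraph A).edist Hs.tree Ht.tree
        + (splittingGraph A).edist Ht.tree hz'.tree :=
        SimpleGraph.edist_triangle.trans (add_le_add_left SimpleGraph.edist_triangle _)
    _ ≤ 1 + 1 + 1 := add_le_add (add_le_add k1 hmid) k2
    _ = 3 := by norm_num

theorem edist_le_of_bad {s t : Set.Icc α ω} (hs : G.Bad A s) (ht : G.Bad A t)
    {σ τ : SplittingVertex A} (hσ : σ ∈ G.proj A s) (hτ : τ ∈ G.proj A t) :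
    (splittingGraph A).edist σ τ ≤ 3 := by
  rcases le_total s t with h | h
  · exact G.edist_le_of_bad_aux A h ht hσ hτ
  · rw [SimpleGraph.edist_comm]
    exact G.edist_le_of_bad_aux A h hs hτ hσ

end FoldingPath

/-! ### Interior points of natural edges -/

section Interior

variable {T : Type*} [MetricSpace T]

theorem ne_left_of_mem_seg (hT : IsRealTree T) {x y a b z : T} (ha : a ∈ seg x y) (hb : b ∈ seg x y)
    (hz : z ∈ seg a b) (hza : z ≠ a) (hzb : z ≠ b) : z ≠ x := by
  rintro rfl
  rcases le_total (dist z a) (dist z b) with h | h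
  · exact hza (eq_of_mem_seg_of_mem_seg (mem_seg_symm (mem_seg_of_dist_le hT ha hb h))
      (mem_seg_symm hz))
  · exact hzb (eq_of_mem_seg_of_mem_seg (mem_seg_symm (mem_seg_of_dist_le hT hb ha h)) hz)

theorem IsNatEdge.not_natVertex (hT : IsRealTree T) {Y : Set T} {x y a b z : T} (h : IsNatEdge Y x y)
    (ha : a ∈ seg x y) (hb : b ∈ seg x y) (hz : z ∈ seg a b) (hza : z ≠ a) (hzb : z ≠ b) :
    ¬ IsNatVertex Y z :=
  h.2.2.2 z (seg_subset_of_mem hT ha hb hz) (ne_left_of_mem_seg hT ha hb hz hza hzb)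
    (ne_left_of_mem_seg hT (mem_seg_symm ha) (mem_seg_symm hb) hz hza hzb)

end Interior

/-! ### Half-spaces force a natural vertex -/

section Line

open scoped Pointwise

variable {T : Type*} [MetricSpace T] {F : Type} [Group F] [MulAction F T]
  (hO : IsOuterSpacePoint F T)
include hO

/-- A core without natural vertices is a line on which `g` translates. Translated sides are then
contained in one another, so no translate of a side is disjoint from it. -/
theorem exists_natVertex_of_isHalf [IsMulTorsionFree F] {A : Subgroup F} {z p o : T}
    (hz : z ∈ core T A) (hp : p ∈ core T A) (h : IsHalf (cut A z p o)) :
    ∃ v, IsNatVertex (core T A) v := by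
  have hT := hO.tree
  have hY := core_cvx (T := T) A
  by_contra! hno
  obtain ⟨g, hg⟩ := h.move
  have hne := h.nonempty
  have hg1 : (g : F) ≠ 1 := by
    intro e
    have e : g = 1 := Subtype.ext e
    rw [e, one_smul, disjoint_self] at hg
    exact hne.ne_empty hg
  have hgz := hO.smul_ne hg1 z
  have hgzY := smul_mem_core g.2 hz
  have hggY := smul_mem_core g.2 hgzY
  have hdist : dist ((g : F) • z) ((g : F) • (g : F) • z) = dist ((g : F) • z) z := by
    rw [hO.isometric, dist_comm]
  have htr : (g : F) • z ∈ seg z ((g : F) • (g : F) • z) := by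
    by_contra hcon
    have : (g : F) • (g : F) • z = z := by
      rcases mem_seg_or_of_no_natVertex hT hY hgzY hz hggY hcon (fun v _ _ _ => hno v) with h1 | h1
      · rw [mem_seg, hdist] at h1
        exact (dist_eq_zero.1 (by linarith)).symm
      · rw [mem_seg, hdist] at h1
        exact dist_eq_zero.1 (by linarith)
    rw [smul_smul] at this
    exact hg1 (hO.eq_one_of_sq (hO.free _ _ this) z)
  rw [smul_cut hO] at hg
  have hkey : (cut A z p o ⊆ cut A ((g : F) • z) ((g : F) • p) o) ∨
      (cut A ((g : F) • z) ((g : F) • p) o ⊆ cut A z p o) := by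
    by_cases h1 : z ∈ seg p ((g : F) • z)
    · left
      have h2 : (g : F) • z ∉ seg ((g : F) • p) z := by
        by_cases hpz : p = z
        · obtain ⟨a, ha⟩ := h.nonempty
          exact absurd (hpz ▸ left_mem_seg p _) ha
        have h3 := hO.smul_mem_seg (g : F) h1
        intro h4
        refine hno _ (isNatVertex_iff.2 ⟨hgzY, _, smul_mem_core g.2 hp, _, hggY, z, hz,
          fun e => hpz (MulAction.injective _ e), hO.smul_ne hg1 _, hgz.symm, h3,
          mem_seg_symm htr, h4⟩)
      exact fun a ha => (branch_nested hT hgz.symm).2.1 h1 h2 _ ha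
    · right
      have h2 : (g : F) • z ∈ seg ((g : F) • p) z := by
        have h3 := (hO.smul_mem_seg_iff (g : F)).not.2 h1
        by_contra h4
        exact not_mem_seg_trans hT (not_mem_seg_symm h4) h3 htr
      exact fun a ha => (branch_nested hT hgz).2.1 h2 h1 _ ha
  rcases hkey with hk | hk
  · obtain ⟨a, ha⟩ := hne
    exact Set.disjoint_left.1 hg (hk ha) ha
  · rw [← smul_cut hO] at hk hg
    obtain ⟨a, ha⟩ := hne
    have := Set.smul_mem_smul_set (a := g) ha
    exact Set.disjoint_left.1 hg this (hk this)

end Line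

/-! ### Long legal segments persist and fix a splitting -/

namespace FoldingPath

open scoped Pointwise

variable {n : ℕ} {α ω : ℝ} {G : FoldingPath.{u} n α ω} {A : Subgroup (FreeGroup (Fin n))}
  {s t : Set.Icc α ω}

/-- If `w` lies beyond `p`, the image path cancels by at most `c - 1` at `p`, which does not reach
back to the image of `ν`. If `w` lies on `[ν, p]`, legality gives the claim. -/
theorem map_not_mem_seg (h : s ≤ t) {x y p q ν w : G.T s} (hxy : IsNatEdge (G.sub A s) x y)
    (hp : p ∈ seg x y) (hq : q ∈ seg x y) (hl : G.Legal s p q) (hν : ν ∈ seg p q)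
    (hd : Real.exp ((t : ℝ) - s) - 1 < Real.exp ((t : ℝ) - s) * dist p ν) (hw : w ∈ G.sub A s)
    (hpw : ν ∉ seg p w) : G.map s t h ν ∉ seg (G.map s t h p) (G.map s t h w) := by
  have hT := (G.outer s).tree
  have hT' := (G.outer t).tree
  have hY := core_cvx (T := G.T s) A
  have hνxy : ν ∈ seg x y := seg_subset_of_mem hT hp hq hν
  have hl' := hl.sub hν (left_mem_seg _ _)
  obtain ⟨-, hwν⟩ := ne_of_not_mem_seg hpw
  rcases mem_seg_or_of_no_natVertex hT hY (hxy.subset hY hνxy) (hxy.subset hY hp) hw hpw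
    (fun z hz h1 h2 => hxy.not_natVertex hT hνxy hp hz h1 h2) with h1 | h1
  · obtain ⟨m, k0, k1, k2, k3⟩ := (G.bcc h).exists_near hT hT' (Real.exp_pos _) (G.isFolding h).lip h1
    refine not_mem_seg_of_common hT' (fun e => ?_) k1 k0
    have h2 : dist (G.map s t h ν) (G.map s t h p) = _ := (hl'.str h).1
    rw [e, dist_comm, h2, dist_comm] at k3
    linarith
  · exact not_mem_seg_symm (not_mem_seg_of_mem hT' ((hl'.sub h1 (left_mem_seg _ _)).map_ne h hwν)
      (hl'.map_mem h h1))

theorem not_mem_seg_map_iff (h : s ≤ t) {x y p q ν w : G.T s} (hxy : IsNatEdge (G.sub A s) x y)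
    (hp : p ∈ seg x y) (hq : q ∈ seg x y) (hl : G.Legal s p q) (hν : ν ∈ seg p q)
    (hd : Real.exp ((t : ℝ) - s) - 1 < Real.exp ((t : ℝ) - s) * dist p ν)
    (hd' : Real.exp ((t : ℝ) - s) - 1 < Real.exp ((t : ℝ) - s) * dist q ν) (hw : w ∈ G.sub A s) :
    (ν ∉ seg p w ↔ G.map s t h ν ∉ seg (G.map s t h p) (G.map s t h w)) ∧
      (w ≠ ν → ν ∉ seg p w ∨ ν ∉ seg q w) := by
  have hT := (G.outer s).tree
  have hT' := (G.outer t).tree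
  have hY := core_cvx (T := G.T s) A
  have hc := one_le_exp h
  have hpν : p ≠ ν := by
    rintro rfl
    rw [dist_self] at hd
    linarith
  have hqν : q ≠ ν := by
    rintro rfl
    rw [dist_self] at hd'
    linarith
  have hνn := hxy.not_natVertex hT hp hq hν hpν.symm hqν.symm
  have hνY := hxy.subset hY (seg_subset_of_mem hT hp hq hν)
  have htwo : w ≠ ν → ν ∉ seg p w ∨ ν ∉ seg q w := fun hwν =>
    two_of_not_natVertex hνn hνY (hxy.subset hY hp) (hxy.subset hY hq) hw hwν hpν hqν hν
  refine ⟨⟨map_not_mem_seg h hxy hp hq hl hν hd hw, fun h1 h2 => ?_⟩, htwo⟩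
  by_cases hwν : w = ν
  · rw [hwν] at h1
    exact h1 (right_mem_seg _ _)
  · have h3 := (htwo hwν).resolve_left (not_not.2 h2)
    have h4 := map_not_mem_seg h hxy hq hp hl.symm (mem_seg_symm hν) hd' hw h3
    exact not_mem_seg_trans hT' h1 (not_mem_seg_symm h4) (hl.map_mem h hν)

/-- Every core direction at the image lifts to a direction at `ν`, of which there are two, and lifts
on the same side have images on the same side. -/
theorem not_natVertex_map (h : s ≤ t) {x y p q ν : G.T s} (hxy : IsNatEdge (G.sub A s) x y)
    (hp : p ∈ seg x y) (hq : q ∈ seg x y) (hl : G.Legal s p q) (hν : ν ∈ seg p q)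
    (hd : Real.exp ((t : ℝ) - s) - 1 < Real.exp ((t : ℝ) - s) * dist p ν)
    (hd' : Real.exp ((t : ℝ) - s) - 1 < Real.exp ((t : ℝ) - s) * dist q ν) :
    ¬ IsNatVertex (G.sub A t) (G.map s t h ν) := by
  intro hn
  have hT' := (G.outer t).tree
  obtain ⟨-, p1, h1, p2, h2, p3, h3, n1, n2, n3, k1, k2, k3⟩ := isNatVertex_iff.1 hn
  have key : ∀ p' ∈ G.sub A t, p' ≠ G.map s t h ν →
      G.map s t h ν ∉ seg (G.map s t h p) p' ∨ G.map s t h ν ∉ seg (G.map s t h q) p' := by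
    intro p' hp' hne
    obtain ⟨w, hw, rfl⟩ := G.sub_subset_image h hp'
    have hwν : w ≠ ν := fun e => hne (e ▸ rfl)
    rcases (not_mem_seg_map_iff h hxy hp hq hl hν hd hd' hw).2 hwν with h4 | h4
    · exact Or.inl (map_not_mem_seg h hxy hp hq hl hν hd hw h4)
    · exact Or.inr (map_not_mem_seg h hxy hq hp hl.symm (mem_seg_symm hν) hd' hw h4)
  have hcl : ∀ {r a b : G.T t}, G.map s t h ν ∈ seg a b → G.map s t h ν ∉ seg r a →
      G.map s t h ν ∉ seg r b → False := fun hab ha hb =>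
    not_mem_seg_trans hT' (not_mem_seg_symm ha) hb hab
  rcases key p1 h1 n1 with e1 | e1 <;> rcases key p2 h2 n2 with e2 | e2 <;>
    rcases key p3 h3 n3 with e3 | e3
  · exact hcl k1 e1 e2
  · exact hcl k1 e1 e2
  · exact hcl k3 e1 e3
  · exact hcl k2 e2 e3
  · exact hcl k2 e2 e3
  · exact hcl k3 e1 e3
  · exact hcl k1 e1 e2
  · exact hcl k1 e1 e2

/-- The midpoint of a long legal segment. -/
theorem HasLongLegalSegment.exists_mid (hlong : G.HasLongLegalSegment A s) :
    ∃ x y p q ν, IsNatEdge (G.sub A s) x y ∧ p ∈ seg x y ∧ q ∈ seg x y ∧ G.Legal s p q ∧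
      ν ∈ seg p q ∧ 1 ≤ dist p ν ∧ dist q ν = dist p ν := by
  obtain ⟨x, y, hxy, p, hp, q, hq, hd, hleg⟩ := hlong
  have hT := (G.outer s).tree
  obtain ⟨ν, hν, hpν⟩ := exists_mem_seg_dist hT (x := p) (y := q) (r := dist p q / 2)
    (by linarith) (by linarith)
  have h1 := hν
  rw [mem_seg, dist_comm ν q] at h1
  exact ⟨x, y, p, q, ν, hxy, hp, hq, str_of_legal hT (G.outer _).tree (Real.exp_pos _)
    (G.isFolding_toEnd s).slope hleg, hν, by linarith, by linarith⟩

/-- This equality of subsets of `A` is why the splitting does not change along the last segment. -/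
theorem cut_map (h : s ≤ t) {x y p q ν o : G.T s} (hxy : IsNatEdge (G.sub A s) x y)
    (hp : p ∈ seg x y) (hq : q ∈ seg x y) (hl : G.Legal s p q) (hν : ν ∈ seg p q)
    (hd : Real.exp ((t : ℝ) - s) - 1 < Real.exp ((t : ℝ) - s) * dist p ν)
    (hd' : Real.exp ((t : ℝ) - s) - 1 < Real.exp ((t : ℝ) - s) * dist q ν) (ho : o ∈ G.sub A s) :
    cut A (G.map s t h ν) (G.map s t h p) (G.map s t h o) = cut A ν p o := by
  ext a
  change _ ∉ _ ↔ _ ∉ _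
  rw [← G.map_smul]
  exact ((not_mem_seg_map_iff h hxy hp hq hl hν hd hd' (smul_mem_core a.2 ho)).1).symm

theorem exists_half_mid {x y p q ν : G.T s} (hxy : IsNatEdge (G.sub A s) x y)
    (hp : p ∈ seg x y) (hq : q ∈ seg x y) (hν : ν ∈ seg p q) (hd : 1 ≤ dist p ν)
    (hd' : dist q ν = dist p ν) (o : G.T s) : IsHalf (cut A ν p o) := by
  have hT := (G.outer s).tree
  have hY := core_cvx (T := G.T s) A
  have hpν : p ≠ ν := by
    rintro rfl
    rw [dist_self] at hd
    linarith
  have hqν : q ≠ ν := by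
    rintro rfl
    rw [dist_self] at hd'
    linarith
  exact isHalf_cut (G.outer s) hxy.1 (hxy.subset hY (seg_subset_of_mem hT hp hq hν))
    (hxy.not_natVertex hT hp hq hν hpν.symm hqν.symm) (hxy.subset hY hp) hpν o

theorem exp_lt_of_one_le (h : s ≤ t) {d : ℝ} (hd : 1 ≤ d) :
    Real.exp ((t : ℝ) - s) - 1 < Real.exp ((t : ℝ) - s) * d := by
  nlinarith [one_le_exp h]

/-- Both splittings are one step from the common cut at the midpoint of the long segment. -/
theorem edist_le_of_long (h : s ≤ t) (hs : ¬ G.Bad A s) (hlong : G.HasLongLegalSegment A s)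
    {σ τ : SplittingVertex A} (hσ : σ ∈ G.proj A s) (hτ : τ ∈ G.proj A t) :
    (splittingGraph A).edist σ τ ≤ 2 := by
  obtain ⟨x, y, p, q, ν, hxy, hp, hq, hl, hν, hd, hd'⟩ := hlong.exists_mid
  obtain ⟨u1, u2, hu, S, hS, rfl⟩ := hσ
  obtain ⟨w1, w2, hw, S', hS', rfl⟩ := hτ
  have ho := hxy.1.1
  obtain ⟨z, hz, e1⟩ := hS.exists_cut (G.outer s) hu x
  obtain ⟨z', hz', e2⟩ := hS'.exists_cut (G.outer t) hw (G.map s t h x)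
  have H := exists_half_mid hxy hp hq hν hd hd' x
  have k1 := edist_cut_le_one (G.outer s) hz H
  have hcut := cut_map h hxy hp hq hl hν (exp_lt_of_one_le h hd) (exp_lt_of_one_le h (by rw [hd']; exact hd)) ho
  have H' : IsHalf (cut A (G.map s t h ν) (G.map s t h p) (G.map s t h x)) := hcut ▸ H
  have k2 := edist_cut_le_one (G.outer t) H' hz'
  have hHH : H'.tree = H.tree := H.tree_eq_of_mem H' (hcut ▸ self_mem_orb _)
  rw [hHH] at k2
  rw [e1, e2]
  calc (splittingGraph A).edist hz.tree hz'.tree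
      ≤ (splittingGraph A).edist hz.tree H.tree + (splittingGraph A).edist H.tree hz'.tree :=
        SimpleGraph.edist_triangle
    _ ≤ 1 + 1 := add_le_add k1 k2
    _ = 2 := by norm_num

/-- If the next natural vertex came earlier, it would be the image of a point strictly between `p1`
and `ν`. Such a point is still far enough from `p` and `q` for `not_natVertex_map` to exclude this.
-/
theorem map_mem_seg_natVertex (h : s ≤ t) (hs : ¬ G.Bad A s) {x y p q ν p1 : G.T s} {u : G.T t}
    (hxy : IsNatEdge (G.sub A s) x y) (hp : p ∈ seg x y) (hq : q ∈ seg x y) (hl : G.Legal s p q)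
    (hν : ν ∈ seg p q) (hd : 1 ≤ dist p ν) (hd' : dist q ν = dist p ν)
    (hu : IsNatVertex (G.sub A t) u) (hpu : G.map s t h ν ∉ seg (G.map s t h p) u)
    (hn : ∀ z ∈ seg (G.map s t h ν) u, z ≠ G.map s t h ν → z ≠ u → ¬ IsNatVertex (G.sub A t) z)
    (hp1 : p1 ∈ seg p ν)
    (hpp : Real.exp ((t : ℝ) - s) * dist p p1 = Real.exp ((t : ℝ) - s) - 1) :
    G.map s t h p1 ∈ seg (G.map s t h ν) u := by
  have hT := (G.outer s).tree
  have hT' := (G.outer t).tree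
  have hY := core_cvx (T := G.T s) A
  have hYt := core_cvx (T := G.T t) A
  have hνY := hxy.subset hY (seg_subset_of_mem hT hp hq hν)
  have hp1pq : p1 ∈ seg p q := mem_seg_left hp1 hν
  have hp1Y := hxy.subset hY (seg_subset_of_mem hT hp hq hp1pq)
  have hlt := exp_lt_of_one_le h hd
  have hne : p1 ≠ ν := by
    rintro rfl
    linarith
  have hne' := (hl.sub hp1pq hν).map_ne h hne
  have h1 : G.map s t h ν ∉ seg (G.map s t h p1) u :=
    not_mem_seg_trans hT' (not_mem_seg_of_mem hT' hne'
      ((hl.sub hν (left_mem_seg _ _)).map_mem h (mem_seg_symm hp1))) hpu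
  rcases mem_seg_or_of_no_natVertex hT' hYt (map_mem_of_not_bad h hs hνY) hu.1
    (map_mem_of_not_bad h hs hp1Y) (not_mem_seg_symm h1) hn with h2 | h2
  · obtain ⟨ν', hν', rfl⟩ := exists_mem_seg_map_eq hT hT' (Real.exp_pos _) (G.isFolding h).lip h2
    by_cases e : ν' = p1
    · rw [e]; exact right_mem_seg _ _
    · exfalso
      have k1 : ν' ∈ seg p ν := mem_seg_right (mem_seg_symm hν') hp1
      have k2 : p1 ∈ seg p ν' := mem_seg_between' (mem_seg_symm hν') hp1
      have k3 : ν ∈ seg ν' q := mem_seg_between k1 hν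
      have k4 := dist_le_of_mem_seg' k3
      refine not_natVertex_map h hxy hp hq hl (mem_seg_left k1 hν) ?_ ?_ hu
      · rw [mem_seg] at k2
        rw [← k2, mul_add, hpp]
        have := mul_pos (Real.exp_pos ((t : ℝ) - s)) (dist_pos.2 (Ne.symm e))
        linarith
      · refine exp_lt_of_one_le h ?_
        rw [dist_comm] at k4
        rw [dist_comm q]
        linarith [dist_comm q ν]
  · exact h2

/-- Cut off length `(c - 1) / c` at each end. What remains maps into a single topological edge and
has length `2 * c * d - 2 * (c - 1)`, where `d ≥ 1` is half of the original length. This is at least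
2. -/
theorem hasLong_mono (h : s ≤ t) (hs : ¬ G.Bad A s) (hlong : G.HasLongLegalSegment A s) :
    G.HasLongLegalSegment A t := by
  obtain ⟨x, y, p, q, ν, hxy, hp, hq, hl, hν, hd, hd'⟩ := hlong.exists_mid
  have hT := (G.outer s).tree
  have hT' := (G.outer t).tree
  have hY := core_cvx (T := G.T s) A
  have hd2 : 1 ≤ dist q ν := by rw [hd']; exact hd
  have hlt := exp_lt_of_one_le h hd
  have hlt' := exp_lt_of_one_le h hd2
  have hH := exists_half_mid hxy hp hq hν hd hd' x
  rw [← cut_map h hxy hp hq hl hν hlt hlt' hxy.1.1] at hH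
  have hc := one_le_exp h
  have hpν : p ≠ ν := by
    rintro rfl
    rw [dist_self] at hd
    linarith
  have hqν : q ≠ ν := by
    rintro rfl
    rw [dist_self] at hd2
    linarith
  have hνY := map_mem_of_not_bad h hs (hxy.subset hY (seg_subset_of_mem hT hp hq hν))
  have hpY := map_mem_of_not_bad h hs (hxy.subset hY hp)
  have hqY := map_mem_of_not_bad h hs (hxy.subset hY hq)
  obtain ⟨v0, hv0⟩ := exists_natVertex_of_isHalf (G.outer t) hνY hpY hH
  have hνn := not_natVertex_map h hxy hp hq hl hν hlt hlt'
  have hlp := hl.sub (left_mem_seg _ _) hν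
  have hlq := hl.sub (right_mem_seg _ _) hν
  obtain ⟨u, w, huw, hνuw, hu, hw, hpu, hqw⟩ := (G.outer t).exists_natEdge_mem hv0 hpY hqY
    (hlp.map_ne h hpν) (hlq.map_ne h hqν) (hl.map_mem h hν) hνn
  set c := Real.exp ((t : ℝ) - s) with hcdef
  have hcpos : 0 < c := Real.exp_pos _
  have hr : (c - 1) / c ≤ 1 := by
    rw [div_le_one hcpos]; linarith
  have hr0 : 0 ≤ (c - 1) / c := div_nonneg (by linarith) hcpos.le
  have hcr : c * ((c - 1) / c) = c - 1 := by field_simp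
  obtain ⟨p1, hp1, hpp1⟩ := exists_mem_seg_dist hT hr0 (hr.trans hd)
  obtain ⟨q1, hq1, hqq1⟩ := exists_mem_seg_dist hT hr0 (hr.trans hd2)
  have kp := map_mem_seg_natVertex h hs hxy hp hq hl hν hd hd' huw.1 hpu
    (fun z hz h1 h2 => huw.not_natVertex hT' hνuw (left_mem_seg _ _) hz h1 h2) hp1
    (by rw [hpp1]; exact hcr)
  have kq := map_mem_seg_natVertex h hs hxy hq hp hl.symm (mem_seg_symm hν) hd2 hd'.symm huw.2.1 hqw
    (fun z hz h1 h2 => huw.not_natVertex hT' hνuw (right_mem_seg _ _) hz h1 h2) hq1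
    (by rw [hqq1]; exact hcr)
  have hp1pq : p1 ∈ seg p q := mem_seg_left hp1 hν
  have hq1pq : q1 ∈ seg p q := mem_seg_symm (mem_seg_left hq1 (mem_seg_symm hν))
  have hmid : ν ∈ seg p1 q1 :=
    mem_seg_between' (mem_seg_symm hq1) (mem_seg_between hp1 hν)
  have hl1 := hl.sub hp1pq hq1pq
  refine ⟨u, w, huw, _, mem_seg_left (mem_seg_symm kp) hνuw, _, mem_seg_right kq hνuw, ?_,
    fun z hz h1 h2 => (hl1.str h).2.not_sameGate hz h1.symm h2.symm⟩
  have h5 : dist (G.map s t h p1) (G.map s t h q1) = c * dist p1 q1 := (hl1.str h).1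
  rw [h5]
  rw [mem_seg] at hmid hp1 hq1
  have h6 : dist p1 q1 = 2 * dist p ν - 2 * ((c - 1) / c) := by
    linarith [dist_comm ν q1]
  rw [h6, mul_sub, mul_left_comm c 2 ((c - 1) / c), hcr]
  nlinarith

end FoldingPath

/-! ### Finitely many edges in the quotient of a core -/

section Finiteness

variable {T : Type*} [MetricSpace T] {F : Type*} [Group F] [MulAction F T]

theorem IsNatEdge.mem_seg_or (hT : IsRealTree T) {Y : Set T} (hY : Cvx Y) {x y m v : T}
    (h : IsNatEdge Y x y) (hm : m ∈ seg x y) (hmx : m ≠ x) (hmy : m ≠ y) (hv : IsNatVertex Y v) :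
    x ∈ seg m v ∨ y ∈ seg m v := by
  have hmn := h.2.2.2 m hm hmx hmy
  have hmY := h.subset hY hm
  have hvm : v ≠ m := fun e => hmn (e ▸ hv)
  have key : ∀ x y, IsNatEdge Y x y → m ∈ seg x y → m ∉ seg x v → x ∈ seg m v ∨ y ∈ seg m v := by
    intro x y h hm hn
    rcases mem_seg_or_of_no_natVertex hT hY hmY h.1.1 hv.1 hn
      (fun z hz h1 h2 => h.not_natVertex hT hm (left_mem_seg _ _) hz h1 h2) with h1 | h1
    · exact Or.inl h1
    · by_cases e1 : v = x
      · exact Or.inl (e1 ▸ right_mem_seg _ _)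
      · exact absurd hv (h.not_natVertex hT hm (left_mem_seg _ _) h1 hvm e1)
  rcases two_of_not_natVertex hmn hmY h.1.1 h.2.1.1 hv.1 hvm hmx.symm hmy.symm hm with h1 | h1
  · exact key x y h hm h1
  · exact (key y x h.symm (mem_seg_symm hm) h1).symm

theorem IsNatEdge.mem_seg_of_mem (hT : IsRealTree T) {Y : Set T} (hY : Cvx Y) {x y m v w : T}
    (h : IsNatEdge Y x y) (hm : m ∈ seg x y) (hmx : m ≠ x) (hmy : m ≠ y) (hv : IsNatVertex Y v)
    (hw : IsNatVertex Y w) (hvw : m ∈ seg v w) : x ∈ seg v w ∧ y ∈ seg v w := by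
  rcases h.mem_seg_or hT hY hm hmx hmy hv with h1 | h1 <;>
    rcases h.mem_seg_or hT hY hm hmx hmy hw with h2 | h2
  · exact absurd hvw (not_mem_seg_of_common hT hmx.symm h1 h2)
  · exact ⟨mem_seg_left (mem_seg_symm h1) hvw, mem_seg_right h2 hvw⟩
  · exact ⟨mem_seg_right h2 hvw, mem_seg_left (mem_seg_symm h1) hvw⟩
  · exact absurd hvw (not_mem_seg_of_common hT hmy.symm h1 h2)

theorem IsNatEdge.exists_mid (hT : IsRealTree T) {Y : Set T} {x y : T} (h : IsNatEdge Y x y) :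
    ∃ m ∈ seg x y, m ≠ x ∧ m ≠ y := by
  have hd : 0 < dist x y := dist_pos.2 h.2.2.1
  obtain ⟨z, hz, hxz⟩ := exists_mem_seg_dist hT (x := x) (y := y) (r := dist x y / 2)
    (by linarith) (by linarith)
  refine ⟨z, hz, ?_, ?_⟩
  · rintro rfl
    rw [dist_self] at hxz
    linarith
  · rintro rfl
    linarith

variable (hO : IsOuterSpacePoint F T)
include hO

theorem IsOuterSpacePoint.finite_natVertex_seg (p q : T) :
    {v ∈ seg p q | IsNatVertex Set.univ v}.Finite := by
  obtain ⟨ε, hε, hsep⟩ := hO.exists_sep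
  refine Set.Finite.of_finite_image (f := fun v => ⌊dist p v / ε⌋₊)
    ((Set.finite_Iic ⌊dist p q / ε⌋₊).subset ?_) ?_
  · rintro _ ⟨v, hv, rfl⟩
    exact Nat.floor_le_floor (by gcongr; exact dist_le_of_mem_seg hv.1)
  · intro v hv w hw e
    by_contra hne
    have h1 := hsep v w hv.2 hw.2 hne
    rw [dist_of_mem_seg hO.tree hv.1 hw.1] at h1
    have e : ⌊dist p v / ε⌋₊ = ⌊dist p w / ε⌋₊ := e
    have a1 := Nat.floor_le (show 0 ≤ dist p v / ε by positivity)
    have a2 := Nat.floor_le (show 0 ≤ dist p w / ε by positivity)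
    have a3 := Nat.lt_floor_add_one (dist p v / ε)
    have a4 := Nat.lt_floor_add_one (dist p w / ε)
    rw [e] at a1 a3
    have : |dist p v / ε - dist p w / ε| < 1 := by
      rw [abs_lt]
      constructor <;> linarith
    rw [← sub_div, abs_div, abs_of_pos hε, div_lt_one hε] at this
    linarith

/-- The core lies in the union of the translates of finitely many segments. -/
theorem IsOuterSpacePoint.core_subset_translates {A : Subgroup F} {v0 : T} {S : Set A}
    (hS : Subgroup.closure S = ⊤) (h1 : (1 : A) ∈ S) {z : T} (hz : z ∈ core T A) :
    ∃ a : A, ∃ s ∈ S, z ∈ seg ((a : F) • v0) ((a : F) • (s : F) • v0) := by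
  have hT := hO.tree
  set X : Set T := {z | ∃ a : A, ∃ s ∈ S, z ∈ seg ((a : F) • v0) ((a : F) • (s : F) • v0)} with hX
  have hsm : ∀ a ∈ A, ∀ x ∈ X, a • x ∈ X := by
    rintro a ha x ⟨b, s, hs, hx⟩
    refine ⟨⟨a, ha⟩ * b, s, hs, ?_⟩
    rw [Subgroup.coe_mul, mul_smul, mul_smul]
    exact hO.smul_mem_seg a hx
  have hbase : ∀ a : A, seg v0 ((a : F) • v0) ⊆ X := by
    intro a
    refine Subgroup.closure_induction (k := S) (p := fun (a : A) _ => seg v0 ((a : F) • v0) ⊆ X) ?_ ?_ ?_ ?_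
      (hS ▸ Subgroup.mem_top a : a ∈ Subgroup.closure S)
    · intro s hs z hz
      refine ⟨1, s, hs, ?_⟩
      rwa [OneMemClass.coe_one, one_smul, one_smul]
    · intro z hz
      rw [OneMemClass.coe_one, one_smul] at hz
      refine ⟨1, 1, h1, ?_⟩
      rwa [OneMemClass.coe_one, one_smul, one_smul]
    · intro a b _ _ ha hb z hz
      rcases mem_seg_or hT ((a : F) • v0) hz with h | h
      · exact ha h
      · have := hb ((hO.smul_mem_seg_iff ((a : F)⁻¹)).2 h |> fun h => by
          rwa [Subgroup.coe_mul, mul_smul, inv_smul_smul, inv_smul_smul] at h)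
        have := hsm a a.2 _ this
        rwa [smul_inv_smul] at this
    · intro a _ ha z hz
      have h := hO.smul_mem_seg (a : F) hz
      rw [Subgroup.coe_inv, smul_inv_smul] at h
      have := hsm _ (inv_mem a.2) _ (ha (mem_seg_symm h))
      rwa [inv_smul_smul] at this
  refine core_subset (Y := X) ⟨v0, hbase 1 (left_mem_seg _ _)⟩ hsm ?_ hz
  have hpath : ∀ a b : A, seg ((a : F) • v0) ((b : F) • v0) ⊆ X := by
    intro a b z hz
    have h := hO.smul_mem_seg (a : F)⁻¹ hz
    rw [inv_smul_smul, smul_smul] at h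
    have := hsm a a.2 _ (hbase (a⁻¹ * b) h)
    rwa [smul_inv_smul] at this
  have hend : ∀ u ∈ X, ∃ a : A, seg u ((a : F) • v0) ⊆ X := by
    rintro u ⟨a, s, hs, hu⟩
    exact ⟨a, fun z hz => ⟨a, s, hs, mem_seg_left (mem_seg_symm hz) hu⟩⟩
  intro u hu w hw z hz
  obtain ⟨a, ha⟩ := hend u hu
  obtain ⟨b, hb⟩ := hend w hw
  rcases mem_seg_or hT ((a : F) • v0) hz with h | h
  · exact ha h
  · rcases mem_seg_or hT ((b : F) • v0) h with h | h
    · exact hpath a b h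
    · exact hb (mem_seg_symm h)

/-- The core is covered by translates of the segments from a natural vertex to its images under the
generators. A natural edge meeting such a segment in an interior point lies inside it, and the
segment contains finitely many vertices. -/
theorem IsOuterSpacePoint.finite_edgeOrbit (A : Subgroup F) [Group.FG A] :
    Finite (EdgeOrbit A (core T A)) := by
  have hT := hO.tree
  have hY := core_cvx (T := T) A
  by_cases hex : ∃ v0, IsNatVertex (core T A) v0
  swap
  · refine @Finite.of_subsingleton _ ⟨fun o => ?_⟩
    induction o using Quot.ind with
    | mk e => exact absurd ⟨_, e.2.1⟩ hex
  obtain ⟨v0, hv0⟩ := hex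
  obtain ⟨S, hS⟩ := Group.FG.out (G := A)
  set S' : Set A := insert 1 (S : Set A) with hS'
  have hcl : Subgroup.closure S' = ⊤ := by
    rw [Subgroup.closure_insert_one, hS]
  have hfin : S'.Finite := S.finite_toSet.insert 1
  set N : Set T := ⋃ s ∈ S', {v ∈ seg v0 ((s : F) • v0) | IsNatVertex Set.univ v} with hN
  have hNf : N.Finite := hfin.biUnion fun s _ => hO.finite_natVertex_seg _ _
  have hD : {e : T × T | e ∈ N ×ˢ N ∧ IsNatEdge (core T A) e.1 e.2}.Finite :=
    (hNf.prod hNf).subset fun e he => he.1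
  have := hD.to_subtype
  refine Finite.of_surjective
    (fun e : {e : T × T | e ∈ N ×ˢ N ∧ IsNatEdge (core T A) e.1 e.2} =>
      (Quot.mk _ ⟨e.1, e.2.2⟩ : EdgeOrbit A (core T A))) fun o => ?_
  induction o using Quot.ind with
  | mk e =>
    obtain ⟨m, hm, hmx, hmy⟩ := e.2.exists_mid hT
    obtain ⟨a, s, hs, hma⟩ := hO.core_subset_translates (v0 := v0) hcl (Set.mem_insert 1 _)
      (e.2.subset hY hm)
    have hma' := hO.smul_mem_seg (a : F)⁻¹ hma
    rw [inv_smul_smul, inv_smul_smul] at hma'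
    have hedge := hO.natEdge_smul (inv_mem a.2) e.2
    have hm' := hO.smul_mem_seg (a : F)⁻¹ hm
    have h1 := hedge.mem_seg_of_mem hT hY hm' (fun e => hmx (MulAction.injective _ e))
      (fun e => hmy (MulAction.injective _ e)) hv0 (hO.natVertex_smul s.2 hv0) hma'
    refine ⟨⟨((a : F)⁻¹ • e.1.1, (a : F)⁻¹ • e.1.2), ⟨⟨Set.mem_biUnion hs ⟨h1.1, hedge.1.univ⟩,
      Set.mem_biUnion hs ⟨h1.2, hedge.2.1.univ⟩⟩, hedge⟩⟩, Quot.sound ⟨a, a.2, ?_, ?_⟩⟩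
    · exact smul_inv_smul _ _
    · exact smul_inv_smul _ _

theorem IsNatEdge.smul_not_mem {A : Subgroup F} {x y x' y' z : T} (hxy : IsNatEdge (core T A) x y)
    (hz : z ∈ seg x y) (hzx : z ≠ x) (hzy : z ≠ y) (h' : IsNatEdge (core T A) x' y') {a : F}
    (ha : a ∈ A) (h1 : ¬ (a • x = x' ∧ a • y = y')) (h2 : ¬ (a • x = y' ∧ a • y = x')) :
    a • z ∉ seg x' y' := by
  intro h
  have hn := hO.natEdge_smul ha hxy
  have hzn : ¬ IsNatVertex (core T A) z := hxy.2.2.2 z hz hzx hzy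
  have hne : ∀ u, IsNatVertex (core T A) u → a • z ≠ u := by
    intro u hu e
    have := hO.natVertex_smul (inv_mem ha) hu
    rw [← e, inv_smul_smul] at this
    exact hzn this
  rcases hn.eq_or_of_mem hO.tree (core_cvx A) h' (hO.smul_mem_seg a hz) (hne _ hn.1) (hne _ hn.2.1)
    h (hne _ h'.1) (hne _ h'.2.1) with h3 | h3
  · exact h1 h3
  · exact h2 h3

theorem IsNatEdge.smul_eq_one {Y : Set T} {x y : T} (hxy : IsNatEdge Y x y) {a : F}
    (h : (a • x = x ∧ a • y = y) ∨ (a • x = y ∧ a • y = x)) : a = 1 := by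
  rcases h with h | h
  · exact hO.free a x h.1
  · have : (a * a) • x = x := by rw [mul_smul, h.1, h.2]
    exact hO.eq_one_of_sq (hO.free _ _ this) x

end Finiteness

/-! ### Crossing numbers and the number of edges -/

section Potential

variable {T : Type*} [MetricSpace T] {F : Type*} [Group F] [MulAction F T]

open Classical in
/-- The indicator of the branch at `z` containing `p`. -/
noncomputable def side (z p v : T) : ℚ := if z ∉ seg p v then 1 else 0

/-- The signed number of translates of `z`, directed to the branch of `p`, crossed on the way from
`w` to `v`. -/
noncomputable def crossing (A : Subgroup F) (z p v w : T) : ℚ :=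
  ∑ᶠ a : A, (side ((a : F) • z) ((a : F) • p) v - side ((a : F) • z) ((a : F) • p) w)

theorem side_congr {z p v z' p' v' : T} (h : z ∈ seg p v ↔ z' ∈ seg p' v') :
    side z p v = side z' p' v' := by
  unfold side
  by_cases h1 : z ∈ seg p v
  · rw [if_neg (not_not.2 h1), if_neg (not_not.2 (h.1 h1))]
  · rw [if_pos h1, if_pos (fun h2 => h1 (h.2 h2))]

theorem side_eq (hT : IsRealTree T) {z p v w : T} (h : z ∉ seg v w) : side z p v = side z p w := by
  refine side_congr (not_iff_not.1 ?_)
  exact ⟨fun h1 => not_mem_seg_trans hT h1 h, fun h1 => not_mem_seg_trans hT h1 (not_mem_seg_symm h)⟩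

variable (hO : IsOuterSpacePoint F T) {A : Subgroup F} (z p : T)
include hO

theorem finite_side (v w : T) : Function.HasFiniteSupport
    fun a : A => side ((a : F) • z) ((a : F) • p) v - side ((a : F) • z) ((a : F) • p) w := by
  refine ((hO.finite_smul_mem_seg z v w).preimage
    (f := fun a : A => (a : F)) Subtype.val_injective.injOn).subset fun a ha => ?_
  by_contra hcon
  exact ha (sub_eq_zero.2 (side_eq hO.tree hcon))

theorem crossing_add (u v w : T) :
    crossing A z p u v + crossing A z p v w = crossing A z p u w := by
  rw [crossing, crossing, ← finsum_add_distrib (finite_side hO z p u v) (finite_side hO z p v w)]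
  simp only [sub_add_sub_cancel]
  rfl

theorem crossing_smul {b : F} (hb : b ∈ A) (v w : T) :
    crossing A z p (b • v) (b • w) = crossing A z p v w := by
  rw [crossing, crossing, ← finsum_comp_equiv (Equiv.mulLeft (⟨b, hb⟩ : A))]
  refine finsum_congr fun a => ?_
  have key : ∀ u, side (((⟨b, hb⟩ * a : A) : F) • z) (((⟨b, hb⟩ * a : A) : F) • p) (b • u) =
      side ((a : F) • z) ((a : F) • p) u := fun u => side_congr (by
    rw [Subgroup.coe_mul, mul_smul, mul_smul, hO.smul_mem_seg_iff])
  simp only [Equiv.coe_mulLeft, key]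

theorem crossing_self {x y z : T} (hxy : IsNatEdge (core T A) x y) (hz : z ∈ seg x y) (hzx : z ≠ x)
    (hzy : z ≠ y) : crossing A z y y x = 1 := by
  rw [crossing, finsum_eq_single _ (1 : A)]
  · have h1 : z ∉ seg y y := fun h => hzy (mem_seg_self h)
    have h2 : z ∈ seg y x := mem_seg_symm hz
    simp only [OneMemClass.coe_one, one_smul, side, h1, h2, not_true_eq_false, not_false_eq_true,
      if_true, if_false, sub_zero]
  · intro a ha
    have ha' : (a : F) ≠ 1 := fun e => ha (Subtype.ext e)
    refine sub_eq_zero.2 (side_eq hO.tree (not_mem_seg_symm ?_))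
    exact hxy.smul_not_mem hO hz hzx hzy hxy a.2 (fun h => ha' (hxy.smul_eq_one hO (Or.inl h)))
      (fun h => ha' (hxy.smul_eq_one hO (Or.inr h)))

theorem crossing_eq_zero {x y x' y' z : T} (hxy : IsNatEdge (core T A) x y) (hz : z ∈ seg x y)
    (hzx : z ≠ x) (hzy : z ≠ y) (h' : IsNatEdge (core T A) x' y')
    (h1 : ∀ a ∈ A, ¬ (a • x = x' ∧ a • y = y')) (h2 : ∀ a ∈ A, ¬ (a • x = y' ∧ a • y = x')) :
    crossing A z y y' x' = 0 := by
  refine finsum_eq_zero_of_forall_eq_zero fun a => ?_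
  exact sub_eq_zero.2 (side_eq hO.tree (not_mem_seg_symm
    (hxy.smul_not_mem hO hz hzx hzy h' a.2 (h1 a a.2) (h2 a a.2))))

/-- Half of the Euler characteristic estimate: pairwise inequivalent edges give linearly independent
potentials, and a potential is determined by its periods and its values on vertex orbits. -/
theorem card_edges_le {S : Finset A} (hS : Subgroup.closure (S : Set A) = ⊤) {v0 : T} {ι κ : Type*}
    [Fintype ι] [Fintype κ] (e : ι → T × T) (he : ∀ i, IsNatEdge (core T A) (e i).1 (e i).2)
    (hne : ∀ i j, i ≠ j → ∀ a ∈ A, ¬ (a • (e i).1 = (e j).1 ∧ a • (e i).2 = (e j).2) ∧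
      ¬ (a • (e i).1 = (e j).2 ∧ a • (e i).2 = (e j).1))
    (v : κ → T) (hv : ∀ w, IsNatVertex (core T A) w → ∃ a ∈ A, w = a • v0 ∨ ∃ k, w = a • v k) :
    Fintype.card ι ≤ S.card + Fintype.card κ := by
  classical
  choose z hz hzx hzy using fun i => (he i).exists_mid hO.tree
  let H : (ι → ℚ) → T → T → ℚ := fun c v w => ∑ i, c i * crossing A (z i) (e i).2 v w
  have hadd : ∀ c u v w, H c u v + H c v w = H c u w := fun c u v w => by
    simp only [H, ← Finset.sum_add_distrib, ← mul_add, crossing_add hO]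
  have hsmul : ∀ c, ∀ b ∈ A, ∀ v w, H c (b • v) (b • w) = H c v w := fun c b hb v w => by
    simp only [H, crossing_smul hO _ _ hb]
  have hself : ∀ c u, H c u u = 0 := fun c u => by
    have := hadd c u u u
    linarith
  have hedge : ∀ c j, H c (e j).2 (e j).1 = c j := fun c j => by
    simp only [H]
    rw [Finset.sum_eq_single j]
    · rw [crossing_self hO (he j) (hz j) (hzx j) (hzy j), mul_one]
    · intro i _ hij
      rw [crossing_eq_zero hO (he i) (hz i) (hzx i) (hzy i) (he j)
        (fun a ha => (hne i j hij a ha).1) (fun a ha => (hne i j hij a ha).2), mul_zero]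
    · exact fun h => absurd (Finset.mem_univ j) h
  -- A combination of crossing numbers is a potential with periods. Record its periods along
  -- generators and its values at representatives of vertex orbits, relative to `v0`.
  let Φ : (ι → ℚ) →ₗ[ℚ] (S ⊕ κ → ℚ) :=
    { toFun := fun c x => Sum.elim (fun s : S => H c (((s : A) : F) • v0) v0)
        (fun k => H c (v k) v0) x
      map_add' := by
        intro c d
        funext x
        cases x <;> simp [H, add_mul, Finset.sum_add_distrib]
      map_smul' := by
        intro r c
        funext x
        cases x <;> simp [H, mul_assoc, Finset.mul_sum] }
  -- Vanishing periods on generators vanish on `A`, so the potential is zero at all natural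
  -- vertices. Its jump across the edge `j` is the coefficient of `j`.
  have hinj : Function.Injective Φ := by
    rw [injective_iff_map_eq_zero]
    intro c hc
    have hs : ∀ s ∈ S, H c ((s : F) • v0) v0 = 0 := fun s hs => congrFun hc (Sum.inl ⟨s, hs⟩)
    have hk : ∀ k, H c (v k) v0 = 0 := fun k => congrFun hc (Sum.inr k)
    have hA : ∀ a : A, H c ((a : F) • v0) v0 = 0 := by
      intro a
      refine Subgroup.closure_induction (k := (S : Set A))
        (p := fun (a : A) _ => H c ((a : F) • v0) v0 = 0) ?_ ?_ ?_ ?_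
        (hS.symm ▸ Subgroup.mem_top a : a ∈ Subgroup.closure (S : Set A))
      · exact hs
      · rw [OneMemClass.coe_one, one_smul, hself]
      · intro a b _ _ ha hb
        rw [Subgroup.coe_mul, mul_smul, ← hadd c _ ((a : F) • v0), hsmul c a a.2, ha, hb, add_zero]
      · intro a _ ha
        have := hadd c v0 ((a : F) • v0) v0
        rw [hself, ha, add_zero, ← hsmul c _ (inv_mem a.2), inv_smul_smul] at this
        exact this
    have hall : ∀ w, IsNatVertex (core T A) w → H c w v0 = 0 := by
      intro w hw
      obtain ⟨a, ha, rfl | ⟨k, rfl⟩⟩ := hv w hw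
      · exact hA ⟨a, ha⟩
      · rw [← hadd c _ (a • v0), hsmul c a ha, hk, hA ⟨a, ha⟩, add_zero]
    funext j
    rw [← hedge c j]
    have h3 := hadd c (e j).2 (e j).1 v0
    rw [hall _ (he j).1, hall _ (he j).2.1, add_zero] at h3
    exact h3
  have := LinearMap.finrank_le_finrank_of_injective hinj
  simpa using this

end Potential

/-! ### The volume bound -/

section Count

variable {T : Type*} [MetricSpace T] {F : Type*} [Group F] [MulAction F T]

theorem edgeOrbit_mk_eq {A : Subgroup F} {Y : Set T} {e e' : {e : T × T // IsNatEdge Y e.1 e.2}} :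
    (Quot.mk _ e : EdgeOrbit A Y) = Quot.mk _ e' ↔
      ∃ a ∈ A, a • e.1.1 = e'.1.1 ∧ a • e.1.2 = e'.1.2 := by
  refine Equivalence.quot_mk_eq_iff ⟨fun e => ⟨1, one_mem A, one_smul _ _, one_smul _ _⟩, ?_, ?_⟩ e e'
  · rintro e e' ⟨a, ha, h1, h2⟩
    exact ⟨a⁻¹, inv_mem ha, by rw [← h1, inv_smul_smul], by rw [← h2, inv_smul_smul]⟩
  · rintro e e' e'' ⟨a, ha, h1, h2⟩ ⟨b, hb, h3, h4⟩
    exact ⟨b * a, mul_mem hb ha, by rw [mul_smul, h1, h3], by rw [mul_smul, h2, h4]⟩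

/-- Reversing the orientation of edges. -/
def EdgeOrbit.flip {A : Subgroup F} {Y : Set T} : EdgeOrbit A Y → EdgeOrbit A Y :=
  Quot.map (fun e => ⟨(e.1.2, e.1.1), e.2.symm⟩) fun _ _ ⟨a, ha, h1, h2⟩ => ⟨a, ha, h2, h1⟩

theorem EdgeOrbit.flip_flip {A : Subgroup F} {Y : Set T} (o : EdgeOrbit A Y) : o.flip.flip = o := by
  induction o using Quot.ind with
  | mk e => rfl

/-- Edges without orientation. -/
def UnorientedOrbit (A : Subgroup F) (Y : Set T) : Type _ :=
  Quot fun o o' : EdgeOrbit A Y => o = o' ∨ o.flip = o'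

/-- Orbits of natural vertices. -/
def VertexOrbit (A : Subgroup F) (Y : Set T) : Type _ :=
  Quot fun v w : {v : T // IsNatVertex Y v} => ∃ a ∈ A, a • v.1 = w.1

theorem vertexOrbit_mk_eq {A : Subgroup F} {Y : Set T} {v w : {v : T // IsNatVertex Y v}} :
    (Quot.mk _ v : VertexOrbit A Y) = Quot.mk _ w ↔ ∃ a ∈ A, a • v.1 = w.1 := by
  refine Equivalence.quot_mk_eq_iff ⟨fun e => ⟨1, one_mem A, one_smul _ _⟩, ?_, ?_⟩ v w
  · rintro e e' ⟨a, ha, h1⟩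
    exact ⟨a⁻¹, inv_mem ha, by rw [← h1, inv_smul_smul]⟩
  · rintro e e' e'' ⟨a, ha, h1⟩ ⟨b, hb, h3⟩
    exact ⟨b * a, mul_mem hb ha, by rw [mul_smul, h1, h3]⟩

variable (hO : IsOuterSpacePoint F T) {A : Subgroup F}
include hO

theorem IsOuterSpacePoint.exists_three_edges {v : T} (hv : IsNatVertex (core T A) v) :
    ∃ w : Fin 3 → T, (∀ i, IsNatEdge (core T A) v (w i)) ∧ Function.Injective w := by
  have hT := hO.tree
  have key : ∀ p ∈ core T A, p ≠ v → ∃ w, IsNatEdge (core T A) v w ∧ v ∉ seg p w := by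
    intro p hp hpv
    obtain ⟨w, hw, h1, h2⟩ := hO.exists_natVertex_dir hv hp hpv
    exact ⟨w, ⟨hv, hw, (ne_of_not_mem_seg h1).2.symm, h2⟩, h1⟩
  obtain ⟨-, p, hp, q, hq, r, hr, n1, n2, n3, h1, h2, h3⟩ := isNatVertex_iff.1 hv
  obtain ⟨w1, e1, d1⟩ := key p hp n1
  obtain ⟨w2, e2, d2⟩ := key q hq n2
  obtain ⟨w3, e3, d3⟩ := key r hr n3
  have k1 : w1 ≠ w2 := by
    rintro rfl
    exact not_mem_seg_trans hT d1 (not_mem_seg_symm d2) h1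
  have k2 : w2 ≠ w3 := by
    rintro rfl
    exact not_mem_seg_trans hT d2 (not_mem_seg_symm d3) h2
  have k3 : w1 ≠ w3 := by
    rintro rfl
    exact not_mem_seg_trans hT d1 (not_mem_seg_symm d3) h3
  refine ⟨![w1, w2, w3], fun i => ?_, fun i j hij => ?_⟩
  · fin_cases i <;> assumption
  · fin_cases i <;> fin_cases j <;> simp_all

/-- With `E` edges and `V` vertices in the quotient, `card_edges_le` gives `E ≤ rank + V - 1` and
valence at least three gives `3 * V ≤ 2 * E`, hence `2 * E ≤ 6 * rank - 6`. -/
theorem card_edgeOrbit_add_six_le [Group.FG A] {v0 : T} (hv0 : IsNatVertex (core T A) v0) :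
    Nat.card (EdgeOrbit A (core T A)) + 6 ≤ 6 * Group.rank A := by
  classical
  have hfin := hO.finite_edgeOrbit A
  obtain ⟨S, hScard, hS⟩ := Group.rank_spec A
  have heqv : Equivalence fun o o' : EdgeOrbit A (core T A) => o = o' ∨ o.flip = o' := by
    refine ⟨fun o => Or.inl rfl, ?_, ?_⟩
    · rintro o _ (rfl | rfl)
      · exact Or.inl rfl
      · exact Or.inr o.flip_flip
    · rintro o _ _ (rfl | rfl) (rfl | rfl)
      · exact Or.inl rfl
      · exact Or.inr rfl
      · exact Or.inr rfl
      · exact Or.inl o.flip_flip.symm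
  have hEeq : ∀ o o' : EdgeOrbit A (core T A), (Quot.mk _ o : UnorientedOrbit A (core T A)) = Quot.mk _ o' ↔ o = o' ∨ o.flip = o' :=
    heqv.quot_mk_eq_iff
  have : Finite (UnorientedOrbit A (core T A)) := Finite.of_surjective (Quot.mk _ : EdgeOrbit A (core T A) → UnorientedOrbit A (core T A)) Quot.mk_surjective
  choose w hw hwinj using fun v : {v : T // IsNatVertex (core T A) v} => hO.exists_three_edges v.2
  -- Three outgoing edges per vertex orbit remain inequivalent, because the action is free.
  let ψ : VertexOrbit A (core T A) × Fin 3 → EdgeOrbit A (core T A) := fun k => Quot.mk _ ⟨(k.1.out.1, w k.1.out k.2), hw _ _⟩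
  have hψ : Function.Injective ψ := by
    rintro ⟨k, i⟩ ⟨k', j⟩ h
    obtain ⟨a, ha, h1, h2⟩ := edgeOrbit_mk_eq.1 h
    have hk : k = k' := by
      rw [← Quot.out_eq k, ← Quot.out_eq k']
      exact vertexOrbit_mk_eq.2 ⟨a, ha, h1⟩
    subst hk
    have h3 : a = 1 := hO.free a _ h1
    subst h3
    rw [one_smul] at h2
    exact congrArg (Prod.mk k) (hwinj _ h2)
  have : Finite (VertexOrbit A (core T A)) := Finite.of_injective (fun k => ψ (k, 0)) fun k k' h =>
    congrArg Prod.fst (hψ h)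
  have := Fintype.ofFinite (EdgeOrbit A (core T A))
  have := Fintype.ofFinite (UnorientedOrbit A (core T A))
  have := Fintype.ofFinite (VertexOrbit A (core T A))
  let k0 : VertexOrbit A (core T A) := Quot.mk _ ⟨v0, hv0⟩
  let edge : UnorientedOrbit A (core T A) → T × T := fun i => (Quot.out (Quot.out i)).1
  have hmk : ∀ i : UnorientedOrbit A (core T A), (Quot.mk _ (Quot.out (Quot.out i)) : EdgeOrbit A (core T A)) = Quot.out i := fun i => Quot.out_eq _
  -- The orbit of the base vertex needs no value of its own. Leaving it out gives the `-1`.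
  have hcard := card_edges_le hO hS (v0 := v0) (ι := UnorientedOrbit A (core T A)) (κ := {k : VertexOrbit A (core T A) // k ≠ k0}) edge
    (fun i => (Quot.out (Quot.out i)).2) (fun i j hij a ha => ⟨fun h => hij ?_, fun h => hij ?_⟩)
    (fun k => (Quot.out k.1).1) (fun v hv => ?_)
  · have h1 : Fintype.card {k : VertexOrbit A (core T A) // k ≠ k0} + 1 = Fintype.card (VertexOrbit A (core T A)) := by
      have := Fintype.card_pos_iff.2 ⟨k0⟩
      rw [Fintype.card_subtype_compl, Fintype.card_subtype_eq]
      omega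
    have h2 : 3 * Fintype.card (VertexOrbit A (core T A)) ≤ Fintype.card (EdgeOrbit A (core T A)) := by
      have := Fintype.card_le_of_injective ψ hψ
      rw [Fintype.card_prod, Fintype.card_fin] at this
      omega
    have h3 : Fintype.card (EdgeOrbit A (core T A)) ≤ 2 * Fintype.card (UnorientedOrbit A (core T A)) := by
      have := Fintype.card_le_of_surjective
        (fun x : UnorientedOrbit A (core T A) × Bool => if x.2 then Quot.out x.1 else (Quot.out x.1).flip) (fun o => by
          rcases (hEeq _ _).1 (Quot.out_eq (Quot.mk _ o : UnorientedOrbit A (core T A))) with h | h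
          · exact ⟨(Quot.mk _ o, true), h⟩
          · exact ⟨(Quot.mk _ o, false), h⟩)
      rw [Fintype.card_prod, Fintype.card_bool] at this
      omega
    rw [Nat.card_eq_fintype_card]
    omega
  · have h1 := edgeOrbit_mk_eq.2 ⟨a, ha, h⟩
    rw [hmk, hmk] at h1
    rw [← Quot.out_eq i, ← Quot.out_eq j, h1]
  · have h1 : (Quot.mk _ (Quot.out (Quot.out i)) : EdgeOrbit A (core T A)) = EdgeOrbit.flip (Quot.mk _ (Quot.out (Quot.out j)) : EdgeOrbit A (core T A)) :=
      edgeOrbit_mk_eq.2 ⟨a, ha, h⟩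
    rw [hmk, hmk] at h1
    rw [← Quot.out_eq i, ← Quot.out_eq j]
    exact ((hEeq _ _).2 (Or.inr h1.symm)).symm
  · by_cases hk : (Quot.mk _ ⟨v, hv⟩ : VertexOrbit A (core T A)) = k0
    · obtain ⟨a, ha, h⟩ := vertexOrbit_mk_eq.1 hk.symm
      exact ⟨a, ha, Or.inl h.symm⟩
    · obtain ⟨a, ha, h⟩ := vertexOrbit_mk_eq.1 (Quot.out_eq (Quot.mk _ ⟨v, hv⟩ : VertexOrbit A (core T A)))
      exact ⟨a, ha, Or.inr ⟨⟨_, hk⟩, h.symm⟩⟩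

/-- Each oriented edge contributes half of a length at most 2. If there are no natural vertices, the
sum is empty and only the hypothesis on the rank is needed. -/
theorem volume_add_six_le [Group.FG A] (hr : 2 ≤ Group.rank A)
    (hlen : ∀ x y, IsNatEdge (core T A) x y → dist x y ≤ 2) :
    volume A (core T A) + 6 ≤ 6 * (Group.rank A : ℝ≥0∞) := by
  have hfin := hO.finite_edgeOrbit A
  have := Fintype.ofFinite (EdgeOrbit A (core T A))
  have hvol : volume A (core T A) ≤ Nat.card (EdgeOrbit A (core T A)) := by
    unfold volume
    refine ENNReal.div_le_of_le_mul ?_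
    rw [tsum_fintype, Nat.card_eq_fintype_card, ← nsmul_eq_mul]
    refine Finset.sum_le_card_nsmul _ _ _ fun o _ => ?_
    rw [edist_dist]
    refine (ENNReal.ofReal_le_ofReal (hlen _ _ (Quot.out o).2)).trans ?_
    simp
  refine (add_le_add_left hvol 6).trans ?_
  by_cases hex : ∃ v0, IsNatVertex (core T A) v0
  · obtain ⟨v0, hv0⟩ := hex
    exact_mod_cast card_edgeOrbit_add_six_le hO hv0
  · have hempty : IsEmpty (EdgeOrbit A (core T A)) := ⟨fun o => by
      induction o using Quot.ind with
      | mk e => exact hex ⟨_, e.2.1⟩⟩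
    rw [Nat.card_of_isEmpty]
    norm_cast
    omega

/-- Finite generation enters here: finitely many edge orbits turn strict bounds into a uniform one.
-/
theorem IsOuterSpacePoint.exists_length_lt [Group.FG A]
    (hlen : ∀ x y, IsNatEdge (core T A) x y → dist x y < 2) :
    ∃ M < 2, ∀ x y, IsNatEdge (core T A) x y → dist x y ≤ M := by
  have hfin := hO.finite_edgeOrbit A
  let len : EdgeOrbit A (core T A) → ℝ := fun o => dist (Quot.out o).1.1 (Quot.out o).1.2
  have hle : ∀ x y, IsNatEdge (core T A) x y → ∃ o, dist x y = len o := by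
    intro x y h
    obtain ⟨a, ha, h1, h2⟩ := edgeOrbit_mk_eq.1
      (Quot.out_eq (Quot.mk _ ⟨(x, y), h⟩ : EdgeOrbit A (core T A)))
    refine ⟨Quot.mk _ ⟨(x, y), h⟩, ?_⟩
    exact (congrArg₂ dist h1.symm h2.symm).trans (hO.isometric a _ _)
  rcases isEmpty_or_nonempty (EdgeOrbit A (core T A)) with he | he
  · exact ⟨0, by norm_num, fun x y h => (he.false (hle x y h).choose).elim⟩
  · obtain ⟨o, ho⟩ := Finite.exists_max len
    refine ⟨len o, hlen _ _ (Quot.out o).2, fun x y h => ?_⟩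
    obtain ⟨o', h'⟩ := hle x y h
    rw [h']
    exact ho o'

end Count

/-! ### The two thresholds -/

namespace FoldingPath

variable {n : ℕ} {α ω : ℝ} {G : FoldingPath.{u} n α ω} {A : Subgroup (FreeGroup (Fin n))}
  {s t : Set.Icc α ω}

/-- An illegal turn at a point of valence two in the core would make it a one-gate point. -/
theorem legal_of_no_natVertex (hs : ¬ G.Bad A s) {a b : G.T s} (ha : a ∈ G.sub A s)
    (hb : b ∈ G.sub A s) (hn : ∀ z ∈ seg a b, z ≠ a → z ≠ b → ¬ IsNatVertex (G.sub A s) z) :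
    G.Legal s a b := by
  have hT := (G.outer s).tree
  refine str_of_legal hT (G.outer _).tree (Real.exp_pos _) (G.isFolding_toEnd s).slope ?_
  intro z hz hza hzb hg
  have hzY := core_cvx A _ ha _ hb hz
  refine hs ⟨z, hzY, fun p hp q hq hpz hqz => ?_⟩
  have key : ∀ p ∈ G.sub A s, p ≠ z → z ∉ seg a p ∨ z ∉ seg b p := fun p hp hpz =>
    two_of_not_natVertex (hn z hz hza hzb) hzY ha hb hp hpz hza.symm hzb.symm hz
  rcases key p hp hpz with h1 | h1 <;> rcases key q hq hqz with h2 | h2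
  · exact sameGate_of_not_mem hT _ (not_mem_seg_trans hT (not_mem_seg_symm h1) h2)
  · exact (sameGate_congr hT _ h1 h2).1 hg
  · exact (sameGate_congr hT _ h1 h2).1 hg.symm
  · exact sameGate_of_not_mem hT _ (not_mem_seg_trans hT (not_mem_seg_symm h1) h2)

theorem exists_long_legal_of_not_bad (hs : ¬ G.Bad A s) {y p : G.T s} (hy : y ∈ G.sub A s)
    (hp : p ∈ G.sub A s) (hpy : p ≠ y) (r : ℝ) :
    ∃ w ∈ G.sub A s, w ≠ y ∧ y ∉ seg p w ∧ G.Legal s y w ∧ r < dist y w := by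
  obtain ⟨w, hw, h1, h2, h3, h4⟩ := (G.isFolding_toEnd s).exists_long_legal
    (G.twoGates_toEnd s) hy hp hpy r
  exact ⟨w, hw, h1, h2, h3, h4.resolve_left fun h => hs ⟨w, hw, h⟩⟩

/-- Images of natural vertices are close to natural vertices. -/
theorem exists_natVertex_near (h : s ≤ t) (hs : ¬ G.Bad A s) {v : G.T s}
    (hv : IsNatVertex (G.sub A s) v) : ∃ m, IsNatVertex (G.sub A t) m ∧
      dist (G.map s t h v) m ≤ Real.exp ((t : ℝ) - s) - 1 := by
  have hT := (G.outer s).tree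
  have hT' := (G.outer t).tree
  have hvY : v ∈ G.sub A s := hv.1
  obtain ⟨d1, hd1, d2, hd2, n1, n2, h12⟩ := exists_gates (fun h1 => hs ⟨v, hvY, h1⟩)
  have hv12 : v ∈ seg d1 d2 := by
    by_contra hcon
    exact h12 (sameGate_of_not_mem hT _ hcon)
  obtain ⟨d3, hd3, n3, h13, h23⟩ : ∃ d3 ∈ G.sub A s, d3 ≠ v ∧ v ∈ seg d1 d3 ∧ v ∈ seg d2 d3 := by
    obtain ⟨-, p, hp, q, hq, r, hr, k1, k2, k3, e1, e2, e3⟩ := isNatVertex_iff.1 hv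
    by_contra! hcon
    have key : ∀ p ∈ G.sub A s, p ≠ v → v ∉ seg d1 p ∨ v ∉ seg d2 p := fun p hp hpv => by
      by_cases h1 : v ∈ seg d1 p
      · exact Or.inr (hcon p hp hpv h1)
      · exact Or.inl h1
    have hcl : ∀ {d a b : G.T s}, v ∈ seg a b → v ∉ seg d a → v ∉ seg d b → False :=
      fun hab ha hb => not_mem_seg_trans hT (not_mem_seg_symm ha) hb hab
    rcases key p hp k1 with f1 | f1 <;> rcases key q hq k2 with f2 | f2 <;>
      rcases key r hr k3 with f3 | f3
    · exact hcl e1 f1 f2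
    · exact hcl e1 f1 f2
    · exact hcl e3 f1 f3
    · exact hcl e2 f2 f3
    · exact hcl e2 f2 f3
    · exact hcl e3 f1 f3
    · exact hcl e1 f1 f2
    · exact hcl e1 f1 f2
  -- The turns from `d2` to `d1` and to `d3` are legal, while the one between `d1` and `d3` may be
  -- folded. The images of long legal segments in these two directions separate within the
  -- cancellation bound, and the segment towards `d2` is the third direction there.
  have main : ∀ d1 ∈ G.sub A s, ∀ d2 ∈ G.sub A s, d1 ≠ v → d2 ≠ v → ¬ SameGate (G.toEnd s) v d1 d2 →
      v ∈ seg d1 d2 → v ∈ seg d1 d3 → v ∈ seg d2 d3 → ¬ SameGate (G.toEnd s) v d2 d3 →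
      ∃ m, IsNatVertex (G.sub A t) m ∧
        dist (G.map s t h v) m ≤ Real.exp ((t : ℝ) - s) - 1 := by
    intro d1 hd1 d2 hd2 n1 n2 g12 h12 h13 h23 g23
    obtain ⟨w1, hw1, k1, e1, l1, r1⟩ := exists_long_legal_of_not_bad hs hvY hd1 n1
      (Real.exp ((t : ℝ) - s) - 1)
    obtain ⟨w2, hw2, k2, e2, l2, r2⟩ := exists_long_legal_of_not_bad hs hvY hd2 n2
      (Real.exp ((t : ℝ) - s) - 1)
    obtain ⟨w3, hw3, k3, e3, l3, r3⟩ := exists_long_legal_of_not_bad hs hvY hd3 n3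
      (Real.exp ((t : ℝ) - s) - 1)
    obtain ⟨f12, l12⟩ := l1.symm.concat l2 (by rwa [← sameGate_congr hT (G.toEnd s) e1 e2])
    obtain ⟨f23, l23⟩ := l2.symm.concat l3 (by rwa [← sameGate_congr hT (G.toEnd s) e2 e3])
    have f13 : v ∈ seg w1 w3 := by
      by_contra hcon
      exact not_mem_seg_trans hT (not_mem_seg_trans hT e1 hcon) (not_mem_seg_symm e3) h13
    obtain ⟨m, m0, m1, m3, hm⟩ := (G.bcc h).exists_near hT hT' (Real.exp_pos _) (G.isFolding h).lip f13
    have i12 := l12.map_mem h f12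
    have i23 := l23.map_mem h f23
    have hfar : ∀ {w}, G.Legal s v w → Real.exp ((t : ℝ) - s) - 1 < dist v w →
        m ≠ G.map s t h w := by
      rintro w hl hr rfl
      have h1 : dist (G.map s t h v) (G.map s t h w) = _ := (hl.str h).1
      rw [h1] at hm
      nlinarith [one_le_exp h, dist_nonneg (x := v) (y := w)]
    refine ⟨m, isNatVertex_of_median (core_cvx A) (map_mem_of_not_bad h hs hw1)
      (map_mem_of_not_bad h hs hw2) (map_mem_of_not_bad h hs hw3) (mem_seg_left m1 i12)
      (mem_seg_right m3 i23) m0 (hfar l1 r1) ?_ (hfar l3 r3), hm⟩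
    rintro rfl
    exact l2.map_ne h k2.symm (eq_of_mem_seg_of_mem_seg i12 m1).symm
  by_cases g23 : SameGate (G.toEnd s) v d2 d3
  · refine main d2 hd2 d1 hd1 n2 n1 (fun h1 => h12 h1.symm) (mem_seg_symm hv12) h23 h13 fun g13 => ?_
    exact h12 (g13.trans hT n3 g23.symm)
  · exact main d1 hd1 d2 hd2 n1 n2 h12 hv12 h13 h23 g23

/-- The midpoint of the segment is at least 1 away from both ends of its edge, hence from every
natural vertex. -/
theorem HasLongLegalSegment.exists_far (hlong : G.HasLongLegalSegment A t) :
    ∃ ν ∈ G.sub A t, (∃ m, IsNatVertex (G.sub A t) m) ∧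
      ∀ m, IsNatVertex (G.sub A t) m → 1 ≤ dist ν m := by
  have hT := (G.outer t).tree
  have hY := core_cvx (T := G.T t) A
  obtain ⟨x, y, p, q, ν, hxy, hp, hq, -, hν, hd, hd'⟩ := hlong.exists_mid
  have hνxy := seg_subset_of_mem hT hp hq hν
  have key : ∀ p q, p ∈ seg x y → q ∈ seg x y → ν ∈ seg p q → 1 ≤ dist p ν → 1 ≤ dist q ν →
      dist x p ≤ dist x q → 1 ≤ dist ν x ∧ 1 ≤ dist ν y := by
    intro p q hp hq hν h1 h2 hle
    have k1 := mem_seg_of_dist_le hT hp hq hle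
    have k2 := dist_le_of_mem_seg' (mem_seg_between' hν k1)
    have k3 := dist_le_of_mem_seg (mem_seg_between hν (mem_seg_between k1 hq))
    constructor
    · rw [dist_comm]; linarith
    · rw [dist_comm q ν] at h2; linarith
  have hdd : 1 ≤ dist ν x ∧ 1 ≤ dist ν y := by
    rcases le_total (dist x p) (dist x q) with h | h
    · exact key p q hp hq hν hd (by rw [hd']; exact hd) h
    · exact key q p hq hp (mem_seg_symm hν) (by rw [hd']; exact hd) hd h
  refine ⟨ν, hxy.subset hY hνxy, ⟨x, hxy.1⟩, fun m hm => ?_⟩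
  rcases hxy.mem_seg_or hT hY hνxy (by rintro rfl; rw [dist_self] at hdd; linarith [hdd.1])
    (by rintro rfl; rw [dist_self] at hdd; linarith [hdd.2]) hm with h | h
  · exact hdd.1.trans (dist_le_of_mem_seg h)
  · exact hdd.2.trans (dist_le_of_mem_seg h)

/-- Without natural vertices every segment in a good core is legal, so three directions at an image
point come from three directions at a preimage. -/
theorem exists_natVertex_of_map (h : s ≤ t) (hs : ¬ G.Bad A s) {v' : G.T t}
    (hv' : IsNatVertex (G.sub A t) v') : ∃ v, IsNatVertex (G.sub A s) v := by
  have hT := (G.outer s).tree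
  have hT' := (G.outer t).tree
  have hY := core_cvx (T := G.T s) A
  by_contra! hno
  obtain ⟨hvY, p1, h1, p2, h2, p3, h3, n1, n2, n3, k1, k2, k3⟩ := isNatVertex_iff.1 hv'
  obtain ⟨v, hv, rfl⟩ := G.sub_subset_image h hvY
  obtain ⟨w1, hw1, rfl⟩ := G.sub_subset_image h h1
  obtain ⟨w2, hw2, rfl⟩ := G.sub_subset_image h h2
  obtain ⟨w3, hw3, rfl⟩ := G.sub_subset_image h h3
  have key : ∀ w ∈ G.sub A s, ∀ w' ∈ G.sub A s, G.map s t h w ≠ G.map s t h v →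
      G.map s t h w' ≠ G.map s t h v → G.map s t h v ∈ seg (G.map s t h w) (G.map s t h w') →
      v ∈ seg w w' := by
    intro w hw w' hw' hn hn' hm
    by_contra hcon
    have hleg : ∀ a ∈ G.sub A s, G.Legal s v a := fun a ha =>
      legal_of_no_natVertex hs hv ha fun z _ _ _ => hno z
    rcases mem_seg_or_of_no_natVertex hT hY hv hw hw' hcon (fun z _ _ _ => hno z) with e | e
    · exact not_mem_seg_of_mem hT' hn ((hleg w' hw').map_mem h e) hm
    · exact not_mem_seg_of_mem hT' hn' ((hleg w hw).map_mem h e) (mem_seg_symm hm)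
  refine hno v (isNatVertex_iff.2 ⟨hv, w1, hw1, w2, hw2, w3, hw3, ?_, ?_, ?_,
    key w1 hw1 w2 hw2 n1 n2 k1, key w2 hw2 w3 hw3 n2 n3 k2, key w1 hw1 w3 hw3 n1 n3 k3⟩)
  · rintro rfl; exact n1 rfl
  · rintro rfl; exact n2 rfl
  · rintro rfl; exact n3 rfl

/-- Long legal segments do not appear right after a time when all edges are short. -/
theorem not_long_right (hs : ¬ G.Bad A s) {M : ℝ} (hM : M < 2)
    (hlen : ∀ x y, IsNatEdge (G.sub A s) x y → dist x y ≤ M) :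
    ∃ ε > 0, ∀ t : Set.Icc α ω, s ≤ t → (t : ℝ) ≤ s + ε → ¬ G.HasLongLegalSegment A t := by
  have hM' : max M 0 < 2 := max_lt hM (by norm_num)
  have hM0 : 0 ≤ max M 0 := le_max_right _ _
  -- A point at distance at least 1 from all later vertices lifts into an edge of length at most
  -- `M`, whose ends map within `c - 1` of vertices. Hence `2 * (2 - c) ≤ c * M`, which fails for `c
  -- - 1 ≤ (2 - max M 0) / 8`.
  obtain ⟨ε, hε, hexp⟩ := exists_exp_sub_one_le (show 0 < (2 - max M 0) / 8 by linarith)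
  refine ⟨ε, hε, fun t h ht hlong => ?_⟩
  have hr := hexp ((t : ℝ) - s) (by linarith)
  have hc := one_le_exp h
  obtain ⟨ν, hν, ⟨v', hv'⟩, hfar⟩ := hlong.exists_far
  obtain ⟨v0, hv0⟩ := exists_natVertex_of_map h hs hv'
  obtain ⟨y, hy, rfl⟩ := G.sub_subset_image h hν
  have hnear : ∀ v, IsNatVertex (G.sub A s) v →
      2 - Real.exp ((t : ℝ) - s) ≤ dist (G.map s t h y) (G.map s t h v) := by
    intro v hv
    obtain ⟨m, hm, hd⟩ := exists_natVertex_near h hs hv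
    have := dist_triangle (G.map s t h y) (G.map s t h v) m
    linarith [hfar m hm]
  by_cases hyn : IsNatVertex (G.sub A s) y
  · have := hnear y hyn
    rw [dist_self] at this
    linarith
  obtain ⟨p, hp, q, hq, hpy, hqy, hpq⟩ := (G.outer s).exists_two_dirs hy
  obtain ⟨u, w, huw, hyuw, -, -, -, -⟩ := (G.outer s).exists_natEdge_mem hv0 hp hq hpy hqy hpq hyn
  have hl := legal_of_no_natVertex hs huw.1.1 huw.2.1.1 huw.2.2.2
  have h1 : dist (G.map s t h u) (G.map s t h w) = _ := (hl.str h).1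
  have h2 := hl.map_mem h hyuw
  rw [mem_seg, h1] at h2
  have h3 := hnear u huw.1
  have h4 := hnear w huw.2.1
  rw [dist_comm] at h3
  have h5 := (hlen u w huw).trans (le_max_left M 0)
  nlinarith [mul_le_mul_of_nonneg_left h5 (Real.exp_pos ((t : ℝ) - s)).le]

variable (G A)

theorem bad_iff : G.Bad A t ↔ G.HasOneGateVertex A t ∨ G.HasInteriorIllegalTurn A t := by
  constructor
  · rintro ⟨x, hx, h1⟩
    by_cases hn : IsNatVertex (G.sub A t) x
    · exact Or.inl ⟨x, hn, h1⟩
    · obtain ⟨p, hp, q, hq, hpx, hqx, h⟩ := (G.outer t).exists_two_dirs hx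
      exact Or.inr ⟨x, ⟨hx, hn, p, hp, q, hq, hpx, hqx, fun hs => sameDir_iff.1 hs h⟩, h1⟩
  · rintro (⟨x, hx, h1⟩ | ⟨x, hx, h1⟩)
    · exact ⟨x, hx.1, h1⟩
    · exact ⟨x, hx.1, h1⟩

/-- Bad times form an initial piece by `not_bad_mono`, without a last element by `bad_right` and
`not_bad_end`. So the supremum is not bad. -/
theorem exists_bad_threshold : ∃ β, α ≤ β ∧ β ≤ ω ∧ ∀ t : Set.Icc α ω, (t : ℝ) < β ↔ G.Bad A t := by
  by_cases hex : ∃ t, G.Bad A t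
  swap
  · push Not at hex
    exact ⟨α, le_rfl, G.le, fun t => ⟨fun h => absurd t.2.1 (not_le.2 h), fun h => absurd h (hex t)⟩⟩
  set B : Set ℝ := {r | ∃ t : Set.Icc α ω, (t : ℝ) = r ∧ G.Bad A t} with hB
  have hBne : B.Nonempty := by
    obtain ⟨t, ht⟩ := hex
    exact ⟨t, t, rfl, ht⟩
  have hBb : BddAbove B := ⟨ω, by rintro _ ⟨t, rfl, -⟩; exact t.2.2⟩
  have hle : ∀ t : Set.Icc α ω, G.Bad A t → (t : ℝ) ≤ sSup B := fun t ht =>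
    le_csSup hBb ⟨t, rfl, ht⟩
  refine ⟨sSup B, ?_, csSup_le hBne (by rintro _ ⟨t, rfl, -⟩; exact t.2.2), fun t => ⟨fun h => ?_,
    fun h => ?_⟩⟩
  · obtain ⟨t, ht⟩ := hex
    exact t.2.1.trans (hle t ht)
  · obtain ⟨_, ⟨t', rfl, ht'⟩, hlt⟩ := exists_lt_of_lt_csSup hBne h
    by_contra hcon
    exact not_bad_mono (show t ≤ t' from hlt.le) hcon ht'
  · have htω : (t : ℝ) < ω := by
      refine lt_of_le_of_ne t.2.2 fun e => ?_
      have : t = ⟨ω, G.le, le_rfl⟩ := Subtype.ext e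
      rw [this] at h
      exact not_bad_end h
    obtain ⟨ε, hε, hr⟩ := bad_right h
    have hlt : (t : ℝ) < min (t + ε) ω := lt_min (by linarith) htω
    exact hlt.trans_le (hle ⟨min (t + ε) ω, t.2.1.trans hlt.le, min_le_right _ _⟩
      (hr _ hlt.le (min_le_left _ _)))

theorem dist_lt_of_not_long (ht : ¬ G.Bad A t) (hl : ¬ G.HasLongLegalSegment A t) {x y : G.T t}
    (h : IsNatEdge (G.sub A t) x y) : dist x y < 2 := by
  by_contra! hcon
  have hleg := legal_of_no_natVertex ht h.1.1 h.2.1.1 h.2.2.2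
  exact hl ⟨x, y, h, x, left_mem_seg _ _, y, right_mem_seg _ _, hcon,
    fun z hz h1 h2 => hleg.not_sameGate hz h1.symm h2.symm⟩

/-- The infimum of the good times with a long segment is attained by `not_long_right`, and all later
times qualify by `hasLong_mono`. -/
theorem exists_long_threshold [Group.FG A] {β : ℝ} (hβ : α ≤ β) (hβω : β ≤ ω)
    (hbad : ∀ t : Set.Icc α ω, (t : ℝ) < β ↔ G.Bad A t) :
    ∃ γ, β ≤ γ ∧ ∀ t : Set.Icc α ω, γ ≤ (t : ℝ) ↔ β ≤ (t : ℝ) ∧ G.HasLongLegalSegment A t := by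
  have hgood : ∀ t : Set.Icc α ω, β ≤ (t : ℝ) → ¬ G.Bad A t := fun t h1 h2 =>
    absurd ((hbad t).2 h2) (not_lt.2 h1)
  by_cases hex : ∃ t : Set.Icc α ω, β ≤ (t : ℝ) ∧ G.HasLongLegalSegment A t
  swap
  -- If there is no such time, a threshold beyond `ω` leaves the last segment empty and lets the
  -- middle one include `ω`.
  · refine ⟨ω + 1, by linarith, fun t => ⟨fun h => ?_, fun h => absurd ⟨t, h⟩ hex⟩⟩
    linarith [t.2.2]
  set L : Set ℝ := {r | ∃ t : Set.Icc α ω, (t : ℝ) = r ∧ β ≤ (t : ℝ) ∧ G.HasLongLegalSegment A t}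
    with hL
  have hLne : L.Nonempty := by
    obtain ⟨t, ht⟩ := hex
    exact ⟨t, t, rfl, ht⟩
  have hLb : BddBelow L := ⟨β, by rintro _ ⟨t, rfl, h, -⟩; exact h⟩
  have hle : ∀ t : Set.Icc α ω, β ≤ (t : ℝ) → G.HasLongLegalSegment A t → sInf L ≤ t :=
    fun t h1 h2 => csInf_le hLb ⟨t, rfl, h1, h2⟩
  have hβL : β ≤ sInf L := le_csInf hLne (by rintro _ ⟨t, rfl, h, -⟩; exact h)
  have hLω : sInf L ≤ ω := by
    obtain ⟨t, h1, h2⟩ := hex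
    exact (hle t h1 h2).trans t.2.2
  set t0 : Set.Icc α ω := ⟨sInf L, hβ.trans hβL, hLω⟩ with ht0
  have hg0 := hgood t0 hβL
  have hl0 : G.HasLongLegalSegment A t0 := by
    by_contra hcon
    obtain ⟨M, hM, hlen⟩ := (G.outer t0).exists_length_lt (A := A) fun x y h =>
      dist_lt_of_not_long G A hg0 hcon h
    obtain ⟨ε, hε, hr⟩ := not_long_right hg0 hM hlen
    obtain ⟨_, ⟨t, rfl, h1, h2⟩, hlt⟩ := exists_lt_of_csInf_lt hLne
      (show sInf L < sInf L + ε by linarith)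
    exact hr t (hle t h1 h2) hlt.le h2
  refine ⟨sInf L, hβL, fun t => ⟨fun h => ⟨hβL.trans h, hasLong_mono (s := t0) h hg0 hl0⟩,
    fun h => hle t h.1 h.2⟩⟩

end FoldingPath

end FoldPath

/-! ### The three intervals -/

theorem lemma3p1 (n : ℕ) :
    ∃ C : ℕ, ∀ (α ω : ℝ) (G : FoldPath.FoldingPath.{u} n α ω)
      (A : Subgroup (FreeGroup (Fin n))) [Group.FG A],
      ∃ β γ : ℝ, α ≤ β ∧ β ≤ γ ∧
        (∀ t : Set.Icc α ω, (t : ℝ) < β →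
          G.HasOneGateVertex A t ∨ G.HasInteriorIllegalTurn A t) ∧
        (∀ t : Set.Icc α ω, β ≤ (t : ℝ) → (t : ℝ) < γ →
          (∀ x y, FoldPath.IsNatEdge (G.sub A t) x y → dist x y ≤ 2) ∧
          (2 ≤ Group.rank A →
            FoldPath.volume A (G.sub A t) + 6 ≤ 6 * (Group.rank A : ENNReal)) ∧
          (∀ x, FoldPath.IsNatVertex (G.sub A t) x →
            FoldPath.TwoGates (G.toEnd t) (G.sub A t) x) ∧
          ¬ G.HasInteriorIllegalTurn A t) ∧
        (∀ t : Set.Icc α ω, γ ≤ (t : ℝ) → G.HasLongLegalSegment A t) ∧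
        (∀ s t : Set.Icc α ω, (s : ℝ) < β → (t : ℝ) < β →
          ∀ σ ∈ G.proj A s, ∀ τ ∈ G.proj A t,
            (FoldPath.splittingGraph A).edist σ τ ≤ C) ∧
        (∀ s t : Set.Icc α ω, γ ≤ (s : ℝ) → γ ≤ (t : ℝ) →
          ∀ σ ∈ G.proj A s, ∀ τ ∈ G.proj A t,
            (FoldPath.splittingGraph A).edist σ τ ≤ C) := by
  -- The constant does not depend on `n`: 3 bounds the first segment and 2 the last.
  refine ⟨3, fun α ω G A _ => ?_⟩
  obtain ⟨β, hαβ, hβω, hβ⟩ := G.exists_bad_threshold A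
  obtain ⟨γ, hβγ, hγ⟩ := G.exists_long_threshold A hαβ hβω hβ
  refine ⟨β, γ, hαβ, hβγ, fun t ht => (G.bad_iff A).1 ((hβ t).1 ht), fun t h1 h2 => ?_,
    fun t ht => ((hγ t).1 ht).2, fun s t hs ht σ hσ τ hτ => ?_, fun s t hs ht σ hσ τ hτ => ?_⟩
  · have hgood : ¬ G.Bad A t := fun h => absurd ((hβ t).2 h) (not_lt.2 h1)
    have hlong : ¬ G.HasLongLegalSegment A t := fun h => absurd ((hγ t).2 ⟨h1, h⟩) (not_le.2 h2)
    have hlen : ∀ x y, FoldPath.IsNatEdge (G.sub A t) x y → dist x y ≤ 2 := fun x y h =>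
      (G.dist_lt_of_not_long A hgood hlong h).le
    refine ⟨hlen, fun hr => FoldPath.volume_add_six_le (G.outer t) hr hlen, fun x hx => ?_,
      fun h => hgood ((G.bad_iff A).2 (Or.inr h))⟩
    exact FoldPath.FoldingPath.exists_gates fun h => hgood ⟨x, hx.1, h⟩
  · exact G.edist_le_of_bad A ((hβ s).1 hs) ((hβ t).1 ht) hσ hτ
  · have hgood : ∀ t : Set.Icc α ω, γ ≤ (t : ℝ) → ¬ G.Bad A t := fun t h1 h2 =>
      absurd ((hβ t).2 h2) (not_lt.2 (hβγ.trans h1))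
    have h23 : (2 : ℕ∞) ≤ ((3 : ℕ) : ℕ∞) := by norm_num
    refine le_trans ?_ h23
    rcases le_total s t with h | h
    · exact FoldPath.FoldingPath.edist_le_of_long h (hgood s hs) ((hγ s).1 hs).2 hσ hτ
    · rw [SimpleGraph.edist_comm]
      exact FoldPath.FoldingPath.edist_le_of_long h (hgood t ht) ((hγ t).1 ht).2 hτ hσ
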